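/- **Setting.** Let $n\ge 0$ and consider the PDE-ODE system with input $u(t)\in\mathbb R$, states $\xi(t)\in\mathbb R^n$ and $x(z,t)\in\mathbb R^2$, $z\in[0,1]$, $$\dot\xi=F\xi+b\,x_1(0,t),\quad x_2(0,t)=q_0x_1(0,t)+c^\top\xi(t),\quad \partial_t x=\Lambda(z)\partial_z x+A(z)x,\quad x_1(1,t)=q_1x_2(1,t)+u(t),\tag{S}$$ where $\Lambda=\mathrm{diag}(\lambda_1,-\lambda_2)$, the $\lambda_i>0$ are continuous and piecewise continuously differentiable on $[0,1]$, and $A=[A_{ij}]$ is continuous. Solutions are understood along characteristics (the PDE is integrated along characteristic curves, the ODE in time); they are measurable and bounded on bounded time intervals. For an initial value problem on $t\ge 0$ the boundary conditions hold for $t>0$. Put $\phi_i(z)=\int_0^z d\zeta/\lambda_i(\zeta)$, $\tau_i=\phi_i(1)$, $\alpha_i(z)=\int_0^z A_{ii}/\lambda_i\,d\zeta$, $E=\mathrm{diag}(e^{\alpha_1},e^{-\alpha_2})$, $\tilde x=Ex$, $\bar q_1=q_1e^{\alpha_1(1)+\alpha_2(1)}$; let $\tilde A$ have zero diagonal, $\tilde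 A_{12}=A_{12}e^{\alpha_1+\alpha_2}$ and $\tilde A_{21}=A_{21}e^{-\alpha_1-\alpha_2}$. *Transformation.* A kernel is a continuous $K(z,\zeta)\in\mathbb R^{2\times2}$ on $0\le\zeta\le z\le1$ satisfying, along characteristics, $\Lambda(z)\partial_zK+\partial_\zeta(K\Lambda(\zeta))=K\tilde A(\zeta)$ with $K_{11}(z,0)=\frac{q_0\lambda_2(0)}{\lambda_1(0)}K_{12}(z,0)$, $K_{12}(z,z)=-\frac{\tilde A_{12}(z)}{\lambda_1(z)+\lambda_2(z)}$, $K_{21}(z,z)=\frac{\tilde A_{21}(z)}{\lambda_1(z)+\lambda_2(z)}$, $K_{22}(z,0)=\frac{\lambda_1(0)}{q_0\lambda_2(0)}K_{21}(z,0)$. With it put $\bar x(z)=\tilde x(z)-\int_0^zK(z,\zeta)\tilde x(\zeta)\,d\zeta$, $\bar u=e^{\alpha_1(1)}u+\int_0^1(\bar q_1e_2^\top-e_1^\top)K(1,z)\tilde x(z)\,dz$ and $C(z)=K(z,0)\Lambda(0)e_2c^\top$. *Parametrization.* Let $M_c=[b,Fb,\dots,F^{n-1}b]$, $h^\top=e_n^\top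 M_c^{-1}$, let $T_c$ have the rows $h^\top F^i$, $0\le i<n$, and write $y^{[k]}=(y,\dot y,\dots,y^{(k)})^\top$. The flat output is $y=h^\top\xi$ if $n\ge1$ and $y=x_1(0,\cdot)$ if $n=0$. It parametrizes the system by $\xi=T_c^{-1}y^{[n-1]}$ and $$\bar x_1(z,t)=p_1^\top y^{[n]}(t+\phi_1(z))-\int_0^z\tfrac{e_1^\top C(\zeta)}{\lambda_1(\zeta)}T_c^{-1}y^{[n-1]}(t+\phi_1(z)-\phi_1(\zeta))\,d\zeta,$$ $$\bar x_2(z,t)=p_2^\top y^{[n]}(t-\phi_2(z))+\int_0^z\tfrac{e_2^\top C(\zeta)}{\lambda_2(\zeta)}T_c^{-1}y^{[n-1]}(t-\phi_2(z)+\phi_2(\zeta))\,d\zeta,$$ $$\bar u(t)=\bar x_1(1,t)-\bar q_1\bar x_2(1,t),$$ where $p_1^\top y^{[n]}=y^{(n)}-e_n^\top T_cFT_c^{-1}y^{[n-1]}$ and $p_2^\top y^{[n]}=q_0p_1^\top y^{[n]}+c^\top T_c^{-1}y^{[n-1]}$. The numbers $a_0,\dots,a_n$ and the continuous function $a$ on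 $[-\tau_2,\tau_1]$ are those for which this input parametrization reads $$\bar u(t)=y^{(n)}(t+\tau_1)+a_ny^{(n)}(t-\tau_2)+\sum_{i=0}^{n-1}a_iy^{(i)}(t-\tau_2)+\int_{-\tau_2}^{\tau_1}a(\tau)y^{(n)}(t+\tau)\,d\tau$$ for all trajectories $y$. The state of the hyperbolic controller canonical form belonging to $(\xi,x)$ at time $t$ is $\eta_i=y^{(i-1)}(t-\tau_2)$, $1\le i\le n$, and $\eta_{n+1}(\tau)=y^{(n)}(t+\tau)$, $\tau\in[-\tau_2,\tau_1]$, where $y$ on $[t-\tau_2,t+\tau_1]$ generates $(\xi,\bar x)$ by the parametrization. *Reference and controller.* For $y_{\mathrm r}\in C^n(\mathbb R)$ the reference $(x_{\mathrm r},\xi_{\mathrm r},u_{\mathrm r})$ is obtained from $y_{\mathrm r}$ by the parametrization and the inverses of the above transformations; $\bar u_{\mathrm r}$ is its transformed input. Given $\gamma,\kappa_0,\dots,\kappa_{n-1}\in\mathbb R$ put $\bar a_n=\gamma$, $\bar a_i=\kappa_i\gamma+\sum_{k=0}^i\kappa_k\frac{(\tau_1+\tau_2)^{i-k}}{(i-k)!}$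 for $i<n$, and $\bar a(\tau)=\sum_{i=0}^{n-1}\kappa_i\frac{(\tau_1-\tau)^{n-i-1}}{(n-i-1)!}$. The flatness-based controller is $$\bar u(t)=\bar u_{\mathrm r}(t)+(a_n-\bar a_n)\big(\eta_{n+1}(-\tau_2,t)-y_{\mathrm r}^{(n)}(t-\tau_2)\big)+\sum_{i=0}^{n-1}(a_i-\bar a_i)\big(\eta_{i+1}(t)-y_{\mathrm r}^{(i)}(t-\tau_2)\big)$$ $$\qquad+\int_{-\tau_2}^{\tau_1}(a(\tau)-\bar a(\tau))\big(\eta_{n+1}(\tau,t)-y_{\mathrm r}^{(n)}(t+\tau)\big)\,d\tau .\tag{C}$$ **Theorem.** Let $(F,b)$ be controllable, $q_0\ne0$, $|\gamma|<1$, and let all complex roots of $s^n+\sum_{i<n}\kappa_is^i$ have negative real part. Then a kernel $K$ and the coefficients $a_i$, $a(\cdot)$ exist, (C) is a well-defined static state feedback $u$ of $(\xi,x)$ (a unique value of $u$ at every time for every $\xi\in\mathbb R^n$ and every bounded measurable profile $x$ on $[0,1]$), and it exponentially stabilizes (S) along the reference trajectories: there are $M,\omega>0$, independent of $y_{\mathrm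 r}$ and of the initial state, such that for every $y_{\mathrm r}\in C^n(\mathbb R)$ the reference exists and satisfies (S) for all $t\in\mathbb R$, the closed loop (S), (C) has a solution on $t\ge0$ for every initial state $\xi_0\in\mathbb R^n$ and bounded measurable $x_0$, and every solution of the closed loop satisfies, in the norm of $\mathbb R^n\times L^2([0,1])^2$, $$\|(\xi-\xi_{\mathrm r},\,x-x_{\mathrm r})(t)\|\le M e^{-\omega t}\,\|(\xi-\xi_{\mathrm r},\,x-x_{\mathrm r})(0)\|,\qquad t\ge0.$$ -/

import Mathlib

open Set MeasureTheory

noncomputable section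

namespace HyperbolicPDEODE

/-- Continuous on `[0,1]` and continuously differentiable on each closed piece of a finite
subdivision of `[0,1]`. -/
def PiecewiseC1 (f : ℝ → ℝ) : Prop :=
  ∃ (N : ℕ) (s : ℕ → ℝ), Monotone s ∧ s 0 = 0 ∧ s N = 1 ∧
    ∀ k < N, ContDiffOn ℝ 1 f (Icc (s k) (s (k + 1)))

/-- The data of the hyperbolic PDE-ODE system
  `ξ' = F ξ + b x₁(0,t)`, `x₂(0,t) = q₀ x₁(0,t) + cᵀ ξ(t)`,
  `∂ₜ x = Λ(z) ∂_z x + A(z) x` with `Λ = diag(λ₁, -λ₂)`, `x₁(1,t) = q₁ x₂(1,t) + u(t)`.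
The components `1, 2` of the distributed state are indexed by `0, 1 : Fin 2`. Only the values of
the coefficients on `[0,1]` matter. -/
structure System (n : ℕ) where
  lam : Fin 2 → ℝ → ℝ
  A : ℝ → Matrix (Fin 2) (Fin 2) ℝ
  F : Matrix (Fin n) (Fin n) ℝ
  b : Fin n → ℝ
  c : Fin n → ℝ
  q0 : ℝ
  q1 : ℝ
  lam_pos : ∀ i, ∀ z ∈ Icc (0 : ℝ) 1, 0 < lam i z
  lam_piecewiseC1 : ∀ i, PiecewiseC1 (lam i)
  A_continuous : ∀ i j, ContinuousOn (fun z => A z i j) (Icc (0 : ℝ) 1)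

/-- Controllability of the pair `(F, b)`: every state can be steered to every state in finite
time by a continuous input. -/
def Controllable {n : ℕ} (F : Matrix (Fin n) (Fin n) ℝ) (b : Fin n → ℝ) : Prop :=
  ∀ ξ₀ ξ₁ : Fin n → ℝ, ∃ T > 0, ∃ (v : ℝ → ℝ) (ξ : ℝ → Fin n → ℝ),
    ContinuousOn v (Icc 0 T) ∧ ξ 0 = ξ₀ ∧ ξ T = ξ₁ ∧
    ∀ t ∈ Icc 0 T, HasDerivWithinAt ξ (F.mulVec (ξ t) + v t • b) (Icc 0 T) t

/-- `κ₀, …, κ_{n-1}` are the coefficients of a monic Hurwitz polynomial of degree `n`. -/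
def IsHurwitz {n : ℕ} (κ : Fin n → ℝ) : Prop :=
  ∀ s : ℂ, s ^ n + ∑ i : Fin n, (κ i : ℂ) * s ^ (i : ℕ) = 0 → s.re < 0

/-- A pair of profiles on `[0,1]` that is bounded and Borel measurable there. -/
def IsProfile (x : Fin 2 → ℝ → ℝ) : Prop :=
  ∀ j, Measurable ((Icc (0 : ℝ) 1).indicator (x j)) ∧ ∃ B, ∀ z ∈ Icc (0 : ℝ) 1, |x j z| ≤ B

/-- The norm of `ℝⁿ × L²([0,1])²`. -/
def stateNorm {n : ℕ} (ξ : Fin n → ℝ) (x : Fin 2 → ℝ → ℝ) : ℝ :=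
  Real.sqrt ((∑ i, ξ i ^ 2) + ∫ z in (0 : ℝ)..1, ∑ j, x j z ^ 2)

/-- The triangle `0 ≤ ζ ≤ z ≤ 1`, as a set of pairs `(z, ζ)`. -/
def triangle : Set (ℝ × ℝ) := {p | 0 ≤ p.2 ∧ p.2 ≤ p.1 ∧ p.1 ≤ 1}

namespace System

variable {n : ℕ} (P : System n)

/-- The diagonal of `Λ(z)`. -/
def Lam (z : ℝ) : Fin 2 → ℝ := ![P.lam 0 z, -P.lam 1 z]

/-- Solutions of the PDE-ODE system with input `u` on the time set `I`, in the sense of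
characteristics: measurable, locally bounded in time, the ODE holds in integrated form, the boundary
conditions hold in the interior of `I`, and the PDE is integrated along all characteristic
curves. Time is the last argument of `x`. -/
structure IsSolution (I : Set ℝ) (u : ℝ → ℝ) (ξ : ℝ → Fin n → ℝ) (x : Fin 2 → ℝ → ℝ → ℝ) :
    Prop where
  measurable : ∀ j, Measurable
    ((Icc (0 : ℝ) 1 ×ˢ I).indicator (fun p : ℝ × ℝ => x j p.1 p.2))
  bounded : ∀ T : ℝ, ∃ B, ∀ j, ∀ t ∈ I, |t| ≤ T → ∀ z ∈ Icc (0 : ℝ) 1, |x j z t| ≤ B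
  continuous_ode : ContinuousOn ξ I
  ode : ∀ s ∈ I, ∀ t ∈ I, s ≤ t → ∀ i,
    ξ t i = ξ s i + ∫ r in s..t, ((P.F.mulVec (ξ r)) i + P.b i * x 0 0 r)
  bc0 : ∀ t ∈ interior I, x 1 0 t = P.q0 * x 0 0 t + P.c ⬝ᵥ ξ t
  bc1 : ∀ t ∈ interior I, x 0 1 t = P.q1 * x 1 1 t + u t
  pde : ∀ (i : Fin 2) (t₀ t₁ : ℝ) (Z : ℝ → ℝ), t₀ ≤ t₁ → Icc t₀ t₁ ⊆ I →
    (∀ t ∈ Icc t₀ t₁, Z t ∈ Icc (0 : ℝ) 1 ∧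
      HasDerivWithinAt Z (-P.Lam (Z t) i) (Icc t₀ t₁) t) →
    x i (Z t₁) t₁ = x i (Z t₀) t₀ + ∫ t in t₀..t₁, ∑ j, P.A (Z t) i j * x j (Z t) t

/-! ### Preliminary transformations -/

/-- `φᵢ(z)`, the transport time from `0` to `z`. -/
def phi (i : Fin 2) (z : ℝ) : ℝ := ∫ ζ in (0 : ℝ)..z, 1 / P.lam i ζ

/-- The delays `τᵢ = φᵢ(1)`. -/
def tau (i : Fin 2) : ℝ := P.phi i 1

def alpha (i : Fin 2) (z : ℝ) : ℝ := ∫ ζ in (0 : ℝ)..z, P.A ζ i i / P.lam i ζ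

/-- The diagonal of the scaling matrix `E(z)`. -/
def E (z : ℝ) : Fin 2 → ℝ := ![Real.exp (P.alpha 0 z), Real.exp (-P.alpha 1 z)]

/-- The scaled profile `x̃ = E x`. -/
def scaled (x : Fin 2 → ℝ → ℝ) (z : ℝ) : Fin 2 → ℝ := fun j => P.E z j * x j z

/-- The in-domain coupling matrix after the scaling. -/
def Atilde (z : ℝ) : Matrix (Fin 2) (Fin 2) ℝ :=
  !![0, P.A z 0 1 * Real.exp (P.alpha 0 z + P.alpha 1 z);
     P.A z 1 0 * Real.exp (-P.alpha 0 z - P.alpha 1 z), 0]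

/-- Continuous solutions `K(z,ζ)` on the triangle of the kernel equations
  `Λ(z) ∂_z K + ∂_ζ (K Λ(ζ)) = K Ã(ζ)` with their boundary conditions. Multiplied by the entry
`Λⱼ(ζ)`, the equation for `Kᵢⱼ` prescribes the derivative of `Kᵢⱼ Λⱼ(ζ)` along the characteristic
curves `z' = Λᵢ(z)`, `ζ' = Λⱼ(ζ)`, which is how it is understood here. -/
structure IsKernel (K : ℝ → ℝ → Matrix (Fin 2) (Fin 2) ℝ) : Prop where
  continuous : ∀ i j, ContinuousOn (fun p : ℝ × ℝ => K p.1 p.2 i j) triangle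
  pde : ∀ (i j : Fin 2) (s₀ s₁ : ℝ) (Z ζ : ℝ → ℝ),
    (∀ s ∈ Icc s₀ s₁, (Z s, ζ s) ∈ triangle ∧
      HasDerivWithinAt Z (P.Lam (Z s) i) (Icc s₀ s₁) s ∧
      HasDerivWithinAt ζ (P.Lam (ζ s) j) (Icc s₀ s₁) s) →
    ∀ s ∈ Icc s₀ s₁, HasDerivWithinAt (fun r => K (Z r) (ζ r) i j * P.Lam (ζ r) j)
      (P.Lam (ζ s) j * (K (Z s) (ζ s) * P.Atilde (ζ s)) i j) (Icc s₀ s₁) s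
  bc11 : ∀ z ∈ Icc (0 : ℝ) 1, K z 0 0 0 = P.q0 * P.lam 1 0 / P.lam 0 0 * K z 0 0 1
  bc12 : ∀ z ∈ Icc (0 : ℝ) 1, K z z 0 1 = -(P.Atilde z 0 1 / (P.lam 0 z + P.lam 1 z))
  bc21 : ∀ z ∈ Icc (0 : ℝ) 1, K z z 1 0 = P.Atilde z 1 0 / (P.lam 0 z + P.lam 1 z)
  bc22 : ∀ z ∈ Icc (0 : ℝ) 1, K z 0 1 1 = P.lam 0 0 / (P.q0 * P.lam 1 0) * K z 0 1 0

variable (K : ℝ → ℝ → Matrix (Fin 2) (Fin 2) ℝ)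

/-- The transformed profile `x̄(z) = x̃(z) - ∫₀ᶻ K(z,ζ) x̃(ζ) dζ`. -/
def xbar (x : Fin 2 → ℝ → ℝ) (j : Fin 2) (z : ℝ) : ℝ :=
  P.scaled x z j - ∫ ζ in (0 : ℝ)..z, ((K z ζ).mulVec (P.scaled x ζ)) j

/-- `q̄₁`. -/
def qbar1 : ℝ := P.q1 * Real.exp (P.alpha 0 1 + P.alpha 1 1)

/-- The transformed input
  `ū = e^{α₁(1)} u + ∫₀¹ (q̄₁ e₂ᵀ - e₁ᵀ) K(1,z) x̃(z) dz`. -/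
def ubar (x : Fin 2 → ℝ → ℝ) (u : ℝ) : ℝ :=
  Real.exp (P.alpha 0 1) * u + ∫ z in (0 : ℝ)..1,
    (P.qbar1 * ((K 1 z).mulVec (P.scaled x z)) 1 - ((K 1 z).mulVec (P.scaled x z)) 0)

/-- `C(z) = K(z,0) Λ(0) e₂ cᵀ`. -/
def C (z : ℝ) : Matrix (Fin 2) (Fin n) ℝ :=
  Matrix.vecMulVec ((K z 0).mulVec ((Matrix.diagonal (P.Lam 0)).mulVec ![0, 1])) P.c

/-! ### Flatness-based parametrization

A family `Y : ℕ → ℝ → ℝ` stands for `Y k τ = y⁽ᵏ⁾(t + τ)`, `k ≤ n`, where `t` is the present time. -/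

/-- The last unit vector of `ℝⁿ`. -/
def eLast (n : ℕ) : Fin n → ℝ := fun i => if (i : ℕ) + 1 = n then 1 else 0

/-- The Kalman matrix `M_c = [b, F b, …, Fⁿ⁻¹ b]`. -/
def kalman : Matrix (Fin n) (Fin n) ℝ :=
  Matrix.of fun i j => ((P.F ^ (j : ℕ)).mulVec P.b) i

/-- `hᵀ = e_nᵀ M_c⁻¹`; for `n ≥ 1` the flat output is `y = hᵀ ξ`. -/
def h : Fin n → ℝ := Matrix.vecMul (eLast n) P.kalman⁻¹

/-- `T_c`, with rows `hᵀ, hᵀ F, …, hᵀ Fⁿ⁻¹`. -/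
def Tc : Matrix (Fin n) (Fin n) ℝ := Matrix.of fun i => Matrix.vecMul P.h (P.F ^ (i : ℕ))

/-- `ξ(t + τ) = T_c⁻¹ y^{[n-1]}(t + τ)`. -/
def xiPar (Y : ℕ → ℝ → ℝ) (τ : ℝ) : Fin n → ℝ := P.Tc⁻¹.mulVec (fun i : Fin n => Y i τ)

/-- `x̄₁(0, t + τ) = p₁ᵀ y^{[n]}(t + τ) = y⁽ⁿ⁾ - e_nᵀ T_c F T_c⁻¹ y^{[n-1]}`. -/
def p1Par (Y : ℕ → ℝ → ℝ) (τ : ℝ) : ℝ :=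
  Y n τ - eLast n ⬝ᵥ (P.Tc * P.F * P.Tc⁻¹).mulVec (fun i : Fin n => Y i τ)

/-- `x̄₂(0, t + τ) = p₂ᵀ y^{[n]}(t + τ)`. -/
def p2Par (Y : ℕ → ℝ → ℝ) (τ : ℝ) : ℝ := P.q0 * P.p1Par Y τ + P.c ⬝ᵥ P.xiPar Y τ

/-- The parametrization of the transformed distributed state `x̄(z,t)`. -/
def xPar (Y : ℕ → ℝ → ℝ) : Fin 2 → ℝ → ℝ :=
  ![fun z => P.p1Par Y (P.phi 0 z) - ∫ ζ in (0 : ℝ)..z,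
      ((P.C K ζ).mulVec (P.xiPar Y (P.phi 0 z - P.phi 0 ζ))) 0 / P.lam 0 ζ,
    fun z => P.p2Par Y (-P.phi 1 z) + ∫ ζ in (0 : ℝ)..z,
      ((P.C K ζ).mulVec (P.xiPar Y (-P.phi 1 z + P.phi 1 ζ))) 1 / P.lam 1 ζ]

/-- The parametrization of the transformed input, from `x̄₁(1,t) = q̄₁ x̄₂(1,t) + ū(t)`. -/
def uPar (Y : ℕ → ℝ → ℝ) : ℝ := P.xPar K Y 0 1 - P.qbar1 * P.xPar K Y 1 1

/-- The window `[-τ₂, τ₁]` of time shifts. -/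
def window : Set ℝ := Icc (-P.tau 1) (P.tau 0)

/-- `Y 0, …, Y n` are a function on the window and its derivatives up to order `n`, the one of
order `n` being bounded and measurable. -/
structure IsJet (Y : ℕ → ℝ → ℝ) : Prop where
  measurable : Measurable (P.window.indicator (Y n))
  bounded : ∃ B, ∀ τ ∈ P.window, |Y n τ| ≤ B
  deriv : ∀ k < n, ∀ τ ∈ P.window,
    Y k τ = Y k (-P.tau 1) + ∫ σ in (-P.tau 1)..τ, Y (k + 1) σ

/-! ### Hyperbolic controller canonical form -/

/-- `(η, v)` is the state of the hyperbolic controller canonical form that corresponds to the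
state `(ξ, x̄)`: there is a trajectory segment of the flat output that generates `(ξ, x̄)`, with
`η_{i+1} = y⁽ⁱ⁾(t - τ₂)` for `i < n` and `v(τ) = η_{n+1}(τ,t) = y⁽ⁿ⁾(t + τ)` on the window. (At
`z = 0` both components of `x̄` would determine `v(0)`, which has no influence.) -/
def IsHCCFState (ξ : Fin n → ℝ) (xb : Fin 2 → ℝ → ℝ) (η : Fin n → ℝ) (v : ℝ → ℝ) : Prop :=
  ∃ Y : ℕ → ℝ → ℝ, P.IsJet Y ∧ (∀ i : Fin n, η i = Y i (-P.tau 1)) ∧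
    (∀ τ ∈ P.window, v τ = Y n τ) ∧
    ξ = P.xiPar Y 0 ∧ ∀ j, ∀ z ∈ Ioc (0 : ℝ) 1, xb j z = P.xPar K Y j z

/-- The functional
  `f(τ₁) + aₙ f(-τ₂) + ∑_{i<n} aᵢ ηᵢ + ∫ a(τ) f(τ) dτ` without its first term `f(τ₁)`. -/
def hccfFunctional (a : Fin (n + 1) → ℝ) (aD : ℝ → ℝ) (η : Fin n → ℝ) (f : ℝ → ℝ) : ℝ :=
  a (Fin.last n) * f (-P.tau 1) + (∑ i : Fin n, a i.castSucc * η i)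
    + ∫ τ in (-P.tau 1)..(P.tau 0), aD τ * f τ

/-- `a₀, …, aₙ` and the continuous function `a(τ)` are the coefficients of the hyperbolic controller
canonical form: the input parametrization reads
  `ū(t) = y⁽ⁿ⁾(t+τ₁) + aₙ y⁽ⁿ⁾(t-τ₂) + ∑_{i<n} aᵢ y⁽ⁱ⁾(t-τ₂) + ∫ a(τ) y⁽ⁿ⁾(t+τ) dτ`. -/
structure IsHCCFCoeff (a : Fin (n + 1) → ℝ) (aD : ℝ → ℝ) : Prop where
  continuous : ContinuousOn aD P.window
  param : ∀ Y : ℕ → ℝ → ℝ, P.IsJet Y →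
    P.uPar K Y = Y n (P.tau 0) + P.hccfFunctional a aD (fun i => Y i (-P.tau 1)) (Y n)

/-! ### Reference and controller -/

/-- `Y k τ = y⁽ᵏ⁾(t + τ)`. -/
def jetAt (y : ℝ → ℝ) (t : ℝ) : ℕ → ℝ → ℝ := fun k τ => iteratedDeriv k y (t + τ)

/-- The feedforward input `ū_r(t)`. -/
def ubarRef (a : Fin (n + 1) → ℝ) (aD : ℝ → ℝ) (yr : ℝ → ℝ) (t : ℝ) : ℝ :=
  jetAt yr t n (P.tau 0)
    + P.hccfFunctional a aD (fun i => jetAt yr t i (-P.tau 1)) (jetAt yr t n)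

/-- `(ξ_r, x_r, u_r)` is generated by the reference `y_r` of the flat output: its image under the
preliminary transformations is given by the flatness-based parametrization. -/
structure IsGeneratedBy (a : Fin (n + 1) → ℝ) (aD : ℝ → ℝ) (yr : ℝ → ℝ)
    (ξr : ℝ → Fin n → ℝ) (xr : Fin 2 → ℝ → ℝ → ℝ) (ur : ℝ → ℝ) : Prop where
  ode : ∀ t, ξr t = P.xiPar (jetAt yr t) 0
  pde : ∀ t, ∀ j, ∀ z ∈ Icc (0 : ℝ) 1,
    P.xbar K (fun j z => xr j z t) j z = P.xPar K (jetAt yr t) j z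
  input : ∀ t, P.ubar K (fun j z => xr j z t) (ur t) = P.ubarRef a aD yr t

/-- The desired coefficients `ā₀, …, ā_{n-1}, āₙ` of the closed loop. -/
def abar (κ : Fin n → ℝ) (γ : ℝ) : Fin (n + 1) → ℝ :=
  Fin.snoc (α := fun _ => ℝ) (fun i : Fin n => κ i * γ + ∑ k : Fin n,
    if k ≤ i then κ k * (P.tau 0 + P.tau 1) ^ ((i : ℕ) - k) / (((i : ℕ) - k).factorial : ℝ)
    else 0) γ

/-- The desired function `ā(τ)` of the closed loop. -/
def abarD (κ : Fin n → ℝ) (τ : ℝ) : ℝ :=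
  ∑ i : Fin n, κ i * (P.tau 0 - τ) ^ (n - (i : ℕ) - 1) / ((n - (i : ℕ) - 1).factorial : ℝ)

/-- `u` is the value at time `t` in the state `(ξ, x)` of the flatness-based tracking controller
  `ū = ū_r + (aₙ-āₙ)(η_{n+1}(-τ₂)-y_r⁽ⁿ⁾(t-τ₂)) + ∑_{i<n} (aᵢ-āᵢ)(η_{i+1}-y_r⁽ⁱ⁾(t-τ₂))
     + ∫ (a(τ)-ā(τ))(η_{n+1}(τ)-y_r⁽ⁿ⁾(t+τ)) dτ`. -/
def IsFeedback (a : Fin (n + 1) → ℝ) (aD : ℝ → ℝ) (κ : Fin n → ℝ) (γ : ℝ) (yr : ℝ → ℝ)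
    (t : ℝ) (ξ : Fin n → ℝ) (x : Fin 2 → ℝ → ℝ) (u : ℝ) : Prop :=
  ∃ (η : Fin n → ℝ) (v : ℝ → ℝ), P.IsHCCFState K ξ (P.xbar K x) η v ∧
    P.ubar K x u = P.ubarRef a aD yr t
      + P.hccfFunctional (fun i => a i - P.abar κ γ i) (fun τ => aD τ - P.abarD κ τ)
          (fun i => η i - jetAt yr t i (-P.tau 1)) (fun τ => v τ - jetAt yr t n τ)

/-- Solutions for `t ≥ 0` of the system in closed loop with the tracking controller. -/
structure IsClosedLoopSolution (a : Fin (n + 1) → ℝ) (aD : ℝ → ℝ) (κ : Fin n → ℝ) (γ : ℝ)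
    (yr : ℝ → ℝ) (ξ : ℝ → Fin n → ℝ) (x : Fin 2 → ℝ → ℝ → ℝ) (u : ℝ → ℝ) : Prop where
  solution : P.IsSolution (Ici 0) u ξ x
  feedback : ∀ t > 0, P.IsFeedback K a aD κ γ yr t (ξ t) (fun j z => x j z t) (u t)

end System

end HyperbolicPDEODE

end

open Set MeasureTheory

noncomputable section

namespace HyperbolicPDEODE

/-! The flat output `y` puts the ordinary differential equation into controller form. Hence `y` and
its derivatives up to order `n` determine `ξ`, then `x₁(0,·)` and, by the boundary condition,
`x₂(0,·)`; integrating the hyperbolic equations in the direction of `z` gives the rest of the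
solution (`exists_solution_of_jet`). Conversely every solution on the whole time axis comes from
such a jet (`IsSolution.exists_jet`). The derivative of order `n` is only measurable and locally
bounded, so all equations are used in integrated form, and a product rule for absolutely continuous
functions (`mul_sub_mul_eq_integral`) takes the place of differentiation.

Backstepping: in travel times, kernel and solution are transported together along straight lines of
slope `±1` in a triangle. Integrating over the triangle turns the Volterra integral into fluxes
through its sides. The sources of the two columns of `K` cancel, the diagonal values of `K` cancel
the coupling in the domain, and its values at `ζ = 0` leave only `cᵀ ξ`. So `x̄` is a transported
boundary value plus a convolution with `cᵀ ξ` (`IsScaledSolution.transform`,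
`IsSolution.xbar_eq_xPar`). The kernel exists because its equations, integrated along
characteristics, contract in an exponentially weighted norm (`exists_goursat`).

At a fixed time, states correspond to segments of `y` on `[-τ₂, τ₁]`. From `ξ`, the profile `x̄₁`
prescribes a differential equation with memory forward in time and `x̄₂` one backward in time, where
`q₀ ≠ 0` is needed to solve for `x₁(0,·)` (`exists_jet_of_state`). Gronwall's inequality bounds
states and segments by each other (`exists_norm_equiv`). Applied to a difference, the bounds give
uniqueness, hence a well-defined feedback; only `y⁽ⁿ⁾` at the present instant stays ambiguous, and
it has no influence.

In terms of the error `e = y - y_r` and the operator `p(D)` with characteristic polynomial `p = sⁿ +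
∑ κᵢ sⁱ`, Taylor's formula turns the controller into `(p(D) e)(t + τ₁) + γ (p(D) e)(t - τ₂) = 0` for
`t > 0` (`add_hccfFunctional_abar`, `IsSolution.isFeedback_iff`). Since `|γ| < 1`, `p(D) e` decays
in a weighted square mean. Factoring `p` over `ℂ`, with an energy estimate for each factor, gives
decay of the orders below `n` (`exists_decay_of_hurwitz`); the order `n` follows in `L²` over the
window (`exists_decay`). The equivalence of norms carries this over to the state.

Closed-loop solutions live on `t ≥ 0`; they are prolonged to negative times by the jet that
generates their initial state (`IsSolution.exists_extension`). For existence the difference equation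
is solved period by period and `e` is recovered from `p(D) e` (`exists_closedLoopSolution`). -/

/-- A weighted pointwise version of the contraction principle, on a class `A` of functions that is
closed under limits at a geometric rate. -/
theorem exists_fixedPoint_of_weighted_contraction {Ω E : Type*} [NormedAddCommGroup E]
    [CompleteSpace E] (w : Ω → ℝ) (A : (Ω → E) → Prop)
    (Φ : (Ω → E) → Ω → E) (hA : ∀ f, A f → A (Φ f))
    (hlim : ∀ (F : ℕ → Ω → E) (f : Ω → E) (C : ℝ), 0 ≤ C → (∀ m, A (F m)) →
      (∀ m p, ‖F m p - f p‖ ≤ C * (1 / 2) ^ m * w p) → A f)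
    (hΦ : ∀ f g, A f → A g → ∀ B ≥ 0, (∀ p, ‖f p - g p‖ ≤ B * w p) →
      ∀ p, ‖Φ f p - Φ g p‖ ≤ B / 2 * w p)
    (f₀ : Ω → E) (h₀ : A f₀) (B : ℝ) (hB0 : 0 ≤ B) (hB : ∀ p, ‖Φ f₀ p - f₀ p‖ ≤ B * w p) :
    ∃ f, A f ∧ Φ f = f := by
  let F : ℕ → Ω → E := fun m => Φ^[m] f₀
  have hsucc : ∀ m, F (m + 1) = Φ (F m) := fun m => Function.iterate_succ_apply' Φ m f₀
  have hFA : ∀ m, A (F m) := by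
    intro m
    induction m with
    | zero => exact h₀
    | succ m ih => rw [hsucc]; exact hA _ ih
  have hstep : ∀ m p, ‖F (m + 1) p - F m p‖ ≤ B * (1 / 2) ^ m * w p := by
    intro m
    induction m with
    | zero => intro p; simpa [F] using hB p
    | succ m ih =>
      intro p
      rw [hsucc (m + 1), hsucc m]
      have := hΦ _ _ (hFA (m + 1)) (hFA m) (B * (1 / 2) ^ m) (by positivity) ih p
      rw [hsucc m] at this
      rw [pow_succ]
      linarith
  have hd : ∀ p m, dist (F m p) (F (m + 1) p) ≤ B * w p * (1 / 2) ^ m := by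
    intro p m
    rw [dist_comm, dist_eq_norm]
    linarith [hstep m p]
  have hc : ∀ p, CauchySeq fun m => F m p := fun p =>
    cauchySeq_of_le_geometric (1 / 2) (B * w p) (by norm_num) (hd p)
  choose f hf using fun p => cauchySeq_tendsto_of_complete (hc p)
  have hest : ∀ m p, ‖F m p - f p‖ ≤ 2 * B * (1 / 2) ^ m * w p := by
    intro m p
    have := dist_le_of_le_geometric_of_tendsto (1 / 2) (B * w p) (by norm_num) (hd p) (hf p) m
    rw [dist_eq_norm] at this
    refine this.trans (le_of_eq ?_)
    ring
  have hAf : A f := hlim F f (2 * B) (by positivity) hFA hest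
  refine ⟨f, hAf, funext fun p => ?_⟩
  have h1 : Filter.Tendsto (fun m => F (m + 1) p) Filter.atTop (nhds (f p)) :=
    (hf p).comp (Filter.tendsto_add_atTop_nat 1)
  refine tendsto_nhds_unique ?_ h1
  rw [tendsto_iff_norm_sub_tendsto_zero]
  refine squeeze_zero (fun _ => norm_nonneg _) (g := fun m => B * w p * (1 / 2) ^ m) (fun m => ?_) ?_
  · rw [hsucc]
    have := hΦ _ _ (hFA m) hAf (2 * B * (1 / 2) ^ m) (by positivity) (hest m) p
    linarith
  · simpa using (tendsto_pow_atTop_nhds_zero_of_lt_one (r := (1 / 2 : ℝ)) (by norm_num)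
      (by norm_num)).const_mul (B * w p)

/-! ### Gronwall's inequality and the product rule in integrated form -/

theorem le_mul_exp_of_le_add_integral {F : ℝ → ℝ} {a C T : ℝ} (hC : 0 ≤ C)
    (hF : ContinuousOn F (Icc 0 T)) (h : ∀ t ∈ Icc 0 T, F t ≤ a + C * ∫ s in (0 : ℝ)..t, F s) :
    ∀ t ∈ Icc 0 T, F t ≤ a * Real.exp (C * t) := by
  rcases lt_or_ge T 0 with hT | hT
  · intro t ht; exact absurd (ht.1.trans ht.2) (not_le.mpr hT)
  have hint : ∀ t ∈ Icc 0 T, IntervalIntegrable F volume 0 t := fun t ht =>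
    (hF.mono (by rw [uIcc_of_le ht.1]; exact Icc_subset_Icc_right ht.2)).intervalIntegrable
  -- The bound `H`, not `F`, is differentiable: `H' = C F ≤ C H`, so the differential form of
  -- Gronwall's inequality applies to `H`, and `F ≤ H`.
  let H : ℝ → ℝ := fun t => a + C * ∫ s in (0 : ℝ)..t, F s
  have hder : ∀ t ∈ Icc 0 T, HasDerivWithinAt H (C * F t) (Icc 0 T) t := by
    intro t ht
    have : Fact (t ∈ Icc 0 T) := ⟨ht⟩
    have := intervalIntegral.integral_hasDerivWithinAt_right (hint t ht) (s := Icc 0 T)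
      (t := Icc 0 T) (hF.stronglyMeasurableAtFilter_nhdsWithin measurableSet_Icc t) (hF t ht)
    exact (this.const_mul C).const_add a
  have key := le_gronwallBound_of_liminf_deriv_right_le (f := H) (f' := fun t => C * F t) (δ := a)
    (K := C) (ε := 0) (a := 0) (b := T) (fun t ht => (hder t ht).continuousWithinAt)
    (fun t ht r hr => by
      have h1 : HasDerivWithinAt H (C * F t) (Ici t) t :=
        (hder t ⟨ht.1, ht.2.le⟩).mono_of_mem_nhdsWithin
          (mem_nhdsWithin.2 ⟨Iio T, isOpen_Iio, ht.2, fun s hs =>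
            ⟨ht.1.trans hs.2, le_of_lt hs.1⟩⟩)
      exact h1.liminf_right_slope_le hr) (by simp [H])
    (fun t ht => by
      have := h t ⟨ht.1, ht.2.le⟩
      simpa using mul_le_mul_of_nonneg_left this hC)
  intro t ht
  have h1 := key t ht
  rw [gronwallBound_ε0, sub_zero] at h1
  exact (h t ht).trans h1

/-- Indefinite integrals are absolutely continuous, so the product rule holds almost everywhere and
may be integrated. Solutions are merely bounded and measurable in time; this identity stands in for
the differentiation of products along them. -/
theorem mul_sub_mul_eq_integral {F G f g : ℝ → ℝ} {a b : ℝ} (hab : a ≤ b)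
    (hf : IntervalIntegrable f volume a b) (hg : IntervalIntegrable g volume a b)
    (hF : ∀ r ∈ Icc a b, F r = F a + ∫ s in a..r, f s)
    (hG : ∀ r ∈ Icc a b, G r = G a + ∫ s in a..r, g s) :
    F b * G b - F a * G a = ∫ r in a..b, (f r * G r + F r * g r) := by
  have ha : a ∈ uIcc a b := left_mem_uIcc
  let F' : ℝ → ℝ := fun r => F a + ∫ s in a..r, f s
  let G' : ℝ → ℝ := fun r => G a + ∫ s in a..r, g s
  have hc : ∀ c : ℝ, AbsolutelyContinuousOnInterval (fun _ => c) a b := fun c =>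
    ((LipschitzWith.const c).lipschitzOnWith (s := uIcc a b)).absolutelyContinuousOnInterval
  have hF' : AbsolutelyContinuousOnInterval F' a b :=
    (hc (F a)).add (hf.absolutelyContinuousOnInterval_intervalIntegral ha)
  have hG' : AbsolutelyContinuousOnInterval G' a b :=
    (hc (G a)).add (hg.absolutelyContinuousOnInterval_intervalIntegral ha)
  have key := hF'.integral_deriv_mul_eq_sub hG'
  have hb' : b ∈ Icc a b := right_mem_Icc.2 hab
  have e1 : F' b = F b := (hF b hb').symm
  have e2 : G' b = G b := (hG b hb').symm
  have e3 : F' a = F a := by simp [F']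
  have e4 : G' a = G a := by simp [G']
  rw [e1, e2, e3, e4] at key
  rw [← key]
  refine intervalIntegral.integral_congr_ae ?_
  filter_upwards [hf.ae_hasDerivAt_integral, hg.ae_hasDerivAt_integral] with x h1 h2 hx
  have hx' : x ∈ uIcc a b := uIoc_subset_uIcc hx
  have hx'' : x ∈ Icc a b := by rwa [uIcc_of_le hab] at hx'
  have d1 : deriv F' x = f x := ((h1 hx' a ha).const_add (F a)).deriv
  have d2 : deriv G' x = g x := ((h2 hx' a ha).const_add (G a)).deriv
  rw [d1, d2, hF x hx'', hG x hx'']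

/-! ### Integration over plane regions and flux identities -/

theorem measurable_intervalIntegral {α : Type*} [MeasurableSpace α] {a b : α → ℝ} {F : α → ℝ → ℝ}
    (ha : Measurable a) (hb : Measurable b) (hF : Measurable (Function.uncurry F)) :
    Measurable fun p => ∫ s in (a p)..(b p), F p s := by
  have key : ∀ {a b : α → ℝ}, Measurable a → Measurable b →
      Measurable fun p => ∫ s in Ioc (a p) (b p), F p s := by
    intro a b ha hb
    have hS : MeasurableSet {q : α × ℝ | a q.1 < q.2 ∧ q.2 ≤ b q.1} :=
      (measurableSet_lt (ha.comp measurable_fst) measurable_snd).inter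
        (measurableSet_le measurable_snd (hb.comp measurable_fst))
    -- Moving limits become the indicator of a measurable set in the product, and measurability of
    -- integrals over a fixed domain applies.
    have h1 : StronglyMeasurable (Function.uncurry fun p s =>
        ({q : α × ℝ | a q.1 < q.2 ∧ q.2 ≤ b q.1}.indicator (Function.uncurry F)) (p, s)) :=
      (hF.indicator hS).stronglyMeasurable
    have h2 := (h1.integral_prod_right (ν := volume)).measurable
    convert h2 using 2 with p
    rw [← integral_indicator measurableSet_Ioc]
    rfl
  exact (key ha hb).sub (key hb ha)

theorem intervalIntegrable_of_bound {f : ℝ → ℝ} {a b C : ℝ} (hf : Measurable f)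
    (h : ∀ x ∈ uIcc a b, |f x| ≤ C) : IntervalIntegrable f volume a b := by
  refine (intervalIntegrable_const (c := C)).mono_fun hf.aestronglyMeasurable ?_
  refine (ae_restrict_iff' measurableSet_uIoc).2 (Filter.Eventually.of_forall fun x hx => ?_)
  simp only [Real.norm_eq_abs]
  exact (h x (uIoc_subset_uIcc hx)).trans (le_abs_self C)

theorem integrable_of_bound_box {f : ℝ × ℝ → ℝ} (hf : Measurable f) {A C : ℝ}
    (hs : ∀ p, f p ≠ 0 → p ∈ Icc (-A) A ×ˢ Icc (-A) A) (hC : ∀ p, |f p| ≤ C) :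
    Integrable f := by
  have h1 : IntegrableOn f (Icc (-A) A ×ˢ Icc (-A) A) := by
    have hfin : volume (Icc (-A) A ×ˢ Icc (-A) A) < ⊤ := by
      rw [Measure.volume_eq_prod, Measure.prod_prod]
      simp [ENNReal.mul_lt_top]
    exact Measure.integrableOn_of_bounded (M := C) hfin.ne hf.aestronglyMeasurable
      (Filter.Eventually.of_forall hC)
  exact (integrableOn_iff_integrable_of_support_subset hs).1 h1

/-- Integration over a triangle along its lines of slope one. -/
theorem integral_triangle_eq_integral_diagonals {q : ℝ → ℝ → ℝ} {A C : ℝ} (hA : 0 ≤ A)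
    (hq : Measurable (Function.uncurry q)) (hC : ∀ a b, 0 ≤ b → b ≤ a → a ≤ A → |q a b| ≤ C) :
    ∫ a in (0 : ℝ)..A, ∫ b in (0 : ℝ)..a, q a b
      = ∫ c in (0 : ℝ)..A, ∫ r in (0 : ℝ)..(A - c), q (c + r) r := by
  have hC0 : 0 ≤ C := (abs_nonneg _).trans (hC 0 0 le_rfl le_rfl hA)
  let S : Set (ℝ × ℝ) := {p | 0 < p.2 ∧ p.2 ≤ p.1 ∧ p.1 ≤ A}
  have hS : MeasurableSet S := by
    refine (measurableSet_lt measurable_const measurable_snd).inter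
      ((measurableSet_le measurable_snd measurable_fst).inter
        (measurableSet_le measurable_fst measurable_const))
  let k : ℝ × ℝ → ℝ := S.indicator (Function.uncurry q)
  have hk : Measurable k := hq.indicator hS
  have hkC : ∀ p, |k p| ≤ C := by
    intro p
    by_cases hp : p ∈ S
    · simp only [k, indicator_of_mem hp]; exact hC _ _ hp.1.le hp.2.1 hp.2.2
    · simp only [k, indicator_of_notMem hp]; simpa using hC0
  have hk1 : Integrable k := integrable_of_bound_box hk (A := A) (C := C) (fun p hp => by
    have hp : p ∈ S := mem_of_indicator_ne_zero hp
    obtain ⟨h1, h2, h3⟩ := hp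
    constructor <;> constructor <;> linarith) hkC
  -- Coordinates `(c, r)` with `c = a - b` constant on each line of slope one. For fixed `r` the
  -- change of variables is a translation, which is used at the end, after both double integrals
  -- have been interchanged.
  let k' : ℝ × ℝ → ℝ := fun p => k (p.1 + p.2, p.2)
  have hk'm : Measurable k' := hk.comp
    ((measurable_fst.add measurable_snd).prodMk measurable_snd)
  have hk1' : Integrable k' := integrable_of_bound_box hk'm (A := A) (C := C) (fun p hp => by
    have hp : (p.1 + p.2, p.2) ∈ S := mem_of_indicator_ne_zero hp
    obtain ⟨h1, h2, h3⟩ := hp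
    simp only at h1 h2 h3
    constructor <;> constructor <;> linarith) (fun p => hkC _)
  have e1 : ∫ a in (0 : ℝ)..A, ∫ b in (0 : ℝ)..a, q a b = ∫ a, ∫ b, k (a, b) := by
    rw [intervalIntegral.integral_of_le hA, ← integral_indicator measurableSet_Ioc]
    refine integral_congr_ae (Filter.Eventually.of_forall fun a => ?_)
    by_cases ha : a ∈ Ioc 0 A
    · simp only [indicator_of_mem ha]
      rw [intervalIntegral.integral_of_le ha.1.le, ← integral_indicator measurableSet_Ioc]
      refine integral_congr_ae (Filter.Eventually.of_forall fun b => ?_)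
      simp only [k, S, indicator, mem_Ioc, mem_ofPred_eq, Function.uncurry]
      simp [ha.2]
    · simp only [indicator_of_notMem ha]
      symm
      refine integral_eq_zero_of_ae (Filter.Eventually.of_forall fun b => ?_)
      refine indicator_of_notMem (fun h => ha ⟨?_, h.2.2⟩) _
      exact h.1.trans_le h.2.1
  have e2 : ∫ c in (0 : ℝ)..A, ∫ r in (0 : ℝ)..(A - c), q (c + r) r = ∫ c, ∫ r, k' (c, r) := by
    rw [intervalIntegral.integral_of_le hA, ← integral_Icc_eq_integral_Ioc,
      ← integral_indicator measurableSet_Icc]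
    refine integral_congr_ae (Filter.Eventually.of_forall fun c => ?_)
    by_cases hc : c ∈ Icc 0 A
    · simp only [indicator_of_mem hc]
      rw [intervalIntegral.integral_of_le (sub_nonneg.2 hc.2),
        ← integral_indicator measurableSet_Ioc]
      refine integral_congr_ae (Filter.Eventually.of_forall fun r => ?_)
      simp only [k', k, S, indicator, mem_Ioc, mem_ofPred_eq, Function.uncurry]
      have : (0 < r ∧ r ≤ A - c) ↔ (0 < r ∧ r ≤ c + r ∧ c + r ≤ A) :=
        ⟨fun h => ⟨h.1, by linarith [hc.1], by linarith [h.2]⟩, fun h => ⟨h.1, by linarith [h.2.2]⟩⟩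
      simp only [this]
    · simp only [indicator_of_notMem hc]
      symm
      refine integral_eq_zero_of_ae (Filter.Eventually.of_forall fun r => ?_)
      refine indicator_of_notMem (fun h => hc ⟨?_, ?_⟩) _
      · have := h.2.1; simp only at this; linarith
      · have := h.2.2; have := h.1; simp only at *; linarith
  rw [e1, e2, integral_integral_swap (f := fun a b => k (a, b)) hk1,
    integral_integral_swap (f := fun a b => k' (a, b)) hk1']
  refine integral_congr_ae (Filter.Eventually.of_forall fun b => ?_)
  exact (integral_add_right_eq_self (fun a => k (a, b)) b).symm

/-- The flux identity for a function that is integrated along the lines of slope one. -/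
theorem flux_identity_same {Q q : ℝ → ℝ → ℝ} {A C : ℝ} (hA : 0 ≤ A)
    (hQ : Measurable (Function.uncurry Q)) (hq : Measurable (Function.uncurry q))
    (hQC : ∀ a b, 0 ≤ b → b ≤ a → a ≤ A → |Q a b| ≤ C)
    (hqC : ∀ a b, 0 ≤ b → b ≤ a → a ≤ A → |q a b| ≤ C)
    (h : ∀ c s, 0 ≤ c → 0 ≤ s → c + s ≤ A → Q (c + s) s = Q c 0 + ∫ r in (0 : ℝ)..s, q (c + r) r) :
    (∫ b in (0 : ℝ)..A, Q A b) - ∫ a in (0 : ℝ)..A, Q a 0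
      = ∫ a in (0 : ℝ)..A, ∫ b in (0 : ℝ)..a, q a b := by
  rw [integral_triangle_eq_integral_diagonals hA hq hqC]
  have e1 : ∫ b in (0 : ℝ)..A, Q A b = ∫ c in (0 : ℝ)..A, Q A (A - c) := by
    rw [intervalIntegral.integral_comp_sub_left (fun b => Q A b) A]; simp
  have i1 : IntervalIntegrable (fun c => Q A (A - c)) volume 0 A :=
    intervalIntegrable_of_bound (C := C) (hQ.comp (measurable_const.prodMk
      (measurable_const.sub measurable_id))) (fun x hx => by
        rw [uIcc_of_le hA] at hx
        exact hQC _ _ (by linarith [hx.2]) (by linarith [hx.1]) le_rfl)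
  have i2 : IntervalIntegrable (fun c => Q c 0) volume 0 A :=
    intervalIntegrable_of_bound (C := C) (hQ.comp (measurable_id.prodMk measurable_const))
      (fun x hx => by
        rw [uIcc_of_le hA] at hx
        exact hQC _ _ le_rfl hx.1 hx.2)
  rw [e1, ← intervalIntegral.integral_sub i1 i2]
  refine intervalIntegral.integral_congr fun c hc => ?_
  rw [uIcc_of_le hA] at hc
  -- The line that enters at `(c, 0)` leaves the triangle at `(A, A - c)`; the difference of the two
  -- boundary values is the integral of `q` along it.
  have := h c (A - c) hc.1 (by linarith [hc.2]) (by linarith)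
  simp only [add_sub_cancel] at this
  simp only [this]
  ring

/-- The flux identity for a function that is integrated along the lines of slope minus one, on the
region `0 ≤ b ≤ δ a`, `0 ≤ a ≤ A`, whose upper boundary is parametrized by `(α m, m - α m)`. -/
theorem flux_identity_opposite {Q q : ℝ → ℝ → ℝ} {A C : ℝ} {α δ : ℝ → ℝ} (hA : 0 ≤ A)
    (hδ : Measurable δ) (hδ0 : ∀ a ∈ Icc 0 A, 0 ≤ δ a) (hδm : ∀ a ∈ Icc 0 A, δ a ≤ δ A)
    (hα : Measurable α) (hα0 : ∀ m ∈ Icc 0 (A + δ A), α m ∈ Icc 0 (min m A))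
    (hαδ : ∀ m r, r ∈ Icc 0 A → (m ≤ r + δ r ↔ α m ≤ r))
    (hQ : Measurable (Function.uncurry Q)) (hq : Measurable (Function.uncurry q))
    (hQC : ∀ a ∈ Icc 0 A, ∀ b ∈ Icc 0 (δ a), |Q a b| ≤ C)
    (hqC : ∀ a ∈ Icc 0 A, ∀ b ∈ Icc 0 (δ a), |q a b| ≤ C)
    (h : ∀ m a, m ∈ Icc 0 (A + δ A) → a ∈ Icc (α m) (min m A) →
      Q a (m - a) = Q (α m) (m - α m) + ∫ r in (α m)..a, q r (m - r)) :
    (∫ b in (0 : ℝ)..δ A, Q A b) + (∫ a in (0 : ℝ)..A, Q a 0)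
        - ∫ m in (0 : ℝ)..(A + δ A), Q (α m) (m - α m)
      = ∫ a in (0 : ℝ)..A, ∫ b in (0 : ℝ)..δ a, q a b := by
  have hAA : A ∈ Icc 0 A := right_mem_Icc.2 hA
  have hD := hδ0 A hAA
  have hC0 : 0 ≤ C := (abs_nonneg _).trans (hQC A hAA 0 (left_mem_Icc.2 hD))
  have hM : 0 ≤ A + δ A := by linarith
  let S : Set (ℝ × ℝ) := {p | 0 < p.1 ∧ p.1 ≤ A ∧ 0 < p.2 ∧ p.2 ≤ δ p.1}
  have hS : MeasurableSet S := by
    refine (measurableSet_lt measurable_const measurable_fst).inter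
      ((measurableSet_le measurable_fst measurable_const).inter
      ((measurableSet_lt measurable_const measurable_snd).inter
        (measurableSet_le measurable_snd (hδ.comp measurable_fst))))
  let k : ℝ × ℝ → ℝ := S.indicator (Function.uncurry q)
  have hk : Measurable k := hq.indicator hS
  have hkC : ∀ p, |k p| ≤ C := by
    intro p
    by_cases hp : p ∈ S
    · simp only [k, indicator_of_mem hp]
      exact hqC _ ⟨hp.1.le, hp.2.1⟩ _ ⟨hp.2.2.1.le, hp.2.2.2⟩
    · simp only [k, indicator_of_notMem hp]; simpa using hC0
  -- Coordinates `(a, m)` with `m = a + b` constant on each line of slope minus one. Such a line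
  -- lies in the region for `a` between `α m` and `min m A`.
  let k' : ℝ × ℝ → ℝ := fun p => k (p.1, p.2 - p.1)
  have hk'm : Measurable k' := hk.comp (measurable_fst.prodMk (measurable_snd.sub measurable_fst))
  have hk1' : Integrable k' := integrable_of_bound_box hk'm (A := A + δ A) (C := C) (fun p hp => by
    have hp : (p.1, p.2 - p.1) ∈ S := mem_of_indicator_ne_zero hp
    obtain ⟨h1, h2, h3, h4⟩ := hp
    simp only at h1 h2 h3 h4
    have := hδm p.1 ⟨h1.le, h2⟩
    constructor <;> constructor <;> linarith) (fun p => hkC _)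
  have e1 : ∫ a in (0 : ℝ)..A, ∫ b in (0 : ℝ)..δ a, q a b = ∫ a, ∫ b, k (a, b) := by
    rw [intervalIntegral.integral_of_le hA, ← integral_indicator measurableSet_Ioc]
    refine integral_congr_ae (Filter.Eventually.of_forall fun a => ?_)
    by_cases ha : a ∈ Ioc 0 A
    · simp only [indicator_of_mem ha]
      rw [intervalIntegral.integral_of_le (hδ0 a ⟨ha.1.le, ha.2⟩),
        ← integral_indicator measurableSet_Ioc]
      refine integral_congr_ae (Filter.Eventually.of_forall fun b => ?_)
      simp only [k, S, indicator, mem_Ioc, mem_ofPred_eq, Function.uncurry]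
      simp [ha.2, ha.1]
    · simp only [indicator_of_notMem ha]
      symm
      refine integral_eq_zero_of_ae (Filter.Eventually.of_forall fun b => ?_)
      exact indicator_of_notMem (fun h => ha ⟨h.1, h.2.1⟩) _
  have e2 : ∫ a, ∫ b, k (a, b) = ∫ m, ∫ a, k' (a, m) := by
    rw [← integral_integral_swap (f := fun a m => k' (a, m)) hk1']
    refine integral_congr_ae (Filter.Eventually.of_forall fun a => ?_)
    exact (integral_sub_right_eq_self (fun b => k (a, b)) a).symm
  have e3 : ∫ m, ∫ a, k' (a, m)
      = ∫ m in (0 : ℝ)..(A + δ A), ∫ r in (α m)..(min m A), q r (m - r) := by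
    rw [intervalIntegral.integral_of_le hM, ← integral_indicator measurableSet_Ioc]
    refine integral_congr_ae (Filter.Eventually.of_forall fun m => ?_)
    by_cases hm : m ∈ Ioc 0 (A + δ A)
    · simp only [indicator_of_mem hm]
      obtain ⟨a1, a2⟩ := hα0 m ⟨hm.1.le, hm.2⟩
      rw [intervalIntegral.integral_of_le a2, integral_Ioc_eq_integral_Ioo,
        ← integral_indicator measurableSet_Ioo]
      -- The region `S` is half open, so its section at `m` agrees with an interval only up to the
      -- two end points.
      have hne : ∀ᵐ a : ℝ, a ≠ α m ∧ a ≠ min m A := by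
        rw [Filter.eventually_and]
        exact ⟨Measure.ae_ne volume _, Measure.ae_ne volume _⟩
      refine integral_congr_ae ?_
      filter_upwards [hne] with r hr
      have hiff : (r, m - r) ∈ S ↔ r ∈ Ioo (α m) (min m A) := by
        constructor
        · rintro ⟨h1, h2, h3, h4⟩
          simp only at h1 h2 h3 h4
          have := (hαδ m r ⟨h1.le, h2⟩).1 (by linarith)
          exact ⟨lt_of_le_of_ne this (Ne.symm hr.1),
            lt_of_le_of_ne (le_min (by linarith) h2) hr.2⟩
        · rintro ⟨h1, h2⟩
          have h3 := lt_min_iff.1 h2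
          have := (hαδ m r ⟨(a1.trans_lt h1).le, h3.2.le⟩).2 h1.le
          exact ⟨a1.trans_lt h1, h3.2.le, by simp only; linarith [h3.1], by simp only; linarith⟩
      simp only [k', k, indicator, hiff, Function.uncurry]
    · simp only [indicator_of_notMem hm]
      refine integral_eq_zero_of_ae (Filter.Eventually.of_forall fun a => ?_)
      refine indicator_of_notMem (fun h => hm ?_) _
      obtain ⟨h1, h2, h3, h4⟩ := h
      simp only at h1 h2 h3 h4
      have := hδm a ⟨h1.le, h2⟩
      exact ⟨by linarith, by linarith⟩
  have hmin : Measurable fun m : ℝ => min m A := measurable_id.min measurable_const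
  have i1 : IntervalIntegrable (fun m => Q (min m A) (m - min m A)) volume 0 (A + δ A) :=
    intervalIntegrable_of_bound (C := C) (hQ.comp (hmin.prodMk (measurable_id.sub hmin)))
      (fun m hm => by
        rw [uIcc_of_le hM] at hm
        have hmm : min m A ∈ Icc 0 A := ⟨le_min hm.1 hA, min_le_right _ _⟩
        refine hQC _ hmm _ ⟨sub_nonneg.2 (min_le_left _ _), ?_⟩
        have := (hαδ m _ hmm).2 (hα0 m hm).2
        linarith)
  have i2 : IntervalIntegrable (fun m => Q (α m) (m - α m)) volume 0 (A + δ A) :=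
    intervalIntegrable_of_bound (C := C) (hQ.comp (hα.prodMk (measurable_id.sub hα)))
      (fun m hm => by
        rw [uIcc_of_le hM] at hm
        obtain ⟨h1, h2⟩ := hα0 m hm
        have hmm : α m ∈ Icc 0 A := ⟨h1, h2.trans (min_le_right _ _)⟩
        refine hQC _ hmm _ ⟨sub_nonneg.2 (h2.trans (min_le_left _ _)), ?_⟩
        have := (hαδ m _ hmm).2 le_rfl
        linarith)
  -- Lines with `m ≤ A` end on the side `b = 0`, the others on the side `a = A`; the integral over
  -- `m` splits accordingly.
  have e4 : (∫ b in (0 : ℝ)..δ A, Q A b) + (∫ a in (0 : ℝ)..A, Q a 0)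
      = ∫ m in (0 : ℝ)..(A + δ A), Q (min m A) (m - min m A) := by
    rw [← intervalIntegral.integral_add_adjacent_intervals (b := A)
      (i1.mono_set (by rw [uIcc_of_le hA, uIcc_of_le hM]; exact Icc_subset_Icc_right (by linarith)))
      (i1.mono_set (by rw [uIcc_of_le hM, uIcc_of_le (by linarith)]; exact Icc_subset_Icc_left hA)),
      add_comm]
    congr 1
    · refine intervalIntegral.integral_congr fun m hm => ?_
      rw [uIcc_of_le hA] at hm
      simp only [min_eq_left hm.2, sub_self]
    · have : ∫ b in (0 : ℝ)..δ A, Q A b = ∫ m in A..(A + δ A), Q A (m - A) := by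
        rw [intervalIntegral.integral_comp_sub_right (fun b => Q A b) A]; simp
      rw [this]
      refine intervalIntegral.integral_congr fun m hm => ?_
      rw [uIcc_of_le (by linarith)] at hm
      simp only [min_eq_right hm.1]
  rw [e1, e2, e3, e4, ← intervalIntegral.integral_sub i1 i2]
  refine intervalIntegral.integral_congr fun m hm => ?_
  rw [uIcc_of_le hM] at hm
  simp only [h m (min m A) hm ⟨(hα0 m hm).2, le_rfl⟩]
  ring

/-! ### Travel times -/

/-- `φ` is the time needed to travel from `0` at the speed `lam`, and `ι` its inverse. -/
structure TravelTime (lam φ ι : ℝ → ℝ) : Prop where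
  continuous : Continuous lam
  pos : ∀ z, 0 < lam z
  zero : φ 0 = 0
  hasDerivAt : ∀ z, HasDerivAt φ (1 / lam z) z
  left_inv : ∀ z, ι (φ z) = z
  right_inv : ∀ s, φ (ι s) = s

namespace TravelTime

variable {lam φ ι : ℝ → ℝ} (h : TravelTime lam φ ι)
include h

theorem strictMono : StrictMono φ :=
  strictMono_of_deriv_pos fun z => by rw [(h.hasDerivAt z).deriv]; exact one_div_pos.2 (h.pos z)

theorem strictMono_inv : StrictMono ι := fun a b hab => by
  rw [← h.strictMono.lt_iff_lt, h.right_inv, h.right_inv]; exact hab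

theorem inv_zero : ι 0 = 0 := by simpa [h.zero] using h.left_inv 0

theorem continuous_travel : Continuous φ :=
  continuous_iff_continuousAt.2 fun z => (h.hasDerivAt z).continuousAt

theorem continuous_inv : Continuous ι :=
  h.strictMono_inv.monotone.continuous_of_surjective fun z => ⟨φ z, h.left_inv z⟩

theorem hasDerivAt_inv (s : ℝ) : HasDerivAt ι (lam (ι s)) s := by
  have := HasDerivAt.of_local_left_inverse h.continuous_inv.continuousAt (h.hasDerivAt (ι s))
    (one_div_pos.2 (h.pos _)).ne' (Filter.Eventually.of_forall h.right_inv)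
  simpa using this

theorem integral_eq (f : ℝ → ℝ) (a b : ℝ) :
    ∫ s in (φ a)..(φ b), f s = ∫ z in a..b, f (φ z) / lam z := by
  rw [← intervalIntegral.integral_deriv_smul_comp_of_deriv_nonneg (f := φ)
    (f' := fun z => 1 / lam z) h.continuous_travel.continuousOn (fun z _ => h.hasDerivAt z)
    (fun z _ => (one_div_pos.2 (h.pos z)).le)]
  refine intervalIntegral.integral_congr fun z _ => ?_
  simp [div_eq_inv_mul]

theorem integral_zero_eq (f : ℝ → ℝ) (b : ℝ) :
    ∫ s in (0 : ℝ)..(φ b), f s = ∫ z in (0 : ℝ)..b, f (φ z) / lam z := by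
  rw [← h.integral_eq, h.zero]

/-- The travel time along a curve of speed `c * lam`. -/
theorem travel_of_hasDerivWithinAt {Z : ℝ → ℝ} {c t₀ t₁ : ℝ}
    (hZ : ∀ t ∈ Icc t₀ t₁, HasDerivWithinAt Z (c * lam (Z t)) (Icc t₀ t₁) t) :
    ∀ t ∈ Icc t₀ t₁, φ (Z t) = φ (Z t₀) + c * (t - t₀) := by
  have hd : ∀ t ∈ Icc t₀ t₁,
      HasDerivWithinAt (fun t => φ (Z t) - c * t) 0 (Icc t₀ t₁) t := by
    intro t ht
    have h1 := (h.hasDerivAt (Z t)).comp_hasDerivWithinAt t (hZ t ht)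
    have h2 := h1.sub ((hasDerivWithinAt_id t (Icc t₀ t₁)).const_mul c)
    refine h2.congr_deriv ?_
    have := (h.pos (Z t)).ne'
    field_simp
    ring
  intro t ht
  have := constant_of_has_deriv_right_zero (f := fun t => φ (Z t) - c * t)
    (fun t ht => (hd t ht).continuousWithinAt)
    (fun t ht => (hd t ⟨ht.1, ht.2.le⟩).mono_of_mem_nhdsWithin
      (mem_nhdsWithin.2 ⟨Iio t₁, isOpen_Iio, ht.2, fun s hs => ⟨ht.1.trans hs.2, le_of_lt hs.1⟩⟩))
    t ht
  linarith

theorem hasDerivAt_inv_line (a c s : ℝ) :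
    HasDerivAt (fun s => ι (a + c * s)) (c * lam (ι (a + c * s))) s := by
  have h1 : HasDerivAt (fun s : ℝ => a + c * s) c s := by
    simpa using ((hasDerivAt_id s).const_mul c).const_add a
  have := (h.hasDerivAt_inv (a + c * s)).comp s h1
  rw [mul_comm]
  exact this

end TravelTime

/-- The bound on the speed makes `φ z - z / M` monotone, so `φ` is unbounded in both directions and
hence onto. With speeds extended to the whole line the inverse needs no domain. -/
theorem exists_travelTime_inverse {lam φ : ℝ → ℝ} (hc : Continuous lam) (hpos : ∀ z, 0 < lam z)
    {M : ℝ} (hM : ∀ z, lam z ≤ M) (h0 : φ 0 = 0) (hd : ∀ z, HasDerivAt φ (1 / lam z) z) :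
    ∃ ι, TravelTime lam φ ι := by
  have hM0 : 0 < M := (hpos 0).trans_le (hM 0)
  have hmono : StrictMono φ :=
    strictMono_of_deriv_pos fun z => by rw [(hd z).deriv]; exact one_div_pos.2 (hpos z)
  have hcont : Continuous φ := continuous_iff_continuousAt.2 fun z => (hd z).continuousAt
  have hψ : Monotone fun z => φ z - M⁻¹ * z := by
    refine monotone_of_deriv_nonneg (fun z => ((hd z).sub
      ((hasDerivAt_id z).const_mul M⁻¹)).differentiableAt) fun z => ?_
    have : HasDerivAt (fun z => φ z - M⁻¹ * z) (1 / lam z - M⁻¹ * 1) z :=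
      (hd z).sub ((hasDerivAt_id z).const_mul M⁻¹)
    rw [this.deriv, mul_one, sub_nonneg, inv_eq_one_div]
    exact one_div_le_one_div_of_le (hpos z) (hM z)
  have hsurj : Function.Surjective φ := by
    refine hcont.surjective ?_ ?_
    · refine Filter.tendsto_atTop_mono' _ (f₁ := fun z => M⁻¹ * z) ?_
        (Filter.tendsto_id.const_mul_atTop (inv_pos.2 hM0))
      filter_upwards [Filter.eventually_ge_atTop 0] with z hz
      have := hψ hz
      simp only [h0] at this
      linarith
    · refine Filter.tendsto_atBot_mono' Filter.atBot (f₂ := φ) (f₁ := fun z => M⁻¹ * z) ?_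
        (Filter.tendsto_id.const_mul_atBot (inv_pos.2 hM0))
      filter_upwards [Filter.eventually_le_atBot 0] with z hz
      have := hψ hz
      simp only [h0] at this
      linarith
  refine ⟨Function.surjInv hsurj, hc, hpos, h0, hd, fun z => ?_, Function.surjInv_eq hsurj⟩
  exact hmono.injective (Function.surjInv_eq hsurj _)

/-- The sum of two travel times is a travel time. -/
theorem TravelTime.exists_add {lam φ ι mu χ κ : ℝ → ℝ} (h : TravelTime lam φ ι)
    (k : TravelTime mu χ κ) {M : ℝ} (hM : ∀ z, lam z ≤ M) :
    ∃ ν, TravelTime (fun z => lam z * mu z / (lam z + mu z)) (fun z => φ z + χ z) ν := by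
  have hp : ∀ z, 0 < lam z + mu z := fun z => add_pos (h.pos z) (k.pos z)
  -- The reciprocals of the speeds add, and the resulting speed stays below the first one. The
  -- inverse of the sum serves to find the point of the diagonal with a given value of `φ + χ`, the
  -- quantity that is constant along lines of slope minus one.
  refine exists_travelTime_inverse (M := M)
    ((h.continuous.mul k.continuous).div (h.continuous.add k.continuous) fun z => (hp z).ne')
    (fun z => div_pos (mul_pos (h.pos z) (k.pos z)) (hp z)) (fun z => ?_)
    (by rw [h.zero, k.zero, add_zero]) (fun z => ?_)
  · rw [div_le_iff₀ (hp z)]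
    have h1 := h.pos z; have h2 := k.pos z; have h3 := hM z
    nlinarith
  · refine ((h.hasDerivAt z).add (k.hasDerivAt z)).congr_deriv ?_
    have h1 := (h.pos z).ne'; have h2 := (k.pos z).ne'; have := (hp z).ne'
    field_simp
    ring

/-! ### Extension of the coefficients to the real line -/

/-- The retraction of the real line onto `[0,1]`. -/
def unitClamp (z : ℝ) : ℝ := max 0 (min z 1)

theorem continuous_unitClamp : Continuous unitClamp := by unfold unitClamp; fun_prop

theorem unitClamp_mem (z : ℝ) : unitClamp z ∈ Icc (0 : ℝ) 1 :=
  ⟨le_max_left _ _, max_le zero_le_one (min_le_right _ _)⟩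

theorem unitClamp_of_mem {z : ℝ} (hz : z ∈ Icc (0 : ℝ) 1) : unitClamp z = z := by
  rw [unitClamp, min_eq_left hz.2, max_eq_right hz.1]

theorem ContinuousOn.comp_unitClamp {f : ℝ → ℝ} (hf : ContinuousOn f (Icc 0 1)) :
    Continuous fun z => f (unitClamp z) :=
  hf.comp_continuous continuous_unitClamp unitClamp_mem

theorem exists_bound_comp_unitClamp {f : ℝ → ℝ} (hf : ContinuousOn f (Icc 0 1)) :
    ∃ B, ∀ z, |f (unitClamp z)| ≤ B := by
  obtain ⟨B, hB⟩ := isCompact_Icc.exists_bound_of_continuousOn hf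
  exact ⟨B, fun z => hB _ (unitClamp_mem z)⟩

theorem PiecewiseC1.continuousOn {f : ℝ → ℝ} (hf : PiecewiseC1 f) : ContinuousOn f (Icc 0 1) := by
  obtain ⟨N, s, hs, h0, h1, h⟩ := hf
  have key : ∀ k ≤ N, ContinuousOn f (Icc (s 0) (s k)) := by
    intro k
    induction k with
    | zero => intro _; simp
    | succ k ih =>
      intro hk
      rw [← Icc_union_Icc_eq_Icc (hs (Nat.zero_le k)) (hs (Nat.le_succ k))]
      exact (ih (by omega)).union_of_isClosed ((h k (by omega)).continuousOn) isClosed_Icc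
        isClosed_Icc
  rw [← h0, ← h1]
  exact key N le_rfl

/-- The sign of the `i`-th characteristic speed. -/
def sgn (i : Fin 2) : ℝ := ![1, -1] i

theorem sgn_mul_self (i : Fin 2) : sgn i * sgn i = 1 := by fin_cases i <;> simp [sgn]

theorem abs_sgn (i : Fin 2) : |sgn i| = 1 := by fin_cases i <;> simp [sgn]

theorem sgn_rev (i : Fin 2) : sgn (1 - i) = -sgn i := by fin_cases i <;> simp [sgn]

namespace System

variable {n : ℕ} (P : System n)

theorem Lam_eq (z : ℝ) (i : Fin 2) : P.Lam z i = sgn i * P.lam i z := by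
  fin_cases i <;> simp [Lam, sgn]

/-- The characteristic speed, extended from `[0,1]` by constants. -/
def lamE (i : Fin 2) (z : ℝ) : ℝ := P.lam i (unitClamp z)

theorem lamE_of_mem (i : Fin 2) {z : ℝ} (hz : z ∈ Icc (0 : ℝ) 1) : P.lamE i z = P.lam i z := by
  rw [lamE, unitClamp_of_mem hz]

theorem continuous_lamE (i : Fin 2) : Continuous (P.lamE i) :=
  ContinuousOn.comp_unitClamp (P.lam_piecewiseC1 i).continuousOn

theorem lamE_pos (i : Fin 2) (z : ℝ) : 0 < P.lamE i z := P.lam_pos i _ (unitClamp_mem z)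

theorem exists_lamE_le : ∃ M, ∀ i z, P.lamE i z ≤ M := by
  choose B hB using fun i => exists_bound_comp_unitClamp (P.lam_piecewiseC1 i).continuousOn
  refine ⟨max (B 0) (B 1), fun i z => ?_⟩
  have := (le_abs_self _).trans (hB i z)
  fin_cases i
  · exact this.trans (le_max_left _ _)
  · exact this.trans (le_max_right _ _)

theorem exists_inv_lamE_le : ∃ M > 0, ∀ i z, 1 / P.lamE i z ≤ M := by
  have : ∀ i, ∃ B, ∀ z, |(1 / P.lam i (unitClamp z))| ≤ B := fun i =>
    exists_bound_comp_unitClamp (f := fun z => 1 / P.lam i z)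
      (continuousOn_const.div (P.lam_piecewiseC1 i).continuousOn fun z hz => (P.lam_pos i z hz).ne')
  choose B hB using this
  have h := fun i z => (le_abs_self _).trans (hB i z)
  refine ⟨max (B 0) (B 1), ?_, fun i z => ?_⟩
  · exact lt_of_lt_of_le (one_div_pos.2 (P.lamE_pos 0 0)) ((h 0 0).trans (le_max_left _ _))
  · fin_cases i
    · exact (h 0 z).trans (le_max_left _ _)
    · exact (h 1 z).trans (le_max_right _ _)

/-- The transport time, extended to the real line. -/
def phiE (i : Fin 2) (z : ℝ) : ℝ := ∫ ζ in (0 : ℝ)..z, 1 / P.lamE i ζ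

theorem phiE_of_mem (i : Fin 2) {z : ℝ} (hz : z ∈ Icc (0 : ℝ) 1) : P.phiE i z = P.phi i z := by
  refine intervalIntegral.integral_congr fun ζ hζ => ?_
  rw [uIcc_of_le hz.1] at hζ
  simp only [P.lamE_of_mem i ⟨hζ.1, hζ.2.trans hz.2⟩]

theorem exists_travelTime (i : Fin 2) : ∃ ι, TravelTime (P.lamE i) (P.phiE i) ι := by
  obtain ⟨M, hM⟩ := P.exists_lamE_le
  refine exists_travelTime_inverse (P.continuous_lamE i) (P.lamE_pos i) (hM i)
    intervalIntegral.integral_same fun z => ?_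
  have hc : Continuous fun ζ => 1 / P.lamE i ζ :=
    continuous_const.div (P.continuous_lamE i) fun z => (P.lamE_pos i z).ne'
  exact intervalIntegral.integral_hasDerivAt_right (hc.intervalIntegrable _ _)
    (hc.stronglyMeasurableAtFilter _ _) hc.continuousAt

/-- The inverse of the transport time. -/
def phiInv (i : Fin 2) : ℝ → ℝ := (P.exists_travelTime i).choose

theorem travelTime (i : Fin 2) : TravelTime (P.lamE i) (P.phiE i) (P.phiInv i) :=
  (P.exists_travelTime i).choose_spec

theorem tau_eq (i : Fin 2) : P.tau i = P.phiE i 1 :=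
  (P.phiE_of_mem i (right_mem_Icc.2 zero_le_one)).symm

theorem tau_pos (i : Fin 2) : 0 < P.tau i := by
  rw [P.tau_eq, ← (P.travelTime i).zero]
  exact (P.travelTime i).strictMono zero_lt_one

theorem phiE_mem_Icc (i : Fin 2) {z : ℝ} (hz : z ∈ Icc (0 : ℝ) 1) :
    P.phiE i z ∈ Icc 0 (P.tau i) := by
  have h := (P.travelTime i).strictMono.monotone
  refine ⟨?_, ?_⟩
  · rw [← (P.travelTime i).zero]; exact h hz.1
  · rw [P.tau_eq]; exact h hz.2

theorem phiInv_mem_Icc (i : Fin 2) {s : ℝ} (hs : s ∈ Icc 0 (P.tau i)) :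
    P.phiInv i s ∈ Icc (0 : ℝ) 1 := by
  have h := (P.travelTime i).strictMono_inv.monotone
  refine ⟨?_, ?_⟩
  · rw [← (P.travelTime i).inv_zero]; exact h hs.1
  · rw [← (P.travelTime i).left_inv 1, ← P.tau_eq]; exact h hs.2

/-- The coefficient matrix, extended from `[0,1]` by constants. -/
def AE (z : ℝ) : Matrix (Fin 2) (Fin 2) ℝ := P.A (unitClamp z)

theorem continuous_AE (i j : Fin 2) : Continuous fun z => P.AE z i j :=
  ContinuousOn.comp_unitClamp (P.A_continuous i j)

theorem exists_bound_AE : ∃ M, 0 ≤ M ∧ ∀ i j z, |P.AE z i j| ≤ M := by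
  choose B hB using fun i j => exists_bound_comp_unitClamp (P.A_continuous i j)
  refine ⟨∑ i, ∑ j, |B i j|, by positivity, fun i j z => ?_⟩
  refine ((hB i j z).trans (le_abs_self _)).trans ?_
  exact (Finset.single_le_sum (f := fun j => |B i j|) (fun _ _ => abs_nonneg _)
    (Finset.mem_univ j)).trans (Finset.single_le_sum (f := fun i => ∑ j, |B i j|)
      (fun _ _ => by positivity) (Finset.mem_univ i))

end System

/-! ### Solving the hyperbolic equations from boundary values at `z = 0` -/

theorem exists_monotone_bound {ι : Type*} {f : ι → ℝ → ℝ}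
    (h : ∀ T : ℝ, ∃ B, ∀ j t, |t| ≤ T → |f j t| ≤ B) :
    ∃ b : ℝ → ℝ, Monotone b ∧ (∀ r, 0 < b r) ∧ ∀ j t, |f j t| ≤ b |t| := by
  choose B hB using h
  -- Summing the bounds at all integers up to `⌈r⌉₊` makes the majorant monotone, and the summand
  -- `1` makes it positive, so that it can serve as a weight.
  refine ⟨fun r => 1 + ∑ k ∈ Finset.range (⌈r⌉₊ + 1), |B k|, fun r s hrs => ?_, fun r => ?_,
    fun j t => ?_⟩
  · have : Finset.range (⌈r⌉₊ + 1) ⊆ Finset.range (⌈s⌉₊ + 1) :=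
      Finset.range_subset_range.2 (Nat.add_le_add_right (Nat.ceil_mono hrs) 1)
    have := Finset.sum_le_sum_of_subset_of_nonneg (f := fun k : ℕ => |B k|) this
      (fun _ _ _ => abs_nonneg _)
    simpa using this
  · positivity
  · have h1 := hB (⌈|t|⌉₊ : ℕ) j t (Nat.le_ceil _)
    have h2 := Finset.single_le_sum (f := fun k : ℕ => |B k|) (fun _ _ => abs_nonneg _)
      (Finset.self_mem_range_succ ⌈|t|⌉₊)
    simp only at h2 ⊢
    linarith [le_abs_self (B (⌈|t|⌉₊ : ℕ))]

theorem integral_exp_mul_le {L z : ℝ} (hL : 0 < L) :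
    ∫ w in (0 : ℝ)..z, Real.exp (L * w) ≤ Real.exp (L * z) / L := by
  have : ∫ w in (0 : ℝ)..z, Real.exp (L * w) = L⁻¹ * (Real.exp (L * z) - 1) := by
    rw [intervalIntegral.integral_comp_mul_left (fun w => Real.exp w) hL.ne', integral_exp]
    simp
  rw [this, div_eq_inv_mul]
  gcongr
  linarith

/-- Integration gains the factor `1 / L` against the weight `exp (L w)`. For large `L` this makes
Volterra operators contract without any smallness assumption. -/
theorem abs_integral_le_of_exp_bound {F : ℝ → ℝ} {L z c : ℝ} (hL : 0 < L) (hz : 0 ≤ z)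
    (hc : 0 ≤ c) (h : ∀ w ∈ Icc 0 z, |F w| ≤ c * Real.exp (L * w)) :
    |∫ w in (0 : ℝ)..z, F w| ≤ c / L * Real.exp (L * z) := by
  have h1 : |∫ w in (0 : ℝ)..z, F w| ≤ ∫ w in (0 : ℝ)..z, c * Real.exp (L * w) := by
    rw [← Real.norm_eq_abs]
    refine intervalIntegral.norm_integral_le_of_norm_le hz ?_ ?_
    · exact Filter.Eventually.of_forall fun w hw => h w (Ioc_subset_Icc_self hw)
    · exact (by fun_prop : Continuous fun w => c * Real.exp (L * w)).intervalIntegrable _ _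
  refine h1.trans ?_
  rw [intervalIntegral.integral_const_mul]
  calc c * _ ≤ c * (Real.exp (L * z) / L) := mul_le_mul_of_nonneg_left (integral_exp_mul_le hL) hc
    _ = _ := by ring

namespace System

variable {n : ℕ} (P : System n)

/-- The distributed states generated by their boundary values at `z = 0`: solution of the
hyperbolic equations by integration in the direction of `z`. -/
theorem exists_of_boundary_values {f : Fin 2 → ℝ → ℝ} (hf : ∀ j, Measurable (f j))
    (hb : ∀ T : ℝ, ∃ B, ∀ j t, |t| ≤ T → |f j t| ≤ B) :
    ∃ x : Fin 2 → ℝ → ℝ → ℝ, (∀ j, Measurable (Function.uncurry (x j))) ∧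
      (∀ T : ℝ, ∃ B, ∀ j t, |t| ≤ T → ∀ z, |x j z t| ≤ B) ∧
      ∀ i, ∀ z ∈ Icc (0 : ℝ) 1, ∀ t, x i z t = f i (t + sgn i * P.phiE i z)
        - sgn i * ∫ w in (0 : ℝ)..z, (∑ j, P.AE w i j *
            x j w (t + sgn i * (P.phiE i z - P.phiE i w))) / P.lamE i w := by
  obtain ⟨b, hbm, hb0, hbf⟩ := exists_monotone_bound hb
  obtain ⟨MA, hMA0, hMA⟩ := P.exists_bound_AE
  obtain ⟨ML, hML0, hML⟩ := P.exists_inv_lamE_le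
  have hmeasphi : ∀ i, Measurable (P.phiE i) := fun i =>
    (P.travelTime i).continuous_travel.measurable
  have hmeaslam : ∀ i, Measurable (P.lamE i) := fun i => (P.continuous_lamE i).measurable
  have hmeasA : ∀ i j, Measurable fun z => P.AE z i j := fun i j => (P.continuous_AE i j).measurable
  have hphimono : ∀ i, Monotone (P.phiE i) := fun i => (P.travelTime i).strictMono.monotone
  have hphi0 : ∀ i z, 0 ≤ z → 0 ≤ P.phiE i z := fun i z hz => by
    rw [← (P.travelTime i).zero]; exact hphimono i hz
  -- The value at `(z, t)` depends on positions `w ≤ z` at times within `φ z - φ w` of `t`, so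
  -- `|time| + Θ` does not grow on the way to the boundary. The weight `b (|t| + Θ z)` therefore
  -- dominates all data on which a point depends.
  let Θ : ℝ → ℝ := fun z => P.phiE 0 z + P.phiE 1 z
  have hΘm : Monotone Θ := (hphimono 0).add (hphimono 1)
  have hΘ : ∀ i z, 0 ≤ z → P.phiE i z ≤ Θ z := fun i z hz => by
    have h0 := hphi0 0 z hz; have h1 := hphi0 1 z hz
    fin_cases i <;> simp only [Θ] <;> simp <;> assumption
  have hΘ2 : ∀ i z w, w ≤ z → P.phiE i z - P.phiE i w + Θ w ≤ Θ z := fun i z w hw => by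
    have h0 := hphimono 0 hw; have h1 := hphimono 1 hw
    fin_cases i <;> simp only [Θ] <;> simp <;> linarith
  -- Two summands with coefficients at most `MA`, divided by a speed, give the constant `2 * MA *
  -- ML`; its quotient by this `L` is at most one half.
  let L : ℝ := 4 * MA * ML + 1
  have hL : 0 < L := by positivity
  let W : Fin 2 × ℝ × ℝ → ℝ := fun p =>
    Real.exp (L * unitClamp p.2.1) * b (|p.2.2| + Θ (unitClamp p.2.1))
  have hW : ∀ p, 0 < W p := fun p => mul_pos (Real.exp_pos _) (hb0 _)
  let tm : Fin 2 × ℝ × ℝ → ℝ → ℝ := fun p w =>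
    p.2.2 + sgn p.1 * (P.phiE p.1 (unitClamp p.2.1) - P.phiE p.1 w)
  let I : (Fin 2 × ℝ × ℝ → ℝ) → Fin 2 × ℝ × ℝ → ℝ → ℝ := fun x p w =>
    (∑ j, P.AE w p.1 j * x (j, w, tm p w)) / P.lamE p.1 w
  let Φ : (Fin 2 × ℝ × ℝ → ℝ) → Fin 2 × ℝ × ℝ → ℝ := fun x p =>
    f p.1 (p.2.2 + sgn p.1 * P.phiE p.1 (unitClamp p.2.1))
      - sgn p.1 * ∫ w in (0 : ℝ)..(unitClamp p.2.1), I x p w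
  have hWI : ∀ p j, ∀ w ∈ Icc 0 (unitClamp p.2.1),
      W (j, w, tm p w) ≤ b (|p.2.2| + Θ (unitClamp p.2.1)) * Real.exp (L * w) := by
    intro p j w hw
    have hw1 : unitClamp w = w := unitClamp_of_mem ⟨hw.1, hw.2.trans (unitClamp_mem _).2⟩
    simp only [W, hw1]
    rw [mul_comm]
    refine mul_le_mul_of_nonneg_right (hbm ?_) (Real.exp_pos _).le
    have h1 : |tm p w| ≤ |p.2.2| + (P.phiE p.1 (unitClamp p.2.1) - P.phiE p.1 w) := by
      refine (abs_add_le _ _).trans ?_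
      rw [abs_mul, abs_sgn, one_mul, abs_of_nonneg (sub_nonneg.2 (hphimono p.1 hw.2))]
    linarith [hΘ2 p.1 _ w hw.2]
  have hIbound : ∀ (x : Fin 2 × ℝ × ℝ → ℝ) (C : ℝ), 0 ≤ C → (∀ p, |x p| ≤ C * W p) →
      ∀ p, ∀ w ∈ Icc 0 (unitClamp p.2.1), |I x p w| ≤
        2 * MA * ML * C * b (|p.2.2| + Θ (unitClamp p.2.1)) * Real.exp (L * w) := by
    intro x C hC hx p w hw
    have h1 : ∀ j, |P.AE w p.1 j * x (j, w, tm p w)|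
        ≤ MA * (C * (b (|p.2.2| + Θ (unitClamp p.2.1)) * Real.exp (L * w))) := by
      intro j
      rw [abs_mul]
      refine mul_le_mul (hMA _ _ _) ?_ (abs_nonneg _) hMA0
      exact (hx _).trans (mul_le_mul_of_nonneg_left (hWI p j w hw) hC)
    have h2 : |∑ j, P.AE w p.1 j * x (j, w, tm p w)|
        ≤ 2 * (MA * (C * (b (|p.2.2| + Θ (unitClamp p.2.1)) * Real.exp (L * w)))) := by
      rw [Fin.sum_univ_two]
      refine (abs_add_le _ _).trans ?_
      linarith [h1 0, h1 1]
    simp only [I]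
    rw [abs_div, abs_of_pos (P.lamE_pos _ _), div_eq_mul_one_div]
    calc _ ≤ 2 * (MA * (C * (b (|p.2.2| + Θ (unitClamp p.2.1)) * Real.exp (L * w)))) * ML := by
          refine mul_le_mul h2 (hML _ _) (one_div_pos.2 (P.lamE_pos _ _)).le ?_
          exact (abs_nonneg _).trans h2
      _ = _ := by ring
  have hmeasI : ∀ x, (∀ j, Measurable fun q : ℝ × ℝ => x (j, q)) → ∀ i,
      Measurable (Function.uncurry fun (q : ℝ × ℝ) w => I x (i, q) w) := by
    intro x hx i
    have htm : Measurable fun q : (ℝ × ℝ) × ℝ => tm (i, q.1) q.2 := by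
      have h1 : Measurable fun q : (ℝ × ℝ) × ℝ => P.phiE i (unitClamp q.1.1) :=
        (hmeasphi i).comp (continuous_unitClamp.measurable.comp measurable_fst.fst)
      have h2 : Measurable fun q : (ℝ × ℝ) × ℝ => P.phiE i q.2 :=
        (hmeasphi i).comp measurable_snd
      exact measurable_fst.snd.add ((h1.sub h2).const_mul _)
    refine Measurable.div (Finset.measurable_sum _ fun j _ => ?_)
      ((hmeaslam i).comp measurable_snd)
    exact ((hmeasA i j).comp measurable_snd).mul ((hx j).comp (measurable_snd.prodMk htm))
  have hIint : ∀ x, (∀ j, Measurable fun q : ℝ × ℝ => x (j, q)) → (∃ C ≥ 0, ∀ p, |x p| ≤ C * W p) →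
      ∀ p, IntervalIntegrable (I x p) volume 0 (unitClamp p.2.1) := by
    rintro x hx ⟨C, hC, hxC⟩ p
    refine intervalIntegrable_of_bound
      (C := 2 * MA * ML * C * b (|p.2.2| + Θ (unitClamp p.2.1)) * Real.exp (L * 1))
      ((hmeasI x hx p.1).comp (measurable_const (a := p.2) |>.prodMk measurable_id)) fun w hw => ?_
    rw [uIcc_of_le (unitClamp_mem _).1] at hw
    refine (hIbound x C hC hxC p w hw).trans (mul_le_mul_of_nonneg_left ?_ ?_)
    · exact Real.exp_le_exp.2 (mul_le_mul_of_nonneg_left (hw.2.trans (unitClamp_mem _).2) hL.le)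
    · have := (hb0 (|p.2.2| + Θ (unitClamp p.2.1))).le
      positivity
  have hLq : 2 * MA * ML / L ≤ 1 / 2 := by
    rw [div_le_iff₀ hL]; simp only [L]; linarith
  have hIabs : ∀ (x : Fin 2 × ℝ × ℝ → ℝ) (C : ℝ), 0 ≤ C → (∀ p, |x p| ≤ C * W p) →
      ∀ p, |∫ w in (0 : ℝ)..(unitClamp p.2.1), I x p w| ≤ C / 2 * W p := by
    intro x C hC hx p
    have hbp := (hb0 (|p.2.2| + Θ (unitClamp p.2.1))).le
    refine (abs_integral_le_of_exp_bound hL (unitClamp_mem _).1 (by positivity)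
      (hIbound x C hC hx p)).trans ?_
    calc _ = 2 * MA * ML / L * (C * W p) := by simp only [W]; ring
      _ ≤ 1 / 2 * (C * W p) := mul_le_mul_of_nonneg_right hLq (mul_nonneg hC (hW p).le)
      _ = _ := by ring
  have hdata : ∀ p : Fin 2 × ℝ × ℝ, |f p.1 (p.2.2 + sgn p.1 * P.phiE p.1 (unitClamp p.2.1))|
      ≤ 1 * W p := by
    intro p
    have h0 := (unitClamp_mem p.2.1).1
    have h1 : b |p.2.2 + sgn p.1 * P.phiE p.1 (unitClamp p.2.1)|
        ≤ b (|p.2.2| + Θ (unitClamp p.2.1)) := by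
      refine hbm ((abs_add_le _ _).trans ?_)
      rw [abs_mul, abs_sgn, one_mul, abs_of_nonneg (hphi0 _ _ h0)]
      linarith [hΘ p.1 _ h0]
    refine (hbf _ _).trans (h1.trans ?_)
    rw [one_mul]
    refine le_mul_of_one_le_left (hb0 _).le (Real.one_le_exp (mul_nonneg hL.le h0))
  let A : (Fin 2 × ℝ × ℝ → ℝ) → Prop := fun x =>
    (∀ j, Measurable fun q : ℝ × ℝ => x (j, q)) ∧ ∃ C ≥ 0, ∀ p, |x p| ≤ C * W p
  obtain ⟨x, ⟨hxm, C, hC, hxC⟩, hx⟩ := exists_fixedPoint_of_weighted_contraction W A Φ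
    (fun x hx => ⟨fun i => by
        have h1 : Measurable fun q : ℝ × ℝ => unitClamp q.1 :=
          continuous_unitClamp.measurable.comp measurable_fst
        refine Measurable.sub ((hf i).comp (measurable_snd.add
          (((hmeasphi i).comp h1).const_mul _))) (Measurable.const_mul ?_ _)
        exact measurable_intervalIntegral measurable_const h1 (hmeasI x hx.1 i),
      by
        obtain ⟨C, hC, hxC⟩ := hx.2
        refine ⟨1 + C / 2, by positivity, fun p => (abs_sub _ _).trans ?_⟩
        rw [abs_mul, abs_sgn, one_mul, add_mul]
        exact add_le_add (hdata p) (hIabs x C hC hxC p)⟩)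
    (fun F x C hC hF hlim => ⟨fun j => by
        refine measurable_of_tendsto_metrizable (fun m => (hF m).1 j) (tendsto_pi_nhds.2 fun q => ?_)
        rw [tendsto_iff_norm_sub_tendsto_zero]
        refine squeeze_zero (fun _ => norm_nonneg _) (fun m => hlim m (j, q)) ?_
        simpa using ((tendsto_pow_atTop_nhds_zero_of_lt_one (r := (1 / 2 : ℝ)) (by norm_num)
          (by norm_num)).const_mul C).mul_const (W (j, q)), by
        obtain ⟨D, hD, hxD⟩ := (hF 0).2
        refine ⟨D + C, by positivity, fun p => ?_⟩
        have h1 := hlim 0 p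
        have h2 := hxD p
        rw [Real.norm_eq_abs, abs_sub_comm] at h1
        have h3 : x p = F 0 p + (x p - F 0 p) := by ring
        rw [h3]
        refine (abs_add_le _ _).trans ?_
        simp only [pow_zero, mul_one] at h1
        linarith⟩)
    (fun x y hx hy B hB hxy p => by
      have h1 : ∀ q, |(fun q => x q - y q) q| ≤ B * W q := hxy
      have h2 := hIabs _ B hB h1 p
      have h3 : ∫ w in (0 : ℝ)..(unitClamp p.2.1), I (fun q => x q - y q) p w
          = (∫ w in (0 : ℝ)..(unitClamp p.2.1), I x p w)
            - ∫ w in (0 : ℝ)..(unitClamp p.2.1), I y p w := by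
        rw [← intervalIntegral.integral_sub (hIint x hx.1 hx.2 p) (hIint y hy.1 hy.2 p)]
        refine intervalIntegral.integral_congr fun w _ => ?_
        simp only [I, mul_sub, Finset.sum_sub_distrib, sub_div]
      rw [h3] at h2
      have h4 : Φ x p - Φ y p = -sgn p.1 * ((∫ w in (0 : ℝ)..(unitClamp p.2.1), I x p w)
            - ∫ w in (0 : ℝ)..(unitClamp p.2.1), I y p w) := by
        simp only [Φ]; ring
      rw [Real.norm_eq_abs, h4, abs_mul, abs_neg, abs_sgn, one_mul]
      exact h2)
    (fun _ => 0) ⟨fun _ => measurable_const, 0, le_rfl, fun p => by simp⟩ 1 zero_le_one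
    (fun p => by simpa [Φ, I] using hdata p)
  refine ⟨fun j z t => x (j, z, t), fun j => hxm j, fun T => ?_, fun i z hz t => ?_⟩
  · refine ⟨C * (Real.exp L * b (T + Θ 1)), fun j t ht z => (hxC _).trans ?_⟩
    refine mul_le_mul_of_nonneg_left ?_ hC
    refine mul_le_mul (Real.exp_le_exp.2 ?_) (hbm ?_) (hb0 _).le (Real.exp_pos _).le
    · exact mul_le_of_le_one_right hL.le (unitClamp_mem _).2
    · exact add_le_add ht (hΘm (unitClamp_mem _).2)
  · have h := congrFun hx (i, z, t)
    refine h.symm.trans ?_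
    simp only [Φ, I, tm, unitClamp_of_mem hz]

end System

/-! ### The backstepping transformation along trajectories -/

/-- A kernel, extended from the triangle to the plane by a retraction. -/
def kerE (K : ℝ → ℝ → Matrix (Fin 2) (Fin 2) ℝ) (z ζ : ℝ) : Matrix (Fin 2) (Fin 2) ℝ :=
  K (unitClamp z) (min (unitClamp ζ) (unitClamp z))

theorem retract_mem_triangle (z ζ : ℝ) : (unitClamp z, min (unitClamp ζ) (unitClamp z)) ∈ triangle :=
  ⟨le_min (unitClamp_mem _).1 (unitClamp_mem _).1, min_le_right _ _, (unitClamp_mem _).2⟩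

theorem retract_of_mem {z ζ : ℝ} (h : (z, ζ) ∈ triangle) :
    (unitClamp z, min (unitClamp ζ) (unitClamp z)) = (z, ζ) := by
  obtain ⟨h0, h1, h2⟩ := h
  simp only at h0 h1 h2
  rw [unitClamp_of_mem ⟨h0.trans h1, h2⟩, unitClamp_of_mem ⟨h0, h1.trans h2⟩, min_eq_left h1]

theorem kerE_of_mem (K : ℝ → ℝ → Matrix (Fin 2) (Fin 2) ℝ) {z ζ : ℝ} (h : (z, ζ) ∈ triangle) :
    kerE K z ζ = K z ζ := by
  have := retract_of_mem h
  rw [Prod.mk.injEq] at this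
  rw [kerE, this.2, this.1]

namespace System

variable {n : ℕ} (P : System n)

/-- The exponents of the scaling, extended to the real line. -/
def alphaE (i : Fin 2) (z : ℝ) : ℝ := ∫ ζ in (0 : ℝ)..z, P.AE ζ i i / P.lamE i ζ

theorem alphaE_of_mem (i : Fin 2) {z : ℝ} (hz : z ∈ Icc (0 : ℝ) 1) :
    P.alphaE i z = P.alpha i z := by
  refine intervalIntegral.integral_congr fun ζ hζ => ?_
  rw [uIcc_of_le hz.1] at hζ
  have hζ' : ζ ∈ Icc (0 : ℝ) 1 := ⟨hζ.1, hζ.2.trans hz.2⟩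
  simp only [P.lamE_of_mem i hζ', AE, unitClamp_of_mem hζ']

theorem hasDerivAt_alphaE (i : Fin 2) (z : ℝ) :
    HasDerivAt (P.alphaE i) (P.AE z i i / P.lamE i z) z := by
  have hc : Continuous fun ζ => P.AE ζ i i / P.lamE i ζ :=
    (P.continuous_AE i i).div (P.continuous_lamE i) fun z => (P.lamE_pos i z).ne'
  exact intervalIntegral.integral_hasDerivAt_right (hc.intervalIntegrable _ _)
    (hc.stronglyMeasurableAtFilter _ _) hc.continuousAt

theorem continuous_alphaE (i : Fin 2) : Continuous (P.alphaE i) :=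
  continuous_iff_continuousAt.2 fun z => (P.hasDerivAt_alphaE i z).continuousAt

/-- The scaling factors, extended to the real line. -/
def scaleE (i : Fin 2) (z : ℝ) : ℝ := Real.exp (sgn i * P.alphaE i z)

theorem scaleE_pos (i : Fin 2) (z : ℝ) : 0 < P.scaleE i z := Real.exp_pos _

theorem scaleE_zero (i : Fin 2) : P.scaleE i 0 = 1 := by simp [scaleE, alphaE]

theorem continuous_scaleE (i : Fin 2) : Continuous (P.scaleE i) :=
  Real.continuous_exp.comp (continuous_const.mul (P.continuous_alphaE i))

theorem E_of_mem (i : Fin 2) {z : ℝ} (hz : z ∈ Icc (0 : ℝ) 1) : P.E z i = P.scaleE i z := by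
  fin_cases i <;> simp [E, scaleE, sgn, P.alphaE_of_mem _ hz]

theorem hasDerivAt_scaleE_phiInv (i : Fin 2) (s : ℝ) :
    HasDerivAt (fun a => P.scaleE i (P.phiInv i a))
      (sgn i * P.AE (P.phiInv i s) i i * P.scaleE i (P.phiInv i s)) s := by
  have h1 := (P.hasDerivAt_alphaE i (P.phiInv i s)).comp s ((P.travelTime i).hasDerivAt_inv s)
  refine ((h1.const_mul (sgn i)).exp).congr_deriv ?_
  have := (P.lamE_pos i (P.phiInv i s)).ne'
  simp only [scaleE, Function.comp]
  field_simp

/-- The coupling matrix after the scaling, extended to the real line. -/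
def AtE (z : ℝ) : Matrix (Fin 2) (Fin 2) ℝ := P.Atilde (unitClamp z)

theorem AtE_of_mem {z : ℝ} (hz : z ∈ Icc (0 : ℝ) 1) : P.AtE z = P.Atilde z := by
  rw [AtE, unitClamp_of_mem hz]

theorem AtE_self (z : ℝ) (i : Fin 2) : P.AtE z i i = 0 := by
  fin_cases i <;> simp [AtE, Atilde]

/-- The exponentials in `Atilde` are the ratios of the two scaling factors, so scaling a solution
turns the off-diagonal coefficients of `A` into those of `Atilde`. -/
theorem AtE_rev {z : ℝ} (hz : z ∈ Icc (0 : ℝ) 1) (i : Fin 2) :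
    P.AtE z i (1 - i) * P.scaleE (1 - i) z = P.AE z i (1 - i) * P.scaleE i z := by
  rw [P.AtE_of_mem hz, AE, unitClamp_of_mem hz]
  fin_cases i
  · simp [Atilde, scaleE, sgn, P.alphaE_of_mem _ hz, mul_assoc, ← Real.exp_add]
  · simp [Atilde, scaleE, sgn, P.alphaE_of_mem _ hz, mul_assoc, ← Real.exp_add]
    left; ring

theorem continuous_AtE (i j : Fin 2) : Continuous fun z => P.AtE z i j := by
  have ha : ∀ i, Continuous fun z => P.alpha i (unitClamp z) := fun i => by
    have : (fun z => P.alpha i (unitClamp z)) = fun z => P.alphaE i (unitClamp z) :=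
      funext fun z => (P.alphaE_of_mem i (unitClamp_mem z)).symm
    rw [this]
    exact (P.continuous_alphaE i).comp continuous_unitClamp
  have h01 := P.continuous_AE 0 1
  have h10 := P.continuous_AE 1 0
  fin_cases i <;> fin_cases j <;> simp [AtE, Atilde]
  · exact continuous_const
  · exact h01.mul (Real.continuous_exp.comp ((ha 0).add (ha 1)))
  · exact h10.mul (Real.continuous_exp.comp ((ha 0).neg.sub (ha 1)))
  · exact continuous_const

theorem continuous_kerE {K : ℝ → ℝ → Matrix (Fin 2) (Fin 2) ℝ}
    (hK : ∀ i j, ContinuousOn (fun p : ℝ × ℝ => K p.1 p.2 i j) triangle) (i j : Fin 2) :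
    Continuous fun p : ℝ × ℝ => kerE K p.1 p.2 i j := by
  have h := (hK i j).comp_continuous (f := fun p : ℝ × ℝ =>
    (unitClamp p.1, min (unitClamp p.2) (unitClamp p.1)))
    (((continuous_unitClamp.comp continuous_fst)).prodMk
      ((continuous_unitClamp.comp continuous_snd).min (continuous_unitClamp.comp continuous_fst)))
    (fun p => retract_mem_triangle _ _)
  exact h

/-- Along the kernel characteristics, traversed in the direction of increasing `z`. -/
theorem IsKernel.hasDerivWithinAt_along {P : System n} {K : ℝ → ℝ → Matrix (Fin 2) (Fin 2) ℝ}
    (hK : P.IsKernel K) (i j : Fin 2) {a b s₁ : ℝ}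
    (hT : ∀ s ∈ Icc 0 s₁, (P.phiInv i (a + s), P.phiInv j (b + sgn i * sgn j * s)) ∈ triangle) :
    ∀ s ∈ Icc 0 s₁, HasDerivWithinAt
      (fun s => kerE K (P.phiInv i (a + s)) (P.phiInv j (b + sgn i * sgn j * s)) i j
        * P.lamE j (P.phiInv j (b + sgn i * sgn j * s)))
      (sgn i * P.lamE j (P.phiInv j (b + sgn i * sgn j * s)) *
        (kerE K (P.phiInv i (a + s)) (P.phiInv j (b + sgn i * sgn j * s)) *
          P.AtE (P.phiInv j (b + sgn i * sgn j * s))) i j) (Icc 0 s₁) s := by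
  have hmem : ∀ {z ζ : ℝ}, (z, ζ) ∈ triangle → z ∈ Icc (0 : ℝ) 1 ∧ ζ ∈ Icc (0 : ℝ) 1 :=
    fun h => ⟨⟨h.1.trans h.2.1, h.2.2⟩, ⟨h.1, h.2.1.trans h.2.2⟩⟩
  have hss : ∀ r, sgn i * (sgn i * r) = r := fun r => by rw [← mul_assoc, sgn_mul_self, one_mul]
  -- The kernel equation is parametrized by `z' = Λᵢ(z)`, so for `i = 1` its parameter runs against
  -- increasing `z`. Substituting `sgn i * s` reverses the direction; in that case the original
  -- parameter lies in `[-s₁, 0]`.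
  let Z : ℝ → ℝ := fun s => P.phiInv i (a + sgn i * s)
  let ζ : ℝ → ℝ := fun s => P.phiInv j (b + sgn j * s)
  have key : ∀ c d : ℝ, (∀ s ∈ Icc c d, sgn i * s ∈ Icc 0 s₁) → ∀ s ∈ Icc c d,
      HasDerivWithinAt (fun r => K (Z r) (ζ r) i j * P.Lam (ζ r) j)
        (P.Lam (ζ s) j * (K (Z s) (ζ s) * P.Atilde (ζ s)) i j) (Icc c d) s := by
    intro c d hcd
    refine hK.pde i j c d Z ζ fun s hs => ?_
    have h1 := hT _ (hcd s hs)
    have e : b + sgn i * sgn j * (sgn i * s) = b + sgn j * s := by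
      rw [mul_comm (sgn i) (sgn j), mul_assoc, hss]
    rw [e] at h1
    obtain ⟨m1, m2⟩ := hmem h1
    refine ⟨h1, ?_, ?_⟩
    · rw [P.Lam_eq, ← P.lamE_of_mem i m1]
      exact ((P.travelTime i).hasDerivAt_inv_line a (sgn i) s).hasDerivWithinAt
    · rw [P.Lam_eq, ← P.lamE_of_mem j m2]
      exact ((P.travelTime j).hasDerivAt_inv_line b (sgn j) s).hasDerivWithinAt
  intro s hs
  have main : HasDerivWithinAt (fun r => K (Z (sgn i * r)) (ζ (sgn i * r)) i j *
      P.Lam (ζ (sgn i * r)) j) (sgn i * (P.Lam (ζ (sgn i * s)) j *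
        (K (Z (sgn i * s)) (ζ (sgn i * s)) * P.Atilde (ζ (sgn i * s))) i j)) (Icc 0 s₁) s := by
    have hlin : HasDerivWithinAt (fun r : ℝ => sgn i * r) (sgn i) (Icc 0 s₁) s := by
      simpa using (hasDerivWithinAt_id s (Icc 0 s₁)).const_mul (sgn i)
    have hcomp : ∀ c d : ℝ, (∀ s ∈ Icc c d, sgn i * s ∈ Icc 0 s₁) →
        MapsTo (fun r => sgn i * r) (Icc 0 s₁) (Icc c d) → _ := fun c d h1 h2 =>
      (key c d h1 _ (h2 hs)).scomp s hlin h2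
    have hi : sgn i = 1 ∨ sgn i = -1 := by fin_cases i <;> simp [sgn]
    rcases hi with hi | hi
    · exact hcomp 0 s₁ (fun s hs => by rw [hi, one_mul]; exact hs)
        (fun s hs => by simp only [hi, one_mul]; exact hs)
    · exact hcomp (-s₁) 0 (fun s hs => by rw [hi]; constructor <;> linarith [hs.1, hs.2])
        (fun s hs => by simp only [hi]; constructor <;> linarith [hs.1, hs.2])
  have eZ : ∀ r, Z (sgn i * r) = P.phiInv i (a + r) := fun r => by simp only [Z, hss]
  have eζ : ∀ r, ζ (sgn i * r) = P.phiInv j (b + sgn i * sgn j * r) := fun r => by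
    simp only [ζ]; congr 2; ring
  simp only [eZ, eζ] at main
  have h2 := main.const_mul (sgn j)
  refine (h2.congr_deriv ?_).congr_of_mem (fun r hr => ?_) hs
  · have m := (hmem (hT s hs)).2
    rw [kerE_of_mem K (hT s hs), P.AtE_of_mem m, P.Lam_eq, ← P.lamE_of_mem j m]
    linear_combination (sgn i * P.lamE j (P.phiInv j (b + sgn i * sgn j * s)) *
      (K (P.phiInv i (a + s)) (P.phiInv j (b + sgn i * sgn j * s)) *
          P.Atilde (P.phiInv j (b + sgn i * sgn j * s))) i j) * sgn_mul_self j
  · have m := (hmem (hT r hr)).2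
    rw [kerE_of_mem K (hT r hr), P.Lam_eq, ← P.lamE_of_mem j m]
    linear_combination -(K (P.phiInv i (a + r)) (P.phiInv j (b + sgn i * sgn j * r)) i j *
      P.lamE j (P.phiInv j (b + sgn i * sgn j * r))) * sgn_mul_self j

/-- Distributed states for all times that solve the scaled hyperbolic equations, in travel time
coordinates. -/
structure IsScaledSolution (y : Fin 2 → ℝ → ℝ → ℝ) : Prop where
  measurable : ∀ j, Measurable (Function.uncurry (y j))
  bounded : ∀ T : ℝ, ∃ B, ∀ j t, |t| ≤ T → ∀ z, |y j z t| ≤ B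
  pde : ∀ i s a₀ a₁, 0 ≤ a₀ → a₀ ≤ a₁ → a₁ ≤ P.tau i →
    y i (P.phiInv i a₁) (s - sgn i * a₁) = y i (P.phiInv i a₀) (s - sgn i * a₀)
      - sgn i * ∫ a in a₀..a₁, ∑ j, P.AtE (P.phiInv i a) i j *
          y j (P.phiInv i a) (s - sgn i * a)

end System

namespace System

variable {n : ℕ} {P : System n}

/-- If `z` moves along its part of a characteristic of `Kᵢⱼ` and time is tied to it by `s - sgn i *
(a + r)`, then `ζ` and time together run through a characteristic of component `j`. This
synchronization is what removes the transport terms from the product of kernel and state. -/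
theorem IsScaledSolution.along {y : Fin 2 → ℝ → ℝ → ℝ} (hy : P.IsScaledSolution y) (i j : Fin 2)
    {a b r s : ℝ} (hr : 0 ≤ r) (hb : b ∈ Icc 0 (P.tau j))
    (hb' : b + sgn i * sgn j * r ∈ Icc 0 (P.tau j)) :
    y j (P.phiInv j (b + sgn i * sgn j * r)) (s - sgn i * (a + r))
      = y j (P.phiInv j b) (s - sgn i * a) + ∫ r' in (0 : ℝ)..r,
        -sgn i * ∑ k, P.AtE (P.phiInv j (b + sgn i * sgn j * r')) j k *
          y k (P.phiInv j (b + sgn i * sgn j * r')) (s - sgn i * (a + r')) := by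
  have hi : ∀ i, sgn i = 1 ∨ sgn i = -1 := fun i => by fin_cases i <;> simp [sgn]
  rw [intervalIntegral.integral_const_mul]
  have hij : sgn i * sgn j = 1 ∨ sgn i * sgn j = -1 := by
    rcases hi i with h | h <;> rcases hi j with h' | h' <;> rw [h, h'] <;> norm_num
  rcases hij with hij | hij
  · have hj : sgn j = sgn i := by
      have := sgn_mul_self i; rw [← hij] at this
      rcases hi i with h | h <;> rw [h] at this ⊢ <;> linarith
    rw [hij, one_mul] at hb'
    have h1 := hy.pde j (s - sgn i * (a - b)) b (b + r) hb.1 (by linarith) hb'.2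
    have e := intervalIntegral.integral_comp_add_left (a := 0) (b := r)
      (fun a' => ∑ k, P.AtE (P.phiInv j a') j k * y k (P.phiInv j a')
        (s - sgn i * (a - b) - sgn j * a')) b
    rw [add_zero] at e
    rw [← e, hj] at h1
    simp only [hij, one_mul]
    have t1 : s - sgn i * (a - b) - sgn i * (b + r) = s - sgn i * (a + r) := by ring
    have t2 : s - sgn i * (a - b) - sgn i * b = s - sgn i * a := by ring
    have t3 : ∀ x, s - sgn i * (a - b) - sgn i * (b + x) = s - sgn i * (a + x) := fun x => by ring
    simp only [t1, t2, t3] at h1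
    rw [h1]; ring
  · have hj : sgn j = -sgn i := by
      have := sgn_mul_self i
      rcases hi i with h | h <;> rw [h] at hij ⊢ <;> linarith
    rw [hij] at hb'
    have h1 := hy.pde j (s - sgn i * (a + b)) (b + -1 * r) b hb'.1 (by linarith) hb.2
    have e := intervalIntegral.integral_comp_sub_left (a := 0) (b := r)
      (fun a' => ∑ k, P.AtE (P.phiInv j a') j k * y k (P.phiInv j a')
        (s - sgn i * (a + b) - sgn j * a')) b
    rw [sub_zero, show b - r = b + -1 * r by ring] at e
    rw [← e, hj] at h1
    simp only [hij]
    have t1 : s - sgn i * (a + b) - -sgn i * (b + -1 * r) = s - sgn i * (a + r) := by ring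
    have t2 : s - sgn i * (a + b) - -sgn i * b = s - sgn i * a := by ring
    have t3 : ∀ x, s - sgn i * (a + b) - -sgn i * (b - x) = s - sgn i * (a + x) := fun x => by ring
    have t4 : ∀ x, b + -1 * x = b - x := fun x => by ring
    simp only [t1, t2, t3] at h1
    simp only [t4] at h1 ⊢
    rw [h1]; ring

/-- The density that is transported along the kernel characteristics, in travel times. -/
def fluxDensity (P : System n) (K : ℝ → ℝ → Matrix (Fin 2) (Fin 2) ℝ) (y : Fin 2 → ℝ → ℝ → ℝ)
    (i j : Fin 2) (s a b : ℝ) : ℝ :=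
  kerE K (P.phiInv i a) (P.phiInv j b) i j * P.lamE j (P.phiInv j b) *
    y j (P.phiInv j b) (s - sgn i * a)

/-- The derivative of the density along the kernel characteristics, in travel times. -/
def fluxSource (P : System n) (K : ℝ → ℝ → Matrix (Fin 2) (Fin 2) ℝ) (y : Fin 2 → ℝ → ℝ → ℝ)
    (i j : Fin 2) (s a b : ℝ) : ℝ :=
  sgn i * P.lamE j (P.phiInv j b) *
    ((kerE K (P.phiInv i a) (P.phiInv j b) * P.AtE (P.phiInv j b)) i j *
        y j (P.phiInv j b) (s - sgn i * a)
      - kerE K (P.phiInv i a) (P.phiInv j b) i j *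
        ∑ k, P.AtE (P.phiInv j b) j k * y k (P.phiInv j b) (s - sgn i * a))

variable {K : ℝ → ℝ → Matrix (Fin 2) (Fin 2) ℝ} {y : Fin 2 → ℝ → ℝ → ℝ}

theorem continuous_phiInv (P : System n) (i : Fin 2) : Continuous (P.phiInv i) :=
  (P.travelTime i).continuous_inv

theorem measurable_fluxDensity (hK : P.IsKernel K) (hy : P.IsScaledSolution y) (i j : Fin 2)
    (s : ℝ) : Measurable (Function.uncurry (P.fluxDensity K y i j s)) := by
  have h1 : Continuous fun p : ℝ × ℝ => kerE K (P.phiInv i p.1) (P.phiInv j p.2) i j :=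
    (continuous_kerE hK.continuous i j).comp
      (((P.continuous_phiInv i).comp continuous_fst).prodMk
        ((P.continuous_phiInv j).comp continuous_snd))
  have h2 : Continuous fun p : ℝ × ℝ => P.lamE j (P.phiInv j p.2) :=
    (P.continuous_lamE j).comp ((P.continuous_phiInv j).comp continuous_snd)
  refine (h1.measurable.mul h2.measurable).mul ((hy.measurable j).comp (Measurable.prodMk ?_ ?_))
  · exact (P.continuous_phiInv j).measurable.comp measurable_snd
  · exact measurable_const.sub (measurable_fst.const_mul _)

theorem measurable_fluxSource (hK : P.IsKernel K) (hy : P.IsScaledSolution y) (i j : Fin 2)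
    (s : ℝ) : Measurable (Function.uncurry (P.fluxSource K y i j s)) := by
  have h1 : ∀ k, Continuous fun p : ℝ × ℝ => kerE K (P.phiInv i p.1) (P.phiInv j p.2) i k :=
    fun k => (continuous_kerE hK.continuous i k).comp
      (((P.continuous_phiInv i).comp continuous_fst).prodMk
        ((P.continuous_phiInv j).comp continuous_snd))
  have h2 : Continuous fun p : ℝ × ℝ => P.lamE j (P.phiInv j p.2) :=
    (P.continuous_lamE j).comp ((P.continuous_phiInv j).comp continuous_snd)
  have h3 : ∀ k l, Continuous fun p : ℝ × ℝ => P.AtE (P.phiInv j p.2) k l := fun k l =>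
    (P.continuous_AtE k l).comp ((P.continuous_phiInv j).comp continuous_snd)
  have h4 : ∀ k, Measurable fun p : ℝ × ℝ => y k (P.phiInv j p.2) (s - sgn i * p.1) := fun k =>
    (hy.measurable k).comp (((P.continuous_phiInv j).measurable.comp measurable_snd).prodMk
      (measurable_const.sub (measurable_fst.const_mul _)))
  have h5 : Continuous fun p : ℝ × ℝ =>
      (kerE K (P.phiInv i p.1) (P.phiInv j p.2) * P.AtE (P.phiInv j p.2)) i j := by
    simp only [Matrix.mul_apply]
    exact continuous_finsetSum _ fun k _ => (h1 k).mul (h3 k j)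
  refine (h2.measurable.const_mul _).mul (Measurable.sub (h5.measurable.mul (h4 j)) ?_)
  exact (h1 j).measurable.mul (Finset.measurable_sum _ fun k _ => (h3 j k).measurable.mul (h4 k))

theorem exists_bound_flux (hK : P.IsKernel K) (hy : P.IsScaledSolution y) (i j : Fin 2)
    (s A B : ℝ) : ∃ C, ∀ a ∈ Icc 0 A, ∀ b ∈ Icc 0 B,
      |P.fluxDensity K y i j s a b| ≤ C ∧ |P.fluxSource K y i j s a b| ≤ C := by
  have hcomp : IsCompact (Icc 0 A ×ˢ Icc 0 B) := isCompact_Icc.prod isCompact_Icc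
  have h1 : ∀ k, Continuous fun p : ℝ × ℝ => kerE K (P.phiInv i p.1) (P.phiInv j p.2) i k :=
    fun k => (continuous_kerE hK.continuous i k).comp
      (((P.continuous_phiInv i).comp continuous_fst).prodMk
        ((P.continuous_phiInv j).comp continuous_snd))
  have h2 : Continuous fun p : ℝ × ℝ => P.lamE j (P.phiInv j p.2) :=
    (P.continuous_lamE j).comp ((P.continuous_phiInv j).comp continuous_snd)
  have h3 : ∀ k l, Continuous fun p : ℝ × ℝ => P.AtE (P.phiInv j p.2) k l := fun k l =>
    (P.continuous_AtE k l).comp ((P.continuous_phiInv j).comp continuous_snd)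
  have h5 : Continuous fun p : ℝ × ℝ =>
      (kerE K (P.phiInv i p.1) (P.phiInv j p.2) * P.AtE (P.phiInv j p.2)) i j := by
    simp only [Matrix.mul_apply]
    exact continuous_finsetSum _ fun k _ => (h1 k).mul (h3 k j)
  obtain ⟨c1, hc1⟩ := hcomp.exists_bound_of_continuousOn (h1 j).continuousOn
  obtain ⟨c2, hc2⟩ := hcomp.exists_bound_of_continuousOn h2.continuousOn
  obtain ⟨c5, hc5⟩ := hcomp.exists_bound_of_continuousOn h5.continuousOn
  obtain ⟨c3, hc3⟩ := hcomp.exists_bound_of_continuousOn (h3 j 0).continuousOn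
  obtain ⟨c4, hc4⟩ := hcomp.exists_bound_of_continuousOn (h3 j 1).continuousOn
  obtain ⟨c6, hc6⟩ := hy.bounded (|s| + A)
  have main : ∀ a ∈ Icc 0 A, ∀ b ∈ Icc 0 B, |P.fluxDensity K y i j s a b| ≤ c1 * c2 * c6 ∧
      |P.fluxSource K y i j s a b| ≤ c2 * (c5 * c6 + c1 * (c3 * c6 + c4 * c6)) := by
    intro a ha b hb
    have hp : (a, b) ∈ Icc 0 A ×ˢ Icc 0 B := ⟨ha, hb⟩
    have b1 := hc1 _ hp; have b2 := hc2 _ hp; have b3 := hc3 _ hp; have b4 := hc4 _ hp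
    have b5 := hc5 _ hp
    simp only [Real.norm_eq_abs] at b1 b2 b3 b4 b5
    have b6 : ∀ k, |y k (P.phiInv j b) (s - sgn i * a)| ≤ c6 := fun k => by
      refine hc6 k _ ((abs_sub _ _).trans ?_) _
      rw [abs_mul, abs_sgn, one_mul, abs_of_nonneg ha.1]
      linarith [ha.2]
    have n1 := (abs_nonneg _).trans b1; have n2 := (abs_nonneg _).trans b2
    have n3 := (abs_nonneg _).trans b3; have n4 := (abs_nonneg _).trans b4
    have n5 := (abs_nonneg _).trans b5
    have n6 := (abs_nonneg _).trans (b6 0)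
    have b6j := b6 j; have b60 := b6 0; have b61 := b6 1
    constructor
    · rw [fluxDensity, abs_mul, abs_mul]
      gcongr
    · rw [fluxSource, abs_mul, abs_mul, abs_sgn, one_mul, Fin.sum_univ_two]
      gcongr
      refine (abs_sub _ _).trans ?_
      rw [abs_mul, abs_mul]
      gcongr
      refine (abs_add_le _ _).trans ?_
      rw [abs_mul, abs_mul]
      gcongr
  refine ⟨max (c1 * c2 * c6) (c2 * (c5 * c6 + c1 * (c3 * c6 + c4 * c6))), fun a ha b hb =>
    ⟨(main a ha b hb).1.trans (le_max_left _ _), (main a ha b hb).2.trans (le_max_right _ _)⟩⟩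

/-- The product rule combines the kernel equation `IsKernel.hasDerivWithinAt_along` with the state
equation `IsScaledSolution.along`. In travel times both are integrated along the same straight line,
of slope `sgn i * sgn j`. -/
theorem fluxDensity_along (hK : P.IsKernel K) (hy : P.IsScaledSolution y) (i j : Fin 2)
    {s a b r : ℝ} (hr : 0 ≤ r)
    (hT : ∀ r' ∈ Icc 0 r, (P.phiInv i (a + r'), P.phiInv j (b + sgn i * sgn j * r')) ∈ triangle)
    (hb : ∀ r' ∈ Icc 0 r, b + sgn i * sgn j * r' ∈ Icc 0 (P.tau j)) :
    P.fluxDensity K y i j s (a + r) (b + sgn i * sgn j * r) = P.fluxDensity K y i j s a b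
      + ∫ r' in (0 : ℝ)..r, P.fluxSource K y i j s (a + r') (b + sgn i * sgn j * r') := by
  let σ : ℝ := sgn i * sgn j
  have hb0 : b ∈ Icc 0 (P.tau j) := by simpa using hb 0 ⟨le_rfl, hr⟩
  have hline : Continuous fun r' : ℝ => b + σ * r' := by fun_prop
  have hline' : Continuous fun r' : ℝ => a + r' := by fun_prop
  have k1 : ∀ k, Continuous fun r' : ℝ =>
      kerE K (P.phiInv i (a + r')) (P.phiInv j (b + σ * r')) i k := fun k =>
    (continuous_kerE hK.continuous i k).comp
      (((P.continuous_phiInv i).comp hline').prodMk ((P.continuous_phiInv j).comp hline))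
  have k2 : Continuous fun r' : ℝ => P.lamE j (P.phiInv j (b + σ * r')) :=
    (P.continuous_lamE j).comp ((P.continuous_phiInv j).comp hline)
  have k3 : ∀ k l, Continuous fun r' : ℝ => P.AtE (P.phiInv j (b + σ * r')) k l := fun k l =>
    (P.continuous_AtE k l).comp ((P.continuous_phiInv j).comp hline)
  have k5 : Continuous fun r' : ℝ => sgn i * P.lamE j (P.phiInv j (b + σ * r')) *
      (kerE K (P.phiInv i (a + r')) (P.phiInv j (b + σ * r')) *
        P.AtE (P.phiInv j (b + σ * r'))) i j := by
    simp only [Matrix.mul_apply]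
    exact (continuous_const.mul k2).mul
      (continuous_finsetSum _ fun k _ => (k1 k).mul (k3 k j))
  have hG : ∀ r' ∈ Icc 0 r, kerE K (P.phiInv i (a + r')) (P.phiInv j (b + σ * r')) i j *
        P.lamE j (P.phiInv j (b + σ * r'))
      = kerE K (P.phiInv i (a + 0)) (P.phiInv j (b + σ * 0)) i j *
        P.lamE j (P.phiInv j (b + σ * 0)) + ∫ r'' in (0 : ℝ)..r',
          sgn i * P.lamE j (P.phiInv j (b + σ * r'')) *
          (kerE K (P.phiInv i (a + r'')) (P.phiInv j (b + σ * r'')) *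
            P.AtE (P.phiInv j (b + σ * r''))) i j := by
    intro r' hr'
    have hd := hK.hasDerivWithinAt_along i j (a := a) (b := b) (s₁ := r) hT
    rw [intervalIntegral.integral_eq_sub_of_hasDeriv_right_of_le hr'.1
      (f := fun r' => kerE K (P.phiInv i (a + r')) (P.phiInv j (b + σ * r')) i j *
        P.lamE j (P.phiInv j (b + σ * r'))) ((k1 j).mul k2).continuousOn (fun x hx => ?_)
      (k5.intervalIntegrable _ _)]
    · ring
    · exact (hd x ⟨hx.1.le, hx.2.le.trans hr'.2⟩).mono_of_mem_nhdsWithin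
        (mem_nhdsWithin_of_mem_nhds (Icc_mem_nhds hx.1 (hx.2.trans_le hr'.2)))
  have hY : ∀ r' ∈ Icc 0 r, y j (P.phiInv j (b + σ * r')) (s - sgn i * (a + r'))
      = y j (P.phiInv j (b + σ * 0)) (s - sgn i * (a + 0)) + ∫ r'' in (0 : ℝ)..r',
        -sgn i * ∑ k, P.AtE (P.phiInv j (b + σ * r'')) j k *
          y k (P.phiInv j (b + σ * r'')) (s - sgn i * (a + r'')) := by
    intro r' hr'
    simp only [mul_zero, add_zero]
    exact hy.along i j hr'.1 hb0 (hb r' hr')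
  have mY : ∀ k, Measurable fun r' : ℝ => y k (P.phiInv j (b + σ * r')) (s - sgn i * (a + r')) :=
    fun k => (hy.measurable k).comp ((((P.continuous_phiInv j).comp hline).measurable).prodMk
      (measurable_const.sub (hline'.measurable.const_mul _)))
  have iY : IntervalIntegrable (fun r'' => -sgn i * ∑ k, P.AtE (P.phiInv j (b + σ * r'')) j k *
          y k (P.phiInv j (b + σ * r'')) (s - sgn i * (a + r''))) volume 0 r := by
    obtain ⟨c, hc⟩ := hy.bounded (|s| + (|a| + r))
    have hyi : ∀ k, IntervalIntegrable (fun r' : ℝ =>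
        y k (P.phiInv j (b + σ * r')) (s - sgn i * (a + r'))) volume 0 r := fun k =>
      intervalIntegrable_of_bound (C := c) (mY k) fun x hx => by
        rw [uIcc_of_le hr] at hx
        refine hc k _ ((abs_sub _ _).trans ?_) _
        rw [abs_mul, abs_sgn, one_mul]
        have := abs_add_le a x
        rw [abs_of_nonneg hx.1] at this
        linarith [hx.2]
    simp only [Fin.sum_univ_two]
    exact (((hyi 0).continuousOn_mul (k3 j 0).continuousOn).add
      ((hyi 1).continuousOn_mul (k3 j 1).continuousOn)).const_mul _
  have key := mul_sub_mul_eq_integral hr (k5.intervalIntegrable _ _) iY hG hY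
  simp only [fluxDensity]
  have e0 : b + σ * 0 = b := by ring
  have e1 : a + 0 = a := by ring
  rw [e0, e1] at key
  rw [eq_add_of_sub_eq' key]
  congr 1
  refine intervalIntegral.integral_congr fun r' _ => ?_
  simp only [fluxSource, σ]
  ring

end System

namespace System

variable {n : ℕ} {P : System n}
variable {K : ℝ → ℝ → Matrix (Fin 2) (Fin 2) ℝ} {y : Fin 2 → ℝ → ℝ → ℝ}

theorem phiE_mono (P : System n) (i : Fin 2) : Monotone (P.phiE i) :=
  (P.travelTime i).strictMono.monotone

theorem phiInv_mono (P : System n) (i : Fin 2) : Monotone (P.phiInv i) :=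
  (P.travelTime i).strictMono_inv.monotone

theorem phiInv_phiE (P : System n) (i : Fin 2) (z : ℝ) : P.phiInv i (P.phiE i z) = z :=
  (P.travelTime i).left_inv z

theorem phiE_phiInv (P : System n) (i : Fin 2) (s : ℝ) : P.phiE i (P.phiInv i s) = s :=
  (P.travelTime i).right_inv s

theorem phiE_zero (P : System n) (i : Fin 2) : P.phiE i 0 = 0 := (P.travelTime i).zero

theorem phiInv_zero (P : System n) (i : Fin 2) : P.phiInv i 0 = 0 := (P.travelTime i).inv_zero

theorem phiE_nonneg (P : System n) (i : Fin 2) {z : ℝ} (hz : 0 ≤ z) : 0 ≤ P.phiE i z := by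
  rw [← P.phiE_zero i]; exact P.phiE_mono i hz

theorem phiInv_nonneg (P : System n) (i : Fin 2) {s : ℝ} (hs : 0 ≤ s) : 0 ≤ P.phiInv i s := by
  rw [← P.phiInv_zero i]; exact P.phiInv_mono i hs

/-- The integrand of the source term on the triangle. -/
def sourceTerm (P : System n) (K : ℝ → ℝ → Matrix (Fin 2) (Fin 2) ℝ) (y : Fin 2 → ℝ → ℝ → ℝ)
    (i j : Fin 2) (s w ζ : ℝ) : ℝ :=
  (kerE K w ζ * P.AtE ζ) i j * y j ζ (s - sgn i * P.phiE i w)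
    - kerE K w ζ i j * ∑ k, P.AtE ζ j k * y k ζ (s - sgn i * P.phiE i w)

theorem fluxSource_phiE (P : System n) (K : ℝ → ℝ → Matrix (Fin 2) (Fin 2) ℝ)
    (y : Fin 2 → ℝ → ℝ → ℝ) (i j : Fin 2) (s w ζ : ℝ) :
    P.fluxSource K y i j s (P.phiE i w) (P.phiE j ζ) / P.lamE j ζ
      = sgn i * P.sourceTerm K y i j s w ζ := by
  have := (P.lamE_pos j ζ).ne'
  rw [fluxSource, sourceTerm, phiInv_phiE, phiInv_phiE]
  field_simp

theorem fluxDensity_phiE (P : System n) (K : ℝ → ℝ → Matrix (Fin 2) (Fin 2) ℝ)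
    (y : Fin 2 → ℝ → ℝ → ℝ) (i j : Fin 2) (s w ζ : ℝ) :
    P.fluxDensity K y i j s (P.phiE i w) (P.phiE j ζ)
      = kerE K w ζ i j * P.lamE j ζ * y j ζ (s - sgn i * P.phiE i w) := by
  rw [fluxDensity, phiInv_phiE, phiInv_phiE]

theorem fluxDensity_phiE_zero (P : System n) (K : ℝ → ℝ → Matrix (Fin 2) (Fin 2) ℝ)
    (y : Fin 2 → ℝ → ℝ → ℝ) (i j : Fin 2) (s w : ℝ) :
    P.fluxDensity K y i j s (P.phiE i w) 0
      = kerE K w 0 i j * P.lamE j 0 * y j 0 (s - sgn i * P.phiE i w) := by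
  have := P.fluxDensity_phiE K y i j s w 0
  rwa [phiE_zero] at this

theorem integral_source_eq (P : System n) (K : ℝ → ℝ → Matrix (Fin 2) (Fin 2) ℝ)
    (y : Fin 2 → ℝ → ℝ → ℝ) (i j : Fin 2) (s z : ℝ) :
    ∫ a in (0 : ℝ)..(P.phiE i z), ∫ b in (0 : ℝ)..(P.phiE j (P.phiInv i a)),
        P.fluxSource K y i j s a b
      = sgn i * ∫ w in (0 : ℝ)..z, (∫ ζ in (0 : ℝ)..w, P.sourceTerm K y i j s w ζ) / P.lamE i w := by
  rw [(P.travelTime i).integral_zero_eq, ← intervalIntegral.integral_const_mul]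
  refine intervalIntegral.integral_congr fun w _ => ?_
  simp only [phiInv_phiE]
  rw [(P.travelTime j).integral_zero_eq]
  simp only [fluxSource_phiE]
  rw [intervalIntegral.integral_const_mul, mul_div_assoc]

/-- For `j = i` the lines have slope one and run from the side `ζ = 0` to the opposite side, so no
flux passes through the diagonal. -/
theorem flux_same (hK : P.IsKernel K) (hy : P.IsScaledSolution y) (i : Fin 2) {z : ℝ}
    (hz : z ∈ Icc (0 : ℝ) 1) (s : ℝ) :
    (∫ ζ in (0 : ℝ)..z, kerE K z ζ i i * y i ζ (s - sgn i * P.phiE i z))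
      - ∫ w in (0 : ℝ)..z, kerE K w 0 i i * P.lamE i 0 * y i 0 (s - sgn i * P.phiE i w) / P.lamE i w
    = sgn i * ∫ w in (0 : ℝ)..z, (∫ ζ in (0 : ℝ)..w, P.sourceTerm K y i i s w ζ) / P.lamE i w := by
  obtain ⟨hA0, hA1⟩ := P.phiE_mem_Icc i hz
  obtain ⟨C, hC⟩ := exists_bound_flux hK hy i i s (P.phiE i z) (P.phiE i z)
  have h := flux_identity_same (Q := P.fluxDensity K y i i s) (q := P.fluxSource K y i i s) hA0
    (measurable_fluxDensity hK hy i i s) (measurable_fluxSource hK hy i i s)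
    (fun a b h0 h1 h2 => (hC a ⟨h0.trans h1, h2⟩ b ⟨h0, h1.trans h2⟩).1)
    (fun a b h0 h1 h2 => (hC a ⟨h0.trans h1, h2⟩ b ⟨h0, h1.trans h2⟩).2)
    (fun c r hc hr hcr => by
      have := fluxDensity_along hK hy i i (s := s) (a := c) (b := 0) hr
        (fun r' hr' => by
          rw [sgn_mul_self, one_mul, zero_add]
          refine ⟨P.phiInv_nonneg i hr'.1, P.phiInv_mono i (by linarith), ?_⟩
          exact (P.phiInv_mem_Icc i ⟨by linarith [hr'.1], by linarith [hr'.2]⟩).2)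
        (fun r' hr' => by
          rw [sgn_mul_self, one_mul, zero_add]
          exact ⟨hr'.1, by linarith [hr'.2]⟩)
      simpa [sgn_mul_self] using this)
  have e := P.integral_source_eq K y i i s z
  simp only [phiE_phiInv] at e
  rw [e, (P.travelTime i).integral_zero_eq, (P.travelTime i).integral_zero_eq] at h
  rw [← h]
  congr 1
  · refine intervalIntegral.integral_congr fun ζ _ => ?_
    simp only [fluxDensity_phiE]
    have := (P.lamE_pos i ζ).ne'
    field_simp
  · refine intervalIntegral.integral_congr fun w _ => ?_
    simp only [fluxDensity_phiE_zero]

/-- For opposite signs the lines have slope minus one and start on the diagonal, which now carries a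
flux. With `m = φᵢ(w) + φⱼ(w)` one has `dm = (1/λᵢ + 1/λⱼ) dw`, whence the factor `λᵢ + λⱼ`. -/
theorem flux_opposite (hK : P.IsKernel K) (hy : P.IsScaledSolution y) {i j : Fin 2}
    (hij : sgn i * sgn j = -1) {z : ℝ} (hz : z ∈ Icc (0 : ℝ) 1) (s : ℝ) :
    (∫ ζ in (0 : ℝ)..z, kerE K z ζ i j * y j ζ (s - sgn i * P.phiE i z))
      + (∫ w in (0 : ℝ)..z, kerE K w 0 i j * P.lamE j 0 * y j 0 (s - sgn i * P.phiE i w) /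
          P.lamE i w)
      - ∫ w in (0 : ℝ)..z, kerE K w w i j * (P.lamE i w + P.lamE j w) *
          y j w (s - sgn i * P.phiE i w) / P.lamE i w
    = sgn i * ∫ w in (0 : ℝ)..z, (∫ ζ in (0 : ℝ)..w, P.sourceTerm K y i j s w ζ) / P.lamE i w := by
  obtain ⟨hA0, hA1⟩ := P.phiE_mem_Icc i hz
  obtain ⟨M, hM⟩ := P.exists_lamE_le
  obtain ⟨ν, hν⟩ := (P.travelTime i).exists_add (P.travelTime j) (hM i)
  obtain ⟨C, hC⟩ := exists_bound_flux hK hy i j s (P.phiE i z) (P.phiE j z)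
  have hδ : ∀ a ∈ Icc 0 (P.phiE i z), P.phiInv i a ∈ Icc 0 z := fun a ha =>
    ⟨P.phiInv_nonneg i ha.1, by rw [← P.phiInv_phiE i z]; exact P.phiInv_mono i ha.2⟩
  have hδA : P.phiE j (P.phiInv i (P.phiE i z)) = P.phiE j z := by rw [phiInv_phiE]
  have hνz : ∀ m ∈ Icc 0 (P.phiE i z + P.phiE j z), ν m ∈ Icc 0 z := fun m hm => by
    refine ⟨?_, ?_⟩
    · rw [← hν.inv_zero]; exact hν.strictMono_inv.monotone hm.1
    · rw [← hν.left_inv z]; exact hν.strictMono_inv.monotone hm.2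
  have hνs : ∀ m, m - P.phiE i (ν m) = P.phiE j (ν m) := fun m => by
    have := hν.right_inv m; linarith
  have hCδ : ∀ a ∈ Icc 0 (P.phiE i z), ∀ b ∈ Icc 0 (P.phiE j (P.phiInv i a)),
      b ∈ Icc 0 (P.phiE j z) := fun a ha b hb =>
    ⟨hb.1, hb.2.trans (P.phiE_mono j (hδ a ha).2)⟩
  have h := flux_identity_opposite (Q := P.fluxDensity K y i j s) (q := P.fluxSource K y i j s)
    (A := P.phiE i z) (C := C) (α := fun m => P.phiE i (ν m)) (δ := fun a => P.phiE j (P.phiInv i a))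
    hA0 (((P.travelTime j).continuous_travel.comp (P.continuous_phiInv i)).measurable)
    (fun a ha => P.phiE_nonneg j (hδ a ha).1)
    (fun a ha => P.phiE_mono j (P.phiInv_mono i ha.2))
    (((P.travelTime i).continuous_travel.comp hν.continuous_inv).measurable)
    (fun m hm => by
      rw [hδA] at hm
      have h1 := hνz m hm
      refine ⟨P.phiE_nonneg i h1.1, le_min ?_ (P.phiE_mono i h1.2)⟩
      linarith [hνs m, P.phiE_nonneg j h1.1])
    (fun m r hr => by
      have h1 : r + P.phiE j (P.phiInv i r)
          = P.phiE i (P.phiInv i r) + P.phiE j (P.phiInv i r) := by rw [phiE_phiInv]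
      have h2 : m = P.phiE i (ν m) + P.phiE j (ν m) := by linarith [hνs m]
      rw [h1]
      conv_lhs => rw [h2]
      constructor
      · intro h3
        rw [← P.phiE_phiInv i r]
        exact P.phiE_mono i (hν.strictMono.le_iff_le.1 h3)
      · intro h3
        rw [← P.phiE_phiInv i r] at h3
        exact hν.strictMono.le_iff_le.2 ((P.travelTime i).strictMono.le_iff_le.1 h3))
    (measurable_fluxDensity hK hy i j s) (measurable_fluxSource hK hy i j s)
    (fun a ha b hb => (hC a ha b (hCδ a ha b hb)).1)
    (fun a ha b hb => (hC a ha b (hCδ a ha b hb)).2)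
    (fun m a hm ha => by
      rw [hδA] at hm
      have h1 := hνz m hm
      have hν1 : ν m ∈ Icc (0 : ℝ) 1 := ⟨h1.1, h1.2.trans hz.2⟩
      have ham := le_min_iff.1 ha.2
      have hr : 0 ≤ a - P.phiE i (ν m) := sub_nonneg.2 ha.1
      have hj : ∀ r' ∈ Icc 0 (a - P.phiE i (ν m)),
          P.phiE j (ν m) + sgn i * sgn j * r' ∈ Icc 0 (P.phiE j (ν m)) := fun r' hr' => by
        rw [hij]
        have := hνs m
        exact ⟨by linarith [hr'.2], by linarith [hr'.1]⟩
      have := fluxDensity_along hK hy i j (s := s) (a := P.phiE i (ν m)) (b := P.phiE j (ν m)) hr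
        (fun r' hr' => by
          have h2 := hj r' hr'
          refine ⟨P.phiInv_nonneg j h2.1, ?_, ?_⟩
          · refine (P.phiInv_mono j h2.2).trans ?_
            rw [phiInv_phiE]
            nth_rewrite 1 [← P.phiInv_phiE i (ν m)]
            exact P.phiInv_mono i (by linarith [hr'.1])
          · refine (P.phiInv_mem_Icc i ⟨?_, ?_⟩).2
            · linarith [hr'.1, P.phiE_nonneg i h1.1]
            · linarith [hr'.2, ham.2])
        (fun r' hr' => ⟨(hj r' hr').1, (hj r' hr').2.trans (P.phiE_mem_Icc j hν1).2⟩)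
      rw [hij] at this
      have t1 : P.phiE i (ν m) + (a - P.phiE i (ν m)) = a := by ring
      have t2 : P.phiE j (ν m) + -1 * (a - P.phiE i (ν m)) = m - a := by
        linarith [hνs m]
      rw [t1, t2] at this
      rw [hνs m, this]
      congr 1
      have e := intervalIntegral.integral_comp_add_left (a := 0) (b := a - P.phiE i (ν m))
        (fun r => P.fluxSource K y i j s r (m - r)) (P.phiE i (ν m))
      rw [add_zero, t1] at e
      rw [← e]
      refine intervalIntegral.integral_congr fun r' _ => ?_
      have t3 : P.phiE j (ν m) + -1 * r' = m - (P.phiE i (ν m) + r') := by linarith [hνs m]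
      simp only [t3])
  rw [hδA, P.integral_source_eq K y i j s z, (P.travelTime j).integral_zero_eq,
    (P.travelTime i).integral_zero_eq] at h
  have e := hν.integral_zero_eq (fun m => P.fluxDensity K y i j s (P.phiE i (ν m))
    (m - P.phiE i (ν m))) z
  beta_reduce at e h
  rw [e] at h
  rw [← h]
  congr 1
  · congr 1
    · refine intervalIntegral.integral_congr fun ζ _ => ?_
      simp only [fluxDensity_phiE]
      have := (P.lamE_pos j ζ).ne'
      field_simp
    · refine intervalIntegral.integral_congr fun w _ => ?_
      simp only [fluxDensity_phiE_zero]
  · refine intervalIntegral.integral_congr fun w _ => ?_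
    have e1 := hν.left_inv w
    simp only [e1]
    rw [show P.phiE i w + P.phiE j w - P.phiE i w = P.phiE j w by ring]
    rw [fluxDensity_phiE]
    have h1 := (P.lamE_pos j w).ne'
    have h2 := (P.lamE_pos i w).ne'
    have h3 := (add_pos (P.lamE_pos i w) (P.lamE_pos j w)).ne'
    field_simp

/-- Since `AtE` has zero diagonal, each source consists of two products, and they are the same two
with opposite signs in the two columns. Adding the flux identities of a row thus removes the
integral over the area. -/
theorem sourceTerm_rev (P : System n) (K : ℝ → ℝ → Matrix (Fin 2) (Fin 2) ℝ)
    (y : Fin 2 → ℝ → ℝ → ℝ) (i : Fin 2) (s w ζ : ℝ) :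
    P.sourceTerm K y i (1 - i) s w ζ = -P.sourceTerm K y i i s w ζ := by
  fin_cases i <;> simp [sourceTerm, Matrix.mul_apply, Fin.sum_univ_two] <;> ring

theorem IsScaledSolution.integrable_kernel_mul (hK : P.IsKernel K) (hy : P.IsScaledSolution y)
    (i j : Fin 2) (z t a b : ℝ) :
    IntervalIntegrable (fun ζ => kerE K z ζ i j * y j ζ t) volume a b := by
  obtain ⟨B, hB⟩ := hy.bounded |t|
  refine IntervalIntegrable.continuousOn_mul (intervalIntegrable_of_bound (C := B)
    ((hy.measurable j).comp (measurable_id.prodMk measurable_const))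
    fun x _ => hB j t le_rfl x) ?_
  exact ((continuous_kerE hK.continuous i j).comp
    (continuous_const.prodMk continuous_id)).continuousOn

/-- The Volterra part of the backstepping transformation along a trajectory. -/
theorem IsScaledSolution.integral_kernel (hK : P.IsKernel K) (hy : P.IsScaledSolution y)
    (i : Fin 2) {z : ℝ} (hz : z ∈ Icc (0 : ℝ) 1) (s : ℝ) :
    ∫ ζ in (0 : ℝ)..z, ∑ j, kerE K z ζ i j * y j ζ (s - sgn i * P.phiE i z)
      = (∫ w in (0 : ℝ)..z, kerE K w 0 i i * P.lamE i 0 * y i 0 (s - sgn i * P.phiE i w) /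
          P.lamE i w)
        - (∫ w in (0 : ℝ)..z, kerE K w 0 i (1 - i) * P.lamE (1 - i) 0 *
            y (1 - i) 0 (s - sgn i * P.phiE i w) / P.lamE i w)
        + ∫ w in (0 : ℝ)..z, kerE K w w i (1 - i) * (P.lamE i w + P.lamE (1 - i) w) *
          y (1 - i) w (s - sgn i * P.phiE i w) / P.lamE i w := by
  have hij : sgn i * sgn (1 - i) = -1 := by rw [sgn_rev, mul_neg, sgn_mul_self]
  have h1 := flux_same hK hy i hz s
  have h2 := flux_opposite hK hy hij hz s
  simp only [sourceTerm_rev, intervalIntegral.integral_neg, neg_div] at h2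
  have h3 : ∫ ζ in (0 : ℝ)..z, ∑ j, kerE K z ζ i j * y j ζ (s - sgn i * P.phiE i z)
      = (∫ ζ in (0 : ℝ)..z, kerE K z ζ i i * y i ζ (s - sgn i * P.phiE i z))
        + ∫ ζ in (0 : ℝ)..z, kerE K z ζ i (1 - i) * y (1 - i) ζ (s - sgn i * P.phiE i z) := by
    rw [← intervalIntegral.integral_add (hy.integrable_kernel_mul hK i i _ _ _ _)
      (hy.integrable_kernel_mul hK i (1 - i) _ _ _ _)]
    refine intervalIntegral.integral_congr fun ζ _ => ?_
    fin_cases i <;> simp [Fin.sum_univ_two, add_comm]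
  rw [h3]
  linarith

theorem IsKernel.bc_diag (hK : P.IsKernel K) (i : Fin 2) {w : ℝ} (hw : w ∈ Icc (0 : ℝ) 1) :
    kerE K w w i (1 - i) * (P.lamE i w + P.lamE (1 - i) w) = -sgn i * P.AtE w i (1 - i) := by
  rw [kerE_of_mem K ⟨hw.1, le_rfl, hw.2⟩, P.AtE_of_mem hw]
  have h0 := P.lamE_pos 0 w; have h1 := P.lamE_pos 1 w
  rw [P.lamE_of_mem _ hw] at h0 h1
  have hne := (add_pos h0 h1).ne'
  fin_cases i
  · simp [P.lamE_of_mem _ hw, hK.bc12 w hw, sgn]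
    field_simp
  · simp [P.lamE_of_mem _ hw, hK.bc21 w hw, sgn]
    rw [add_comm (P.lam 1 w)]
    field_simp

/-- The backstepping transformation along a trajectory. -/
theorem IsScaledSolution.transform (hK : P.IsKernel K) (hy : P.IsScaledSolution y)
    (i : Fin 2) {z : ℝ} (hz : z ∈ Icc (0 : ℝ) 1) (s : ℝ) :
    y i z (s - sgn i * P.phiE i z)
        - ∫ ζ in (0 : ℝ)..z, ∑ j, kerE K z ζ i j * y j ζ (s - sgn i * P.phiE i z)
      = y i 0 s - ((∫ w in (0 : ℝ)..z, kerE K w 0 i i * P.lamE i 0 *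
            y i 0 (s - sgn i * P.phiE i w) / P.lamE i w)
        - ∫ w in (0 : ℝ)..z, kerE K w 0 i (1 - i) * P.lamE (1 - i) 0 *
            y (1 - i) 0 (s - sgn i * P.phiE i w) / P.lamE i w) := by
  have hA := P.phiE_mem_Icc i hz
  have h1 := hy.pde i s 0 (P.phiE i z) le_rfl hA.1 hA.2
  rw [phiInv_phiE, phiInv_zero, mul_zero, sub_zero, (P.travelTime i).integral_zero_eq] at h1
  -- The diagonal values of the kernel make the diagonal flux equal to the coupling integral in the
  -- equation for `y i`. The two cancel, and only fluxes through `ζ = 0` remain.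
  have h2 : ∫ w in (0 : ℝ)..z, kerE K w w i (1 - i) * (P.lamE i w + P.lamE (1 - i) w) *
          y (1 - i) w (s - sgn i * P.phiE i w) / P.lamE i w
      = -sgn i * ∫ w in (0 : ℝ)..z, (∑ j, P.AtE (P.phiInv i (P.phiE i w)) i j *
          y j (P.phiInv i (P.phiE i w)) (s - sgn i * P.phiE i w)) / P.lamE i w := by
    rw [← intervalIntegral.integral_const_mul]
    refine intervalIntegral.integral_congr fun w hw => ?_
    rw [uIcc_of_le hz.1] at hw
    have hw' : w ∈ Icc (0 : ℝ) 1 := ⟨hw.1, hw.2.trans hz.2⟩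
    simp only [phiInv_phiE, hK.bc_diag i hw']
    have h3 : ∑ j, P.AtE w i j * y j w (s - sgn i * P.phiE i w)
        = P.AtE w i (1 - i) * y (1 - i) w (s - sgn i * P.phiE i w) := by
      fin_cases i <;> simp [Fin.sum_univ_two, AtE_self]
    rw [h3]; ring
  rw [hy.integral_kernel hK i hz s, h1, h2]
  ring

end System

/-! ### Existence of the kernel -/

theorem TravelTime.abs_integral_le {lam φ ι : ℝ → ℝ} (h : TravelTime lam φ ι) {M L : ℝ}
    (hL : 0 < L) (hM : ∀ z, 1 / lam z ≤ M) {F : ℝ → ℝ} {c a z : ℝ} (ha : 0 ≤ a) (hc : 0 ≤ c)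
    (haz : a ≤ φ z) (hF : ∀ s ∈ Icc a (φ z), |F s| ≤ c * Real.exp (L * ι s)) :
    |∫ s in a..(φ z), F s| ≤ c * M / L * Real.exp (L * z) := by
  have hM0 : 0 ≤ M := (one_div_pos.2 (h.pos 0)).le.trans (hM 0)
  have hι0 : 0 ≤ ι a := by rw [← h.inv_zero]; exact h.strictMono_inv.monotone ha
  have hιz : ι a ≤ z := by rw [← h.left_inv z]; exact h.strictMono_inv.monotone haz
  have e := h.integral_eq F (ι a) z
  rw [h.right_inv] at e
  have h0z : 0 ≤ z := hι0.trans hιz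
  have hcont : Continuous fun w => c * M * Real.exp (L * w) := by fun_prop
  have h1 : |∫ w in (ι a)..z, F (φ w) / lam w| ≤ ∫ w in (ι a)..z, c * M * Real.exp (L * w) := by
    rw [← Real.norm_eq_abs]
    refine intervalIntegral.norm_integral_le_of_norm_le hιz ?_ (hcont.intervalIntegrable _ _)
    refine Filter.Eventually.of_forall fun w hw => ?_
    have hw1 : φ w ∈ Icc a (φ z) := by
      refine ⟨?_, h.strictMono.monotone hw.2⟩
      rw [← h.right_inv a]; exact h.strictMono.monotone hw.1.le
    have h2 := hF _ hw1
    rw [h.left_inv] at h2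
    rw [Real.norm_eq_abs, abs_div, abs_of_pos (h.pos w), div_eq_mul_one_div]
    calc |F (φ w)| * (1 / lam w) ≤ c * Real.exp (L * w) * M := by
          refine mul_le_mul h2 (hM w) (one_div_pos.2 (h.pos w)).le (by positivity)
      _ = _ := by ring
  rw [e]
  refine h1.trans ?_
  have h3 : ∫ w in (ι a)..z, c * M * Real.exp (L * w)
      ≤ ∫ w in (0 : ℝ)..z, c * M * Real.exp (L * w) := by
    rw [← intervalIntegral.integral_add_adjacent_intervals (hcont.intervalIntegrable 0 (ι a))
      (hcont.intervalIntegrable (ι a) z)]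
    have : 0 ≤ ∫ w in (0 : ℝ)..(ι a), c * M * Real.exp (L * w) :=
      intervalIntegral.integral_nonneg hι0 fun w _ => by positivity
    linarith
  refine h3.trans ?_
  rw [intervalIntegral.integral_const_mul]
  calc _ ≤ c * M * (Real.exp (L * z) / L) :=
        mul_le_mul_of_nonneg_left (integral_exp_mul_le hL) (by positivity)
    _ = _ := by ring

/-- Solvability of a pair of transport equations on the triangle, one with characteristics that
start at the side `ζ = 0`, the other with characteristics that start at the diagonal. -/
theorem exists_goursat {lam φ ι mu χ κ ν : ℝ → ℝ} (h : TravelTime lam φ ι)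
    (k : TravelTime mu χ κ)
    (hν : TravelTime (fun z => lam z * mu z / (lam z + mu z)) (fun z => φ z + χ z) ν)
    {M Mp Mr Md : ℝ} (hM : ∀ z, 1 / lam z ≤ M) {p r d : ℝ → ℝ} (hp : Continuous p)
    (hr : Continuous r) (hd : Continuous d) (hpM : ∀ z, |p z| ≤ Mp) (hrM : ∀ z, |r z| ≤ Mr)
    (hdM : ∀ z ∈ Icc (0 : ℝ) 1, |d z| ≤ Md) (ρ : ℝ) :
    ∃ f g : ℝ × ℝ → ℝ, Continuous f ∧ Continuous g ∧
      (∀ z ζ, (z, ζ) ∈ triangle → f (z, ζ) = ρ * g (ι (φ z - φ ζ), 0)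
        + ∫ σ in (0 : ℝ)..(φ ζ), p (ι σ) * g (ι (φ z - φ ζ + σ), ι σ)) ∧
      ∀ z ζ, (z, ζ) ∈ triangle → g (z, ζ) = d (ν (φ z + χ ζ))
        + ∫ σ in (0 : ℝ)..(φ z - φ (ν (φ z + χ ζ))), r (κ (χ (ν (φ z + χ ζ)) - σ)) *
          f (ι (φ (ν (φ z + χ ζ)) + σ), κ (χ (ν (φ z + χ ζ)) - σ)) := by
  have hM0 : 0 < M := (one_div_pos.2 (h.pos 0)).trans_le (hM 0)
  have hMp0 : 0 ≤ Mp := (abs_nonneg _).trans (hpM 0)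
  have hMr0 : 0 ≤ Mr := (abs_nonneg _).trans (hrM 0)
  have hMd0 : 0 ≤ Md := (abs_nonneg _).trans (hdM 0 ⟨le_rfl, zero_le_one⟩)
  -- The boundary term `ρ * g` is not integrated and gains nothing from `L`. Allowing `f` to be `N`
  -- times as large as `g` makes it contract, since `|ρ| + 1 = N / 2`; the factor `N` enters the
  -- equation for `g` only under an integral, where `L` absorbs it.
  let N : ℝ := 2 * |ρ| + 2
  have hN0 : 0 < N := by positivity
  let L : ℝ := M * Mp + 2 * Mr * N * M + 1
  have hL : 0 < L := by positivity
  let zc : ℝ × ℝ → ℝ := fun q => unitClamp q.1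
  let ζc : ℝ × ℝ → ℝ := fun q => min (unitClamp q.2) (unitClamp q.1)
  have hzc : Continuous zc := continuous_unitClamp.comp continuous_fst
  have hζc : Continuous ζc := (continuous_unitClamp.comp continuous_snd).min hzc
  have hT : ∀ q, 0 ≤ ζc q ∧ ζc q ≤ zc q ∧ zc q ≤ 1 := fun q => retract_mem_triangle q.1 q.2
  -- The foot on the diagonal of the characteristic through `(z, ζ)` along which `φ z + χ ζ` is
  -- constant.
  let m : ℝ × ℝ → ℝ := fun q => ν (φ (zc q) + χ (ζc q))
  have hm : Continuous m := hν.continuous_inv.comp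
    ((h.continuous_travel.comp hzc).add (k.continuous_travel.comp hζc))
  have hm1 : ∀ q, ζc q ≤ m q ∧ m q ≤ zc q := by
    intro q
    constructor
    · rw [← hν.left_inv (ζc q)]
      exact hν.strictMono_inv.monotone
        (add_le_add_left (h.strictMono.monotone (hT q).2.1) _)
    · rw [← hν.left_inv (zc q)]
      exact hν.strictMono_inv.monotone
        (add_le_add_right (k.strictMono.monotone (hT q).2.1) _)
  have hφmono := h.strictMono.monotone
  have hιmono := h.strictMono_inv.monotone
  have hφ0 : ∀ z, 0 ≤ z → 0 ≤ φ z := fun z hz => by rw [← h.zero]; exact hφmono hz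
  let I0 : (Fin 2 × ℝ × ℝ → ℝ) → ℝ × ℝ → ℝ → ℝ := fun x q σ =>
    p (ι σ) * x (1, ι (φ (zc q) - φ (ζc q) + σ), ι σ)
  let I1 : (Fin 2 × ℝ × ℝ → ℝ) → ℝ × ℝ → ℝ → ℝ := fun x q σ =>
    r (κ (χ (m q) - σ)) * x (0, ι (φ (m q) + σ), κ (χ (m q) - σ))
  let Φ0 : (Fin 2 × ℝ × ℝ → ℝ) → ℝ × ℝ → ℝ := fun x q =>
    ρ * x (1, ι (φ (zc q) - φ (ζc q)), 0) + ∫ σ in (0 : ℝ)..(φ (ζc q)), I0 x q σ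
  let Φ1 : (Fin 2 × ℝ × ℝ → ℝ) → ℝ × ℝ → ℝ := fun x q =>
    d (m q) + ∫ σ in (0 : ℝ)..(φ (zc q) - φ (m q)), I1 x q σ
  let Φ : (Fin 2 × ℝ × ℝ → ℝ) → Fin 2 × ℝ × ℝ → ℝ := fun x s => ![Φ0 x s.2, Φ1 x s.2] s.1
  let W : Fin 2 × ℝ × ℝ → ℝ := fun s => ![N, 1] s.1 * Real.exp (L * zc s.2)
  let A : (Fin 2 × ℝ × ℝ → ℝ) → Prop := fun x => ∀ j, Continuous fun q : ℝ × ℝ => x (j, q)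
  have hI0c : ∀ x, A x → Continuous (Function.uncurry (I0 x)) := by
    intro x hx
    have c1 : Continuous fun u : (ℝ × ℝ) × ℝ => ι u.2 := h.continuous_inv.comp continuous_snd
    have c2 : Continuous fun u : (ℝ × ℝ) × ℝ => ι (φ (zc u.1) - φ (ζc u.1) + u.2) :=
      h.continuous_inv.comp ((((h.continuous_travel.comp hzc).sub
        (h.continuous_travel.comp hζc)).comp continuous_fst).add continuous_snd)
    exact (hp.comp c1).mul ((hx 1).comp (c2.prodMk c1))
  have hI1c : ∀ x, A x → Continuous (Function.uncurry (I1 x)) := by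
    intro x hx
    have c1 : Continuous fun u : (ℝ × ℝ) × ℝ => κ (χ (m u.1) - u.2) :=
      k.continuous_inv.comp (((k.continuous_travel.comp hm).comp continuous_fst).sub continuous_snd)
    have c2 : Continuous fun u : (ℝ × ℝ) × ℝ => ι (φ (m u.1) + u.2) :=
      h.continuous_inv.comp (((h.continuous_travel.comp hm).comp continuous_fst).add continuous_snd)
    exact (hr.comp c1).mul ((hx 0).comp (c2.prodMk c1))
  have hb0 : ∀ (x : Fin 2 × ℝ × ℝ → ℝ) C, 0 ≤ C → (∀ s, |x s| ≤ C * W s) → ∀ q,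
      |ρ * x (1, ι (φ (zc q) - φ (ζc q)), 0) + ∫ σ in (0 : ℝ)..(φ (ζc q)), I0 x q σ|
        ≤ C / 2 * (N * Real.exp (L * zc q)) := by
    intro x C hC hx q
    obtain ⟨h1, h2, h3⟩ := hT q
    have hζ0 := hφ0 _ h1
    have hsub : 0 ≤ φ (zc q) - φ (ζc q) := sub_nonneg.2 (hφmono h2)
    have hιle : ∀ s ∈ Icc (φ (zc q) - φ (ζc q)) (φ (zc q)), unitClamp (ι s) = ι s := fun s hs =>
      unitClamp_of_mem ⟨by rw [← h.inv_zero]; exact hιmono (hsub.trans hs.1),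
        le_trans (by rw [← h.left_inv (zc q)]; exact hιmono hs.2) h3⟩
    have hx1 : ∀ s ∈ Icc (φ (zc q) - φ (ζc q)) (φ (zc q)), ∀ ζ,
        |x (1, ι s, ζ)| ≤ C * Real.exp (L * ι s) := fun s hs ζ => by
      refine (hx _).trans (le_of_eq ?_)
      simp [W, zc, hιle s hs]
    have t1 : |ρ * x (1, ι (φ (zc q) - φ (ζc q)), 0)| ≤ |ρ| * (C * Real.exp (L * zc q)) := by
      rw [abs_mul]
      refine mul_le_mul_of_nonneg_left ((hx1 _ ⟨le_rfl, by linarith⟩ 0).trans ?_) (abs_nonneg _)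
      have : ι (φ (zc q) - φ (ζc q)) ≤ zc q := by
        conv_rhs => rw [← h.left_inv (zc q)]
        exact hιmono (by linarith)
      gcongr
    have t2 : |∫ σ in (0 : ℝ)..(φ (ζc q)), I0 x q σ|
        ≤ Mp * C * M / L * Real.exp (L * zc q) := by
      have e := intervalIntegral.integral_comp_add_left (a := 0) (b := φ (ζc q))
        (fun a => p (ι (a - (φ (zc q) - φ (ζc q)))) *
          x (1, ι a, ι (a - (φ (zc q) - φ (ζc q))))) (φ (zc q) - φ (ζc q))
      rw [add_zero, sub_add_cancel] at e
      have e2 : ∫ σ in (0 : ℝ)..(φ (ζc q)), I0 x q σ = _ :=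
        (intervalIntegral.integral_congr fun σ _ => by simp only [I0, add_sub_cancel_left]).trans e
      rw [e2]
      refine h.abs_integral_le hL hM hsub (by positivity) (by linarith) fun s hs => ?_
      rw [abs_mul, mul_assoc]
      exact mul_le_mul (hpM _) (hx1 s hs _) (abs_nonneg _) hMp0
    refine (abs_add_le _ _).trans ((add_le_add t1 t2).trans ?_)
    have t3 : Mp * M / L ≤ 1 := by
      rw [div_le_one hL]
      simp only [L]
      have : 0 ≤ 2 * Mr * N * M := by positivity
      linarith
    have hE := Real.exp_pos (L * zc q)
    calc _ = (|ρ| + Mp * M / L) * (C * Real.exp (L * zc q)) := by ring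
      _ ≤ (|ρ| + 1) * (C * Real.exp (L * zc q)) := by gcongr
      _ = _ := by simp only [N]; ring
  have hb1 : ∀ (x : Fin 2 × ℝ × ℝ → ℝ) C, 0 ≤ C → (∀ s, |x s| ≤ C * W s) → ∀ q,
      |∫ σ in (0 : ℝ)..(φ (zc q) - φ (m q)), I1 x q σ| ≤ C / 2 * Real.exp (L * zc q) := by
    intro x C hC hx q
    obtain ⟨h1, h2, h3⟩ := hT q
    obtain ⟨h4, h5⟩ := hm1 q
    have hm0 : 0 ≤ φ (m q) := hφ0 _ (h1.trans h4)
    have e := intervalIntegral.integral_comp_add_left (a := 0) (b := φ (zc q) - φ (m q))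
      (fun a => r (κ (χ (m q) - (a - φ (m q)))) * x (0, ι a, κ (χ (m q) - (a - φ (m q)))))
      (φ (m q))
    rw [add_zero, add_sub_cancel] at e
    have e2 : ∫ σ in (0 : ℝ)..(φ (zc q) - φ (m q)), I1 x q σ = _ :=
      (intervalIntegral.integral_congr fun σ _ => by simp only [I1, add_sub_cancel_left]).trans e
    rw [e2]
    have t2 := h.abs_integral_le hL hM (c := Mr * (C * N)) hm0 (by positivity) (hφmono h5)
      (F := fun a => r (κ (χ (m q) - (a - φ (m q)))) * x (0, ι a, κ (χ (m q) - (a - φ (m q)))))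
      fun s hs => by
        have hι : unitClamp (ι s) = ι s := unitClamp_of_mem
          ⟨by rw [← h.inv_zero]; exact hιmono (hm0.trans hs.1),
            le_trans (by rw [← h.left_inv (zc q)]; exact hιmono hs.2) h3⟩
        rw [abs_mul, mul_assoc]
        refine mul_le_mul (hrM _) ((hx _).trans (le_of_eq ?_)) (abs_nonneg _) hMr0
        simp [W, zc, hι, mul_assoc]
    refine t2.trans (mul_le_mul_of_nonneg_right ?_ (Real.exp_pos _).le)
    rw [div_le_iff₀ hL]
    simp only [L]
    have : 0 ≤ C * (M * Mp + 1) := by positivity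
    nlinarith
  have hcomp : ∀ x y, A x → A y → ∀ q, Φ0 x q - Φ0 y q
      = ρ * (fun s => x s - y s) ((1 : Fin 2), ι (φ (zc q) - φ (ζc q)), (0 : ℝ))
        + ∫ σ in (0 : ℝ)..(φ (ζc q)), I0 (fun s => x s - y s) q σ := by
    intro x y hx hy q
    have i1 := ((hI0c x hx).comp (continuous_const (y := q) |>.prodMk continuous_id)).intervalIntegrable
      (μ := volume) 0 (φ (ζc q))
    have i2 := ((hI0c y hy).comp (continuous_const (y := q) |>.prodMk continuous_id)).intervalIntegrable
      (μ := volume) 0 (φ (ζc q))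
    have e3 : ∫ σ in (0 : ℝ)..(φ (ζc q)), I0 (fun s => x s - y s) q σ
        = (∫ σ in (0 : ℝ)..(φ (ζc q)), I0 x q σ) - ∫ σ in (0 : ℝ)..(φ (ζc q)), I0 y q σ := by
      refine Eq.trans ?_ (intervalIntegral.integral_sub i1 i2)
      refine intervalIntegral.integral_congr fun σ _ => ?_
      simp only [I0, mul_sub]
    rw [e3]
    simp only [Φ0]
    ring
  have hcomp1 : ∀ x y, A x → A y → ∀ q, Φ1 x q - Φ1 y q
      = ∫ σ in (0 : ℝ)..(φ (zc q) - φ (m q)), I1 (fun s => x s - y s) q σ := by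
    intro x y hx hy q
    have i1 := ((hI1c x hx).comp (continuous_const (y := q) |>.prodMk continuous_id)).intervalIntegrable
      (μ := volume) 0 (φ (zc q) - φ (m q))
    have i2 := ((hI1c y hy).comp (continuous_const (y := q) |>.prodMk continuous_id)).intervalIntegrable
      (μ := volume) 0 (φ (zc q) - φ (m q))
    have e3 : ∫ σ in (0 : ℝ)..(φ (zc q) - φ (m q)), I1 (fun s => x s - y s) q σ
        = (∫ σ in (0 : ℝ)..(φ (zc q) - φ (m q)), I1 x q σ)
          - ∫ σ in (0 : ℝ)..(φ (zc q) - φ (m q)), I1 y q σ := by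
      refine Eq.trans ?_ (intervalIntegral.integral_sub i1 i2)
      refine intervalIntegral.integral_congr fun σ _ => ?_
      simp only [I1, mul_sub]
    rw [e3]
    simp only [Φ1]
    ring
  obtain ⟨x, hxA, hx⟩ := exists_fixedPoint_of_weighted_contraction W A Φ
    (fun x hx j => by
      have c0 : Continuous (Φ0 x) := by
        refine (continuous_const.mul ((hx 1).comp ((h.continuous_inv.comp
          ((h.continuous_travel.comp hzc).sub (h.continuous_travel.comp hζc))).prodMk
            continuous_const))).add ?_
        exact intervalIntegral.continuous_parametric_intervalIntegral_of_continuous (hI0c x hx)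
          (h.continuous_travel.comp hζc)
      have c1 : Continuous (Φ1 x) := by
        refine (hd.comp hm).add ?_
        exact intervalIntegral.continuous_parametric_intervalIntegral_of_continuous (hI1c x hx)
          ((h.continuous_travel.comp hzc).sub (h.continuous_travel.comp hm))
      fin_cases j
      · exact c0
      · exact c1)
    (fun F x C hC hF hlim j => by
      refine TendstoUniformly.continuous (F := fun m (q : ℝ × ℝ) => F m (j, q))
        (p := Filter.atTop) ?_ (Filter.Frequently.of_forall fun m => hF m j)
      rw [Metric.tendstoUniformly_iff]
      intro ε hε
      have hlim0 : Filter.Tendsto (fun m : ℕ => C * (1 / 2) ^ m * ((N + 1) * Real.exp L))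
          Filter.atTop (nhds 0) := by
        simpa using ((tendsto_pow_atTop_nhds_zero_of_lt_one (r := (1 / 2 : ℝ)) (by norm_num)
          (by norm_num)).const_mul C).mul_const ((N + 1) * Real.exp L)
      filter_upwards [hlim0.eventually_lt_const hε] with m hm q
      rw [dist_comm, dist_eq_norm]
      refine ((hlim m (j, q)).trans ?_).trans_lt hm
      refine mul_le_mul_of_nonneg_left ?_ (by positivity)
      refine mul_le_mul ?_ (Real.exp_le_exp.2 (mul_le_of_le_one_right hL.le (hT q).2.2))
        (Real.exp_pos _).le (by positivity)
      fin_cases j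
      · simp
      · simp; exact hN0.le)
    (fun x y hx hy B hB hxy s => by
      obtain ⟨j, q⟩ := s
      have h1 : ∀ q, |(fun q => x q - y q) q| ≤ B * W q := hxy
      fin_cases j
      · have := hb0 _ B hB h1 q
        rw [← hcomp x y hx hy q] at this
        simpa [Φ, W] using this
      · have := hb1 _ B hB h1 q
        rw [← hcomp1 x y hx hy q] at this
        simpa [Φ, W] using this)
    (fun _ => 0) (fun _ => continuous_const) Md hMd0 (fun s => by
      obtain ⟨j, q⟩ := s
      have hexp : 1 ≤ Real.exp (L * zc q) :=
        Real.one_le_exp (mul_nonneg hL.le ((hT q).1.trans (hT q).2.1))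
      fin_cases j
      · simp [Φ, Φ0, I0, W]; positivity
      · simp [Φ, Φ1, I1, W]
        refine (hdM _ ⟨(hT q).1.trans (hm1 q).1, (hm1 q).2.trans (hT q).2.2⟩).trans ?_
        exact le_mul_of_one_le_right hMd0 hexp)
  have hret : ∀ z ζ, (z, ζ) ∈ triangle → zc (z, ζ) = z ∧ ζc (z, ζ) = ζ := fun z ζ hq => by
    have := retract_of_mem hq
    rwa [Prod.mk.injEq] at this
  refine ⟨fun q => x (0, q), fun q => x (1, q), hxA 0, hxA 1, fun z ζ hq => ?_, fun z ζ hq => ?_⟩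
  · obtain ⟨e1, e2⟩ := hret z ζ hq
    refine (congrFun hx (0, z, ζ)).symm.trans ?_
    simp [Φ, Φ0, I0, e1, e2]
  · obtain ⟨e1, e2⟩ := hret z ζ hq
    refine (congrFun hx (1, z, ζ)).symm.trans ?_
    simp [Φ, Φ1, I1, m, e1, e2]

namespace System

variable {n : ℕ} (P : System n)

/-- The kernel equations couple only entries of the same row. For row `i` and `j = 1 - i`, the
unknowns `f = Kᵢᵢ λᵢ` and `g = Kᵢⱼ λⱼ` satisfy two transport equations; `f` receives its data from
the side `ζ = 0` and `g` from the diagonal. -/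
theorem exists_goursat_pair (i : Fin 2) (ρ : ℝ) :
    ∃ (ν : ℝ → ℝ) (f g : ℝ × ℝ → ℝ), Continuous f ∧ Continuous g ∧
      (∀ z, P.phiE i (ν z) + P.phiE (1 - i) (ν z) = z) ∧
      (∀ z, ν (P.phiE i z + P.phiE (1 - i) z) = z) ∧
      (∀ z ζ, (z, ζ) ∈ triangle → f (z, ζ) = ρ * g (P.phiInv i (P.phiE i z - P.phiE i ζ), 0)
        + ∫ σ in (0 : ℝ)..(P.phiE i ζ), sgn i * (P.lamE i (P.phiInv i σ) /
          P.lamE (1 - i) (P.phiInv i σ)) * P.AtE (P.phiInv i σ) (1 - i) i *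
            g (P.phiInv i (P.phiE i z - P.phiE i ζ + σ), P.phiInv i σ)) ∧
      ∀ z ζ, (z, ζ) ∈ triangle → g (z, ζ) = -sgn i * P.AtE (ν (P.phiE i z + P.phiE (1 - i) ζ))
          i (1 - i) * (P.lamE (1 - i) (ν (P.phiE i z + P.phiE (1 - i) ζ)) /
            (P.lamE i (ν (P.phiE i z + P.phiE (1 - i) ζ))
              + P.lamE (1 - i) (ν (P.phiE i z + P.phiE (1 - i) ζ))))
        + ∫ σ in (0 : ℝ)..(P.phiE i z - P.phiE i (ν (P.phiE i z + P.phiE (1 - i) ζ))),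
          (fun z => sgn i * (P.lamE (1 - i) z / P.lamE i z) * P.AtE z i (1 - i))
            (P.phiInv (1 - i) (P.phiE (1 - i) (ν (P.phiE i z + P.phiE (1 - i) ζ)) - σ)) *
          f (P.phiInv i (P.phiE i (ν (P.phiE i z + P.phiE (1 - i) ζ)) + σ),
            P.phiInv (1 - i) (P.phiE (1 - i) (ν (P.phiE i z + P.phiE (1 - i) ζ)) - σ)) := by
  obtain ⟨M, hM⟩ := P.exists_lamE_le
  obtain ⟨M', -, hM'⟩ := P.exists_inv_lamE_le
  obtain ⟨ν, hν⟩ := (P.travelTime i).exists_add (P.travelTime (1 - i)) (hM i)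
  have hne : ∀ j z, P.lamE j z ≠ 0 := fun j z => (P.lamE_pos j z).ne'
  have hlc := P.continuous_lamE
  have hp : Continuous fun z => sgn i * (P.lamE i z / P.lamE (1 - i) z) * P.AtE z (1 - i) i :=
    (continuous_const.mul ((hlc i).div (hlc _) (hne _))).mul (P.continuous_AtE _ _)
  have hr : Continuous fun z => sgn i * (P.lamE (1 - i) z / P.lamE i z) * P.AtE z i (1 - i) :=
    (continuous_const.mul ((hlc _).div (hlc i) (hne _))).mul (P.continuous_AtE _ _)
  have hd : Continuous fun z => -sgn i * P.AtE z i (1 - i) *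
      (P.lamE (1 - i) z / (P.lamE i z + P.lamE (1 - i) z)) :=
    (continuous_const.mul (P.continuous_AtE _ _)).mul ((hlc _).div ((hlc _).add (hlc _))
      fun z => (add_pos (P.lamE_pos i z) (P.lamE_pos _ z)).ne')
  have hcl : ∀ z, unitClamp (unitClamp z) = unitClamp z := fun z => unitClamp_of_mem (unitClamp_mem z)
  have hbd : ∀ F : ℝ → ℝ, Continuous F → (∀ z, F (unitClamp z) = F z) → ∃ B, ∀ z, |F z| ≤ B := by
    intro F hF hFc
    obtain ⟨B, hB⟩ := exists_bound_comp_unitClamp hF.continuousOn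
    exact ⟨B, fun z => by rw [← hFc]; exact hB z⟩
  obtain ⟨Mp, hMp⟩ := hbd _ hp fun z => by simp only [lamE, AtE, hcl]
  obtain ⟨Mr, hMr⟩ := hbd _ hr fun z => by simp only [lamE, AtE, hcl]
  obtain ⟨Md, hMd⟩ := hbd _ hd fun z => by simp only [lamE, AtE, hcl]
  obtain ⟨f, g, hf, hg, h1, h2⟩ := exists_goursat (P.travelTime i) (P.travelTime (1 - i)) hν
    (hM' i) hp hr hd hMp hMr (fun z _ => hMd z) ρ
  exact ⟨ν, f, g, hf, hg, hν.right_inv, hν.left_inv, h1, h2⟩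

theorem exists_isKernel (hq0 : P.q0 ≠ 0) : ∃ K, P.IsKernel K := by
  -- After multiplication by the speeds, the conditions at `ζ = 0` read `f = q₀ g` in the first row
  -- and `f = g / q₀` in the second.
  choose ν f g hf hg hν1 hν2 hf1 hg1 using fun i => P.exists_goursat_pair i (![P.q0, 1 / P.q0] i)
  have hne : ∀ j z, P.lamE j z ≠ 0 := fun j z => (P.lamE_pos j z).ne'
  let K : ℝ → ℝ → Matrix (Fin 2) (Fin 2) ℝ := fun z ζ => Matrix.of fun i j =>
    (if j = i then f i (z, ζ) else g i (z, ζ)) / P.lamE j ζ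
  have hKii : ∀ i z ζ, K z ζ i i = f i (z, ζ) / P.lamE i ζ := fun i z ζ => by simp [K]
  have hrev : ∀ i : Fin 2, 1 - i ≠ i := by decide
  have hKij : ∀ i z ζ, K z ζ i (1 - i) = g i (z, ζ) / P.lamE (1 - i) ζ := fun i z ζ => by
    simp [K, hrev i]
  have hcancel : ∀ x σ l : ℝ, l ≠ 0 → x / l * (σ * l) = σ * x := by
    intro x σ l hl; field_simp
  have h0mem : (0 : ℝ) ∈ Icc (0 : ℝ) 1 := ⟨le_rfl, zero_le_one⟩
  have hbot : ∀ i, ∀ z ∈ Icc (0 : ℝ) 1, f i (z, 0) = ![P.q0, 1 / P.q0] i * g i (z, 0) := by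
    intro i z hz
    rw [hf1 i z 0 ⟨le_rfl, hz.1, hz.2⟩]
    simp [phiE_zero, phiInv_phiE]
  have hdiag : ∀ i, ∀ z ∈ Icc (0 : ℝ) 1, g i (z, z) = -sgn i * P.AtE z i (1 - i) *
      (P.lamE (1 - i) z / (P.lamE i z + P.lamE (1 - i) z)) := by
    intro i z hz
    rw [hg1 i z z ⟨hz.1, le_rfl, hz.2⟩]
    simp [hν2]
  refine ⟨K, ⟨?_, ?_, ?_, ?_, ?_, ?_⟩⟩
  · intro i j
    have hl : Continuous fun p : ℝ × ℝ => P.lamE j p.2 := (P.continuous_lamE j).comp continuous_snd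
    by_cases hji : j = i
    · simp only [K, Matrix.of_apply, if_pos hji]
      exact ((hf i).div hl fun p => hne _ _).continuousOn
    · simp only [K, Matrix.of_apply, if_neg hji]
      exact ((hg i).div hl fun p => hne _ _).continuousOn
  · intro i j s₀ s₁ Z ζ hZ s hs
    have hmZ : ∀ s ∈ Icc s₀ s₁, Z s ∈ Icc (0 : ℝ) 1 ∧ ζ s ∈ Icc (0 : ℝ) 1 := fun s hs => by
      obtain ⟨h1, h2, h3⟩ := (hZ s hs).1
      exact ⟨⟨h1.trans h2, h3⟩, ⟨h1, h2.trans h3⟩⟩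
    have tZ := (P.travelTime i).travel_of_hasDerivWithinAt (Z := Z) (c := sgn i) fun t ht => by
      rw [P.lamE_of_mem i (hmZ t ht).1, ← P.Lam_eq]; exact (hZ t ht).2.1
    have tζ := (P.travelTime j).travel_of_hasDerivWithinAt (Z := ζ) (c := sgn j) fun t ht => by
      rw [P.lamE_of_mem j (hmZ t ht).2, ← P.Lam_eq]; exact (hZ t ht).2.2
    have hLam : ∀ r ∈ Icc s₀ s₁, P.Lam (ζ r) j = sgn j * P.lamE j (ζ r) := fun r hr => by
      rw [P.Lam_eq, P.lamE_of_mem j (hmZ r hr).2]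
    have hlin : ∀ c e : ℝ, HasDerivAt (fun r : ℝ => c + e * (r - s₀)) e s := fun c e => by
      simpa using (((hasDerivAt_id s).sub_const s₀).const_mul e).const_add c
    have hAt : P.Atilde (ζ s) = P.AtE (ζ s) := (P.AtE_of_mem (hmZ s hs).2).symm
    by_cases hji : j = i
    · subst hji
      -- The difference of the travel times is constant along the characteristic. There `f` is an
      -- integral of a fixed function with a moving upper limit, so the fundamental theorem of
      -- calculus gives its derivative.
      let c : ℝ := P.phiE j (Z s₀) - P.phiE j (ζ s₀)
      have hc : ∀ r ∈ Icc s₀ s₁, P.phiE j (Z r) - P.phiE j (ζ r) = c := fun r hr => by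
        rw [tZ r hr, tζ r hr]; ring
      let H : ℝ → ℝ := fun σ => sgn j * (P.lamE j (P.phiInv j σ) /
          P.lamE (1 - j) (P.phiInv j σ)) * P.AtE (P.phiInv j σ) (1 - j) j *
            g j (P.phiInv j (c + σ), P.phiInv j σ)
      have hι := P.continuous_phiInv j
      have hH : Continuous H :=
        ((continuous_const.mul (((P.continuous_lamE j).comp hι).div
          ((P.continuous_lamE (1 - j)).comp hι) fun _ => hne _ _)).mul
          ((P.continuous_AtE (1 - j) j).comp hι)).mul
          ((hg j).comp ((hι.comp (by fun_prop)).prodMk hι))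
      have hd1 := intervalIntegral.integral_hasDerivAt_right (hH.intervalIntegrable 0
        (P.phiE j (ζ s))) (hH.stronglyMeasurableAtFilter _ _) hH.continuousAt
      rw [tζ s hs] at hd1
      have hd2 := ((hd1.comp s (hlin (P.phiE j (ζ s₀)) (sgn j))).const_add
        (![P.q0, 1 / P.q0] j * g j (P.phiInv j c, 0))).const_mul (sgn j)
      refine (hd2.hasDerivWithinAt.congr_deriv ?_).congr_of_mem (fun r hr => ?_) hs
      · rw [← tζ s hs, hLam s hs, hAt, Matrix.mul_apply]
        have e1 : ∑ k, K (Z s) (ζ s) j k * P.AtE (ζ s) k j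
            = g j (Z s, ζ s) / P.lamE (1 - j) (ζ s) * P.AtE (ζ s) (1 - j) j := by
          rw [← hKij]
          fin_cases j <;> simp [Fin.sum_univ_two, AtE_self]
        have e2 : c + P.phiE j (ζ s) = P.phiE j (Z s) := by rw [← hc s hs]; ring
        rw [e1]
        simp only [H, phiInv_phiE, e2]
        have h1 := hne (1 - j) (ζ s)
        have h2 := sgn_mul_self j
        field_simp
        linear_combination (sgn j * P.lamE j (ζ s) * g j (Z s, ζ s) * P.AtE (ζ s) (1 - j) j) * h2
      · rw [hKii, hLam r hr, hf1 j _ _ (hZ r hr).1, hc r hr]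
        simp only [Function.comp, ← tζ r hr]
        exact hcancel _ _ _ (hne j (ζ r))
    · obtain rfl : j = 1 - i := by
        have : ∀ i j : Fin 2, j ≠ i → j = 1 - i := by decide
        exact this i j hji
      have hsg := sgn_rev i
      -- Here the sum of the travel times is invariant, so the foot `ν i m` is fixed and again only
      -- the upper limit moves.
      let m : ℝ := P.phiE i (Z s₀) + P.phiE (1 - i) (ζ s₀)
      have hm : ∀ r ∈ Icc s₀ s₁, P.phiE i (Z r) + P.phiE (1 - i) (ζ r) = m := fun r hr => by
        rw [tZ r hr, tζ r hr, hsg]; ring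
      let R : ℝ → ℝ := fun z => sgn i * (P.lamE (1 - i) z / P.lamE i z) * P.AtE z i (1 - i)
      have hR : Continuous R := (continuous_const.mul ((P.continuous_lamE _).div
        (P.continuous_lamE i) (hne i))).mul (P.continuous_AtE _ _)
      let H : ℝ → ℝ := fun σ => R (P.phiInv (1 - i) (P.phiE (1 - i) (ν i m) - σ)) *
          f i (P.phiInv i (P.phiE i (ν i m) + σ), P.phiInv (1 - i) (P.phiE (1 - i) (ν i m) - σ))
      have c1 : Continuous fun σ => P.phiInv (1 - i) (P.phiE (1 - i) (ν i m) - σ) :=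
        (P.continuous_phiInv (1 - i)).comp (by fun_prop)
      have c2 : Continuous fun σ => P.phiInv i (P.phiE i (ν i m) + σ) :=
        (P.continuous_phiInv i).comp (by fun_prop)
      have hH : Continuous H := (hR.comp c1).mul ((hf i).comp (c2.prodMk c1))
      have hd1 := intervalIntegral.integral_hasDerivAt_right (hH.intervalIntegrable 0
        (P.phiE i (Z s) - P.phiE i (ν i m))) (hH.stronglyMeasurableAtFilter _ _) hH.continuousAt
      have eZ : ∀ r ∈ Icc s₀ s₁, P.phiE i (Z r) - P.phiE i (ν i m)
          = P.phiE i (Z s₀) - P.phiE i (ν i m) + sgn i * (r - s₀) := fun r hr => by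
        rw [tZ r hr]; ring
      rw [eZ s hs] at hd1
      have hd2 := ((hd1.comp s (hlin (P.phiE i (Z s₀) - P.phiE i (ν i m)) (sgn i))).const_add
        (-sgn i * P.AtE (ν i m) i (1 - i) *
          (P.lamE (1 - i) (ν i m) / (P.lamE i (ν i m) + P.lamE (1 - i) (ν i m))))).const_mul
            (sgn (1 - i))
      refine (hd2.hasDerivWithinAt.congr_deriv ?_).congr_of_mem (fun r hr => ?_) hs
      · rw [← eZ s hs, hLam s hs, hAt, Matrix.mul_apply]
        have e1 : ∑ k, K (Z s) (ζ s) i k * P.AtE (ζ s) k (1 - i)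
            = f i (Z s, ζ s) / P.lamE i (ζ s) * P.AtE (ζ s) i (1 - i) := by
          rw [← hKii]
          fin_cases i <;> simp [Fin.sum_univ_two, AtE_self]
        have e2 : P.phiE (1 - i) (ν i m) - (P.phiE i (Z s) - P.phiE i (ν i m))
            = P.phiE (1 - i) (ζ s) := by linarith [hm s hs, hν1 i m]
        rw [e1]
        simp only [H, R, e2, phiInv_phiE, add_sub_cancel]
        have h1 := hne i (ζ s)
        have h2 := sgn_mul_self i
        field_simp
        linear_combination (sgn (1 - i) * P.lamE (1 - i) (ζ s) * f i (Z s, ζ s) *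
          P.AtE (ζ s) i (1 - i)) * h2
      · rw [hKij, hLam r hr, hg1 i _ _ (hZ r hr).1, hm r hr]
        simp only [Function.comp, ← eZ r hr]
        exact hcancel _ _ _ (hne (1 - i) (ζ r))
  · intro z hz
    have h1 := hKij 0 z 0
    simp only [sub_zero] at h1
    rw [hKii, h1, hbot 0 z hz, ← P.lamE_of_mem 0 h0mem, ← P.lamE_of_mem 1 h0mem]
    have := hne 0 0; have := hne 1 0
    simp
    field_simp
  · intro z hz
    have h1 := hKij 0 z z
    simp only [sub_zero] at h1
    rw [h1, hdiag 0 z hz, ← P.lamE_of_mem 0 hz, ← P.lamE_of_mem 1 hz, ← P.AtE_of_mem hz]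
    have := hne 0 z; have := hne 1 z
    have := (add_pos (P.lamE_pos 0 z) (P.lamE_pos 1 z)).ne'
    simp [sgn]
    field_simp
  · intro z hz
    have h1 := hKij 1 z z
    simp only [sub_self] at h1
    rw [h1, hdiag 1 z hz, ← P.lamE_of_mem 0 hz, ← P.lamE_of_mem 1 hz, ← P.AtE_of_mem hz]
    have := hne 0 z; have := hne 1 z
    have := (add_pos (P.lamE_pos 0 z) (P.lamE_pos 1 z)).ne'
    simp [sgn]
    rw [add_comm (P.lamE 1 z)]
    field_simp
  · intro z hz
    have h1 := hKij 1 z 0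
    simp only [sub_self] at h1
    rw [hKii, h1, hbot 1 z hz, ← P.lamE_of_mem 0 h0mem, ← P.lamE_of_mem 1 h0mem]
    have := hne 0 0; have := hne 1 0
    simp
    field_simp

end System

/-! ### Controllability and the flat output -/

namespace System

variable {n : ℕ} (P : System n)

-- By the Cayley–Hamilton theorem `F ^ n` reduces to lower powers, so the companion matrix of the
-- characteristic polynomial closes the chain `w F^k ξ`, `k < n`.
open Matrix in
theorem vecMul_pow_eq_zero (F : Matrix (Fin n) (Fin n) ℝ) (w : Fin n → ℝ) :
    ∃ C : Matrix (Fin n) (Fin n) ℝ, ∀ ξ : Fin n → ℝ,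
      (fun k : Fin n => w ⬝ᵥ (F ^ ((k : ℕ) + 1) *ᵥ ξ))
        = C *ᵥ fun k : Fin n => w ⬝ᵥ (F ^ (k : ℕ) *ᵥ ξ) := by
  refine ⟨Matrix.of fun k l => if (k : ℕ) + 1 < n then (if (l : ℕ) = k + 1 then 1 else 0)
    else -(F.charpoly.coeff l), fun ξ => funext fun k => ?_⟩
  by_cases hk : (k : ℕ) + 1 < n
  · change w ⬝ᵥ (F ^ ((k : ℕ) + 1) *ᵥ ξ) = ∑ l : Fin n, (if (k : ℕ) + 1 < n then
      (if (l : ℕ) = k + 1 then 1 else 0) else -(F.charpoly.coeff l)) * (w ⬝ᵥ (F ^ (l : ℕ) *ᵥ ξ))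
    rw [Finset.sum_eq_single (⟨k + 1, hk⟩ : Fin n)]
    · simp [hk]
    · intro l _ hl
      have : (l : ℕ) ≠ k + 1 := fun h => hl (Fin.ext h)
      simp [this, hk]
    · simp
  · have hkn : (k : ℕ) + 1 = n := by omega
    have hCH := F.aeval_self_charpoly
    rw [F.charpoly_monic.as_sum, F.charpoly_natDegree_eq_dim, Fintype.card_fin] at hCH
    simp only [map_add, map_sum, map_mul, map_pow, Polynomial.aeval_X, Polynomial.aeval_C,
      Algebra.algebraMap_eq_smul_one, smul_mul_assoc, one_mul] at hCH
    have hF : F ^ n = -∑ i ∈ Finset.range n, F.charpoly.coeff i • F ^ i :=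
      eq_neg_of_add_eq_zero_left hCH
    rw [hkn, hF, Finset.sum_range]
    simp only [mulVec, of_apply, hk, if_false]
    change w ⬝ᵥ ((-∑ i : Fin n, F.charpoly.coeff i • F ^ (i : ℕ)) *ᵥ ξ) = _
    rw [neg_mulVec, dotProduct_neg, sum_mulVec, dotProduct_sum]
    simp only [smul_mulVec, dotProduct_smul, smul_eq_mul]
    rw [dotProduct, ← Finset.sum_neg_distrib]
    refine Finset.sum_congr rfl fun l _ => ?_
    simp

-- If `w` annihilated all `F^k b`, then along any controlled trajectory the functions `w F^k ξ(t)`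
-- would solve a homogeneous linear equation that does not see the input. Starting from zero they
-- would stay zero, whereas steering to the target `w` requires `w ⬝ᵥ w` to be attained.
open Matrix in
theorem isUnit_kalman (hFb : Controllable P.F P.b) : IsUnit P.kalman.det := by
  rw [isUnit_iff_ne_zero]
  intro h0
  obtain ⟨w, hw0, hw⟩ := Matrix.exists_vecMul_eq_zero_iff.2 h0
  have hwF : ∀ k : Fin n, w ⬝ᵥ (P.F ^ (k : ℕ) *ᵥ P.b) = 0 := fun k => congrFun hw k
  obtain ⟨C, hC⟩ := vecMul_pow_eq_zero P.F w
  obtain ⟨T, hT, v, ξ, -, h1, h2, h3⟩ := hFb 0 w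
  let W : Matrix (Fin n) (Fin n) ℝ := Matrix.of fun k => w ᵥ* (P.F ^ (k : ℕ))
  have hW : ∀ ξ, W *ᵥ ξ = fun k : Fin n => w ⬝ᵥ (P.F ^ (k : ℕ) *ᵥ ξ) := fun ξ => by
    funext k
    rw [dotProduct_mulVec]
    rfl
  have hder : ∀ t ∈ Icc 0 T, HasDerivWithinAt (fun t => W *ᵥ ξ t) (C *ᵥ (W *ᵥ ξ t)) (Icc 0 T) t := by
    intro t ht
    have := (LinearMap.toContinuousLinearMap W.mulVecLin).hasFDerivAt.comp_hasDerivWithinAt t (h3 t ht)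
    refine this.congr_deriv ?_
    change W *ᵥ (P.F *ᵥ ξ t + v t • P.b) = _
    rw [mulVec_add, mulVec_smul, hW P.b]
    have e1 : (fun k : Fin n => w ⬝ᵥ (P.F ^ (k : ℕ) *ᵥ P.b)) = 0 := funext hwF
    rw [e1, smul_zero, add_zero, hW (ξ t), ← hC, hW]
    funext k
    rw [mulVec_mulVec, pow_succ]
  have hg := norm_le_gronwallBound_of_norm_deriv_right_le (f := fun t => W *ᵥ ξ t)
    (f' := fun t => C *ᵥ (W *ᵥ ξ t)) (δ := 0)
    (K := ‖LinearMap.toContinuousLinearMap C.mulVecLin‖) (ε := 0) (a := 0) (b := T)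
    (fun t ht => (hder t ht).continuousWithinAt)
    (fun t ht => (hder t ⟨ht.1, ht.2.le⟩).mono_of_mem_nhdsWithin
      (mem_nhdsWithin.2 ⟨Iio T, isOpen_Iio, ht.2, fun s hs => ⟨ht.1.trans hs.2, le_of_lt hs.1⟩⟩))
    (by simp [h1])
    (fun t _ => by
      rw [add_zero]
      exact (LinearMap.toContinuousLinearMap C.mulVecLin).le_opNorm _)
    T ⟨hT.le, le_rfl⟩
  rw [gronwallBound_ε0_δ0, norm_le_zero_iff, h2, hW] at hg
  have hn : 0 < n := by
    rcases Nat.eq_zero_or_pos n with hn | hn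
    · subst hn; exact absurd (Subsingleton.elim w 0) hw0
    · exact hn
  have := congrFun hg ⟨0, hn⟩
  simp only [pow_zero, one_mulVec, Pi.zero_apply] at this
  exact hw0 (dotProduct_self_eq_zero.1 this)

open Matrix in
theorem h_dotProduct (hu : IsUnit P.kalman.det) (j : Fin n) :
    P.h ⬝ᵥ (P.F ^ (j : ℕ) *ᵥ P.b) = eLast n j := by
  have : P.h ᵥ* P.kalman = eLast n := by
    rw [h, vecMul_vecMul, nonsing_inv_mul _ hu, vecMul_one]
  exact congrFun this j

-- The numbers `h F^(i+j) b` vanish for `i + j < n - 1` and are one for `i + j = n - 1`. Pairing a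
-- dependence of the rows with `F^(n-1-i₀) b`, where `i₀` is the last index with nonzero
-- coefficient, isolates that coefficient.
open Matrix in
theorem isUnit_Tc (hu : IsUnit P.kalman.det) : IsUnit P.Tc.det := by
  rw [isUnit_iff_ne_zero]
  intro h0
  obtain ⟨c, hc0, hc⟩ := Matrix.exists_vecMul_eq_zero_iff.2 h0
  obtain ⟨i₀, hi₀, hmax⟩ : ∃ i : Fin n, c i ≠ 0 ∧ ∀ j, i < j → c j = 0 := by
    obtain ⟨i₁, hi₁⟩ := Function.ne_iff.1 hc0
    let S := Finset.univ.filter fun i => c i ≠ 0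
    have hS : S.Nonempty := ⟨i₁, by simpa [S] using hi₁⟩
    refine ⟨S.max' hS, by simpa [S] using S.max'_mem hS, fun j hj => ?_⟩
    by_contra hne
    exact absurd (S.le_max' j (by simpa [S] using hne)) (not_le.2 hj)
  have h1 : (c ᵥ* P.Tc) ⬝ᵥ (P.F ^ (n - 1 - (i₀ : ℕ)) *ᵥ P.b) = 0 := by rw [hc, zero_dotProduct]
  rw [← dotProduct_mulVec, dotProduct, Finset.sum_eq_single i₀] at h1
  · have e : (P.Tc *ᵥ (P.F ^ (n - 1 - (i₀ : ℕ)) *ᵥ P.b)) i₀ = 1 := by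
      change (P.h ᵥ* P.F ^ (i₀ : ℕ)) ⬝ᵥ _ = 1
      rw [← dotProduct_mulVec, mulVec_mulVec, ← pow_add]
      have h2 : (i₀ : ℕ) + (n - 1 - (i₀ : ℕ)) = n - 1 := by omega
      have h3 := P.h_dotProduct hu ⟨n - 1, by omega⟩
      rw [h2]
      simp only at h3
      rw [h3, eLast, if_pos (by simp only; omega)]
    rw [e, mul_one] at h1
    exact hi₀ h1
  · intro i _ hi
    rcases lt_or_gt_of_ne hi with hlt | hgt
    · have e : (P.Tc *ᵥ (P.F ^ (n - 1 - (i₀ : ℕ)) *ᵥ P.b)) i = 0 := by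
        change (P.h ᵥ* P.F ^ (i : ℕ)) ⬝ᵥ _ = 0
        rw [← dotProduct_mulVec, mulVec_mulVec, ← pow_add]
        have hlt' : (i : ℕ) < i₀ := hlt
        have h3 := P.h_dotProduct hu ⟨(i : ℕ) + (n - 1 - (i₀ : ℕ)), by omega⟩
        simp only at h3
        rw [h3, eLast, if_neg (by simp only; omega)]
      rw [e, mul_zero]
    · rw [hmax i hgt, zero_mul]
  · simp

open Matrix in
theorem Tc_mulVec_b (hu : IsUnit P.kalman.det) : P.Tc *ᵥ P.b = eLast n := by
  funext i
  rw [← P.h_dotProduct hu i, dotProduct_mulVec]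
  rfl

open Matrix in
theorem Tc_mulVec_F (ξ : Fin n → ℝ) {k : ℕ} (hk : k + 1 < n) :
    (P.Tc *ᵥ (P.F *ᵥ ξ)) ⟨k, by omega⟩ = (P.Tc *ᵥ ξ) ⟨k + 1, hk⟩ := by
  change (P.h ᵥ* P.F ^ k) ⬝ᵥ (P.F *ᵥ ξ) = (P.h ᵥ* P.F ^ (k + 1)) ⬝ᵥ ξ
  rw [dotProduct_mulVec, vecMul_vecMul, ← pow_succ]

open Matrix in
/-- The chain of derivatives in terms of the companion matrix. -/
theorem succ_eq (hT : IsUnit P.Tc.det) (Y : ℕ → ℝ → ℝ) (τ : ℝ) :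
    (fun k : Fin n => Y (k + 1) τ)
      = (P.Tc * P.F * P.Tc⁻¹) *ᵥ (fun i : Fin n => Y i τ) + P.p1Par Y τ • eLast n := by
  funext k
  by_cases hk : (k : ℕ) + 1 < n
  · have h1 := P.Tc_mulVec_F (P.Tc⁻¹ *ᵥ fun i : Fin n => Y i τ) hk
    have e1 : ∀ v, P.Tc *ᵥ (P.F *ᵥ (P.Tc⁻¹ *ᵥ v)) = (P.Tc * P.F * P.Tc⁻¹) *ᵥ v := fun v => by
      simp only [mulVec_mulVec, Matrix.mul_assoc]
    have e2 : ∀ v, P.Tc *ᵥ (P.Tc⁻¹ *ᵥ v) = v := fun v => by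
      rw [mulVec_mulVec, mul_nonsing_inv _ hT, one_mulVec]
    rw [e1, e2] at h1
    have h2 : eLast n k = 0 := if_neg (by omega)
    simp only [Pi.add_apply, Pi.smul_apply, h2, smul_zero, add_zero]
    exact h1.symm
  · have hkn : (k : ℕ) + 1 = n := by omega
    have h2 : eLast n k = 1 := if_pos hkn
    have h3 : ∀ v : Fin n → ℝ, eLast n ⬝ᵥ v = v k := fun v => by
      rw [dotProduct, Finset.sum_eq_single k]
      · rw [h2, one_mul]
      · intro l _ hl
        have : eLast n l = 0 := if_neg fun h => hl (Fin.ext (by omega))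
        rw [this, zero_mul]
      · simp
    simp only [Pi.add_apply, Pi.smul_apply, h2, smul_eq_mul, mul_one, p1Par, h3, hkn]
    ring

open Matrix in
theorem xiPar_succ (hu : IsUnit P.kalman.det) (Y : ℕ → ℝ → ℝ) (τ : ℝ) :
    P.Tc⁻¹ *ᵥ (fun k : Fin n => Y (k + 1) τ)
      = P.F *ᵥ P.xiPar Y τ + P.p1Par Y τ • P.b := by
  have hT := P.isUnit_Tc hu
  rw [P.succ_eq hT, mulVec_add, mulVec_smul, ← P.Tc_mulVec_b hu, mulVec_mulVec, mulVec_mulVec,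
    nonsing_inv_mul _ hT, one_mulVec, ← Matrix.mul_assoc, ← Matrix.mul_assoc,
    nonsing_inv_mul _ hT, Matrix.one_mul, xiPar, mulVec_mulVec]

open Matrix in
theorem Tc_mulVec_xiPar (hu : IsUnit P.kalman.det) (Y : ℕ → ℝ → ℝ) (τ : ℝ) :
    P.Tc *ᵥ P.xiPar Y τ = fun i : Fin n => Y i τ := by
  rw [xiPar, mulVec_mulVec, mul_nonsing_inv _ (P.isUnit_Tc hu), one_mulVec]

/-- The flat output and its derivatives along a solution of the ordinary differential equation. -/
def flatJet (ξ : ℝ → Fin n → ℝ) (x₁ : ℝ → ℝ) : ℕ → ℝ → ℝ := fun k t =>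
  if hk : k < n then (P.Tc.mulVec (ξ t)) ⟨k, hk⟩
  else x₁ t + eLast n ⬝ᵥ (P.Tc * P.F * P.Tc⁻¹).mulVec (P.Tc.mulVec (ξ t))

theorem flatJet_lt (ξ : ℝ → Fin n → ℝ) (x₁ : ℝ → ℝ) (t : ℝ) :
    (fun i : Fin n => P.flatJet ξ x₁ i t) = P.Tc.mulVec (ξ t) := by
  funext i; simp [flatJet]

theorem p1Par_flatJet (ξ : ℝ → Fin n → ℝ) (x₁ : ℝ → ℝ) (t : ℝ) :
    P.p1Par (P.flatJet ξ x₁) t = x₁ t := by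
  rw [p1Par, flatJet_lt]; simp [flatJet]

open Matrix in
theorem xiPar_flatJet (hu : IsUnit P.kalman.det) (ξ : ℝ → Fin n → ℝ) (x₁ : ℝ → ℝ) (t : ℝ) :
    P.xiPar (P.flatJet ξ x₁) t = ξ t := by
  rw [xiPar, flatJet_lt, mulVec_mulVec, nonsing_inv_mul _ (P.isUnit_Tc hu), one_mulVec]

open Matrix in
theorem flatJet_succ (hu : IsUnit P.kalman.det) (ξ : ℝ → Fin n → ℝ) (x₁ : ℝ → ℝ) (t : ℝ) :
    (fun k : Fin n => P.flatJet ξ x₁ (k + 1) t) = P.Tc *ᵥ (P.F *ᵥ ξ t + x₁ t • P.b) := by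
  have hT := P.isUnit_Tc hu
  rw [P.succ_eq hT, p1Par_flatJet, flatJet_lt, mulVec_add, mulVec_smul, P.Tc_mulVec_b hu,
    mulVec_mulVec, mulVec_mulVec, Matrix.mul_assoc, Matrix.mul_assoc, nonsing_inv_mul _ hT,
    Matrix.mul_one]

end System

/-! ### Locally bounded functions and jets on the real line -/

/-- Borel measurable functions that are bounded on bounded sets. -/
structure LocBounded (f : ℝ → ℝ) : Prop where
  measurable : Measurable f
  bounded : ∀ T : ℝ, ∃ B, ∀ t, |t| ≤ T → |f t| ≤ B

namespace LocBounded

variable {f g : ℝ → ℝ}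

theorem of_continuous (hf : Continuous f) : LocBounded f := by
  refine ⟨hf.measurable, fun T => ?_⟩
  obtain ⟨B, hB⟩ := (isCompact_Icc (a := -T) (b := T)).exists_bound_of_continuousOn hf.continuousOn
  exact ⟨B, fun t ht => hB t (abs_le.1 ht)⟩

theorem add (hf : LocBounded f) (hg : LocBounded g) : LocBounded fun t => f t + g t := by
  refine ⟨hf.1.add hg.1, fun T => ?_⟩
  obtain ⟨B, hB⟩ := hf.2 T
  obtain ⟨C, hC⟩ := hg.2 T
  exact ⟨B + C, fun t ht => (abs_add_le _ _).trans (add_le_add (hB t ht) (hC t ht))⟩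

theorem mul (hf : LocBounded f) (hg : LocBounded g) : LocBounded fun t => f t * g t := by
  refine ⟨hf.1.mul hg.1, fun T => ?_⟩
  obtain ⟨B, hB⟩ := hf.2 T
  obtain ⟨C, hC⟩ := hg.2 T
  refine ⟨B * C, fun t ht => ?_⟩
  rw [abs_mul]
  exact mul_le_mul (hB t ht) (hC t ht) (abs_nonneg _) ((abs_nonneg _).trans (hB t ht))

theorem const (c : ℝ) : LocBounded fun _ => c := of_continuous continuous_const

theorem const_mul (hf : LocBounded f) (c : ℝ) : LocBounded fun t => c * f t := (const c).mul hf

theorem neg (hf : LocBounded f) : LocBounded fun t => -f t := by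
  simpa using hf.const_mul (-1)

theorem sub (hf : LocBounded f) (hg : LocBounded g) : LocBounded fun t => f t - g t := by
  simpa [sub_eq_add_neg] using hf.add hg.neg

theorem sum {ι : Type*} {f : ι → ℝ → ℝ} (s : Finset ι) (hf : ∀ i ∈ s, LocBounded (f i)) :
    LocBounded fun t => ∑ i ∈ s, f i t := by
  classical
  induction s using Finset.induction_on with
  | empty => simpa using const 0
  | insert a s ha ih =>
    simp only [Finset.sum_insert ha]
    exact (hf a (Finset.mem_insert_self a s)).add
      (ih fun i hi => hf i (Finset.mem_insert_of_mem hi))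

theorem abs (hf : LocBounded f) : LocBounded fun t => |f t| := by
  refine ⟨hf.1.abs, fun T => ?_⟩
  obtain ⟨B, hB⟩ := hf.2 T
  exact ⟨B, fun t ht => by rw [abs_abs]; exact hB t ht⟩

theorem comp_continuous (hf : LocBounded f) (hg : Continuous g) : LocBounded fun t => f (g t) := by
  refine ⟨hf.1.comp hg.measurable, fun T => ?_⟩
  obtain ⟨C, hC⟩ := (of_continuous hg).2 T
  obtain ⟨B, hB⟩ := hf.2 C
  exact ⟨B, fun t ht => hB _ (hC t ht)⟩

theorem shift (hf : LocBounded f) (t : ℝ) : LocBounded fun s => f (t + s) :=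
  hf.comp_continuous (continuous_const.add continuous_id)

theorem indicator (hf : LocBounded f) {s : Set ℝ} (hs : MeasurableSet s) :
    LocBounded (s.indicator f) := by
  refine ⟨hf.1.indicator hs, fun T => ?_⟩
  obtain ⟨B, hB⟩ := hf.2 T
  refine ⟨B, fun t ht => ?_⟩
  by_cases h : t ∈ s
  · rw [indicator_of_mem h]; exact hB t ht
  · rw [indicator_of_notMem h, abs_zero]; exact (abs_nonneg _).trans (hB t ht)

theorem ite (hf : LocBounded f) (hg : LocBounded g) {p : ℝ → Prop} [DecidablePred p]
    (hp : MeasurableSet {t | p t}) : LocBounded fun t => if p t then f t else g t := by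
  refine ⟨Measurable.ite hp hf.1 hg.1, fun T => ?_⟩
  obtain ⟨B, hB⟩ := hf.2 T
  obtain ⟨C, hC⟩ := hg.2 T
  refine ⟨max B C, fun t ht => ?_⟩
  split_ifs
  · exact (hB t ht).trans (le_max_left _ _)
  · exact (hC t ht).trans (le_max_right _ _)

theorem intervalIntegrable (hf : LocBounded f) (a b : ℝ) : IntervalIntegrable f volume a b := by
  obtain ⟨B, hB⟩ := hf.2 (max |a| |b|)
  exact intervalIntegrable_of_bound hf.1 fun x hx => hB x (abs_le_max_abs_abs hx.1 hx.2 |>.trans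
    (by
      rcases le_total a b with h | h
      · rw [min_eq_left h, max_eq_right h]
      · rw [min_eq_right h, max_eq_left h, max_comm]))

theorem continuous_primitive (hf : LocBounded f) (a : ℝ) : Continuous fun t => ∫ s in a..t, f s :=
  intervalIntegral.continuous_primitive (fun a b => hf.intervalIntegrable a b) a

end LocBounded

/-- A function `Y 0` on `ℝ` and its derivatives `Y 0, …, Y n`, the last of which is measurable and
locally bounded. -/
structure IsGlobalJet (n : ℕ) (Y : ℕ → ℝ → ℝ) : Prop where
  top : LocBounded (Y n)
  deriv : ∀ k < n, ∀ s t, Y k t = Y k s + ∫ σ in s..t, Y (k + 1) σ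

namespace IsGlobalJet

variable {n : ℕ} {Y Z : ℕ → ℝ → ℝ}

theorem locBounded (hY : IsGlobalJet n Y) {k : ℕ} (hk : k ≤ n) : LocBounded (Y k) := by
  induction hk using Nat.decreasingInduction with
  | self => exact hY.top
  | of_succ k hk ih =>
    have : Y k = fun t => Y k 0 + ∫ σ in (0 : ℝ)..t, Y (k + 1) σ :=
      funext fun t => hY.deriv k hk 0 t
    rw [this]
    exact (LocBounded.const _).add (LocBounded.of_continuous (ih.continuous_primitive 0))

theorem continuous (hY : IsGlobalJet n Y) {k : ℕ} (hk : k < n) : Continuous (Y k) := by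
  have : Y k = fun t => Y k 0 + ∫ σ in (0 : ℝ)..t, Y (k + 1) σ :=
    funext fun t => hY.deriv k hk 0 t
  rw [this]
  exact continuous_const.add ((hY.locBounded hk).continuous_primitive 0)

theorem add (hY : IsGlobalJet n Y) (hZ : IsGlobalJet n Z) :
    IsGlobalJet n fun k t => Y k t + Z k t := by
  refine ⟨hY.top.add hZ.top, fun k hk s t => ?_⟩
  rw [intervalIntegral.integral_add ((hY.locBounded hk).intervalIntegrable _ _)
    ((hZ.locBounded hk).intervalIntegrable _ _), hY.deriv k hk s t, hZ.deriv k hk s t]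
  ring

theorem sub (hY : IsGlobalJet n Y) (hZ : IsGlobalJet n Z) :
    IsGlobalJet n fun k t => Y k t - Z k t := by
  refine ⟨hY.top.sub hZ.top, fun k hk s t => ?_⟩
  rw [intervalIntegral.integral_sub ((hY.locBounded hk).intervalIntegrable _ _)
    ((hZ.locBounded hk).intervalIntegrable _ _), hY.deriv k hk s t, hZ.deriv k hk s t]
  ring

theorem shift (hY : IsGlobalJet n Y) (t : ℝ) : IsGlobalJet n fun k s => Y k (t + s) := by
  refine ⟨hY.top.shift t, fun k hk r s => ?_⟩
  rw [intervalIntegral.integral_comp_add_left (fun x => Y (k + 1) x) t]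
  exact hY.deriv k hk _ _

theorem exists_of_base (η : Fin n → ℝ) {v : ℝ → ℝ} (hv : LocBounded v) (a : ℝ) :
    ∃ Y, IsGlobalJet n Y ∧ Y n = v ∧ ∀ k : Fin n, Y k a = η k := by
  induction n with
  | zero => exact ⟨fun _ => v, ⟨hv, fun k hk => absurd hk (Nat.not_lt_zero k)⟩, rfl, fun k => k.elim0⟩
  | succ n ih =>
    obtain ⟨Y, hY, hYn, hYa⟩ := ih (fun k => η k.succ)
    have h0 : LocBounded (Y 0) := hY.locBounded (Nat.zero_le n)
    refine ⟨fun k => Nat.casesOn k (fun t => η 0 + ∫ s in a..t, Y 0 s) Y, ⟨hY.top, ?_⟩, hYn, ?_⟩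
    · rintro (_ | k) hk s t
      · change η 0 + _ = η 0 + _ + ∫ σ in s..t, Y 0 σ
        rw [add_assoc, intervalIntegral.integral_add_adjacent_intervals
          (h0.intervalIntegrable _ _) (h0.intervalIntegrable _ _)]
      · exact hY.deriv k (by omega) s t
    · intro k
      refine Fin.cases (by simp) (fun k => ?_) k
      exact hYa k

/-- Bound of the derivatives of lower order on an interval. -/
theorem abs_le (hY : IsGlobalJet n Y) {a b : ℝ} {k : ℕ} (hk : k < n) {t : ℝ} (ht : t ∈ Icc a b) :
    |Y k t| ≤ (2 * (1 + (b - a))) ^ n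
      * (‖fun i : Fin n => Y i a‖ + ∫ σ in a..b, |Y n σ|) := by
  have hab : a ≤ b := ht.1.trans ht.2
  have hI : 0 ≤ ∫ σ in a..b, |Y n σ| :=
    intervalIntegral.integral_nonneg hab fun _ _ => abs_nonneg _
  set c : ℝ := 2 * (1 + (b - a)) with hc
  have hc1 : 1 ≤ c := by linarith
  set S : ℝ := ‖fun i : Fin n => Y i a‖ + ∫ σ in a..b, |Y n σ| with hS
  have hη : ∀ k < n, |Y k a| ≤ S := fun k hk => by
    have := norm_le_pi_norm (fun i : Fin n => Y i a) ⟨k, hk⟩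
    rw [Real.norm_eq_abs] at this
    simp only at this
    linarith
  have hS0 : 0 ≤ S := by positivity
  have hstep : ∀ k < n, (∀ t ∈ Icc a b, |∫ σ in a..t, Y (k + 1) σ| ≤ c ^ (n - (k + 1)) * S) →
      ∀ t ∈ Icc a b, |Y k t| ≤ 2 * (c ^ (n - (k + 1)) * S) := by
    intro k hk h t ht
    rw [hY.deriv k hk a t]
    have h1 : S ≤ c ^ (n - (k + 1)) * S := le_mul_of_one_le_left hS0 (one_le_pow₀ hc1)
    linarith [abs_add_le (Y k a) (∫ σ in a..t, Y (k + 1) σ), hη k hk, h t ht]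
  -- Induction downward on the order. Integrals rather than values are estimated because the top
  -- derivative is controlled only in `L¹`; each further integration costs one factor `c`.
  have key : ∀ k (_ : k ≤ n), ∀ t ∈ Icc a b, |∫ σ in a..t, Y k σ| ≤ c ^ (n - k) * S := by
    intro k hk
    induction hk using Nat.decreasingInduction with
    | self =>
      intro t ht
      rw [Nat.sub_self, pow_zero, one_mul]
      have h1 := intervalIntegral.abs_integral_le_integral_abs (f := Y n) (μ := volume) ht.1
      have h2 := intervalIntegral.integral_mono_interval (c := a) (d := b) (f := fun σ => |Y n σ|)
        (μ := volume) le_rfl ht.1 ht.2 (Filter.Eventually.of_forall fun _ => abs_nonneg _)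
        (hY.top.abs.intervalIntegrable _ _)
      linarith [norm_nonneg fun i : Fin n => Y i a]
    | of_succ k hk ih =>
      intro t ht
      have h1 := intervalIntegral.norm_integral_le_of_norm_le_const (a := a) (b := t) (f := Y k)
        (C := 2 * (c ^ (n - (k + 1)) * S)) fun s hs => by
          rw [uIoc_of_le ht.1] at hs
          exact hstep k hk ih s ⟨hs.1.le, hs.2.trans ht.2⟩
      rw [Real.norm_eq_abs, abs_of_nonneg (sub_nonneg.2 ht.1)] at h1
      have e : n - k = (n - (k + 1)) + 1 := by omega
      rw [e, pow_succ]
      have h2 : 0 ≤ c ^ (n - (k + 1)) * S := by positivity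
      nlinarith [ht.2]
  have h1 := hstep k hk (key (k + 1) hk) t ht
  refine h1.trans ?_
  have h2 : 2 * c ^ (n - (k + 1)) ≤ c ^ n := by
    calc 2 * c ^ (n - (k + 1)) ≤ c * c ^ (n - (k + 1)) := by gcongr; linarith
      _ = c ^ (n - (k + 1) + 1) := by ring
      _ ≤ c ^ n := pow_le_pow_right₀ hc1 (by omega)
  nlinarith

theorem of_contDiff {y : ℝ → ℝ} (hy : ContDiff ℝ n y) : IsGlobalJet n fun k => iteratedDeriv k y := by
  refine ⟨LocBounded.of_continuous (hy.continuous_iteratedDeriv n le_rfl), fun k hk s t => ?_⟩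
  have hd : ∀ r, HasDerivAt (iteratedDeriv k y) (iteratedDeriv (k + 1) y r) r := fun r => by
    rw [iteratedDeriv_succ]
    exact ((hy.differentiable_iteratedDeriv k (by exact_mod_cast hk)) r).hasDerivAt
  rw [intervalIntegral.integral_eq_sub_of_hasDerivAt (fun r _ => hd r)
    ((hy.continuous_iteratedDeriv (k + 1) (by exact_mod_cast hk)).intervalIntegrable _ _)]
  ring

end IsGlobalJet

namespace System

variable {n : ℕ} (P : System n) {Y Z : ℕ → ℝ → ℝ}

theorem zero_mem_window : (0 : ℝ) ∈ P.window :=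
  ⟨by linarith [P.tau_pos 1], (P.tau_pos 0).le⟩

theorem window_le : -P.tau 1 ≤ P.tau 0 := by linarith [P.tau_pos 0, P.tau_pos 1]

theorem left_mem_window : -P.tau 1 ∈ P.window := left_mem_Icc.2 P.window_le

theorem right_mem_window : P.tau 0 ∈ P.window := right_mem_Icc.2 P.window_le

theorem _root_.HyperbolicPDEODE.IsGlobalJet.isJet (hY : IsGlobalJet n Y) : P.IsJet Y := by
  refine ⟨hY.top.1.indicator measurableSet_Icc, ?_, fun k hk τ _ => hY.deriv k hk _ _⟩
  obtain ⟨B, hB⟩ := hY.top.2 (max |-P.tau 1| |P.tau 0|)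
  exact ⟨B, fun τ hτ => hB τ (abs_le_max_abs_abs hτ.1 hτ.2)⟩

variable {P}

/-- Integration does not see null sets, so almost everywhere equality of the top derivatives yields
equality everywhere below order `n`. At order `n` itself nothing can be gained, hence the exception
`k = n`. -/
theorem IsJet.congr (hY : P.IsJet Y) (hZ : P.IsJet Z) (hη : ∀ k < n, Y k (-P.tau 1) = Z k (-P.tau 1))
    {k : ℕ} (hk : k ≤ n) (hv : ∀ᵐ τ, τ ∈ P.window → Y n τ = Z n τ) :
    k = n ∨ ∀ τ ∈ P.window, Y k τ = Z k τ := by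
  have key : ∀ k (_ : k ≤ n), (∀ᵐ τ, τ ∈ P.window → Y k τ = Z k τ) ∧
      (k = n ∨ ∀ τ ∈ P.window, Y k τ = Z k τ) := by
    intro k hk
    induction hk using Nat.decreasingInduction with
    | self => exact ⟨hv, Or.inl rfl⟩
    | of_succ k hk ih =>
      have h1 : ∀ τ ∈ P.window, Y k τ = Z k τ := fun τ hτ => by
        rw [hY.deriv k hk τ hτ, hZ.deriv k hk τ hτ, hη k hk]
        congr 1
        refine intervalIntegral.integral_congr_ae ?_
        filter_upwards [ih.1] with σ hσ h
        rw [uIoc_of_le hτ.1] at h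
        exact hσ ⟨h.1.le, h.2.trans hτ.2⟩
      exact ⟨Filter.Eventually.of_forall h1, Or.inr h1⟩
  exact (key k hk).2

/-- The top derivative is extended by zero outside the window and integrated back from the left end.
All later analysis can then work with jets on `ℝ`. -/
theorem IsJet.exists_global (hY : P.IsJet Y) :
    ∃ Z, IsGlobalJet n Z ∧ ∀ k ≤ n, ∀ τ ∈ P.window, Y k τ = Z k τ := by
  have hv : LocBounded (P.window.indicator (Y n)) := by
    refine ⟨hY.measurable, fun T => ?_⟩
    obtain ⟨B, hB⟩ := hY.bounded
    refine ⟨B, fun t _ => ?_⟩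
    by_cases h : t ∈ P.window
    · rw [indicator_of_mem h]; exact hB t h
    · rw [indicator_of_notMem h, abs_zero]
      exact (abs_nonneg _).trans (hB _ P.zero_mem_window)
  obtain ⟨Z, hZ, hZn, hZa⟩ := IsGlobalJet.exists_of_base (fun k : Fin n => Y k (-P.tau 1)) hv
    (-P.tau 1)
  have htop : ∀ τ ∈ P.window, Y n τ = Z n τ := fun τ hτ => by rw [hZn, indicator_of_mem hτ]
  refine ⟨Z, hZ, fun k hk τ hτ => ?_⟩
  rcases hY.congr (hZ.isJet P) (fun k hk => (hZa ⟨k, hk⟩).symm) hk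
    (Filter.Eventually.of_forall htop) with rfl | h
  · exact htop τ hτ
  · exact h τ hτ

end System

/-! ### The parametrization for jets on the real line -/

open Matrix in
theorem integral_mulVec {m n : ℕ} (M : Matrix (Fin m) (Fin n) ℝ) {f : ℝ → Fin n → ℝ} {a b : ℝ}
    (hf : ∀ j, IntervalIntegrable (fun r => f r j) volume a b) (i : Fin m) :
    ∫ r in a..b, (M *ᵥ f r) i = (M *ᵥ fun j => ∫ r in a..b, f r j) i := by
  simp only [mulVec, dotProduct]
  rw [intervalIntegral.integral_finsetSum fun j _ => (hf j).const_mul _]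
  simp only [intervalIntegral.integral_const_mul]

open Matrix in
theorem LocBounded.mulVec {m n : ℕ} (M : Matrix (Fin m) (Fin n) ℝ) {f : ℝ → Fin n → ℝ}
    (hf : ∀ j, LocBounded fun t => f t j) (i : Fin m) : LocBounded fun t => (M *ᵥ f t) i := by
  simp only [Matrix.mulVec, _root_.dotProduct]
  exact LocBounded.sum _ fun j _ => (hf j).const_mul _

theorem LocBounded.dotProduct {n : ℕ} (v : Fin n → ℝ) {f : ℝ → Fin n → ℝ}
    (hf : ∀ j, LocBounded fun t => f t j) : LocBounded fun t => v ⬝ᵥ f t :=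
  LocBounded.sum _ fun j _ => (hf j).const_mul _

theorem LocBounded.dotProduct_of_continuous {n : ℕ} (v : Fin n → ℝ) {f : ℝ → Fin n → ℝ}
    (hf : Continuous f) : LocBounded fun t => v ⬝ᵥ f t :=
  LocBounded.dotProduct v fun j => .of_continuous ((continuous_apply j).comp hf)

namespace System

variable {n : ℕ} (P : System n)

/-- The boundary values of the transformed distributed state at `z = 0`. -/
def pPar (Y : ℕ → ℝ → ℝ) (i : Fin 2) (τ : ℝ) : ℝ := ![P.p1Par Y τ, P.p2Par Y τ] i

theorem pPar_zero (Y : ℕ → ℝ → ℝ) (τ : ℝ) : P.pPar Y 0 τ = P.p1Par Y τ := rfl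

theorem pPar_one (Y : ℕ → ℝ → ℝ) (τ : ℝ) : P.pPar Y 1 τ = P.q0 * P.p1Par Y τ + P.c ⬝ᵥ P.xiPar Y τ :=
  rfl

section GlobalJet

variable {P} {Y Z : ℕ → ℝ → ℝ}

theorem continuous_xiPar (hY : IsGlobalJet n Y) : Continuous (P.xiPar Y) :=
  Continuous.matrix_mulVec continuous_const (continuous_pi fun i => hY.continuous i.2)

theorem locBounded_xiPar (hY : IsGlobalJet n Y) (i : Fin n) : LocBounded fun t => P.xiPar Y t i :=
  .of_continuous ((continuous_apply i).comp (continuous_xiPar hY))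

theorem locBounded_p1Par (hY : IsGlobalJet n Y) : LocBounded (P.p1Par Y) :=
  hY.top.sub (LocBounded.dotProduct _ fun j =>
    LocBounded.mulVec _ (fun i : Fin n => hY.locBounded i.2.le) j)

theorem locBounded_pPar (hY : IsGlobalJet n Y) (i : Fin 2) : LocBounded (P.pPar Y i) := by
  fin_cases i
  · exact locBounded_p1Par hY
  · exact ((locBounded_p1Par hY).const_mul _).add (LocBounded.dotProduct _ (locBounded_xiPar hY))

theorem xiPar_eq_integral (hu : IsUnit P.kalman.det) (hY : IsGlobalJet n Y) (s t : ℝ) (i : Fin n) :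
    P.xiPar Y t i = P.xiPar Y s i
      + ∫ r in s..t, ((P.F.mulVec (P.xiPar Y r)) i + P.b i * P.p1Par Y r) := by
  have e : ∀ r, (P.F.mulVec (P.xiPar Y r)) i + P.b i * P.p1Par Y r
      = (P.Tc⁻¹.mulVec fun k : Fin n => Y (k + 1) r) i := fun r => by
    rw [P.xiPar_succ hu, Pi.add_apply, Pi.smul_apply, smul_eq_mul, mul_comm]
  simp only [e]
  rw [integral_mulVec _ fun j : Fin n => (hY.locBounded j.2).intervalIntegrable s t, ← Pi.add_apply,
    xiPar, xiPar, ← Matrix.mulVec_add]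
  congr 2
  funext k
  exact hY.deriv k k.2 s t

/-- In the chain `h F^k ξ` the input drops out for `k < n - 1` and enters with coefficient one at `k
= n - 1`, because `T_c b` is the last unit vector. Each member is therefore the integral of the next
one. -/
theorem isGlobalJet_flatJet (hu : IsUnit P.kalman.det) {ξ : ℝ → Fin n → ℝ} {x₁ : ℝ → ℝ}
    (hξ : Continuous ξ) (hx : LocBounded x₁)
    (h : ∀ s t i, ξ t i = ξ s i + ∫ r in s..t, ((P.F.mulVec (ξ r)) i + P.b i * x₁ r)) :
    IsGlobalJet n (P.flatJet ξ x₁) := by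
  have hξb : ∀ j, LocBounded fun t => ξ t j := fun j =>
    .of_continuous ((continuous_apply j).comp hξ)
  refine ⟨?_, fun k hk s t => ?_⟩
  · have : P.flatJet ξ x₁ n = fun t =>
        x₁ t + eLast n ⬝ᵥ (P.Tc * P.F * P.Tc⁻¹).mulVec (P.Tc.mulVec (ξ t)) := by
      funext t; simp [flatJet]
    rw [this]
    exact hx.add (LocBounded.dotProduct _ (LocBounded.mulVec _ (LocBounded.mulVec _ hξb)))
  · have e1 : ∀ t, P.flatJet ξ x₁ k t = P.Tc.mulVec (ξ t) ⟨k, hk⟩ := fun t =>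
      congrFun (P.flatJet_lt ξ x₁ t) ⟨k, hk⟩
    have e2 : ∀ t, P.flatJet ξ x₁ (k + 1) t
        = P.Tc.mulVec (fun i => P.F.mulVec (ξ t) i + P.b i * x₁ t) ⟨k, hk⟩ := fun t => by
      have := congrFun (P.flatJet_succ hu ξ x₁ t) ⟨k, hk⟩
      simp only at this
      rw [this]
      congr 2
      funext i
      simp [mul_comm]
    have hI : ∀ j, LocBounded fun r => (P.F.mulVec (ξ r)) j + P.b j * x₁ r := fun j =>
      (LocBounded.mulVec _ hξb j).add (hx.const_mul _)
    simp only [e1, e2]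
    rw [integral_mulVec _ fun j => (hI j).intervalIntegrable s t, ← Pi.add_apply,
      ← Matrix.mulVec_add]
    congr 2
    funext i
    exact h s t i

end GlobalJet

variable {P} in
theorem xiPar_congr {Y Z : ℕ → ℝ → ℝ} {τ : ℝ} (h : ∀ k < n, Y k τ = Z k τ) :
    P.xiPar Y τ = P.xiPar Z τ := by
  unfold xiPar; congr 1; funext i; exact h i i.2

variable {P} in
theorem p1Par_congr {Y Z : ℕ → ℝ → ℝ} {τ : ℝ} (h : ∀ k ≤ n, Y k τ = Z k τ) :
    P.p1Par Y τ = P.p1Par Z τ := by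
  have : (fun i : Fin n => Y i τ) = fun i : Fin n => Z i τ := funext fun i => h i i.2.le
  rw [p1Par, p1Par, this, h n le_rfl]

variable {P} in
theorem pPar_congr {Y Z : ℕ → ℝ → ℝ} {τ : ℝ} (h : ∀ k ≤ n, Y k τ = Z k τ) (i : Fin 2) :
    P.pPar Y i τ = P.pPar Z i τ := by
  fin_cases i
  · exact p1Par_congr h
  · simp only [pPar, p2Par, p1Par_congr h, xiPar_congr fun k hk => h k hk.le]

theorem xiPar_sub (Y Z : ℕ → ℝ → ℝ) (τ : ℝ) :
    P.xiPar (fun k t => Y k t - Z k t) τ = P.xiPar Y τ - P.xiPar Z τ := by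
  rw [xiPar, xiPar, xiPar, ← Matrix.mulVec_sub]; rfl

theorem p1Par_sub (Y Z : ℕ → ℝ → ℝ) (τ : ℝ) :
    P.p1Par (fun k t => Y k t - Z k t) τ = P.p1Par Y τ - P.p1Par Z τ := by
  have : (fun i : Fin n => Y i τ - Z i τ) = (fun i : Fin n => Y i τ) - fun i : Fin n => Z i τ := rfl
  rw [p1Par, p1Par, p1Par, this, Matrix.mulVec_sub, dotProduct_sub]; ring

theorem pPar_sub (Y Z : ℕ → ℝ → ℝ) (i : Fin 2) (τ : ℝ) :
    P.pPar (fun k t => Y k t - Z k t) i τ = P.pPar Y i τ - P.pPar Z i τ := by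
  fin_cases i
  · exact P.p1Par_sub Y Z τ
  · simp only [pPar, p2Par, p1Par_sub, xiPar_sub, dotProduct_sub]
    simp
    ring

variable (K : ℝ → ℝ → Matrix (Fin 2) (Fin 2) ℝ)

/-- The coefficient of the distributed delays in the parametrization, in the time scale of the
transport. -/
def delayCoeff (i : Fin 2) (σ : ℝ) : ℝ := -(kerE K (P.phiInv i σ) 0 i 1 * P.lamE 1 0)

variable {K} in
theorem continuous_delayCoeff (hK : P.IsKernel K) (i : Fin 2) : Continuous (P.delayCoeff K i) := by
  have := (continuous_kerE hK.continuous i 1).comp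
    ((P.travelTime i).continuous_inv.prodMk (continuous_const (y := (0 : ℝ))))
  exact (this.mul continuous_const).neg

open Matrix in
theorem C_mulVec {z : ℝ} (hz : z ∈ Icc (0 : ℝ) 1) (v : Fin n → ℝ) (i : Fin 2) :
    (P.C K z *ᵥ v) i = P.delayCoeff K i (P.phiE i z) * (P.c ⬝ᵥ v) := by
  have h1 : kerE K z 0 = K z 0 := kerE_of_mem K ⟨le_rfl, hz.1, hz.2⟩
  have h2 : P.lamE 1 0 = P.lam 1 0 := P.lamE_of_mem 1 (left_mem_Icc.2 zero_le_one)
  rw [delayCoeff, P.phiInv_phiE, h1, h2, C, vecMulVec_mulVec]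
  fin_cases i <;> simp [Lam, dotProduct]

/-- In the travel time of component `i` the two delay integrals take the same form up to `sgn i`, so
prediction and delay can be treated together. -/
theorem xPar_eq (Y : ℕ → ℝ → ℝ) (i : Fin 2) {z : ℝ} (hz : z ∈ Icc (0 : ℝ) 1) :
    P.xPar K Y i z = P.pPar Y i (sgn i * P.phiE i z) - sgn i * ∫ σ in (0 : ℝ)..(P.phiE i z),
      P.delayCoeff K i σ * (P.c ⬝ᵥ P.xiPar Y (sgn i * (P.phiE i z - σ))) := by
  rw [(P.travelTime i).integral_zero_eq]
  have e : ∀ ζ ∈ uIcc 0 z, ζ ∈ Icc (0 : ℝ) 1 := fun ζ hζ => by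
    rw [uIcc_of_le hz.1] at hζ; exact ⟨hζ.1, hζ.2.trans hz.2⟩
  have key : ∀ ζ ∈ uIcc 0 z, P.delayCoeff K i (P.phiE i ζ) *
      (P.c ⬝ᵥ P.xiPar Y (sgn i * (P.phiE i z - P.phiE i ζ))) / P.lamE i ζ
      = ((P.C K ζ).mulVec (P.xiPar Y (sgn i * (P.phiE i z - P.phiE i ζ)))) i / P.lam i ζ :=
    fun ζ hζ => by rw [P.C_mulVec K (e ζ hζ), P.lamE_of_mem i (e ζ hζ)]
  rw [intervalIntegral.integral_congr key, P.phiE_of_mem i hz]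
  have key2 : ∀ ζ ∈ uIcc 0 z,
      ((P.C K ζ).mulVec (P.xiPar Y (sgn i * (P.phi i z - P.phiE i ζ)))) i / P.lam i ζ
      = ((P.C K ζ).mulVec (P.xiPar Y (sgn i * (P.phi i z - P.phi i ζ)))) i / P.lam i ζ :=
    fun ζ hζ => by rw [P.phiE_of_mem i (e ζ hζ)]
  rw [intervalIntegral.integral_congr key2]
  fin_cases i
  · simp [xPar, pPar, sgn]
  · simp [xPar, pPar, sgn, neg_add_eq_sub]

/-- The points of the window that determine the component `i`. -/
theorem sgn_mul_mem_window (i : Fin 2) {σ : ℝ} (hσ : σ ∈ Icc 0 (P.tau i)) :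
    sgn i * σ ∈ P.window := by
  have h0 := P.tau_pos 0
  have h1 := P.tau_pos 1
  obtain ⟨h2, h3⟩ := hσ
  fin_cases i
  · simp [sgn, window] at h3 ⊢; constructor <;> linarith
  · simp [sgn, window] at h3 ⊢; constructor <;> linarith

variable {P} in
theorem xPar_congr {Y Z : ℕ → ℝ → ℝ} (h : ∀ k ≤ n, ∀ τ ∈ P.window, Y k τ = Z k τ) (i : Fin 2)
    {z : ℝ} (hz : z ∈ Icc (0 : ℝ) 1) : P.xPar K Y i z = P.xPar K Z i z := by
  rw [P.xPar_eq K Y i hz, P.xPar_eq K Z i hz]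
  have hφ := P.phiE_mem_Icc i hz
  rw [pPar_congr (fun k hk => h k hk _ (P.sgn_mul_mem_window i hφ)) i]
  congr 2
  refine intervalIntegral.integral_congr fun σ hσ => ?_
  rw [uIcc_of_le hφ.1] at hσ
  rw [xiPar_congr fun k hk => h k hk.le _ (P.sgn_mul_mem_window i
    ⟨sub_nonneg.2 hσ.2, by linarith [hσ.1, hφ.2]⟩)]

variable {P} in
theorem uPar_congr {Y Z : ℕ → ℝ → ℝ} (h : ∀ k ≤ n, ∀ τ ∈ P.window, Y k τ = Z k τ) :
    P.uPar K Y = P.uPar K Z := by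
  rw [uPar, uPar, xPar_congr K h 0 (right_mem_Icc.2 zero_le_one),
    xPar_congr K h 1 (right_mem_Icc.2 zero_le_one)]

variable {P K} in
theorem xPar_sub (hK : P.IsKernel K) {Y Z : ℕ → ℝ → ℝ} (hY : IsGlobalJet n Y) (hZ : IsGlobalJet n Z)
    (i : Fin 2) {z : ℝ} (hz : z ∈ Icc (0 : ℝ) 1) :
    P.xPar K (fun k t => Y k t - Z k t) i z = P.xPar K Y i z - P.xPar K Z i z := by
  have hc : ∀ {Y}, IsGlobalJet n Y → IntervalIntegrable (fun σ => P.delayCoeff K i σ *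
      (P.c ⬝ᵥ P.xiPar Y (sgn i * (P.phiE i z - σ)))) volume 0 (P.phiE i z) := fun {Y} hY => by
    have h1 : Continuous fun σ => P.c ⬝ᵥ P.xiPar Y (sgn i * (P.phiE i z - σ)) :=
      Continuous.dotProduct continuous_const
        ((continuous_xiPar hY).comp (by fun_prop))
    exact ((P.continuous_delayCoeff hK i).mul h1).intervalIntegrable _ _
  rw [P.xPar_eq K _ i hz, P.xPar_eq K _ i hz, P.xPar_eq K _ i hz, pPar_sub]
  simp only [xiPar_sub, dotProduct_sub, mul_sub]
  rw [intervalIntegral.integral_sub]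
  · ring
  · simpa only [mul_sub] using hc hY
  · simpa only [mul_sub] using hc hZ

end System

/-! ### Coefficients of the canonical form -/

/-- Functionals of a jet that depend on the initial values at `a` of the derivatives of lower order
and on the derivative of highest order on `[a, b]`, with a continuous density. -/
def IsRepresentable (n : ℕ) (a b : ℝ) (L : (ℕ → ℝ → ℝ) → ℝ) : Prop :=
  ∃ (α : Fin n → ℝ) (d : ℝ → ℝ), Continuous d ∧ ∀ Y, IsGlobalJet n Y →
    L Y = (∑ i : Fin n, α i * Y i a) + ∫ τ in a..b, d τ * Y n τ

namespace IsRepresentable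

variable {n : ℕ} {a b : ℝ} {L M : (ℕ → ℝ → ℝ) → ℝ}

theorem congr (hL : IsRepresentable n a b L) (h : ∀ Y, IsGlobalJet n Y → M Y = L Y) :
    IsRepresentable n a b M := by
  obtain ⟨α, d, hd, hα⟩ := hL
  exact ⟨α, d, hd, fun Y hY => (h Y hY).trans (hα Y hY)⟩

theorem add (hL : IsRepresentable n a b L) (hM : IsRepresentable n a b M) :
    IsRepresentable n a b fun Y => L Y + M Y := by
  obtain ⟨α, d, hd, hα⟩ := hL
  obtain ⟨β, e, he, hβ⟩ := hM
  refine ⟨fun i => α i + β i, fun τ => d τ + e τ, hd.add he, fun Y hY => ?_⟩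
  simp only [add_mul, Finset.sum_add_distrib]
  rw [intervalIntegral.integral_add
    (((LocBounded.of_continuous hd).mul hY.top).intervalIntegrable _ _)
    (((LocBounded.of_continuous he).mul hY.top).intervalIntegrable _ _), hα Y hY, hβ Y hY]
  ring

theorem const_mul (hL : IsRepresentable n a b L) (c : ℝ) :
    IsRepresentable n a b fun Y => c * L Y := by
  obtain ⟨α, d, hd, hα⟩ := hL
  refine ⟨fun i => c * α i, fun τ => c * d τ, continuous_const.mul hd, fun Y hY => ?_⟩
  simp only [mul_assoc, ← Finset.mul_sum, intervalIntegral.integral_const_mul]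
  rw [hα Y hY]
  ring

theorem sum {ι : Type*} {L : ι → (ℕ → ℝ → ℝ) → ℝ} (s : Finset ι)
    (hL : ∀ i ∈ s, IsRepresentable n a b (L i)) : IsRepresentable n a b fun Y => ∑ i ∈ s, L i Y := by
  classical
  induction s using Finset.induction_on with
  | empty => exact ⟨0, 0, continuous_const, fun Y _ => by simp⟩
  | insert j s hj ih =>
    simp only [Finset.sum_insert hj]
    exact (hL j (Finset.mem_insert_self j s)).add
      (ih fun i hi => hL i (Finset.mem_insert_of_mem hi))

theorem initial (i : Fin n) : IsRepresentable n a b fun Y => Y i a :=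
  ⟨Pi.single i 1, 0, continuous_const, fun Y _ => by simp [Pi.single_apply]⟩

/-- Integration by parts gives `∫ k Yᵢ = (∫ k) Yᵢ(a) + ∫ (∫_σ^b k) Yᵢ₊₁`. The new density is
continuous even if `k` is only locally bounded, which is why delays over a part of the window still
contribute a continuous coefficient function. -/
theorem integral_by_parts (hab : a ≤ b) {k : ℝ → ℝ} (hk : LocBounded k) {i : ℕ} (hi : i < n)
    (h : ∀ d, Continuous d → IsRepresentable n a b fun Y => ∫ τ in a..b, d τ * Y (i + 1) τ) :
    IsRepresentable n a b fun Y => ∫ τ in a..b, k τ * Y i τ := by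
  have hd : Continuous fun σ => ∫ τ in σ..b, k τ := by
    have : (fun σ => ∫ τ in σ..b, k τ) = fun σ => -∫ τ in b..σ, k τ :=
      funext fun σ => intervalIntegral.integral_symm _ _
    rw [this]
    exact (hk.continuous_primitive b).neg
  refine (((initial ⟨i, hi⟩).const_mul (∫ τ in a..b, k τ)).add (h _ hd)).congr fun Y hY => ?_
  have hi1 := hY.locBounded (k := i + 1) hi
  have hi0 := hY.locBounded (k := i) hi.le
  have := mul_sub_mul_eq_integral (F := Y i) (G := fun σ => ∫ τ in σ..b, k τ) (f := Y (i + 1))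
    (g := fun τ => -k τ) hab (hi1.intervalIntegrable a b) (hk.neg.intervalIntegrable a b)
    (fun r _ => hY.deriv i hi a r) (fun r _ => by
      rw [intervalIntegral.integral_neg, ← intervalIntegral.integral_add_adjacent_intervals
        (hk.intervalIntegrable a r) (hk.intervalIntegrable r b)]
      ring)
  rw [intervalIntegral.integral_add
    ((hi1.mul (.of_continuous hd)).intervalIntegrable _ _)
    ((hi0.mul hk.neg).intervalIntegrable _ _)] at this
  simp only [intervalIntegral.integral_same, mul_neg, intervalIntegral.integral_neg] at this
  simp only [mul_comm (Y _ _)] at this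
  linarith

theorem integral_continuous (hab : a ≤ b) {i : ℕ} (hi : i ≤ n) :
    ∀ d, Continuous d → IsRepresentable n a b fun Y => ∫ τ in a..b, d τ * Y i τ := by
  induction hi using Nat.decreasingInduction with
  | self => exact fun d hd => ⟨0, d, hd, fun Y _ => by simp⟩
  | of_succ i hi ih => exact fun d hd => integral_by_parts hab (.of_continuous hd) hi ih

theorem integral (hab : a ≤ b) {k : ℝ → ℝ} (hk : LocBounded k) {i : ℕ} (hi : i < n) :
    IsRepresentable n a b fun Y => ∫ τ in a..b, k τ * Y i τ :=
  integral_by_parts hab hk hi (integral_continuous hab hi)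

theorem integral_subinterval (hab : a ≤ b) {k : ℝ → ℝ} (hk : LocBounded k) {i : ℕ} (hi : i < n)
    {c d : ℝ} (hac : a ≤ c) (hcd : c ≤ d) (hdb : d ≤ b) :
    IsRepresentable n a b fun Y => ∫ τ in c..d, k τ * Y i τ := by
  refine (integral hab (hk.indicator (measurableSet_Ioc (a := c) (b := d))) hi).congr fun Y _ => ?_
  rw [intervalIntegral.integral_of_le hab, intervalIntegral.integral_of_le hcd]
  have e : (fun τ => (Ioc c d).indicator k τ * Y i τ) = (Ioc c d).indicator fun τ => k τ * Y i τ :=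
    funext fun τ => (indicator_mul_left (Ioc c d) k (Y i)).symm
  rw [e, setIntegral_indicator measurableSet_Ioc, inter_eq_right.2 (Ioc_subset_Ioc hac hdb)]

theorem final (hab : a ≤ b) (i : Fin n) : IsRepresentable n a b fun Y => Y i b := by
  refine ((initial i).add (integral_continuous hab (i := i + 1) i.2 1 continuous_const)).congr
    fun Y hY => ?_
  simpa using hY.deriv i i.2 a b

theorem dotProduct_mulVec (v : Fin n → ℝ) (M : Matrix (Fin n) (Fin n) ℝ) {t : ℝ}
    (h : ∀ i : Fin n, IsRepresentable n a b fun Y => Y i t) :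
    IsRepresentable n a b fun Y => v ⬝ᵥ M.mulVec (fun i : Fin n => Y i t) := by
  simp only [Matrix.mulVec, dotProduct]
  exact sum _ fun i _ => (sum _ fun j _ => (h j).const_mul _).const_mul _

end IsRepresentable

namespace System

variable {n : ℕ} {P : System n} {K : ℝ → ℝ → Matrix (Fin 2) (Fin 2) ℝ}

theorem isRepresentable_delay (hK : P.IsKernel K) (i : Fin 2) :
    IsRepresentable n (-P.tau 1) (P.tau 0) fun Y => ∫ σ in (0 : ℝ)..(P.tau i),
      P.delayCoeff K i σ * (P.c ⬝ᵥ P.xiPar Y (sgn i * (P.tau i - σ))) := by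
  have ht : ∀ j, 0 < P.tau j := P.tau_pos
  have hd := LocBounded.of_continuous (P.continuous_delayCoeff hK i)
  let w : Fin n → ℝ := Matrix.vecMul P.c P.Tc⁻¹
  have key : ∀ j : Fin n, IsRepresentable n (-P.tau 1) (P.tau 0) fun Y =>
      ∫ σ in (0 : ℝ)..(P.tau i), P.delayCoeff K i σ * Y j (sgn i * (P.tau i - σ)) := by
    intro j
    fin_cases i
    · refine (IsRepresentable.integral_subinterval P.window_le (k := fun τ =>
        P.delayCoeff K 0 (P.tau 0 - τ)) (hd.comp_continuous (by fun_prop)) j.2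
        (by linarith [ht 1]) (ht 0).le le_rfl).congr fun Y _ => ?_
      have := intervalIntegral.integral_comp_sub_left (a := 0) (b := P.tau 0)
        (fun τ => P.delayCoeff K 0 (P.tau 0 - τ) * Y j τ) (P.tau 0)
      simpa [sgn] using this
    · refine (IsRepresentable.integral_subinterval P.window_le (k := fun τ =>
        P.delayCoeff K 1 (P.tau 1 + τ)) (hd.comp_continuous (by fun_prop)) j.2
        le_rfl (by linarith [ht 1]) (ht 0).le).congr fun Y _ => ?_
      have := intervalIntegral.integral_comp_sub_right (a := 0) (b := P.tau 1)
        (fun τ => P.delayCoeff K 1 (P.tau 1 + τ) * Y j τ) (P.tau 1)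
      simpa [sgn] using this
  refine (IsRepresentable.sum Finset.univ fun j _ => (key j).const_mul (w j)).congr fun Y hY => ?_
  have e : ∀ τ, P.c ⬝ᵥ P.xiPar Y τ = ∑ j : Fin n, w j * Y j τ := fun τ => by
    rw [xiPar, Matrix.dotProduct_mulVec]; rfl
  simp only [e, Finset.mul_sum]
  rw [intervalIntegral.integral_finsetSum]
  · refine Finset.sum_congr rfl fun j _ => ?_
    rw [← intervalIntegral.integral_const_mul]
    congr 1
    funext σ
    ring
  · intro j _
    exact (hd.mul (((hY.locBounded j.2.le).comp_continuous (g := fun σ => sgn i * (P.tau i - σ))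
      (by fun_prop)).const_mul (w j))).intervalIntegrable _ _

theorem exists_isHCCFCoeff (hK : P.IsKernel K) : ∃ a aD, P.IsHCCFCoeff K a aD := by
  have hw := P.window_le
  -- Only the point values of `y⁽ⁿ⁾` at the two ends of the window have no continuous density. They
  -- are split off; the one at `-τ₂` has the coefficient `-q̄₁ q₀`, which becomes `aₙ`.
  obtain ⟨α, d, hd, hα⟩ : IsRepresentable n (-P.tau 1) (P.tau 0) fun Y =>
      P.uPar K Y - Y n (P.tau 0) + P.qbar1 * P.q0 * Y n (-P.tau 1) := by
    have h1 := IsRepresentable.dotProduct_mulVec (eLast n) (P.Tc * P.F * P.Tc⁻¹)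
      (IsRepresentable.final hw)
    have h2 := IsRepresentable.dotProduct_mulVec (eLast n) (P.Tc * P.F * P.Tc⁻¹)
      (IsRepresentable.initial (a := -P.tau 1) (b := P.tau 0))
    have h3 := IsRepresentable.dotProduct_mulVec P.c P.Tc⁻¹
      (IsRepresentable.initial (a := -P.tau 1) (b := P.tau 0))
    refine ((((h1.add (isRepresentable_delay hK 0)).const_mul (-1)).add
      ((h2.const_mul (P.qbar1 * P.q0)).add (h3.const_mul (-P.qbar1)))).add
      ((isRepresentable_delay hK 1).const_mul (-P.qbar1))).congr fun Y _ => ?_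
    rw [uPar, P.xPar_eq K Y 0 (right_mem_Icc.2 zero_le_one),
      P.xPar_eq K Y 1 (right_mem_Icc.2 zero_le_one), ← P.tau_eq, ← P.tau_eq, pPar_zero, pPar_one,
      p1Par, p1Par, xiPar]
    simp only [sgn, Matrix.cons_val_zero, Matrix.cons_val_one, one_mul, neg_mul]
    ring
  refine ⟨Fin.snoc (α := fun _ => ℝ) α (-(P.qbar1 * P.q0)), d, hd.continuousOn, fun Y hY => ?_⟩
  obtain ⟨Z, hZ, hYZ⟩ := hY.exists_global
  have h1 := hα Z hZ
  rw [uPar_congr K hYZ, hYZ n le_rfl _ P.right_mem_window, hccfFunctional,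
    hYZ n le_rfl _ P.left_mem_window]
  simp only [Fin.snoc_last, Fin.snoc_castSucc]
  have e1 : ∑ i : Fin n, α i * Y i (-P.tau 1) = ∑ i : Fin n, α i * Z i (-P.tau 1) :=
    Finset.sum_congr rfl fun i _ => by rw [hYZ i i.2.le _ P.left_mem_window]
  have e2 : ∫ τ in (-P.tau 1)..(P.tau 0), d τ * Y n τ
      = ∫ τ in (-P.tau 1)..(P.tau 0), d τ * Z n τ := by
    refine intervalIntegral.integral_congr fun τ hτ => ?_
    rw [uIcc_of_le hw] at hτ
    simp only [hYZ n le_rfl τ hτ]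
  rw [e1, e2]
  linarith

end System

/-! ### From a state to a trajectory segment -/

theorem exists_mulVec_bound {m n : ℕ} (M : Matrix (Fin m) (Fin n) ℝ) :
    ∃ C ≥ 0, ∀ v i, |M.mulVec v i| ≤ C * ‖v‖ := by
  refine ⟨‖LinearMap.toContinuousLinearMap M.mulVecLin‖, norm_nonneg _, fun v i => ?_⟩
  exact (norm_le_pi_norm (M.mulVec v) i).trans
    ((LinearMap.toContinuousLinearMap M.mulVecLin).le_opNorm v)

theorem exists_dotProduct_bound {n : ℕ} (w : Fin n → ℝ) : ∃ C ≥ 0, ∀ v, |w ⬝ᵥ v| ≤ C * ‖v‖ := by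
  refine ⟨∑ i, |w i|, by positivity, fun v => ?_⟩
  rw [dotProduct, Finset.sum_mul]
  refine (Finset.abs_sum_le_sum_abs _ _).trans (Finset.sum_le_sum fun i _ => ?_)
  rw [abs_mul]
  exact mul_le_mul_of_nonneg_left (norm_le_pi_norm v i) (abs_nonneg _)

/-- Linear differential equations with a distributed delay term in the input. -/
theorem exists_ode_with_memory {n : ℕ} (F : Matrix (Fin n) (Fin n) ℝ) (b w ξ₀ : Fin n → ℝ)
    {d r : ℝ → ℝ} (hd : Continuous d) {M : ℝ} (hM : ∀ ρ, |d ρ| ≤ M) (hr : LocBounded r) :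
    ∃ ξ : ℝ → Fin n → ℝ, Continuous ξ ∧ ∀ t ≥ 0, ∀ i, ξ t i = ξ₀ i + ∫ s in (0 : ℝ)..t,
      (F.mulVec (ξ s) i + b i * (r s + ∫ ρ in (0 : ℝ)..s, d (s - ρ) * (w ⬝ᵥ ξ ρ))) := by
  obtain ⟨β, hβm, hβ0, hβ⟩ := exists_monotone_bound (ι := Unit) (f := fun _ => r)
    fun T => (hr.bounded T).imp fun B hB _ t ht => hB t ht
  obtain ⟨CF, hCF0, hCF⟩ := exists_mulVec_bound F
  obtain ⟨Cw, hCw0, hCw⟩ := exists_dotProduct_bound w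
  have hM0 : 0 ≤ M := (abs_nonneg _).trans (hM 0)
  have hbn : ∀ i, |b i| ≤ ‖b‖ := norm_le_pi_norm b
  -- The outer integration supplies the gain `1 / L`. For the memory integral inside it, `L ≥ 1`
  -- suffices, since no second gain is needed.
  let L : ℝ := 2 * (CF + ‖b‖ * M * Cw) + 1
  have hq0 : 0 ≤ CF + ‖b‖ * M * Cw := by positivity
  have hL1 : 1 ≤ L := by simp only [L]; linarith
  have hL : 0 < L := by linarith
  let W : ℝ → ℝ := fun t => β (max t 0) * Real.exp (L * max t 0)
  have hW : ∀ t, 0 < W t := fun t => mul_pos (hβ0 _) (Real.exp_pos _)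
  let G : (ℝ → Fin n → ℝ) → ℝ → Fin n → ℝ := fun ξ s i =>
    F.mulVec (ξ s) i + b i * (r s + ∫ ρ in (0 : ℝ)..s, d (s - ρ) * (w ⬝ᵥ ξ ρ))
  let Φ : (ℝ → Fin n → ℝ) → ℝ → Fin n → ℝ := fun ξ t i =>
    ξ₀ i + ∫ s in (0 : ℝ)..(max t 0), G ξ s i
  have hmem : ∀ ξ, Continuous ξ → Continuous fun s => ∫ ρ in (0 : ℝ)..s, d (s - ρ) * (w ⬝ᵥ ξ ρ) := by
    intro ξ hξ
    refine intervalIntegral.continuous_parametric_intervalIntegral_of_continuous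
      (f := fun s ρ => d (s - ρ) * (w ⬝ᵥ ξ ρ)) ?_ continuous_id
    exact (hd.comp (continuous_fst.sub continuous_snd)).mul
      (Continuous.dotProduct continuous_const (hξ.comp continuous_snd))
  have hG : ∀ ξ, Continuous ξ → ∀ i, LocBounded fun s => G ξ s i := fun ξ hξ i =>
    (LocBounded.mulVec F (fun j => .of_continuous ((continuous_apply j).comp hξ)) i).add
      ((hr.add (.of_continuous (hmem ξ hξ))).const_mul _)
  have hexp : ∀ {B t : ℝ}, 0 ≤ B → 0 ≤ t → ∀ g : ℝ → ℝ,
      (∀ s ∈ Icc 0 t, |g s| ≤ (CF + ‖b‖ * M * Cw) * (B * β t) * Real.exp (L * s)) →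
      |∫ s in (0 : ℝ)..t, g s| ≤ B / 2 * (β t * Real.exp (L * t)) := by
    intro B t hB ht g hg
    have hb0 := (hβ0 t).le
    refine (abs_integral_le_of_exp_bound hL ht (by positivity) hg).trans ?_
    have h1 : (CF + ‖b‖ * M * Cw) / L ≤ 1 / 2 := by
      rw [div_le_iff₀ hL]; simp only [L]; linarith
    calc (CF + ‖b‖ * M * Cw) * (B * β t) / L * Real.exp (L * t)
        = (CF + ‖b‖ * M * Cw) / L * (B * β t * Real.exp (L * t)) := by ring
      _ ≤ 1 / 2 * (B * β t * Real.exp (L * t)) := by gcongr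
      _ = _ := by ring
  obtain ⟨ξ, hξ, hfix⟩ := exists_fixedPoint_of_weighted_contraction W Continuous Φ
    (fun ξ hξ => continuous_pi fun i => continuous_const.add
      (((hG ξ hξ i).continuous_primitive 0).comp (continuous_id.max continuous_const)))
    (fun f g C hC hf hlim => by
      -- The weight is unbounded in time, so the iterates converge only locally uniformly; this is
      -- enough for continuity.
      refine TendstoLocallyUniformly.continuous (F := f) (p := Filter.atTop) ?_
        (Filter.Frequently.of_forall hf)
      rw [Metric.tendstoLocallyUniformly_iff]
      intro ε hε x
      have hlim0 : Filter.Tendsto (fun m : ℕ => C * (1 / 2) ^ m * W (x + 1)) Filter.atTop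
          (nhds 0) := by
        simpa using ((tendsto_pow_atTop_nhds_zero_of_lt_one (r := (1 / 2 : ℝ)) (by norm_num)
          (by norm_num)).const_mul C).mul_const (W (x + 1))
      refine ⟨Iio (x + 1), Iio_mem_nhds (by linarith), ?_⟩
      filter_upwards [hlim0.eventually_lt_const hε] with m hm q hq
      rw [dist_comm, dist_eq_norm]
      refine ((hlim m q).trans ?_).trans_lt hm
      have hmx : max q 0 ≤ max (x + 1) 0 := max_le_max (le_of_lt hq) le_rfl
      refine mul_le_mul_of_nonneg_left (mul_le_mul (hβm hmx) (Real.exp_le_exp.2 ?_)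
        (Real.exp_pos _).le (hβ0 _).le) (by positivity)
      exact mul_le_mul_of_nonneg_left hmx hL.le)
    (fun f g hf hg B hB hfg t => by
      have ht : 0 ≤ max t 0 := le_max_right _ _
      have hWs : ∀ s ∈ Icc 0 (max t 0), ‖f s - g s‖ ≤ B * β (max t 0) * Real.exp (L * s) := by
        intro s hs
        refine (hfg s).trans ?_
        simp only [W, max_eq_left hs.1]
        rw [mul_assoc]
        exact mul_le_mul_of_nonneg_left (mul_le_mul_of_nonneg_right (hβm hs.2) (Real.exp_pos _).le) hB
      rw [pi_norm_le_iff_of_nonneg (mul_nonneg (by linarith) (hW t).le)]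
      intro i
      have e1 : (Φ f t - Φ g t) i = ∫ s in (0 : ℝ)..(max t 0), (G f s i - G g s i) := by
        rw [intervalIntegral.integral_sub ((hG f hf i).intervalIntegrable _ _)
          ((hG g hg i).intervalIntegrable _ _)]
        simp only [Φ, Pi.sub_apply]
        ring
      rw [e1, Real.norm_eq_abs]
      refine hexp hB ht _ fun s hs => ?_
      have e2 : G f s i - G g s i = F.mulVec (f s - g s) i
          + b i * ∫ ρ in (0 : ℝ)..s, d (s - ρ) * (w ⬝ᵥ (f ρ - g ρ)) := by
        simp only [G, Matrix.mulVec_sub, dotProduct_sub, Pi.sub_apply]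
        have hcf : ∀ f : ℝ → Fin n → ℝ, Continuous f →
            IntervalIntegrable (fun ρ => d (s - ρ) * (w ⬝ᵥ f ρ)) volume 0 s := fun f hf =>
          ((hd.comp (continuous_const.sub continuous_id)).mul
            (Continuous.dotProduct continuous_const hf)).intervalIntegrable _ _
        have : ∀ ρ, d (s - ρ) * (w ⬝ᵥ f ρ - w ⬝ᵥ g ρ)
            = d (s - ρ) * (w ⬝ᵥ f ρ) - d (s - ρ) * (w ⬝ᵥ g ρ) := fun ρ => by ring
        simp only [this]
        rw [intervalIntegral.integral_sub (hcf f hf) (hcf g hg)]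
        ring
      rw [e2]
      have h1 : |F.mulVec (f s - g s) i| ≤ CF * (B * β (max t 0) * Real.exp (L * s)) :=
        (hCF _ i).trans (mul_le_mul_of_nonneg_left (hWs s hs) hCF0)
      have hb0 := (hβ0 (max t 0)).le
      have h2 : |∫ ρ in (0 : ℝ)..s, d (s - ρ) * (w ⬝ᵥ (f ρ - g ρ))|
          ≤ M * Cw * (B * β (max t 0)) / L * Real.exp (L * s) := by
        refine abs_integral_le_of_exp_bound hL hs.1 (by positivity) fun ρ hρ => ?_
        rw [abs_mul]
        calc _ ≤ M * (Cw * (B * β (max t 0) * Real.exp (L * ρ))) := by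
              refine mul_le_mul (hM _) ((hCw _).trans ?_) (abs_nonneg _) hM0
              exact mul_le_mul_of_nonneg_left (hWs ρ ⟨hρ.1, hρ.2.trans hs.2⟩) hCw0
          _ = _ := by ring
      have h3 : M * Cw * (B * β (max t 0)) / L ≤ M * Cw * (B * β (max t 0)) :=
        div_le_self (by positivity) hL1
      have h4 : |b i * ∫ ρ in (0 : ℝ)..s, d (s - ρ) * (w ⬝ᵥ (f ρ - g ρ))|
          ≤ ‖b‖ * (M * Cw * (B * β (max t 0)) * Real.exp (L * s)) := by
        rw [abs_mul]
        refine mul_le_mul (hbn i) (h2.trans ?_) (abs_nonneg _) (norm_nonneg _)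
        exact mul_le_mul_of_nonneg_right h3 (Real.exp_pos _).le
      refine (abs_add_le _ _).trans ((add_le_add h1 h4).trans (le_of_eq ?_))
      ring)
    (fun _ => 0) continuous_const (‖ξ₀‖ / β 0 + ‖b‖)
    (add_nonneg (div_nonneg (norm_nonneg _) (hβ0 0).le) (norm_nonneg _)) (fun t => by
      have ht : 0 ≤ max t 0 := le_max_right _ _
      have hB : 0 ≤ ‖ξ₀‖ / β 0 + ‖b‖ :=
        add_nonneg (div_nonneg (norm_nonneg _) (hβ0 0).le) (norm_nonneg _)
      rw [sub_zero, pi_norm_le_iff_of_nonneg (mul_nonneg hB (hW t).le)]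
      intro i
      simp only [Φ, G, Matrix.mulVec_zero, dotProduct_zero, mul_zero,
        intervalIntegral.integral_zero, add_zero, Pi.zero_apply, zero_add, W]
      set T := max t 0
      have h1 : |∫ s in (0 : ℝ)..T, b i * r s| ≤ ‖b‖ * β T * |T - 0| := by
        rw [← Real.norm_eq_abs]
        refine intervalIntegral.norm_integral_le_of_norm_le_const fun s hs => ?_
        rw [uIoc_of_le ht] at hs
        rw [norm_mul]
        refine mul_le_mul (hbn i) ((hβ () s).trans (hβm ?_)) (norm_nonneg _) (norm_nonneg _)
        rw [abs_of_pos hs.1]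
        exact hs.2
      rw [sub_zero, abs_of_nonneg ht] at h1
      have h2 : T ≤ Real.exp (L * T) := by
        have := Real.add_one_le_exp (L * T)
        nlinarith
      have h3 : 1 ≤ Real.exp (L * T) := Real.one_le_exp (by positivity)
      have h4 : ‖ξ₀‖ ≤ ‖ξ₀‖ / β 0 * (β T * Real.exp (L * T)) := by
        have h5 : β 0 ≤ β T * Real.exp (L * T) :=
          (hβm ht).trans (le_mul_of_one_le_right (hβ0 T).le h3)
        calc ‖ξ₀‖ = ‖ξ₀‖ / β 0 * β 0 := (div_mul_cancel₀ _ (hβ0 0).ne').symm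
          _ ≤ _ := mul_le_mul_of_nonneg_left h5 (div_nonneg (norm_nonneg _) (hβ0 0).le)
      have h6 : ‖b‖ * β T * T ≤ ‖b‖ * (β T * Real.exp (L * T)) := by
        rw [mul_assoc]
        exact mul_le_mul_of_nonneg_left (mul_le_mul_of_nonneg_left h2 (hβ0 T).le) (norm_nonneg _)
      have h7 : |ξ₀ i| ≤ ‖ξ₀‖ := norm_le_pi_norm ξ₀ i
      rw [Real.norm_eq_abs, add_mul]
      linarith [abs_add_le (ξ₀ i) (∫ s in (0 : ℝ)..T, b i * r s)])
  refine ⟨ξ, hξ, fun t ht i => ?_⟩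
  have := congrFun (congrFun hfix t) i
  simp only [Φ, max_eq_left ht] at this
  exact this.symm

theorem sgn_zero : sgn 0 = 1 := rfl

theorem sgn_one : sgn 1 = -1 := rfl

namespace System

variable {n : ℕ} (P : System n) (K : ℝ → ℝ → Matrix (Fin 2) (Fin 2) ℝ)

theorem xPar_eq_convolution (Y : ℕ → ℝ → ℝ) (i : Fin 2) {z : ℝ} (hz : z ∈ Icc (0 : ℝ) 1) :
    P.xPar K Y i z = P.pPar Y i (sgn i * P.phiE i z) - sgn i * ∫ σ in (0 : ℝ)..(P.phiE i z),
      P.delayCoeff K i (P.phiE i z - σ) * (P.c ⬝ᵥ P.xiPar Y (sgn i * σ)) := by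
  rw [P.xPar_eq K Y i hz]
  congr 2
  have := intervalIntegral.integral_comp_sub_left (a := 0) (b := P.phiE i z)
    (fun σ => P.delayCoeff K i (P.phiE i z - σ) * (P.c ⬝ᵥ P.xiPar Y (sgn i * σ))) (P.phiE i z)
  simpa using this

variable {P K}

theorem exists_delayCoeff_bound (hK : P.IsKernel K) : ∃ M, ∀ i σ, |P.delayCoeff K i σ| ≤ M := by
  have h : ∀ i, ∃ M, ∀ σ, |P.delayCoeff K i σ| ≤ M := fun i => by
    obtain ⟨B, hB⟩ := exists_bound_comp_unitClamp (f := fun z => -(kerE K z 0 i 1 * P.lamE 1 0))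
      (((continuous_kerE hK.continuous i 1).comp
        (continuous_id.prodMk continuous_const)).mul continuous_const).neg.continuousOn
    refine ⟨B, fun σ => ?_⟩
    have := hB (P.phiInv i σ)
    rwa [kerE, unitClamp_of_mem (unitClamp_mem _)] at this
  choose M hM using h
  exact ⟨max (M 0) (M 1), fun i σ => (hM i σ).trans (by
    fin_cases i
    · exact le_max_left _ _
    · exact le_max_right _ _)⟩

theorem continuous_delay {d : ℝ → ℝ} (hd : Continuous d) {ξ : ℝ → Fin n → ℝ} (hξ : Continuous ξ)
    (w : Fin n → ℝ) : Continuous fun s => ∫ ρ in (0 : ℝ)..s, d (s - ρ) * (w ⬝ᵥ ξ ρ) := by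
  refine intervalIntegral.continuous_parametric_intervalIntegral_of_continuous
    (f := fun s ρ => d (s - ρ) * (w ⬝ᵥ ξ ρ)) ?_ continuous_id
  exact (hd.comp (continuous_fst.sub continuous_snd)).mul
    (Continuous.dotProduct continuous_const (hξ.comp continuous_snd))

/-- Every state is generated by a trajectory of the flat output, whose derivative of highest order
is free at the present time. -/
theorem exists_jet_of_state (hu : IsUnit P.kalman.det) (hq0 : P.q0 ≠ 0) (hK : P.IsKernel K)
    (ξ₀ : Fin n → ℝ) {X : Fin 2 → ℝ → ℝ} (hX : ∀ i, LocBounded (X i)) (p₀ : ℝ) :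
    ∃ Y, IsGlobalJet n Y ∧ P.xiPar Y 0 = ξ₀ ∧ P.p1Par Y 0 = p₀ ∧
      ∀ i, ∀ z ∈ Ioc (0 : ℝ) 1, P.xPar K Y i z = X i z := by
  obtain ⟨M, hM⟩ := exists_delayCoeff_bound hK
  have hd := P.continuous_delayCoeff hK
  have hX' : ∀ i, LocBounded fun s => X i (P.phiInv i s) := fun i =>
    (hX i).comp_continuous (P.continuous_phiInv i)
  -- Forward in time, the formula for the first component gives `x₁(0,·)` as the profile plus a
  -- convolution with `cᵀ ξ`; inserted into the differential equation it yields an equation with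
  -- memory.
  obtain ⟨ξp, hξp, hp⟩ := exists_ode_with_memory P.F P.b P.c ξ₀ (hd 0) (hM 0) (hX' 0)
  -- Backward in time, `x₁(0,·) = (x₂(0,·) - cᵀ ξ) / q₀` with `x₂(0,·)` read off from the second
  -- component. Reversal of time changes the signs of `F` and of `b`.
  obtain ⟨ξm, hξm, hm⟩ := exists_ode_with_memory (-P.F + P.q0⁻¹ • Matrix.vecMulVec P.b P.c)
    (-P.q0⁻¹ • P.b) P.c ξ₀ (d := fun σ => -P.delayCoeff K 1 σ) (hd 1).neg (M := M)
    (fun ρ => by rw [abs_neg]; exact hM 1 ρ) (hX' 1)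
  have hp0 : ξp 0 = ξ₀ := funext fun i => by simpa using hp 0 le_rfl i
  have hm0 : ξm 0 = ξ₀ := funext fun i => by simpa using hm 0 le_rfl i
  let ξ : ℝ → Fin n → ℝ := fun t => if 0 ≤ t then ξp t else ξm (-t)
  let pp : ℝ → ℝ := fun s => X 0 (P.phiInv 0 s)
    + ∫ ρ in (0 : ℝ)..s, P.delayCoeff K 0 (s - ρ) * (P.c ⬝ᵥ ξp ρ)
  let pm : ℝ → ℝ := fun s => P.q0⁻¹ * (X 1 (P.phiInv 1 s) - P.c ⬝ᵥ ξm s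
    + ∫ ρ in (0 : ℝ)..s, -P.delayCoeff K 1 (s - ρ) * (P.c ⬝ᵥ ξm ρ))
  -- Profiles are matched on `(0,1]` only, so neither half fixes `x₁(0,·)` at time zero. The free
  -- value `p₀` serves later to match `x₂` at `z = 0`.
  let p : ℝ → ℝ := fun t => if 0 < t then pp t else if t < 0 then pm (-t) else p₀
  have hξ : Continuous ξ := by
    refine Continuous.if_le hξp (hξm.comp continuous_neg) continuous_const continuous_id ?_
    rintro t rfl
    simp [hp0, hm0]
  have hpp : LocBounded pp := (hX' 0).add (.of_continuous (continuous_delay (hd 0) hξp P.c))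
  have hpm : LocBounded pm :=
    (((hX' 1).sub (.dotProduct_of_continuous _ hξm)).add
      (.of_continuous (continuous_delay (hd 1).neg hξm P.c))).const_mul _
  have hpb : LocBounded p := hpp.ite ((hpm.comp_continuous continuous_neg).ite (.const p₀)
    measurableSet_Iio) measurableSet_Ioi
  have hξb : ∀ j, LocBounded fun t => ξ t j := fun j =>
    .of_continuous ((continuous_apply j).comp hξ)
  have hI : ∀ i, LocBounded fun r => P.F.mulVec (ξ r) i + P.b i * p r := fun i =>
    (LocBounded.mulVec _ hξb i).add (hpb.const_mul _)
  have hbase : ∀ t i, ξ t i = ξ₀ i + ∫ r in (0 : ℝ)..t, (P.F.mulVec (ξ r) i + P.b i * p r) := by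
    intro t i
    rcases le_or_gt 0 t with ht | ht
    · have e : ξ t = ξp t := if_pos ht
      rw [e, hp t ht i]
      congr 1
      refine intervalIntegral.integral_congr_ae (Filter.Eventually.of_forall fun r hr => ?_)
      rw [uIoc_of_le ht] at hr
      have e1 : ξ r = ξp r := if_pos hr.1.le
      have e2 : p r = pp r := if_pos hr.1
      rw [e1, e2]
    · have e : ξ t = ξm (-t) := if_neg (not_le.2 ht)
      have h0 : 0 ≤ -t := by linarith
      rw [e, hm (-t) h0 i]
      congr 1
      have h1 := intervalIntegral.integral_comp_neg (a := 0) (b := -t)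
        (fun r => P.F.mulVec (ξ r) i + P.b i * p r)
      rw [neg_neg, neg_zero] at h1
      rw [intervalIntegral.integral_symm t 0, ← h1, ← intervalIntegral.integral_neg]
      refine intervalIntegral.integral_congr_ae (Filter.Eventually.of_forall fun r hr => ?_)
      rw [uIoc_of_le h0] at hr
      have e1 : ξ (-r) = ξm r := by
        change (if 0 ≤ -r then _ else ξm (- -r)) = _
        rw [if_neg (by linarith [hr.1]), neg_neg]
      have e2 : p (-r) = pm r := by
        change (if 0 < -r then _ else if -r < 0 then pm (- -r) else _) = _
        rw [if_neg (by linarith [hr.1]), if_pos (by linarith [hr.1]), neg_neg]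
      rw [e1, e2]
      simp only [pm, Matrix.add_mulVec, Matrix.neg_mulVec, Matrix.smul_mulVec,
        Matrix.vecMulVec_mulVec, Pi.add_apply, Pi.neg_apply, Pi.smul_apply, smul_eq_mul]
      simp
      ring
  have hode : ∀ s t i, ξ t i = ξ s i + ∫ r in s..t, (P.F.mulVec (ξ r) i + P.b i * p r) := by
    intro s t i
    rw [hbase t i, hbase s i, add_assoc, intervalIntegral.integral_add_adjacent_intervals
      ((hI i).intervalIntegrable _ _) ((hI i).intervalIntegrable _ _)]
  refine ⟨P.flatJet ξ p, isGlobalJet_flatJet hu hξ hpb hode, ?_, ?_, fun i z hz => ?_⟩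
  · rw [xiPar_flatJet P hu]
    change (if (0 : ℝ) ≤ 0 then ξp 0 else _) = _
    rw [if_pos le_rfl, hp0]
  · rw [p1Par_flatJet]
    simp [p]
  · have hφ : 0 < P.phiE i z := by
      rw [← P.phiE_zero i]; exact (P.travelTime i).strictMono hz.1
    rw [P.xPar_eq_convolution K _ i (Ioc_subset_Icc_self hz)]
    simp only [xiPar_flatJet P hu]
    fin_cases i
    · simp only [Fin.zero_eta, pPar_zero, p1Par_flatJet, sgn_zero, one_mul] at hφ ⊢
      have e2 : p (P.phiE 0 z) = pp (P.phiE 0 z) := if_pos hφ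
      have e3 : ∫ σ in (0 : ℝ)..(P.phiE 0 z), P.delayCoeff K 0 (P.phiE 0 z - σ) * (P.c ⬝ᵥ ξ σ)
          = ∫ σ in (0 : ℝ)..(P.phiE 0 z), P.delayCoeff K 0 (P.phiE 0 z - σ) * (P.c ⬝ᵥ ξp σ) := by
        refine intervalIntegral.integral_congr fun r hr => ?_
        rw [uIcc_of_le hφ.le] at hr
        have e1 : ξ r = ξp r := if_pos hr.1
        simp only [e1]
      rw [e2, e3]
      simp [pp, P.phiInv_phiE]
    · simp only [Fin.mk_one, pPar_one, p1Par_flatJet, xiPar_flatJet P hu, sgn_one, neg_mul, one_mul] at hφ ⊢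
      have e0 : ∀ r, 0 ≤ r → ξ (-r) = ξm r := fun r hr => by
        rcases hr.eq_or_lt with rfl | hr
        · rw [neg_zero, hm0]
          change (if (0 : ℝ) ≤ 0 then ξp 0 else _) = _
          rw [if_pos le_rfl, hp0]
        · change (if 0 ≤ -r then _ else ξm (- -r)) = _
          rw [if_neg (by linarith), neg_neg]
      have e2 : p (-P.phiE 1 z) = pm (P.phiE 1 z) := by
        change (if 0 < -P.phiE 1 z then _ else if -P.phiE 1 z < 0 then pm (- -P.phiE 1 z) else _) = _
        rw [if_neg (by linarith), if_pos (by linarith), neg_neg]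
      have e3 : ∫ σ in (0 : ℝ)..(P.phiE 1 z), P.delayCoeff K 1 (P.phiE 1 z - σ) * (P.c ⬝ᵥ ξ (-σ))
          = ∫ σ in (0 : ℝ)..(P.phiE 1 z), P.delayCoeff K 1 (P.phiE 1 z - σ) * (P.c ⬝ᵥ ξm σ) := by
        refine intervalIntegral.integral_congr fun r hr => ?_
        rw [uIcc_of_le hφ.le] at hr
        simp only [e0 r hr.1]
      rw [e2, e3, e0 _ hφ.le]
      simp only [pm, P.phiInv_phiE, neg_mul, intervalIntegral.integral_neg]
      field_simp
      ring

end System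

/-! ### Bounds between states and trajectory segments -/

theorem sq_integral_abs_le {f : ℝ → ℝ} (hf : LocBounded f) {a b : ℝ} (hab : a < b) :
    (∫ s in a..b, |f s|) ^ 2 ≤ (b - a) * ∫ s in a..b, f s ^ 2 := by
  have hba : 0 < b - a := sub_pos.2 hab
  set I := ∫ s in a..b, |f s| with hI
  -- The Cauchy–Schwarz inequality, as nonnegativity of the variance of `|f|`.
  have h0 : 0 ≤ ∫ s in a..b, (|f s| - I / (b - a)) ^ 2 :=
    intervalIntegral.integral_nonneg hab.le fun _ _ => sq_nonneg _
  have hf2 : LocBounded fun s => f s ^ 2 := by simpa [sq] using hf.mul hf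
  have e : ∀ s, (|f s| - I / (b - a)) ^ 2 = f s ^ 2 - 2 * (I / (b - a)) * |f s| + (I / (b - a)) ^ 2 :=
    fun s => by rw [sub_sq, sq_abs]; ring
  simp only [e] at h0
  rw [intervalIntegral.integral_add
    ((hf2.sub (hf.abs.const_mul _)).intervalIntegrable _ _) intervalIntegrable_const,
    intervalIntegral.integral_sub (hf2.intervalIntegrable _ _)
    ((hf.abs.const_mul _).intervalIntegrable _ _), intervalIntegral.integral_const_mul,
    intervalIntegral.integral_const, ← hI, smul_eq_mul] at h0
  have e2 : (b - a) * (I / (b - a)) ^ 2 = I ^ 2 / (b - a) := by field_simp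
  have e3 : 2 * (I / (b - a)) * I = 2 * (I ^ 2 / (b - a)) := by ring
  rw [e2, e3] at h0
  have h1 : I ^ 2 / (b - a) ≤ ∫ s in a..b, f s ^ 2 := by linarith
  rwa [div_le_iff₀ hba, mul_comm] at h1

theorem LocBounded.norm {n : ℕ} {X : ℝ → Fin n → ℝ} (hX : Continuous X) : LocBounded fun t => ‖X t‖ :=
  .of_continuous hX.norm

theorem integral_le_of_subinterval {f : ℝ → ℝ} (hf : LocBounded f) (h0 : ∀ s, 0 ≤ f s) {a b c d : ℝ}
    (hac : a ≤ c) (hcd : c ≤ d) (hdb : d ≤ b) : ∫ s in c..d, f s ≤ ∫ s in a..b, f s :=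
  intervalIntegral.integral_mono_interval hac hcd hdb (Filter.Eventually.of_forall h0)
    (hf.intervalIntegrable _ _)

/-- The memory up to `r` is at most the memory up to `t ≥ r`, so Gronwall's inequality applies with
a constant independent of the solution. The factor `ε` is used with the values `±1` to cover both
directions of time. -/
theorem exists_bound_ode_with_memory {n : ℕ} (F : Matrix (Fin n) (Fin n) ℝ) (b : Fin n → ℝ) {c T : ℝ}
    (hc : 0 ≤ c) (hT : 0 ≤ T) : ∃ C ≥ 0, ∀ (X : ℝ → Fin n → ℝ) (q x : ℝ → ℝ) (ε : ℝ), |ε| ≤ 1 →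
      Continuous X → LocBounded q → LocBounded x →
      (∀ s ∈ Icc 0 T, ∀ i, X s i = X 0 i + ε * ∫ r in (0 : ℝ)..s, (F.mulVec (X r) i + b i * q r)) →
      (∀ s ∈ Icc 0 T, |q s| ≤ c * (|x s| + ‖X s‖ + ∫ r in (0 : ℝ)..s, ‖X r‖)) →
      ∀ s ∈ Icc 0 T, ‖X s‖ ≤ C * (‖X 0‖ + ∫ r in (0 : ℝ)..T, |x r|) := by
  obtain ⟨CF, hCF0, hCF⟩ := exists_mulVec_bound F
  let D : ℝ := CF + ‖b‖ * c * (1 + T)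
  have hD : 0 ≤ D := by positivity
  refine ⟨(1 + ‖b‖ * c) * Real.exp (D * T), by positivity, fun X q x ε hε hXc hq hx hX hqx s hs => ?_⟩
  have hn := LocBounded.norm hXc
  have hI0 : ∀ s, 0 ≤ s → 0 ≤ ∫ r in (0 : ℝ)..s, ‖X r‖ := fun s hs =>
    intervalIntegral.integral_nonneg hs fun _ _ => norm_nonneg _
  have hx0 : 0 ≤ ∫ r in (0 : ℝ)..T, |x r| :=
    intervalIntegral.integral_nonneg hT fun _ _ => abs_nonneg _
  set a := ‖X 0‖ + ‖b‖ * c * ∫ r in (0 : ℝ)..T, |x r| with ha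
  have ha0 : 0 ≤ a := by positivity
  have key : ∀ t ∈ Icc 0 T, ‖X t‖ ≤ a + D * ∫ r in (0 : ℝ)..t, ‖X r‖ := by
    intro t ht
    have hr0 : 0 ≤ a + D * ∫ r in (0 : ℝ)..t, ‖X r‖ := add_nonneg ha0 (mul_nonneg hD (hI0 t ht.1))
    rw [pi_norm_le_iff_of_nonneg hr0]
    intro i
    rw [hX t ht i, Real.norm_eq_abs]
    have h1 : |∫ r in (0 : ℝ)..t, (F.mulVec (X r) i + b i * q r)| ≤ ∫ r in (0 : ℝ)..t,
        (CF * ‖X r‖ + ‖b‖ * c * (|x r| + ‖X r‖ + ∫ r in (0 : ℝ)..t, ‖X r‖)) := by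
      rw [← Real.norm_eq_abs]
      refine intervalIntegral.norm_integral_le_of_norm_le ht.1
        (Filter.Eventually.of_forall fun r hr => ?_) ?_
      · refine (norm_add_le _ _).trans (add_le_add (hCF _ i) ?_)
        rw [norm_mul, mul_assoc]
        refine mul_le_mul (norm_le_pi_norm b i) ?_ (norm_nonneg _) (norm_nonneg _)
        refine (hqx r ⟨hr.1.le, hr.2.trans ht.2⟩).trans (mul_le_mul_of_nonneg_left ?_ hc)
        have := integral_le_of_subinterval hn (fun _ => norm_nonneg _) le_rfl hr.1.le hr.2
        linarith
      · exact ((hn.const_mul _).add (((hx.abs.add hn).add (.const _)).const_mul _)).intervalIntegrable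
          _ _
    have h2 : ∫ r in (0 : ℝ)..t,
        (CF * ‖X r‖ + ‖b‖ * c * (|x r| + ‖X r‖ + ∫ r in (0 : ℝ)..t, ‖X r‖))
        = CF * (∫ r in (0 : ℝ)..t, ‖X r‖) + ‖b‖ * c * ((∫ r in (0 : ℝ)..t, |x r|)
          + (∫ r in (0 : ℝ)..t, ‖X r‖) + t * ∫ r in (0 : ℝ)..t, ‖X r‖) := by
      rw [intervalIntegral.integral_add ((hn.const_mul _).intervalIntegrable _ _)
        ((((hx.abs.add hn).add (.const _)).const_mul _).intervalIntegrable _ _),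
        intervalIntegral.integral_const_mul, intervalIntegral.integral_const_mul,
        intervalIntegral.integral_add ((hx.abs.add hn).intervalIntegrable _ _)
          intervalIntegrable_const,
        intervalIntegral.integral_add (hx.abs.intervalIntegrable _ _) (hn.intervalIntegrable _ _),
        intervalIntegral.integral_const, sub_zero, smul_eq_mul]
    have h3 := integral_le_of_subinterval hx.abs (fun _ => abs_nonneg _) le_rfl ht.1 ht.2
    have h4 : t * (∫ r in (0 : ℝ)..t, ‖X r‖) ≤ T * ∫ r in (0 : ℝ)..t, ‖X r‖ :=
      mul_le_mul_of_nonneg_right ht.2 (hI0 t ht.1)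
    have h5 : |ε * ∫ r in (0 : ℝ)..t, (F.mulVec (X r) i + b i * q r)|
        ≤ 1 * ∫ r in (0 : ℝ)..t,
        (CF * ‖X r‖ + ‖b‖ * c * (|x r| + ‖X r‖ + ∫ r in (0 : ℝ)..t, ‖X r‖)) := by
      rw [abs_mul]; exact mul_le_mul hε h1 (abs_nonneg _) zero_le_one
    have h6 : ‖b‖ * c * ((∫ r in (0 : ℝ)..t, |x r|)
          + (∫ r in (0 : ℝ)..t, ‖X r‖) + t * ∫ r in (0 : ℝ)..t, ‖X r‖)
        ≤ ‖b‖ * c * ((∫ r in (0 : ℝ)..T, |x r|)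
          + (∫ r in (0 : ℝ)..t, ‖X r‖) + T * ∫ r in (0 : ℝ)..t, ‖X r‖) := by
      apply mul_le_mul_of_nonneg_left _ (by positivity)
      linarith
    have h7 : |X 0 i| ≤ ‖X 0‖ := norm_le_pi_norm (X 0) i
    rw [h2, one_mul] at h5
    refine (abs_add_le _ _).trans ?_
    simp only [ha, D]
    linarith
  have h8 := le_mul_exp_of_le_add_integral (F := fun t => ‖X t‖) hD hXc.norm.continuousOn key s hs
  have h9 : Real.exp (D * s) ≤ Real.exp (D * T) :=
    Real.exp_le_exp.2 (mul_le_mul_of_nonneg_left hs.2 hD)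
  have h10 : a ≤ (1 + ‖b‖ * c) * (‖X 0‖ + ∫ r in (0 : ℝ)..T, |x r|) := by
    have : 0 ≤ ‖b‖ * c * ‖X 0‖ := by positivity
    simp only [ha]
    linarith
  calc ‖X s‖ ≤ a * Real.exp (D * s) := h8
    _ ≤ a * Real.exp (D * T) := mul_le_mul_of_nonneg_left h9 ha0
    _ ≤ ((1 + ‖b‖ * c) * (‖X 0‖ + ∫ r in (0 : ℝ)..T, |x r|)) * Real.exp (D * T) :=
      mul_le_mul_of_nonneg_right h10 (Real.exp_pos _).le
    _ = _ := by ring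

namespace System

variable {n : ℕ} (P : System n) (K : ℝ → ℝ → Matrix (Fin 2) (Fin 2) ℝ)

/-- The parametrization of the distributed state, extended to the real line. -/
def xParE (Y : ℕ → ℝ → ℝ) (i : Fin 2) (z : ℝ) : ℝ :=
  P.pPar Y i (sgn i * P.phiE i z) - sgn i * ∫ σ in (0 : ℝ)..(P.phiE i z),
      P.delayCoeff K i (P.phiE i z - σ) * (P.c ⬝ᵥ P.xiPar Y (sgn i * σ))

theorem xPar_eq_xParE (Y : ℕ → ℝ → ℝ) (i : Fin 2) {z : ℝ} (hz : z ∈ Icc (0 : ℝ) 1) :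
    P.xPar K Y i z = P.xParE K Y i z := P.xPar_eq_convolution K Y i hz

variable {P K}

theorem locBounded_xParE (hK : P.IsKernel K) {Y : ℕ → ℝ → ℝ} (hY : IsGlobalJet n Y) (i : Fin 2) :
    LocBounded (P.xParE K Y i) := by
  have hφ : Continuous (P.phiE i) := (P.travelTime i).continuous_travel
  have h1 : Continuous fun s => P.xiPar Y (sgn i * s) :=
    (continuous_xiPar hY).comp (continuous_const.mul continuous_id)
  have h2 := continuous_delay (P.continuous_delayCoeff hK i) h1 P.c
  exact ((locBounded_pPar hY i).comp_continuous (continuous_const.mul hφ)).sub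
    ((LocBounded.of_continuous (h2.comp hφ)).const_mul _)

/-- Integrals over the transport time. -/
theorem integral_transport_le {M : ℝ} (hM : ∀ i z, 1 / P.lamE i z ≤ M) (i : Fin 2) {f : ℝ → ℝ}
    (hf : LocBounded f) (h0 : ∀ s, 0 ≤ f s) :
    ∫ s in (0 : ℝ)..(P.tau i), f s ≤ M * ∫ z in (0 : ℝ)..1, f (P.phiE i z) := by
  rw [P.tau_eq, (P.travelTime i).integral_zero_eq, ← intervalIntegral.integral_const_mul]
  have hφ := hf.comp_continuous (P.travelTime i).continuous_travel
  have hl : LocBounded fun z => 1 / P.lamE i z := .of_continuous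
    (continuous_const.div (P.continuous_lamE i) fun z => (P.lamE_pos i z).ne')
  refine intervalIntegral.integral_mono_on zero_le_one ?_ ((hφ.const_mul M).intervalIntegrable _ _)
    fun z _ => ?_
  · simpa only [mul_one_div] using (hφ.mul hl).intervalIntegrable 0 1
  · rw [div_eq_mul_one_div, mul_comm]
    exact mul_le_mul_of_nonneg_right (hM i z) (h0 _)

/-- The size of a state in `L¹`. -/
def size (ξ : Fin n → ℝ) (x : Fin 2 → ℝ → ℝ) : ℝ :=
  ‖ξ‖ + ((∫ z in (0 : ℝ)..1, |x 0 z|) + ∫ z in (0 : ℝ)..1, |x 1 z|)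

theorem size_nonneg (ξ : Fin n → ℝ) (x : Fin 2 → ℝ → ℝ) : 0 ≤ size ξ x := by
  have := fun j => intervalIntegral.integral_nonneg (μ := volume) (zero_le_one (α := ℝ))
    fun z (_ : z ∈ Icc (0 : ℝ) 1) => abs_nonneg (x j z)
  exact add_nonneg (norm_nonneg _) (add_nonneg (this 0) (this 1))

theorem integral_abs_le_size (ξ : Fin n → ℝ) (x : Fin 2 → ℝ → ℝ) (i : Fin 2) :
    ‖ξ‖ + ∫ z in (0 : ℝ)..1, |x i z| ≤ size ξ x := by
  have := fun j => intervalIntegral.integral_nonneg (μ := volume) (zero_le_one (α := ℝ))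
    fun z (_ : z ∈ Icc (0 : ℝ) 1) => abs_nonneg (x j z)
  have h0 := this 0
  have h1 := this 1
  rw [size]
  fin_cases i
  · simp only [Fin.zero_eta]; linarith
  · simp only [Fin.mk_one]; linarith

theorem abs_delay_le {M : ℝ} (hM : ∀ i σ, |P.delayCoeff K i σ| ≤ M) {C : ℝ}
    (hC : ∀ v, |P.c ⬝ᵥ v| ≤ C * ‖v‖) (i : Fin 2) {X : ℝ → Fin n → ℝ} (hX : Continuous X) {s : ℝ}
    (hs : 0 ≤ s) : |∫ σ in (0 : ℝ)..s, P.delayCoeff K i (s - σ) * (P.c ⬝ᵥ X σ)|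
      ≤ M * C * ∫ σ in (0 : ℝ)..s, ‖X σ‖ := by
  have hM0 : 0 ≤ M := (abs_nonneg _).trans (hM 0 0)
  rw [← Real.norm_eq_abs, ← intervalIntegral.integral_const_mul]
  refine intervalIntegral.norm_integral_le_of_norm_le hs
    (Filter.Eventually.of_forall fun σ _ => ?_) (((LocBounded.norm hX).const_mul _).intervalIntegrable _ _)
  rw [norm_mul, mul_assoc]
  exact mul_le_mul (hM i _) (hC _) (norm_nonneg _) hM0

/-- The trajectory segment is controlled by the state that it generates. -/
theorem exists_bound_jet_of_state (hu : IsUnit P.kalman.det) (hq0 : P.q0 ≠ 0) (hK : P.IsKernel K) :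
    ∃ C ≥ 0, ∀ Y, IsGlobalJet n Y →
      (∀ k < n, ∀ τ ∈ P.window, |Y k τ| ≤ C * size (P.xiPar Y 0) (P.xParE K Y)) ∧
      ∀ i, ∀ z ∈ Icc (0 : ℝ) 1, |Y n (sgn i * P.phiE i z)|
        ≤ C * (|P.xParE K Y i z| + size (P.xiPar Y 0) (P.xParE K Y)) := by
  obtain ⟨M, hM⟩ := exists_delayCoeff_bound hK
  have hM0 : 0 ≤ M := (abs_nonneg _).trans (hM 0 0)
  obtain ⟨Cc, hCc0, hCc⟩ := exists_dotProduct_bound P.c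
  obtain ⟨Ml, hMl0, hMl⟩ := P.exists_inv_lamE_le
  obtain ⟨CT, hCT0, hCT⟩ := exists_mulVec_bound P.Tc
  obtain ⟨Ce, hCe0, hCe⟩ := exists_dotProduct_bound (Matrix.vecMul (eLast n) (P.Tc * P.F * P.Tc⁻¹))
  let c : ℝ := 1 + M * Cc + |P.q0|⁻¹ * (1 + Cc + M * Cc)
  have hc : 0 ≤ c := by positivity
  -- The parametrization solved for `x₁(0,·)`; for the second component this divides by `q₀`.
  have hqx : ∀ Y, IsGlobalJet n Y → ∀ i, ∀ s, 0 ≤ s → |P.p1Par Y (sgn i * s)| ≤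
      c * (|P.xParE K Y i (P.phiInv i s)| + ‖P.xiPar Y (sgn i * s)‖
        + ∫ r in (0 : ℝ)..s, ‖P.xiPar Y (sgn i * r)‖) := by
    intro Y hY i s hs
    have hX : Continuous fun s => P.xiPar Y (sgn i * s) :=
      (continuous_xiPar hY).comp (continuous_const.mul continuous_id)
    have h1 := abs_delay_le hM hCc i hX hs
    have h2 : 0 ≤ ∫ r in (0 : ℝ)..s, ‖P.xiPar Y (sgn i * r)‖ :=
      intervalIntegral.integral_nonneg hs fun _ _ => norm_nonneg _
    set I := ∫ r in (0 : ℝ)..s, ‖P.xiPar Y (sgn i * r)‖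
    have h3 : P.xParE K Y i (P.phiInv i s) = P.pPar Y i (sgn i * s)
      - sgn i * ∫ σ in (0 : ℝ)..s, P.delayCoeff K i (s - σ) * (P.c ⬝ᵥ P.xiPar Y (sgn i * σ)) := by
      rw [xParE, P.phiE_phiInv]
    set D := ∫ σ in (0 : ℝ)..s, P.delayCoeff K i (s - σ) * (P.c ⬝ᵥ P.xiPar Y (sgn i * σ))
    set x := P.xParE K Y i (P.phiInv i s)
    have h4 : |P.pPar Y i (sgn i * s)| ≤ |x| + M * Cc * I := by
      have : P.pPar Y i (sgn i * s) = x + sgn i * D := by rw [h3]; ring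
      rw [this]
      refine (abs_add_le _ _).trans ?_
      rw [abs_mul, abs_sgn, one_mul]
      linarith
    have hx0 := abs_nonneg x
    have hξ0 := norm_nonneg (P.xiPar Y (sgn i * s))
    have hMC : 0 ≤ M * Cc := by positivity
    have hq : 0 ≤ |P.q0|⁻¹ := by positivity
    set ξs := ‖P.xiPar Y (sgn i * s)‖ with hξs
    fin_cases i
    · simp only [Fin.zero_eta, pPar_zero] at h4 ⊢
      refine h4.trans ?_
      have : 0 ≤ |P.q0|⁻¹ * (1 + Cc + M * Cc) := by positivity
      have hc1 : 1 ≤ c := by simp only [c]; linarith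
      have hc2 : M * Cc ≤ c := by simp only [c]; linarith
      nlinarith [mul_nonneg hc hξ0, mul_le_mul_of_nonneg_right hc1 hx0,
        mul_le_mul_of_nonneg_right hc2 h2]
    · simp only [Fin.mk_one, pPar_one] at h4 ⊢
      have h5 := hCc (P.xiPar Y (sgn 1 * s))
      have h6 : P.p1Par Y (sgn 1 * s) = P.q0⁻¹ * ((P.q0 * P.p1Par Y (sgn 1 * s)
          + P.c ⬝ᵥ P.xiPar Y (sgn 1 * s)) - P.c ⬝ᵥ P.xiPar Y (sgn 1 * s)) := by
        field_simp
        ring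
      rw [h6, abs_mul, abs_inv]
      have h7 : |(P.q0 * P.p1Par Y (sgn 1 * s) + P.c ⬝ᵥ P.xiPar Y (sgn 1 * s))
          - P.c ⬝ᵥ P.xiPar Y (sgn 1 * s)| ≤ (1 + Cc + M * Cc) * (|x| + ξs + I) := by
        refine (abs_sub _ _).trans ?_
        have h5' : |P.c ⬝ᵥ P.xiPar Y (sgn 1 * s)| ≤ Cc * ξs := h5
        nlinarith [mul_nonneg hMC hx0, mul_nonneg hMC hξ0, mul_nonneg hCc0 hx0, mul_nonneg hCc0 h2]
      calc _ ≤ |P.q0|⁻¹ * ((1 + Cc + M * Cc) * (|x| + ξs + I)) := mul_le_mul_of_nonneg_left h7 hq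
        _ = |P.q0|⁻¹ * (1 + Cc + M * Cc) * (|x| + ξs + I) := by ring
        _ ≤ c * (|x| + ξs + I) := by
          refine mul_le_mul_of_nonneg_right ?_ (by positivity)
          simp only [c]; linarith
  choose Co hCo0 hCo using fun i => exists_bound_ode_with_memory P.F P.b hc (P.tau_pos i).le
  let C1 : ℝ := (Co 0 + Co 1) * (1 + Ml)
  have hC1 : 0 ≤ C1 := mul_nonneg (add_nonneg (hCo0 0) (hCo0 1)) (by linarith)
  have hξ : ∀ Y, IsGlobalJet n Y → ∀ i, ∀ s ∈ Icc 0 (P.tau i),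
      ‖P.xiPar Y (sgn i * s)‖ ≤ C1 * size (P.xiPar Y 0) (P.xParE K Y) := by
    intro Y hY i s hs
    have hxE := locBounded_xParE hK hY i
    have h1 := hCo i (fun s => P.xiPar Y (sgn i * s)) (fun s => P.p1Par Y (sgn i * s))
      (fun s => P.xParE K Y i (P.phiInv i s)) (sgn i) (abs_sgn i).le
      ((continuous_xiPar hY).comp (continuous_const.mul continuous_id))
      ((locBounded_p1Par hY).comp_continuous (continuous_const.mul continuous_id))
      (hxE.comp_continuous (P.continuous_phiInv i))
      (fun s _ j => by
        rw [xiPar_eq_integral hu hY (sgn i * 0) (sgn i * s) j]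
        congr 1
        exact (intervalIntegral.mul_integral_comp_mul_left (a := 0) (b := s)
          (f := fun r => P.F.mulVec (P.xiPar Y r) j + P.b j * P.p1Par Y r) (sgn i)).symm)
      (fun s hs => hqx Y hY i s hs.1) s hs
    have h2 := integral_transport_le hMl i
      (f := fun s => |P.xParE K Y i (P.phiInv i s)|)
      (hxE.comp_continuous (P.continuous_phiInv i)).abs (fun _ => abs_nonneg _)
    simp only [P.phiInv_phiE] at h2
    have h3 := integral_abs_le_size (P.xiPar Y 0) (P.xParE K Y) i
    have h4 : 0 ≤ ∫ z in (0 : ℝ)..1, |P.xParE K Y i z| :=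
      intervalIntegral.integral_nonneg zero_le_one fun _ _ => abs_nonneg _
    simp only [mul_zero] at h1
    refine h1.trans ?_
    have h5 : ‖P.xiPar Y 0‖ + ∫ r in (0 : ℝ)..(P.tau i), |P.xParE K Y i (P.phiInv i r)|
        ≤ (1 + Ml) * size (P.xiPar Y 0) (P.xParE K Y) := by
      nlinarith [norm_nonneg (P.xiPar Y 0)]
    have h6 : Co i ≤ Co 0 + Co 1 := by
      fin_cases i
      · simpa using hCo0 1
      · simpa using hCo0 0
    calc _ ≤ Co i * ((1 + Ml) * size (P.xiPar Y 0) (P.xParE K Y)) :=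
          mul_le_mul_of_nonneg_left h5 (hCo0 i)
      _ ≤ (Co 0 + Co 1) * ((1 + Ml) * size (P.xiPar Y 0) (P.xParE K Y)) :=
          mul_le_mul_of_nonneg_right h6 (mul_nonneg (by linarith) (size_nonneg _ _))
      _ = _ := by ring
  let T : ℝ := P.tau 0 + P.tau 1
  have hT : ∀ i, P.tau i ≤ T := fun i => by
    have h0 := (P.tau_pos 0).le
    have h1 := (P.tau_pos 1).le
    fin_cases i <;> simp only [T] <;> simp [h0, h1]
  have hT0 : 0 ≤ T := (P.tau_pos 0).le.trans (hT 0)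
  let C2 : ℝ := c * (1 + C1 + T * C1) + Ce * (CT * C1)
  have hC2 : 0 ≤ C2 := by positivity
  refine ⟨CT * C1 + C2, by positivity, fun Y hY => ⟨fun k hk τ hτ => ?_, fun i z hz => ?_⟩⟩
  · have h1 : ∃ i s, s ∈ Icc 0 (P.tau i) ∧ τ = sgn i * s := by
      rcases le_total 0 τ with h | h
      · exact ⟨0, τ, ⟨h, hτ.2⟩, by rw [sgn_zero, one_mul]⟩
      · exact ⟨1, -τ, ⟨by linarith, by linarith [hτ.1]⟩, by rw [sgn_one]; ring⟩
    obtain ⟨i, s, hs, rfl⟩ := h1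
    have h2 := congrFun (P.Tc_mulVec_xiPar hu Y (sgn i * s)) ⟨k, hk⟩
    simp only at h2
    rw [← h2]
    refine (hCT _ _).trans ?_
    have := mul_le_mul_of_nonneg_left (hξ Y hY i s hs) hCT0
    have h3 := mul_nonneg hC2 (size_nonneg (P.xiPar Y 0) (P.xParE K Y))
    linarith
  · have hφ := P.phiE_mem_Icc i hz
    have h1 := hqx Y hY i _ hφ.1
    rw [P.phiInv_phiE] at h1
    have h2 := hξ Y hY i _ hφ
    set S := size (P.xiPar Y 0) (P.xParE K Y)
    have hS : 0 ≤ S := size_nonneg _ _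
    have h3 : ∫ r in (0 : ℝ)..(P.phiE i z), ‖P.xiPar Y (sgn i * r)‖ ≤ T * (C1 * S) := by
      have := intervalIntegral.norm_integral_le_of_norm_le_const (a := 0) (b := P.phiE i z)
        (f := fun r => ‖P.xiPar Y (sgn i * r)‖) (C := C1 * S) fun r hr => by
          rw [uIoc_of_le hφ.1] at hr
          rw [norm_norm]
          exact hξ Y hY i r ⟨hr.1.le, hr.2.trans hφ.2⟩
      refine (le_abs_self _).trans (this.trans ?_)
      rw [sub_zero, abs_of_nonneg hφ.1, mul_comm]
      exact mul_le_mul_of_nonneg_right (hφ.2.trans (hT i)) (by positivity)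
    have h4 : Y n (sgn i * P.phiE i z) = P.p1Par Y (sgn i * P.phiE i z)
        + (Matrix.vecMul (eLast n) (P.Tc * P.F * P.Tc⁻¹)) ⬝ᵥ
          P.Tc.mulVec (P.xiPar Y (sgn i * P.phiE i z)) := by
      rw [P.Tc_mulVec_xiPar hu, ← Matrix.dotProduct_mulVec, p1Par]
      ring
    have h5 : ‖P.Tc.mulVec (P.xiPar Y (sgn i * P.phiE i z))‖ ≤ CT * (C1 * S) := by
      rw [pi_norm_le_iff_of_nonneg (by positivity)]
      exact fun j => (hCT _ j).trans (mul_le_mul_of_nonneg_left h2 hCT0)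
    have h6 := (hCe (P.Tc.mulVec (P.xiPar Y (sgn i * P.phiE i z)))).trans
      (mul_le_mul_of_nonneg_left h5 hCe0)
    rw [h4]
    refine (abs_add_le _ _).trans ((add_le_add h1 h6).trans ?_)
    have hx0 := abs_nonneg (P.xParE K Y i z)
    have h7 : c * (|P.xParE K Y i z| + ‖P.xiPar Y (sgn i * P.phiE i z)‖
        + ∫ r in (0 : ℝ)..(P.phiE i z), ‖P.xiPar Y (sgn i * r)‖)
        ≤ c * (|P.xParE K Y i z| + C1 * S + T * (C1 * S)) := by
      apply mul_le_mul_of_nonneg_left _ hc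
      linarith
    have h8 : c * |P.xParE K Y i z| ≤ (CT * C1 + C2) * |P.xParE K Y i z| := by
      apply mul_le_mul_of_nonneg_right _ hx0
      have e1 : 0 ≤ CT * C1 := by positivity
      have e2 : 0 ≤ c * C1 := by positivity
      have e3 : 0 ≤ c * (T * C1) := by positivity
      have e4 : 0 ≤ Ce * (CT * C1) := by positivity
      simp only [C2]
      linarith
    have h9 : c * (C1 * S + T * (C1 * S)) + Ce * (CT * (C1 * S)) ≤ (CT * C1 + C2) * S := by
      have e1 : 0 ≤ CT * C1 * S := by positivity
      have e2 : 0 ≤ c * S := by positivity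
      simp only [C2]
      linarith
    linarith

/-- The generated state is controlled by the trajectory segment. -/
theorem exists_bound_state_of_jet (hK : P.IsKernel K) :
    ∃ C ≥ 0, ∀ Y, IsGlobalJet n Y → ∀ S, S = (‖fun i : Fin n => Y i (-P.tau 1)‖
        + ∫ σ in (-P.tau 1)..(P.tau 0), |Y n σ|) →
      ‖P.xiPar Y 0‖ ≤ C * S ∧ ∀ i, ∀ z ∈ Icc (0 : ℝ) 1,
        |P.xParE K Y i z| ≤ C * (|Y n (sgn i * P.phiE i z)| + S) := by
  obtain ⟨M, hM⟩ := exists_delayCoeff_bound hK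
  have hM0 : 0 ≤ M := (abs_nonneg _).trans (hM 0 0)
  obtain ⟨Cc, hCc0, hCc⟩ := exists_dotProduct_bound P.c
  obtain ⟨CT, hCT0, hCT⟩ := exists_mulVec_bound P.Tc⁻¹
  obtain ⟨Ce, hCe0, hCe⟩ := exists_dotProduct_bound (Matrix.vecMul (eLast n) (P.Tc * P.F * P.Tc⁻¹))
  let T : ℝ := P.tau 0 + P.tau 1
  have hT : ∀ i, P.tau i ≤ T := fun i => by
    have h0 := (P.tau_pos 0).le
    have h1 := (P.tau_pos 1).le
    fin_cases i <;> simp only [T] <;> simp [h0, h1]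
  have hT0 : 0 ≤ T := (P.tau_pos 0).le.trans (hT 0)
  let D : ℝ := (2 * (1 + T)) ^ n
  have hD : 0 ≤ D := by positivity
  let C1 : ℝ := CT * D
  let C2 : ℝ := (1 + |P.q0|) * (1 + Ce * D) + Cc * C1 + M * Cc * (T * C1)
  have hC1 : 0 ≤ C1 := by positivity
  have hC2 : 0 ≤ C2 := by positivity
  refine ⟨C1 + C2, by positivity, fun Y hY S hS => ?_⟩
  have hS0 : 0 ≤ S := by
    rw [hS]
    exact add_nonneg (norm_nonneg _) (intervalIntegral.integral_nonneg P.window_le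
      fun _ _ => abs_nonneg _)
  have hYk : ∀ τ ∈ P.window, ‖fun k : Fin n => Y k τ‖ ≤ D * S := by
    intro τ hτ
    rw [pi_norm_le_iff_of_nonneg (by positivity)]
    intro k
    have := hY.abs_le k.2 hτ
    rw [← hS] at this
    have e : D = (2 * (1 + (P.tau 0 - -P.tau 1))) ^ n := by simp only [D, T, sub_neg_eq_add]
    rwa [e]
  have hξ : ∀ τ ∈ P.window, ‖P.xiPar Y τ‖ ≤ C1 * S := by
    intro τ hτ
    rw [pi_norm_le_iff_of_nonneg (by positivity)]
    intro k
    refine (hCT _ k).trans ((mul_le_mul_of_nonneg_left (hYk τ hτ) hCT0).trans (le_of_eq ?_))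
    simp only [C1]
    ring
  have hp : ∀ τ ∈ P.window, |P.p1Par Y τ| ≤ |Y n τ| + Ce * D * S := by
    intro τ hτ
    rw [p1Par, Matrix.dotProduct_mulVec]
    refine (abs_sub _ _).trans ?_
    have := (hCe fun k : Fin n => Y k τ).trans (mul_le_mul_of_nonneg_left (hYk τ hτ) hCe0)
    linarith
  refine ⟨?_, fun i z hz => ?_⟩
  · have := mul_nonneg hC2 hS0
    linarith [hξ 0 P.zero_mem_window]
  · have hφ := P.phiE_mem_Icc i hz
    have hw := P.sgn_mul_mem_window i hφ
    have h1 : |P.pPar Y i (sgn i * P.phiE i z)|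
        ≤ (1 + |P.q0|) * (|Y n (sgn i * P.phiE i z)| + Ce * D * S) + Cc * (C1 * S) := by
      have h2 := hp _ hw
      have h3 := (hCc _).trans (mul_le_mul_of_nonneg_left (hξ _ hw) hCc0)
      have h4 : 0 ≤ Cc * (C1 * S) := by positivity
      set v := |Y n (sgn i * P.phiE i z)|
      have h5 : 0 ≤ |P.q0| * (v + Ce * D * S) := by positivity
      have h6 : ∀ j, j = i → |P.pPar Y j (sgn i * P.phiE i z)|
          ≤ (1 + |P.q0|) * (v + Ce * D * S) + Cc * (C1 * S) := by
        intro j _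
        have h7 : 0 ≤ v + Ce * D * S := by positivity
        fin_cases j
        · simp only [Fin.zero_eta, pPar_zero]
          linarith
        · simp only [Fin.mk_one, pPar_one]
          refine (abs_add_le _ _).trans ?_
          rw [abs_mul]
          have := mul_le_mul_of_nonneg_left h2 (abs_nonneg P.q0)
          linarith
      exact h6 i rfl
    have h2 := abs_delay_le hM hCc i (X := fun s => P.xiPar Y (sgn i * s))
      ((continuous_xiPar hY).comp (continuous_const.mul continuous_id)) hφ.1
    have h3 : ∫ r in (0 : ℝ)..(P.phiE i z), ‖P.xiPar Y (sgn i * r)‖ ≤ T * (C1 * S) := by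
      have := intervalIntegral.norm_integral_le_of_norm_le_const (a := 0) (b := P.phiE i z)
        (f := fun r => ‖P.xiPar Y (sgn i * r)‖) (C := C1 * S) fun r hr => by
          rw [uIoc_of_le hφ.1] at hr
          rw [norm_norm]
          exact hξ _ (P.sgn_mul_mem_window i ⟨hr.1.le, hr.2.trans hφ.2⟩)
      refine (le_abs_self _).trans (this.trans ?_)
      rw [sub_zero, abs_of_nonneg hφ.1, mul_comm]
      exact mul_le_mul_of_nonneg_right (hφ.2.trans (hT i)) (by positivity)
    have h4 := mul_le_mul_of_nonneg_left h3 (by positivity : 0 ≤ M * Cc)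
    rw [xParE]
    refine (abs_sub _ _).trans ?_
    rw [abs_mul, abs_sgn, one_mul]
    have hv := abs_nonneg (Y n (sgn i * P.phiE i z))
    set v := |Y n (sgn i * P.phiE i z)|
    have h5 : (1 + |P.q0|) * v ≤ (C1 + C2) * v := by
      apply mul_le_mul_of_nonneg_right _ hv
      have e1 : 0 ≤ (1 + |P.q0|) * (Ce * D) := by positivity
      have e2 : 0 ≤ Cc * C1 := by positivity
      have e3 : 0 ≤ M * Cc * (T * C1) := by positivity
      simp only [C2]
      linarith
    have h6 : (1 + |P.q0|) * (Ce * D * S) + Cc * (C1 * S) + M * Cc * (T * (C1 * S))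
        ≤ (C1 + C2) * S := by
      have e1 : 0 ≤ C1 * S := by positivity
      have e2 : 0 ≤ (1 + |P.q0|) * S := by positivity
      simp only [C2]
      linarith
    linarith

end System

theorem integral_sq_le_of_abs_le {f g : ℝ → ℝ} (hf : LocBounded f) (hg : LocBounded g) {C S : ℝ}
    (h : ∀ z ∈ Ioc (0 : ℝ) 1, |f z| ≤ C * (|g z| + S)) :
    ∫ z in (0 : ℝ)..1, f z ^ 2 ≤ 2 * C ^ 2 * ((∫ z in (0 : ℝ)..1, g z ^ 2) + S ^ 2) := by
  have hf2 : LocBounded fun s => f s ^ 2 := by simpa [sq] using hf.mul hf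
  have hg2 : LocBounded fun s => g s ^ 2 := by simpa [sq] using hg.mul hg
  have e : 2 * C ^ 2 * ((∫ z in (0 : ℝ)..1, g z ^ 2) + S ^ 2)
      = ∫ z in (0 : ℝ)..1, 2 * C ^ 2 * (g z ^ 2 + S ^ 2) := by
    rw [intervalIntegral.integral_const_mul, intervalIntegral.integral_add
      (hg2.intervalIntegrable _ _) intervalIntegrable_const, intervalIntegral.integral_const]
    simp
  rw [e]
  refine intervalIntegral.integral_mono_on_of_le_Ioo zero_le_one (hf2.intervalIntegrable _ _)
    (((hg2.add (.const _)).const_mul _).intervalIntegrable _ _) fun z hz => ?_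
  have h1 := h z ⟨hz.1, hz.2.le⟩
  have h2 : f z ^ 2 ≤ (C * (|g z| + S)) ^ 2 := by
    rw [← sq_abs]
    exact pow_le_pow_left₀ (abs_nonneg _) h1 2
  refine h2.trans ?_
  rw [mul_pow, ← sq_abs (g z), mul_comm 2, mul_assoc]
  refine mul_le_mul_of_nonneg_left ?_ (sq_nonneg C)
  nlinarith [sq_nonneg (|g z| - S)]

/-! ### The backstepping transformation as an invertible bounded operator -/

namespace System

variable {n : ℕ} (P : System n) (K : ℝ → ℝ → Matrix (Fin 2) (Fin 2) ℝ)

/-- The transformed profile, extended to the real line. -/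
def xbarE (X : Fin 2 → ℝ → ℝ) (j : Fin 2) (z : ℝ) : ℝ :=
  P.scaleE j z * X j z - ∫ ζ in (0 : ℝ)..z, ∑ k, kerE K z ζ j k * (P.scaleE k ζ * X k ζ)

theorem xbar_eq_xbarE (X : Fin 2 → ℝ → ℝ) (j : Fin 2) {z : ℝ} (hz : z ∈ Icc (0 : ℝ) 1) :
    P.xbar K X j z = P.xbarE K X j z := by
  rw [xbar, xbarE, scaled, P.E_of_mem j hz]
  congr 1
  refine intervalIntegral.integral_congr fun ζ hζ => ?_
  rw [uIcc_of_le hz.1] at hζ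
  simp only [Matrix.mulVec, dotProduct, scaled, P.E_of_mem _ ⟨hζ.1, hζ.2.trans hz.2⟩]
  rw [kerE_of_mem K ⟨hζ.1, hζ.2, hz.2⟩]

/-- The Volterra integral does not see the point `0`. Profiles are compared on `(0,1]` because at `z
= 0` both components would prescribe `y⁽ⁿ⁾` at the present time. -/
theorem xbar_congr {X X' : Fin 2 → ℝ → ℝ} (h : ∀ j, ∀ z ∈ Ioc (0 : ℝ) 1, X j z = X' j z) (j : Fin 2)
    {z : ℝ} (hz : z ∈ Ioc (0 : ℝ) 1) : P.xbar K X j z = P.xbar K X' j z := by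
  rw [xbar, xbar, scaled, scaled, h j z hz]
  congr 1
  refine intervalIntegral.integral_congr_ae (Filter.Eventually.of_forall fun ζ hζ => ?_)
  rw [uIoc_of_le hz.1.le] at hζ
  have : P.scaled X ζ = P.scaled X' ζ :=
    funext fun k => by rw [scaled, scaled, h k ζ ⟨hζ.1, hζ.2.trans hz.2⟩]
  rw [this]

variable {P K}

theorem exists_kerE_bound (hK : P.IsKernel K) : ∃ M ≥ 0, ∀ z ζ i j, |kerE K z ζ i j| ≤ M := by
  have hT : IsCompact triangle := by
    refine (isCompact_Icc (a := (0 : ℝ)) (b := 1)).prod (isCompact_Icc (a := (0 : ℝ)) (b := 1))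
      |>.of_isClosed_subset ?_ ?_
    · exact (isClosed_le continuous_const continuous_snd).inter
        ((isClosed_le continuous_snd continuous_fst).inter
          (isClosed_le continuous_fst continuous_const))
    · rintro p ⟨h0, h1, h2⟩
      exact ⟨⟨h0.trans h1, h2⟩, h0, h1.trans h2⟩
  choose B hB using fun i j => hT.exists_bound_of_continuousOn (hK.continuous i j)
  refine ⟨∑ i, ∑ j, |B i j|, by positivity, fun z ζ i j => ?_⟩
  refine ((hB i j _ (retract_mem_triangle z ζ)).trans (le_abs_self _)).trans ?_
  exact (Finset.single_le_sum (f := fun j => |B i j|) (fun _ _ => abs_nonneg _)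
    (Finset.mem_univ j)).trans (Finset.single_le_sum (f := fun i => ∑ j, |B i j|)
    (fun _ _ => Finset.sum_nonneg fun _ _ => abs_nonneg _) (Finset.mem_univ i))

theorem measurable_volterra (hK : P.IsKernel K) {y : Fin 2 → ℝ → ℝ} (hy : ∀ k, LocBounded (y k))
    (j : Fin 2) : LocBounded fun z => ∫ ζ in (0 : ℝ)..z, ∑ k, kerE K z ζ j k * y k ζ := by
  obtain ⟨M, hM0, hM⟩ := exists_kerE_bound hK
  refine ⟨measurable_intervalIntegral measurable_const measurable_id ?_, fun T => ?_⟩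
  · exact Finset.measurable_sum _ fun k _ => ((continuous_kerE hK.continuous j k).measurable).mul
      ((hy k).measurable.comp measurable_snd)
  · choose B hB using fun k => (hy k).bounded T
    refine ⟨∑ k, M * |B k| * |T|, fun t ht => ?_⟩
    have h1 := intervalIntegral.norm_integral_le_of_norm_le_const (a := 0) (b := t)
      (f := fun ζ => ∑ k, kerE K t ζ j k * y k ζ) (C := ∑ k, M * |B k|) fun s hs => by
        refine (norm_sum_le _ _).trans (Finset.sum_le_sum fun k _ => ?_)
        rw [norm_mul]
        refine mul_le_mul (hM _ _ _ _) ((hB k s ?_).trans (le_abs_self _)) (norm_nonneg _) hM0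
        refine le_trans ?_ ht
        rcases le_total 0 t with h | h
        · rw [uIoc_of_le h] at hs
          rw [abs_of_pos hs.1, abs_of_nonneg h]; exact hs.2
        · rw [uIoc_of_ge h] at hs
          rw [abs_of_nonpos hs.2, abs_of_nonpos h]; linarith [hs.1]
    rw [sub_zero, Real.norm_eq_abs] at h1
    rw [← Finset.sum_mul]
    exact h1.trans (mul_le_mul_of_nonneg_left (ht.trans (le_abs_self T)) (by positivity))

theorem abs_volterra_le {M : ℝ} (hM : ∀ z ζ i j, |kerE K z ζ i j| ≤ M)
    {y : Fin 2 → ℝ → ℝ} (hy : ∀ k, LocBounded (y k)) (j : Fin 2) {z : ℝ} (hz : 0 ≤ z) :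
    |∫ ζ in (0 : ℝ)..z, ∑ k, kerE K z ζ j k * y k ζ| ≤ M * ∫ ζ in (0 : ℝ)..z, (|y 0 ζ| + |y 1 ζ|) := by
  rw [← Real.norm_eq_abs, ← intervalIntegral.integral_const_mul]
  refine intervalIntegral.norm_integral_le_of_norm_le hz
    (Filter.Eventually.of_forall fun ζ _ => ?_)
    ((((hy 0).abs.add (hy 1).abs).const_mul _).intervalIntegrable _ _)
  rw [Fin.sum_univ_two, mul_add]
  refine (norm_add_le _ _).trans (add_le_add ?_ ?_)
  · rw [norm_mul]; exact mul_le_mul_of_nonneg_right (hM _ _ _ _) (norm_nonneg _)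
  · rw [norm_mul]; exact mul_le_mul_of_nonneg_right (hM _ _ _ _) (norm_nonneg _)

theorem exists_scaleE_bound (P : System n) :
    ∃ M > 0, ∀ i, ∀ z ∈ Icc (0 : ℝ) 1, P.scaleE i z ≤ M ∧ 1 / P.scaleE i z ≤ M := by
  choose B hB using fun i => (isCompact_Icc (a := (0 : ℝ)) (b := 1)).exists_bound_of_continuousOn
    (P.continuous_scaleE i).continuousOn
  choose D hD using fun i => (isCompact_Icc (a := (0 : ℝ)) (b := 1)).exists_bound_of_continuousOn
    (continuous_const.div (P.continuous_scaleE i) fun z => (P.scaleE_pos i z).ne').continuousOn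
    (f := fun z => 1 / P.scaleE i z)
  refine ⟨1 + |B 0| + |B 1| + |D 0| + |D 1|, by positivity, fun i z hz => ?_⟩
  have h1 := (le_abs_self _).trans ((hB i z hz).trans (le_abs_self _))
  have h2 := (le_abs_self _).trans ((hD i z hz).trans (le_abs_self _))
  have := abs_nonneg (B 0)
  have := abs_nonneg (B 1)
  have := abs_nonneg (D 0)
  have := abs_nonneg (D 1)
  fin_cases i
  · simp only [Fin.zero_eta] at *; constructor <;> linarith
  · simp only [Fin.mk_one] at *; constructor <;> linarith

/-- The `L¹` norm of a pair of profiles. -/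
def mass (x : Fin 2 → ℝ → ℝ) : ℝ := (∫ z in (0 : ℝ)..1, |x 0 z|) + ∫ z in (0 : ℝ)..1, |x 1 z|

theorem mass_nonneg (x : Fin 2 → ℝ → ℝ) : 0 ≤ mass x := by
  have := fun j => intervalIntegral.integral_nonneg (μ := volume) (zero_le_one (α := ℝ))
    fun z (_ : z ∈ Icc (0 : ℝ) 1) => abs_nonneg (x j z)
  exact add_nonneg (this 0) (this 1)

theorem mass_le {x y : Fin 2 → ℝ → ℝ} (hx : ∀ k, LocBounded (x k)) (hy : ∀ k, LocBounded (y k))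
    {C S : ℝ} (h : ∀ j, ∀ z ∈ Ioc (0 : ℝ) 1, |x j z| ≤ C * (|y j z| + S)) :
    mass x ≤ C * (mass y + 2 * S) := by
  have key : ∀ j, ∫ z in (0 : ℝ)..1, |x j z| ≤ C * ((∫ z in (0 : ℝ)..1, |y j z|) + S) := by
    intro j
    have e : C * ((∫ z in (0 : ℝ)..1, |y j z|) + S) = ∫ z in (0 : ℝ)..1, C * (|y j z| + S) := by
      rw [intervalIntegral.integral_const_mul, intervalIntegral.integral_add
        ((hy j).abs.intervalIntegrable _ _) intervalIntegrable_const, intervalIntegral.integral_const]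
      simp
    rw [e]
    exact intervalIntegral.integral_mono_on_of_le_Ioo zero_le_one ((hx j).abs.intervalIntegrable _ _)
      ((((hy j).abs.add (.const _)).const_mul _).intervalIntegrable _ _)
      fun z hz => h j z ⟨hz.1, hz.2.le⟩
  have h0 := key 0
  have h1 := key 1
  simp only [mass]
  linarith

theorem locBounded_xbarE (hK : P.IsKernel K) {X : Fin 2 → ℝ → ℝ} (hX : ∀ k, LocBounded (X k))
    (j : Fin 2) : LocBounded (P.xbarE K X j) := by
  have hy : ∀ k, LocBounded fun z => P.scaleE k z * X k z := fun k =>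
    (LocBounded.of_continuous (P.continuous_scaleE k)).mul (hX k)
  exact (hy j).sub (measurable_volterra hK hy j)

/-- The bound for the transformation is immediate. For its inverse, the scaled profile is the image
plus a Volterra term, and Gronwall's inequality for the primitive of `|y 0| + |y 1|` removes that
term. The profile enters pointwise and the correction in `L¹`, which allows the bounds to be squared
later. -/
theorem exists_bound_xbarE (hK : P.IsKernel K) : ∃ C ≥ 0, ∀ X : Fin 2 → ℝ → ℝ,
    (∀ k, LocBounded (X k)) → ∀ j, ∀ z ∈ Icc (0 : ℝ) 1,
      |P.xbarE K X j z| ≤ C * (|X j z| + mass X) ∧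
      |X j z| ≤ C * (|P.xbarE K X j z| + mass (P.xbarE K X)) := by
  obtain ⟨M, hM0, hM⟩ := exists_kerE_bound hK
  obtain ⟨Ms, hMs0, hMs⟩ := exists_scaleE_bound P
  refine ⟨Ms + M * Ms + Ms * (2 * M * Real.exp (2 * M)) + Ms * M * (1 + 2 * M * Real.exp (2 * M)),
    by positivity, fun X hX => ?_⟩
  let y : Fin 2 → ℝ → ℝ := fun k z => P.scaleE k z * X k z
  have hy : ∀ k, LocBounded (y k) := fun k =>
    (LocBounded.of_continuous (P.continuous_scaleE k)).mul (hX k)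
  have hxb := locBounded_xbarE hK hX
  have hyb : ∀ j z, P.xbarE K X j z = y j z - ∫ ζ in (0 : ℝ)..z, ∑ k, kerE K z ζ j k * y k ζ :=
    fun j z => rfl
  have hyX : ∀ k, ∀ z ∈ Icc (0 : ℝ) 1, |y k z| ≤ Ms * |X k z| := fun k z hz => by
    rw [abs_mul, abs_of_pos (P.scaleE_pos k z)]
    exact mul_le_mul_of_nonneg_right (hMs k z hz).1 (abs_nonneg _)
  have hXy : ∀ k, ∀ z ∈ Icc (0 : ℝ) 1, |X k z| ≤ Ms * |y k z| := fun k z hz => by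
    have : X k z = 1 / P.scaleE k z * y k z := by
      simp only [y]
      field_simp [(P.scaleE_pos k z).ne']
    rw [this, abs_mul, abs_of_pos (one_div_pos.2 (P.scaleE_pos k z))]
    exact mul_le_mul_of_nonneg_right (hMs k z hz).2 (abs_nonneg _)
  have hy01 := (hy 0).abs.add (hy 1).abs
  have hmX := mass_nonneg X
  have hmb := mass_nonneg (P.xbarE K X)
  have hVle : ∀ j, ∀ z ∈ Icc (0 : ℝ) 1, |∫ ζ in (0 : ℝ)..z, ∑ k, kerE K z ζ j k * y k ζ|
      ≤ M * ∫ ζ in (0 : ℝ)..z, (|y 0 ζ| + |y 1 ζ|) := fun j z hz => abs_volterra_le hM hy j hz.1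
  have hmono : ∀ z ∈ Icc (0 : ℝ) 1, ∫ ζ in (0 : ℝ)..z, (|y 0 ζ| + |y 1 ζ|) ≤ mass y := fun z hz => by
    have := integral_le_of_subinterval hy01
      (fun _ => add_nonneg (abs_nonneg _) (abs_nonneg _)) le_rfl hz.1 hz.2
    rwa [intervalIntegral.integral_add (a := 0) (b := 1) ((hy 0).abs.intervalIntegrable _ _)
      ((hy 1).abs.intervalIntegrable _ _)] at this
  have hgron : ∀ z ∈ Icc (0 : ℝ) 1, ∫ ζ in (0 : ℝ)..z, (|y 0 ζ| + |y 1 ζ|)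
      ≤ mass (P.xbarE K X) * Real.exp (2 * M * z) := by
    refine le_mul_exp_of_le_add_integral (by positivity)
      (hy01.continuous_primitive 0).continuousOn fun t ht => ?_
    have hc := LocBounded.of_continuous (hy01.continuous_primitive 0)
    have hxb01 := (hxb 0).abs.add (hxb 1).abs
    have h1 : ∫ ζ in (0 : ℝ)..t, (|y 0 ζ| + |y 1 ζ|) ≤ ∫ z in (0 : ℝ)..t,
        ((|P.xbarE K X 0 z| + |P.xbarE K X 1 z|)
          + 2 * M * ∫ ζ in (0 : ℝ)..z, (|y 0 ζ| + |y 1 ζ|)) := by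
      refine intervalIntegral.integral_mono_on ht.1 (hy01.intervalIntegrable _ _)
        ((hxb01.add (hc.const_mul _)).intervalIntegrable _ _) fun z hz => ?_
      have hz' : z ∈ Icc (0 : ℝ) 1 := ⟨hz.1, hz.2.trans ht.2⟩
      have h2 : ∀ j, |y j z| ≤ |P.xbarE K X j z| + M * ∫ ζ in (0 : ℝ)..z, (|y 0 ζ| + |y 1 ζ|) := by
        intro j
        have : y j z = P.xbarE K X j z + ∫ ζ in (0 : ℝ)..z, ∑ k, kerE K z ζ j k * y k ζ := by
          rw [hyb]; ring
        rw [this]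
        exact (abs_add_le _ _).trans (add_le_add le_rfl (hVle j z hz'))
      linarith [h2 0, h2 1]
    rw [intervalIntegral.integral_add (hxb01.intervalIntegrable _ _)
      ((hc.const_mul _).intervalIntegrable _ _), intervalIntegral.integral_const_mul] at h1
    have h3 := integral_le_of_subinterval hxb01
      (fun _ => add_nonneg (abs_nonneg _) (abs_nonneg _)) le_rfl ht.1 ht.2
    rw [intervalIntegral.integral_add (a := 0) (b := 1) ((hxb 0).abs.intervalIntegrable _ _)
      ((hxb 1).abs.intervalIntegrable _ _)] at h3
    simp only [mass]
    linarith
  have hmy : mass y ≤ Ms * mass X := by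
    have := mass_le (x := y) (y := X) (S := 0) hy hX
      fun j z hz => by simpa using hyX j z (Ioc_subset_Icc_self hz)
    simpa using this
  intro j z hz
  have hX0 := abs_nonneg (X j z)
  have hb0 := abs_nonneg (P.xbarE K X j z)
  set e := Real.exp (2 * M) with he
  have he0 : 0 < e := Real.exp_pos _
  constructor
  · rw [hyb]
    have h1 := (hVle j z hz).trans (mul_le_mul_of_nonneg_left ((hmono z hz).trans hmy) hM0)
    refine (abs_sub _ _).trans ((add_le_add (hyX j z hz) h1).trans ?_)
    have e1 : 0 ≤ (M * Ms + Ms * (2 * M * e) + Ms * M * (1 + 2 * M * e)) * |X j z| := by positivity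
    have e2 : 0 ≤ (Ms + Ms * (2 * M * e) + Ms * M * (1 + 2 * M * e)) * mass X := by positivity
    linarith
  · have h1 := hgron z hz
    have h2 : Real.exp (2 * M * z) ≤ e :=
      Real.exp_le_exp.2 (mul_le_of_le_one_right (by positivity) hz.2)
    have h3 := h1.trans (mul_le_mul_of_nonneg_left h2 hmb)
    have h4 := (hVle j z hz).trans (mul_le_mul_of_nonneg_left h3 hM0)
    have h5 : |y j z| ≤ |P.xbarE K X j z| + M * (mass (P.xbarE K X) * e) := by
      have : y j z = P.xbarE K X j z + ∫ ζ in (0 : ℝ)..z, ∑ k, kerE K z ζ j k * y k ζ := by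
        rw [hyb]; ring
      rw [this]
      exact (abs_add_le _ _).trans (add_le_add le_rfl h4)
    refine (hXy j z hz).trans ((mul_le_mul_of_nonneg_left h5 hMs0.le).trans ?_)
    have e1 : 0 ≤ (M * Ms + Ms * (2 * M * e) + Ms * M * (1 + 2 * M * e)) * |P.xbarE K X j z| := by
      positivity
    have e2 : 0 ≤ (Ms + M * Ms + Ms * (M * e) + Ms * M * (1 + 2 * M * e))
        * mass (P.xbarE K X) := by positivity
    linarith

/-- Two-sided bounds between states and the trajectory segments that generate them. -/
theorem exists_bound_state_jet (hu : IsUnit P.kalman.det) (hq0 : P.q0 ≠ 0) (hK : P.IsKernel K) :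
    ∃ C > 0, ∀ Y, IsGlobalJet n Y → ∀ X : Fin 2 → ℝ → ℝ, (∀ k, LocBounded (X k)) →
      (∀ j, ∀ z ∈ Ioc (0 : ℝ) 1, P.xbar K X j z = P.xPar K Y j z) →
      (∀ k < n, ∀ τ ∈ P.window, |Y k τ| ≤ C * (‖P.xiPar Y 0‖ + mass X)) ∧
      (∀ i, ∀ z ∈ Ioc (0 : ℝ) 1, |Y n (sgn i * P.phiE i z)|
        ≤ C * (|X i z| + (‖P.xiPar Y 0‖ + mass X))) ∧
      ∀ S, S = (‖fun i : Fin n => Y i (-P.tau 1)‖ + ∫ σ in (-P.tau 1)..(P.tau 0), |Y n σ|) →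
      ‖P.xiPar Y 0‖ ≤ C * S ∧ ∀ i, ∀ z ∈ Ioc (0 : ℝ) 1,
        |X i z| ≤ C * (|Y n (sgn i * P.phiE i z)| + (S + mass (P.xParE K Y))) ∧
        |P.xParE K Y i z| ≤ C * (|Y n (sgn i * P.phiE i z)| + S) := by
  obtain ⟨C1, hC1, h1⟩ := exists_bound_jet_of_state hu hq0 hK
  obtain ⟨C2, hC2, h2⟩ := exists_bound_state_of_jet hK
  obtain ⟨C3, hC3, h3⟩ := exists_bound_xbarE hK
  refine ⟨1 + C1 * (1 + 4 * C3) + C2 + C3 * (1 + C2), by positivity,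
    fun Y hY X hX hXY => ?_⟩
  have hE : ∀ j, ∀ z ∈ Ioc (0 : ℝ) 1, P.xParE K Y j z = P.xbarE K X j z := fun j z hz => by
    rw [← P.xPar_eq_xParE K Y j (Ioc_subset_Icc_self hz),
      ← P.xbar_eq_xbarE K X j (Ioc_subset_Icc_self hz), hXY j z hz]
  have hxP := locBounded_xParE hK hY
  have hxb := locBounded_xbarE hK hX
  have hmass : mass (P.xbarE K X) = mass (P.xParE K Y) := by
    have : ∀ j, ∫ z in (0 : ℝ)..1, |P.xbarE K X j z| = ∫ z in (0 : ℝ)..1, |P.xParE K Y j z| :=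
      fun j => intervalIntegral.integral_congr_ae (Filter.Eventually.of_forall fun z hz => by
        rw [uIoc_of_le zero_le_one] at hz
        rw [hE j z hz])
    rw [mass, mass, this 0, this 1]
  have hmX := mass_nonneg X
  have hmP := mass_nonneg (P.xParE K Y)
  have hmPX : mass (P.xParE K Y) ≤ C3 * (mass X + 2 * mass X) :=
    mass_le hxP hX fun j z hz => by
      rw [hE j z hz]; exact (h3 X hX j z (Ioc_subset_Icc_self hz)).1
  have hξ0 := norm_nonneg (P.xiPar Y 0)
  have hsize : size (P.xiPar Y 0) (P.xParE K Y) ≤ (1 + 3 * C3) * (‖P.xiPar Y 0‖ + mass X) := by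
    have : size (P.xiPar Y 0) (P.xParE K Y) = ‖P.xiPar Y 0‖ + mass (P.xParE K Y) := rfl
    rw [this]
    have : 0 ≤ C3 * ‖P.xiPar Y 0‖ := by positivity
    linarith
  refine ⟨fun k hk τ hτ => ?_, fun i z hz => ?_, fun S hS => ⟨?_, fun i z hz => ?_⟩⟩
  · refine ((h1 Y hY).1 k hk τ hτ).trans ((mul_le_mul_of_nonneg_left hsize hC1).trans ?_)
    have : 0 ≤ (1 + C1 * C3 + C2 + C3 * (1 + C2)) * (‖P.xiPar Y 0‖ + mass X) := by positivity
    linarith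
  · have hz' := Ioc_subset_Icc_self hz
    refine ((h1 Y hY).2 i z hz').trans ?_
    have h4 := (h3 X hX i z hz').1
    rw [← hE i z hz] at h4
    have hx0 := abs_nonneg (X i z)
    have h5 : |P.xParE K Y i z| + size (P.xiPar Y 0) (P.xParE K Y)
        ≤ C3 * |X i z| + C3 * mass X + (‖P.xiPar Y 0‖ + mass (P.xParE K Y)) :=
      by have : size (P.xiPar Y 0) (P.xParE K Y) = ‖P.xiPar Y 0‖ + mass (P.xParE K Y) := rfl
         rw [this]; linarith
    have h6 := mul_le_mul_of_nonneg_left h5 hC1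
    refine h6.trans ?_
    have h7 := mul_le_mul_of_nonneg_left hmPX hC1
    have e1 : 0 ≤ (1 + C1 * (1 + 3 * C3) + C2 + C3 * (1 + C2)) * |X i z| := by positivity
    have e2 : 0 ≤ (1 + C2 + C3 * (1 + C2)) * (‖P.xiPar Y 0‖ + mass X) := by positivity
    have e3 : 0 ≤ C1 * mass X := by positivity
    have e4 : 0 ≤ C1 * C3 * ‖P.xiPar Y 0‖ := by positivity
    linarith
  · have hS0 : 0 ≤ S := by
      rw [hS]
      exact add_nonneg (norm_nonneg _) (intervalIntegral.integral_nonneg P.window_le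
        fun _ _ => abs_nonneg _)
    refine (h2 Y hY S hS).1.trans (mul_le_mul_of_nonneg_right ?_ hS0)
    have : 0 ≤ C1 * (1 + 4 * C3) := by positivity
    have : 0 ≤ C3 * (1 + C2) := by positivity
    linarith
  · have hS0 : 0 ≤ S := by
      rw [hS]
      exact add_nonneg (norm_nonneg _) (intervalIntegral.integral_nonneg P.window_le
        fun _ _ => abs_nonneg _)
    have hz' := Ioc_subset_Icc_self hz
    have hv := abs_nonneg (Y n (sgn i * P.phiE i z))
    have h4 := (h3 X hX i z hz').2
    rw [← hE i z hz, hmass] at h4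
    have h5 := (h2 Y hY S hS).2 i z hz'
    have e1 : 0 ≤ C1 * (1 + 4 * C3) := by positivity
    have e3 : 0 ≤ C3 * (1 + C2) := by positivity
    have e4 : 0 ≤ C3 * C2 := by positivity
    constructor
    · have h6 := mul_le_mul_of_nonneg_left h5 hC3
      set v := |Y n (sgn i * P.phiE i z)|
      set m := mass (P.xParE K Y)
      have e5 : 0 ≤ (1 + C1 * (1 + 4 * C3) + C2 + C3) * (v + S) := by positivity
      have e6 : 0 ≤ (1 + C1 * (1 + 4 * C3) + C2 + C3 * C2) * m := by positivity
      linarith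
    · refine h5.trans (mul_le_mul_of_nonneg_right ?_ (by positivity))
      linarith

end System

/-! ### Uniqueness, the feedback law and equivalence of norms -/

theorem LocBounded.sq {f : ℝ → ℝ} (hf : LocBounded f) : LocBounded fun s => f s ^ 2 := by
  simpa [pow_two] using hf.mul hf

namespace System

variable {n : ℕ} {P : System n} {K : ℝ → ℝ → Matrix (Fin 2) (Fin 2) ℝ}

theorem exists_of_mem_window {τ : ℝ} (hτ : τ ∈ P.window) (h0 : τ ≠ 0) :
    ∃ i, ∃ z ∈ Ioc (0 : ℝ) 1, τ = sgn i * P.phiE i z := by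
  have key : ∀ i s, 0 < s → s ≤ P.tau i → ∃ z ∈ Ioc (0 : ℝ) 1, s = P.phiE i z := fun i s h h' =>
    ⟨P.phiInv i s, ⟨by rw [← P.phiInv_zero i]; exact (P.travelTime i).strictMono_inv h,
      (P.phiInv_mem_Icc i ⟨h.le, h'⟩).2⟩, (P.phiE_phiInv i s).symm⟩
  rcases lt_or_gt_of_ne h0 with h | h
  · obtain ⟨z, hz, e⟩ := key 1 (-τ) (by linarith) (by linarith [hτ.1])
    exact ⟨1, z, hz, by rw [← e, sgn_one]; ring⟩
  · obtain ⟨z, hz, e⟩ := key 0 τ h hτ.2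
    exact ⟨0, z, hz, by rw [← e, sgn_zero, one_mul]⟩

theorem xbar_zero (j : Fin 2) (z : ℝ) : P.xbar K (fun _ _ => 0) j z = 0 := by
  have : ∀ ζ, P.scaled (fun _ _ => 0) ζ = 0 := fun ζ => funext fun k => by simp [scaled]
  rw [xbar]
  simp [this]

/-- Trajectory segments that generate the same state coincide. -/
theorem jet_unique (hu : IsUnit P.kalman.det) (hq0 : P.q0 ≠ 0) (hK : P.IsKernel K)
    {Y Z : ℕ → ℝ → ℝ} (hY : IsGlobalJet n Y) (hZ : IsGlobalJet n Z)
    (hξ : P.xiPar Y 0 = P.xiPar Z 0)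
    (hx : ∀ j, ∀ z ∈ Ioc (0 : ℝ) 1, P.xPar K Y j z = P.xPar K Z j z) :
    (∀ k < n, ∀ τ ∈ P.window, Y k τ = Z k τ) ∧ ∀ τ ∈ P.window, τ ≠ 0 → Y n τ = Z n τ := by
  obtain ⟨C, hC, h⟩ := exists_bound_state_jet hu hq0 hK
  -- The bounds are applied to the difference of the jets, which generates the zero state. They
  -- leave open only the top derivative at `τ = 0`.
  obtain ⟨h1, h2, -⟩ := h _ (hY.sub hZ) (fun _ _ => 0) (fun _ => .const 0) fun j z hz => by
    rw [xbar_zero, xPar_sub hK hY hZ j (Ioc_subset_Icc_self hz), hx j z hz, sub_self]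
  have h3 : ‖P.xiPar (fun k t => Y k t - Z k t) 0‖ + mass (fun _ _ => 0) = 0 := by
    rw [xiPar_sub, hξ, sub_self, norm_zero]
    simp [mass]
  rw [h3, mul_zero] at h1
  refine ⟨fun k hk τ hτ => sub_eq_zero.1 (abs_nonpos_iff.1 (h1 k hk τ hτ)), fun τ hτ h0 => ?_⟩
  obtain ⟨i, z, hz, rfl⟩ := exists_of_mem_window hτ h0
  have := h2 i z hz
  rw [h3, abs_zero, add_zero, mul_zero] at this
  exact sub_eq_zero.1 (abs_nonpos_iff.1 this)

/-- The state determines the state of the canonical form. -/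
theorem IsHCCFState.unique (hu : IsUnit P.kalman.det) (hq0 : P.q0 ≠ 0) (hK : P.IsKernel K)
    {ξ : Fin n → ℝ} {xb : Fin 2 → ℝ → ℝ} {η η' : Fin n → ℝ} {v v' : ℝ → ℝ}
    (h : P.IsHCCFState K ξ xb η v) (h' : P.IsHCCFState K ξ xb η' v') :
    η = η' ∧ ∀ τ ∈ P.window, τ ≠ 0 → v τ = v' τ := by
  obtain ⟨Y, hY, hη, hv, hξ, hx⟩ := h
  obtain ⟨Y', hY', hη', hv', hξ', hx'⟩ := h'
  obtain ⟨Z, hZ, e⟩ := hY.exists_global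
  obtain ⟨Z', hZ', e'⟩ := hY'.exists_global
  obtain ⟨h1, h2⟩ := jet_unique hu hq0 hK hZ hZ' (by
    rw [← xiPar_congr fun k hk => e k hk.le 0 P.zero_mem_window,
      ← xiPar_congr fun k hk => e' k hk.le 0 P.zero_mem_window, ← hξ, ← hξ'])
    (fun j z hz => by
      rw [← xPar_congr K e j (Ioc_subset_Icc_self hz), ← xPar_congr K e' j (Ioc_subset_Icc_self hz),
        ← hx j z hz, ← hx' j z hz])
  refine ⟨funext fun i => ?_, fun τ hτ h0 => ?_⟩
  · rw [hη, hη', e i i.2.le _ P.left_mem_window, e' i i.2.le _ P.left_mem_window,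
      h1 i i.2 _ P.left_mem_window]
  · rw [hv τ hτ, hv' τ hτ, e n le_rfl τ hτ, e' n le_rfl τ hτ, h2 τ hτ h0]

/-- The functional evaluates `v` at `-τ₂ < 0` and under an integral, so the ambiguous value at the
present time is harmless. -/
theorem hccfFunctional_congr (a : Fin (n + 1) → ℝ) (aD : ℝ → ℝ) {η η' : Fin n → ℝ} {v v' : ℝ → ℝ}
    (hη : η = η') (hv : ∀ τ ∈ P.window, τ ≠ 0 → v τ = v' τ) :
    P.hccfFunctional a aD η v = P.hccfFunctional a aD η' v' := by
  rw [hccfFunctional, hccfFunctional, hη,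
    hv _ P.left_mem_window (by linarith [P.tau_pos 1] : -P.tau 1 < 0).ne]
  congr 1
  refine intervalIntegral.integral_congr_ae ?_
  have h0 : ∀ᵐ τ : ℝ, τ ≠ 0 := by simp [ae_iff, measure_singleton]
  filter_upwards [h0] with τ h h'
  rw [uIoc_of_le P.window_le] at h'
  rw [hv τ ⟨h'.1.le, h'.2⟩ h]

/-- Extension of a profile by zero. -/
theorem _root_.HyperbolicPDEODE.IsProfile.exists_locBounded {x : Fin 2 → ℝ → ℝ} (hx : IsProfile x) :
    ∃ X : Fin 2 → ℝ → ℝ, (∀ j, LocBounded (X j)) ∧ ∀ j, ∀ z ∈ Icc (0 : ℝ) 1, X j z = x j z := by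
  refine ⟨fun j => (Icc (0 : ℝ) 1).indicator (x j), fun j => ⟨(hx j).1, fun T => ?_⟩,
    fun j z hz => indicator_of_mem hz _⟩
  obtain ⟨B, hB⟩ := (hx j).2
  refine ⟨|B|, fun t _ => ?_⟩
  beta_reduce
  by_cases h : t ∈ Icc (0 : ℝ) 1
  · rw [indicator_of_mem h]; exact (hB t h).trans (le_abs_self B)
  · rw [indicator_of_notMem h, abs_zero]; exact abs_nonneg B

theorem exists_jet_of_profile (hu : IsUnit P.kalman.det) (hq0 : P.q0 ≠ 0) (hK : P.IsKernel K)
    (ξ₀ : Fin n → ℝ) {x : Fin 2 → ℝ → ℝ} (hx : IsProfile x) (p₀ : ℝ) :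
    ∃ Y, IsGlobalJet n Y ∧ P.xiPar Y 0 = ξ₀ ∧ P.p1Par Y 0 = p₀ ∧
      ∀ i, ∀ z ∈ Ioc (0 : ℝ) 1, P.xbar K x i z = P.xPar K Y i z := by
  obtain ⟨X, hX, hXx⟩ := hx.exists_locBounded
  obtain ⟨Y, hY, h1, h2, h3⟩ := exists_jet_of_state hu hq0 hK ξ₀ (locBounded_xbarE hK hX) p₀
  refine ⟨Y, hY, h1, h2, fun i z hz => ?_⟩
  rw [h3 i z hz, ← P.xbar_eq_xbarE K X i (Ioc_subset_Icc_self hz)]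
  exact P.xbar_congr K (fun j z hz => (hXx j z (Ioc_subset_Icc_self hz)).symm) i hz

theorem _root_.HyperbolicPDEODE.IsGlobalJet.isHCCFState {Y : ℕ → ℝ → ℝ} (hY : IsGlobalJet n Y)
    {ξ : Fin n → ℝ} {xb : Fin 2 → ℝ → ℝ} (hξ : P.xiPar Y 0 = ξ)
    (hx : ∀ i, ∀ z ∈ Ioc (0 : ℝ) 1, xb i z = P.xPar K Y i z) :
    P.IsHCCFState K ξ xb (fun i => Y i (-P.tau 1)) (Y n) :=
  ⟨Y, hY.isJet P, fun _ => rfl, fun _ _ => rfl, hξ.symm, hx⟩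

theorem exists_ubar_eq (x : Fin 2 → ℝ → ℝ) (w : ℝ) :
    ∃! u, P.ubar K x u = w := by
  have he := (Real.exp_pos (P.alpha 0 1)).ne'
  set I := ∫ z in (0 : ℝ)..1,
    (P.qbar1 * ((K 1 z).mulVec (P.scaled x z)) 1 - ((K 1 z).mulVec (P.scaled x z)) 0) with hI
  refine ⟨(w - I) / Real.exp (P.alpha 0 1), ?_, fun u hu => ?_⟩
  · simp only [ubar, ← hI]; field_simp; ring
  · simp only [ubar, ← hI] at hu; field_simp; linarith

/-- The controller is a well-defined static state feedback. -/
theorem existsUnique_isFeedback (hu : IsUnit P.kalman.det) (hq0 : P.q0 ≠ 0) (hK : P.IsKernel K)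
    (a : Fin (n + 1) → ℝ) (aD : ℝ → ℝ) (κ : Fin n → ℝ) (γ : ℝ) (yr : ℝ → ℝ) (t : ℝ)
    (ξ : Fin n → ℝ) {x : Fin 2 → ℝ → ℝ} (hx : IsProfile x) :
    ∃! u, P.IsFeedback K a aD κ γ yr t ξ x u := by
  obtain ⟨Y, hY, h1, -, h3⟩ := exists_jet_of_profile hu hq0 hK ξ hx 0
  have hH := hY.isHCCFState h1 h3
  obtain ⟨u, hu1, hu2⟩ := exists_ubar_eq (P := P) (K := K) x (P.ubarRef a aD yr t
      + P.hccfFunctional (fun i => a i - P.abar κ γ i) (fun τ => aD τ - P.abarD κ τ)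
          (fun i => Y i (-P.tau 1) - jetAt yr t i (-P.tau 1)) (fun τ => Y n τ - jetAt yr t n τ))
  refine ⟨u, ⟨_, _, hH, hu1⟩, ?_⟩
  rintro u' ⟨η, v, hH', hu'⟩
  obtain ⟨e1, e2⟩ := hH.unique hu hq0 hK hH'
  refine hu2 u' (hu'.trans ?_)
  congr 1
  refine hccfFunctional_congr _ _ ?_ fun τ hτ h0 => ?_
  · funext i; rw [← e1]
  · rw [e2 τ hτ h0]

/-- The squared norm of a state of the canonical form. -/
def jetSq (P : System n) (Y : ℕ → ℝ → ℝ) : ℝ :=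
  ‖fun i : Fin n => Y i (-P.tau 1)‖ ^ 2 + ∫ σ in (-P.tau 1)..(P.tau 0), Y n σ ^ 2

theorem jetSq_nonneg (P : System n) (Y : ℕ → ℝ → ℝ) : 0 ≤ P.jetSq Y :=
  add_nonneg (sq_nonneg _) (intervalIntegral.integral_nonneg P.window_le fun _ _ => sq_nonneg _)

theorem sq_stateNorm (ξ : Fin n → ℝ) {X : Fin 2 → ℝ → ℝ} (hX : ∀ k, LocBounded (X k)) :
    stateNorm ξ X ^ 2
      = (∑ i, ξ i ^ 2) + ((∫ z in (0 : ℝ)..1, X 0 z ^ 2) + ∫ z in (0 : ℝ)..1, X 1 z ^ 2) := by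
  rw [stateNorm, Real.sq_sqrt]
  · congr 1
    simp only [Fin.sum_univ_two]
    exact intervalIntegral.integral_add ((hX 0).sq.intervalIntegrable _ _)
      ((hX 1).sq.intervalIntegrable _ _)
  · exact add_nonneg (Finset.sum_nonneg fun _ _ => sq_nonneg _)
      (intervalIntegral.integral_nonneg zero_le_one fun _ _ =>
        Finset.sum_nonneg fun _ _ => sq_nonneg _)

theorem sq_norm_le_sum (ξ : Fin n → ℝ) : ‖ξ‖ ^ 2 ≤ ∑ i, ξ i ^ 2 := by
  have h : ‖ξ‖ ≤ Real.sqrt (∑ i, ξ i ^ 2) := by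
    rw [pi_norm_le_iff_of_nonneg (Real.sqrt_nonneg _)]
    intro i
    rw [Real.norm_eq_abs]
    refine Real.abs_le_sqrt ?_
    exact Finset.single_le_sum (f := fun i => ξ i ^ 2) (fun _ _ => sq_nonneg _) (Finset.mem_univ i)
  calc _ ≤ Real.sqrt (∑ i, ξ i ^ 2) ^ 2 := pow_le_pow_left₀ (norm_nonneg _) h 2
    _ = _ := Real.sq_sqrt (Finset.sum_nonneg fun _ _ => sq_nonneg _)

theorem sum_sq_le (ξ : Fin n → ℝ) : ∑ i, ξ i ^ 2 ≤ n * ‖ξ‖ ^ 2 := by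
  have := Finset.sum_le_card_nsmul Finset.univ (fun i => ξ i ^ 2) (‖ξ‖ ^ 2) fun i _ => by
    rw [← sq_abs]
    exact pow_le_pow_left₀ (abs_nonneg _) (norm_le_pi_norm ξ i) 2
  simpa using this

/-- Integrals over a transport time, bounded from below. -/
theorem integral_le_transport {M : ℝ} (hM : ∀ i z, P.lamE i z ≤ M) (i : Fin 2) {f : ℝ → ℝ}
    (hf : LocBounded f) (h0 : ∀ s, 0 ≤ f s) :
    ∫ z in (0 : ℝ)..1, f (P.phiE i z) ≤ M * ∫ s in (0 : ℝ)..(P.tau i), f s := by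
  rw [P.tau_eq, (P.travelTime i).integral_zero_eq, ← intervalIntegral.integral_const_mul]
  have hφ := hf.comp_continuous (P.travelTime i).continuous_travel
  have hl : LocBounded fun z => 1 / P.lamE i z := .of_continuous
    (continuous_const.div (P.continuous_lamE i) fun z => (P.lamE_pos i z).ne')
  refine intervalIntegral.integral_mono_on zero_le_one (hφ.intervalIntegrable _ _) ?_ fun z _ => ?_
  · simpa only [mul_one_div] using ((hφ.mul hl).const_mul M).intervalIntegrable 0 1
  · have hp := P.lamE_pos i z
    rw [← mul_div_assoc, le_div_iff₀ hp, mul_comm]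
    exact mul_le_mul_of_nonneg_right (hM i z) (h0 _)

theorem integral_window_eq (P : System n) {f : ℝ → ℝ} (hf : LocBounded f) :
    ∫ σ in (-P.tau 1)..(P.tau 0), f σ = (∫ σ in (0 : ℝ)..(P.tau 0), f (sgn 0 * σ))
      + ∫ σ in (0 : ℝ)..(P.tau 1), f (sgn 1 * σ) := by
  rw [← intervalIntegral.integral_add_adjacent_intervals (hf.intervalIntegrable (-P.tau 1) 0)
    (hf.intervalIntegrable 0 (P.tau 0)), add_comm]
  have h1 := intervalIntegral.integral_comp_neg (a := 0) (b := P.tau 1) f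
  rw [neg_zero] at h1
  rw [← h1, sgn_zero, sgn_one]
  simp only [one_mul, neg_one_mul]

/-- The pointwise bounds carry corrections in `L¹`, which Cauchy–Schwarz estimates by `L²` norms.
The window splits at `0` into the two ranges of travel times, and the change to the variable `z`
costs only bounds on the speeds and their reciprocals. -/
theorem exists_norm_equiv (hu : IsUnit P.kalman.det) (hq0 : P.q0 ≠ 0) (hK : P.IsKernel K) :
    ∃ C > 0, ∀ Y, IsGlobalJet n Y → ∀ X : Fin 2 → ℝ → ℝ, (∀ k, LocBounded (X k)) →
      (∀ j, ∀ z ∈ Ioc (0 : ℝ) 1, P.xbar K X j z = P.xPar K Y j z) →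
      P.jetSq Y ≤ C * stateNorm (P.xiPar Y 0) X ^ 2 ∧
      stateNorm (P.xiPar Y 0) X ^ 2 ≤ C * P.jetSq Y := by
  obtain ⟨C, hC, h⟩ := exists_bound_state_jet hu hq0 hK
  obtain ⟨Ml, hMl0, hMl⟩ := P.exists_inv_lamE_le
  obtain ⟨Λ, hΛ⟩ := P.exists_lamE_le
  have hΛ0 : 0 ≤ Λ := (P.lamE_pos 0 0).le.trans (hΛ 0 0)
  have hT0 := P.tau_pos 0
  have hT1 := P.tau_pos 1
  let T : ℝ := P.tau 0 + P.tau 1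
  have hT : 0 ≤ T := by simp only [T]; linarith
  let R : ℝ := 1 + C * (2 * Λ + 2)
  let C1 : ℝ := 3 * C ^ 2 + 16 * Ml * C ^ 2
  let C2 : ℝ := (n + 1) * (C ^ 2 * (2 * (1 + T))) + 2 * (2 * C ^ 2 * (Λ + R ^ 2 * (2 * (1 + T))))
  have hR : 0 ≤ R := by positivity
  have hC1 : 0 < C1 := by positivity
  have hC2 : 0 ≤ C2 := by positivity
  refine ⟨C1 + C2, by positivity, fun Y hY X hX hXY => ?_⟩
  obtain ⟨h1, h2, h3⟩ := h Y hY X hX hXY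
  have hYi : ∀ i, LocBounded fun z => Y n (sgn i * z) := fun i =>
    hY.top.comp_continuous (continuous_const.mul continuous_id)
  have hYφ : ∀ i, LocBounded fun z => Y n (sgn i * P.phiE i z) := fun i =>
    (hYi i).comp_continuous (P.travelTime i).continuous_travel
  have hN := sq_stateNorm (P.xiPar Y 0) hX
  set N := stateNorm (P.xiPar Y 0) X ^ 2 with hNdef
  have hN0 : 0 ≤ N := sq_nonneg _
  have hJ0 := P.jetSq_nonneg Y
  have hξ2 := sq_norm_le_sum (P.xiPar Y 0)
  have hX2 : ∀ i, 0 ≤ ∫ z in (0 : ℝ)..1, X i z ^ 2 := fun i =>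
    intervalIntegral.integral_nonneg zero_le_one fun _ _ => sq_nonneg _
  have hX20 := hX2 0
  have hX21 := hX2 1
  have hξ0 : 0 ≤ ∑ i, P.xiPar Y 0 i ^ 2 := Finset.sum_nonneg fun _ _ => sq_nonneg _
  constructor
  · set S := ‖P.xiPar Y 0‖ + mass X with hS
    have hS2 : S ^ 2 ≤ 3 * N := by
      have e0 := sq_integral_abs_le (hX 0) (zero_lt_one (α := ℝ))
      have e1 := sq_integral_abs_le (hX 1) (zero_lt_one (α := ℝ))
      rw [sub_zero, one_mul] at e0 e1
      rw [hS, mass]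
      nlinarith [sq_nonneg (‖P.xiPar Y 0‖ - ∫ z in (0 : ℝ)..1, |X 0 z|),
        sq_nonneg (‖P.xiPar Y 0‖ - ∫ z in (0 : ℝ)..1, |X 1 z|),
        sq_nonneg ((∫ z in (0 : ℝ)..1, |X 0 z|) - ∫ z in (0 : ℝ)..1, |X 1 z|)]
    have hS0 : 0 ≤ S := add_nonneg (norm_nonneg _) (mass_nonneg X)
    have hη : ‖fun i : Fin n => Y i (-P.tau 1)‖ ≤ C * S := by
      rw [pi_norm_le_iff_of_nonneg (by positivity)]
      exact fun i => h1 i i.2 _ P.left_mem_window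
    have hη2 : ‖fun i : Fin n => Y i (-P.tau 1)‖ ^ 2 ≤ C ^ 2 * (3 * N) :=
      (pow_le_pow_left₀ (norm_nonneg _) hη 2).trans (by
        rw [mul_pow]; exact mul_le_mul_of_nonneg_left hS2 (sq_nonneg C))
    have hv : ∀ i, ∫ σ in (0 : ℝ)..(P.tau i), Y n (sgn i * σ) ^ 2 ≤ Ml * (8 * C ^ 2 * N) := by
      intro i
      refine (integral_transport_le hMl i (hYi i).sq fun _ => sq_nonneg _).trans
        (mul_le_mul_of_nonneg_left ?_ hMl0.le)
      refine (integral_sq_le_of_abs_le (hYφ i) (hX i) (h2 i)).trans ?_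
      have hXN : ∫ z in (0 : ℝ)..1, X i z ^ 2 ≤ N := by
        fin_cases i
        · simp only [Fin.zero_eta]; linarith
        · simp only [Fin.mk_one]; linarith
      nlinarith [mul_le_mul_of_nonneg_left hXN (sq_nonneg C),
        mul_le_mul_of_nonneg_left hS2 (sq_nonneg C)]
    rw [jetSq, P.integral_window_eq hY.top.sq]
    have := hv 0
    have := hv 1
    have : 0 ≤ C2 * N := by positivity
    simp only [C1]
    linarith
  · obtain ⟨h4, h5⟩ := h3 _ rfl
    set S := ‖fun i : Fin n => Y i (-P.tau 1)‖ + ∫ σ in (-P.tau 1)..(P.tau 0), |Y n σ| with hS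
    have hI0 : 0 ≤ ∫ σ in (-P.tau 1)..(P.tau 0), |Y n σ| :=
      intervalIntegral.integral_nonneg P.window_le fun _ _ => abs_nonneg _
    have hS0 : 0 ≤ S := add_nonneg (norm_nonneg _) hI0
    have hI2 : 0 ≤ ∫ σ in (-P.tau 1)..(P.tau 0), Y n σ ^ 2 :=
      intervalIntegral.integral_nonneg P.window_le fun _ _ => sq_nonneg _
    have hS2 : S ^ 2 ≤ 2 * (1 + T) * P.jetSq Y := by
      have e0 := sq_integral_abs_le hY.top (a := -P.tau 1) (b := P.tau 0) (by linarith)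
      have e1 : P.tau 0 - -P.tau 1 = T := by simp only [T]; ring
      rw [e1] at e0
      have e2 : 0 ≤ T * ‖fun i : Fin n => Y i (-P.tau 1)‖ ^ 2 := by positivity
      rw [hS, jetSq]
      nlinarith [sq_nonneg (‖fun i : Fin n => Y i (-P.tau 1)‖
        - ∫ σ in (-P.tau 1)..(P.tau 0), |Y n σ|)]
    have hwin : ∀ {f : ℝ → ℝ}, LocBounded f → (∀ s, 0 ≤ f s) → ∀ i,
        ∫ σ in (0 : ℝ)..(P.tau i), f (sgn i * σ) ≤ ∫ σ in (-P.tau 1)..(P.tau 0), f σ := by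
      intro f hf hf0 i
      rw [P.integral_window_eq hf]
      have : ∀ j, 0 ≤ ∫ σ in (0 : ℝ)..(P.tau j), f (sgn j * σ) := fun j =>
        intervalIntegral.integral_nonneg (P.tau_pos j).le fun _ _ => hf0 _
      fin_cases i
      · simpa using this 1
      · simpa using this 0
    have hmass : mass (P.xParE K Y) ≤ C * (2 * Λ + 2) * S := by
      have e := mass_le (x := P.xParE K Y) (y := fun i z => Y n (sgn i * P.phiE i z)) (S := S)
        (locBounded_xParE hK hY) hYφ fun j z hz => (h5 j z hz).2
      have e1 : ∀ i, ∫ z in (0 : ℝ)..1, |Y n (sgn i * P.phiE i z)| ≤ Λ * S := fun i => by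
        refine (integral_le_transport hΛ i (hYi i).abs fun _ => abs_nonneg _).trans
          (mul_le_mul_of_nonneg_left ?_ hΛ0)
        refine (hwin hY.top.abs (fun _ => abs_nonneg _) i).trans ?_
        rw [hS]
        exact le_add_of_nonneg_left (norm_nonneg _)
      refine e.trans ?_
      rw [mul_assoc]
      refine mul_le_mul_of_nonneg_left ?_ hC.le
      rw [mass]
      linarith [e1 0, e1 1]
    have hX' : ∀ i, ∫ z in (0 : ℝ)..1, X i z ^ 2
        ≤ 2 * C ^ 2 * (Λ + R ^ 2 * (2 * (1 + T))) * P.jetSq Y := by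
      intro i
      refine (integral_sq_le_of_abs_le (hX i) (hYφ i) fun z hz => (h5 i z hz).1).trans ?_
      rw [mul_assoc (2 * C ^ 2)]
      refine mul_le_mul_of_nonneg_left ?_ (by positivity)
      have e1 : ∫ z in (0 : ℝ)..1, Y n (sgn i * P.phiE i z) ^ 2 ≤ Λ * P.jetSq Y := by
        refine (integral_le_transport hΛ i (hYi i).sq fun _ => sq_nonneg _).trans
          (mul_le_mul_of_nonneg_left ?_ hΛ0)
        refine (hwin hY.top.sq (fun _ => sq_nonneg _) i).trans ?_
        rw [jetSq]
        exact le_add_of_nonneg_left (sq_nonneg _)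
      have e2 : (S + mass (P.xParE K Y)) ^ 2 ≤ R ^ 2 * (2 * (1 + T) * P.jetSq Y) := by
        have e3 : S + mass (P.xParE K Y) ≤ R * S := by simp only [R]; linarith
        refine (pow_le_pow_left₀ (add_nonneg hS0 (mass_nonneg _)) e3 2).trans ?_
        rw [mul_pow]
        exact mul_le_mul_of_nonneg_left hS2 (sq_nonneg R)
      linarith
    have hξ' : ∑ i, P.xiPar Y 0 i ^ 2 ≤ (n + 1) * (C ^ 2 * (2 * (1 + T))) * P.jetSq Y := by
      refine (sum_sq_le _).trans ?_
      have e1 : ‖P.xiPar Y 0‖ ^ 2 ≤ C ^ 2 * (2 * (1 + T) * P.jetSq Y) := by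
        refine (pow_le_pow_left₀ (norm_nonneg _) h4 2).trans ?_
        rw [mul_pow]
        exact mul_le_mul_of_nonneg_left hS2 (sq_nonneg C)
      have e2 := mul_le_mul_of_nonneg_left e1 (Nat.cast_nonneg (α := ℝ) n)
      have e3 : 0 ≤ C ^ 2 * (2 * (1 + T) * P.jetSq Y) := by positivity
      linarith
    have := hX' 0
    have := hX' 1
    have : 0 ≤ C1 * P.jetSq Y := by positivity
    rw [hN]
    simp only [C2]
    linarith

end System

/-! ### Trajectories of the flat output and solutions of the system -/

namespace System

variable {n : ℕ} {P : System n} {K : ℝ → ℝ → Matrix (Fin 2) (Fin 2) ℝ}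

theorem sum_eq_add_rev (f : Fin 2 → ℝ) (i : Fin 2) : ∑ j, f j = f i + f (1 - i) := by
  fin_cases i
  · simp
  · simp [add_comm]

theorem integral_along_line (i : Fin 2) (G : ℝ → ℝ) (s t₀ t₁ : ℝ) :
    ∫ t in t₀..t₁, G (sgn i * (s - t))
      = -(sgn i * ∫ σ in (sgn i * (s - t₀))..(sgn i * (s - t₁)), G σ) := by
  have h1 := intervalIntegral.integral_comp_sub_left (a := t₀) (b := t₁) (fun r => G (sgn i * r)) s
  have h2 := intervalIntegral.mul_integral_comp_mul_left (a := s - t₁) (b := s - t₀) (f := G) (sgn i)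
  rw [h1, intervalIntegral.integral_symm (sgn i * (s - t₁)), ← h2, mul_neg, neg_neg, ← mul_assoc,
    sgn_mul_self, one_mul]

/-- Every trajectory of the flat output generates a solution of the system. -/
theorem exists_solution_of_jet (hu : IsUnit P.kalman.det) {Y : ℕ → ℝ → ℝ} (hY : IsGlobalJet n Y) :
    ∃ x : Fin 2 → ℝ → ℝ → ℝ,
      P.IsSolution univ (fun t => x 0 1 t - P.q1 * x 1 1 t) (P.xiPar Y) x ∧
      ∀ i t, x i 0 t = P.pPar Y i t := by
  obtain ⟨x, hm, hb, hx⟩ := P.exists_of_boundary_values (f := P.pPar Y)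
    (fun j => (locBounded_pPar hY j).measurable) (fun T => by
      choose B hB using fun j => (locBounded_pPar hY j).bounded T
      refine ⟨max (B 0) (B 1), fun j t ht => (hB j t ht).trans ?_⟩
      fin_cases j
      · exact le_max_left _ _
      · exact le_max_right _ _)
  have hx0 : ∀ i t, x i 0 t = P.pPar Y i t := fun i t => by
    rw [hx i 0 (left_mem_Icc.2 zero_le_one) t, P.phiE_zero]
    simp
  refine ⟨x, ⟨fun j => ?_, fun T => ?_, (continuous_xiPar hY).continuousOn, fun s _ t _ _ i => ?_,
    fun t _ => ?_, fun t _ => by ring, fun i t₀ t₁ Z ht _ hZ => ?_⟩, hx0⟩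
  · exact (hm j).indicator (measurableSet_Icc.prod MeasurableSet.univ)
  · obtain ⟨B, hB⟩ := hb T
    exact ⟨B, fun j t _ ht z _ => hB j t ht z⟩
  · simp only [hx0, pPar_zero]
    exact xiPar_eq_integral hu hY s t i
  · rw [hx0, hx0, pPar_one, pPar_zero]
  · have hZ' : ∀ t ∈ Icc t₀ t₁, HasDerivWithinAt Z (-sgn i * P.lamE i (Z t)) (Icc t₀ t₁) t :=
      fun t ht => by
        have := (hZ t ht).2
        rwa [P.Lam_eq, ← P.lamE_of_mem i (hZ t ht).1, ← neg_mul] at this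
    have hφ := (P.travelTime i).travel_of_hasDerivWithinAt hZ'
    -- The quantity `t + sgn i * φᵢ(Z t)` is constant along the characteristic; `s` is the time at
    -- which its prolongation meets `z = 0`. All values on the characteristic are then given by
    -- integrals of one function `G`.
    set s := t₀ + sgn i * P.phiE i (Z t₀) with hs
    have hss := sgn_mul_self i
    have hφ' : ∀ t ∈ Icc t₀ t₁, P.phiE i (Z t) = sgn i * (s - t) := fun t ht => by
      rw [hφ t ht, hs]; linear_combination (-P.phiE i (Z t₀)) * hss
    have hs' : ∀ t ∈ Icc t₀ t₁, t + sgn i * P.phiE i (Z t) = s := fun t ht => by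
      rw [hφ' t ht]; linear_combination (s - t) * hss
    let G : ℝ → ℝ := fun σ => ∑ j, P.AE (P.phiInv i σ) i j * x j (P.phiInv i σ) (s - sgn i * σ)
    have hval : ∀ t ∈ Icc t₀ t₁, x i (Z t) t
        = P.pPar Y i s - sgn i * ∫ σ in (0 : ℝ)..(P.phiE i (Z t)), G σ := fun t ht => by
      rw [hx i _ (hZ t ht).1 t, hs' t ht, (P.travelTime i).integral_zero_eq]
      congr 2
      refine intervalIntegral.integral_congr fun w _ => ?_
      simp only [G, P.phiInv_phiE]
      congr 2
      funext j
      rw [mul_sub, ← add_sub_assoc, hs' t ht]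
    have h0 : t₀ ∈ Icc t₀ t₁ := left_mem_Icc.2 ht
    have h1 : t₁ ∈ Icc t₀ t₁ := right_mem_Icc.2 ht
    have hcont : ∀ a b, IntervalIntegrable G volume a b := fun a b => by
      have hG : Measurable G := by
        refine Finset.measurable_sum _ fun j _ => ?_
        refine ((P.continuous_AE i j).comp (P.continuous_phiInv i)).measurable.mul ?_
        exact (hm j).comp ((P.continuous_phiInv i).measurable.prodMk (by fun_prop))
      obtain ⟨MA, hMA0, hMA⟩ := P.exists_bound_AE
      obtain ⟨B, hB⟩ := hb (|s| + max |a| |b|)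
      refine intervalIntegrable_of_bound (C := ∑ j : Fin 2, MA * |B|) hG fun σ hσ => ?_
      have hσ' : |σ| ≤ max |a| |b| := by
        have := abs_le_max_abs_abs hσ.1 hσ.2
        rcases le_total a b with h | h
        · rwa [min_eq_left h, max_eq_right h] at this
        · rwa [min_eq_right h, max_eq_left h, max_comm] at this
      refine (Finset.abs_sum_le_sum_abs _ _).trans (Finset.sum_le_sum fun j _ => ?_)
      rw [abs_mul]
      refine mul_le_mul (hMA _ _ _) ((hB j _ ?_ _).trans (le_abs_self B)) (abs_nonneg _) hMA0
      refine (abs_sub _ _).trans ?_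
      rw [abs_mul, abs_sgn, one_mul]
      linarith
    have hint : ∫ t in t₀..t₁, ∑ j, P.A (Z t) i j * x j (Z t) t
        = ∫ t in t₀..t₁, G (sgn i * (s - t)) := by
      refine intervalIntegral.integral_congr fun t htt => ?_
      rw [uIcc_of_le ht] at htt
      have e1 : P.phiInv i (sgn i * (s - t)) = Z t := by rw [← hφ' t htt, P.phiInv_phiE]
      have e2 : s - sgn i * (sgn i * (s - t)) = t := by linear_combination (-(s - t)) * hss
      simp only [G, e1, e2, AE, unitClamp_of_mem (hZ t htt).1]
    rw [hval t₁ h1, hval t₀ h0, hint, integral_along_line, hφ' t₀ h0, hφ' t₁ h1,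
      ← intervalIntegral.integral_add_adjacent_intervals (hcont 0 (sgn i * (s - t₀)))
        (hcont _ (sgn i * (s - t₁)))]
    ring

variable {u : ℝ → ℝ} {ξ : ℝ → Fin n → ℝ} {x : Fin 2 → ℝ → ℝ → ℝ}

theorem IsSolution.measurable_clamp (hs : P.IsSolution univ u ξ x) (j : Fin 2) :
    Measurable fun p : ℝ × ℝ => x j (unitClamp p.1) p.2 := by
  have h := (hs.measurable j).comp
    ((continuous_unitClamp.measurable.comp measurable_fst).prodMk measurable_snd :
      Measurable fun p : ℝ × ℝ => (unitClamp p.1, p.2))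
  convert h using 1
  funext p
  exact (indicator_of_mem (f := fun p : ℝ × ℝ => x j p.1 p.2)
    (show ((unitClamp p.1, p.2) : ℝ × ℝ) ∈ Icc (0 : ℝ) 1 ×ˢ univ from
      ⟨unitClamp_mem p.1, mem_univ _⟩)).symm

theorem IsSolution.bounded_clamp (hs : P.IsSolution univ u ξ x) (T : ℝ) :
    ∃ B, ∀ j t, |t| ≤ T → ∀ z, |x j (unitClamp z) t| ≤ B := by
  obtain ⟨B, hB⟩ := hs.bounded T
  exact ⟨B, fun j t ht z => hB j t (mem_univ t) ht _ (unitClamp_mem z)⟩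

theorem IsSolution.locBounded_along (hs : P.IsSolution univ u ξ x) (j : Fin 2) {f g : ℝ → ℝ}
    (hf : Continuous f) (hg : Continuous g) : LocBounded fun a => x j (unitClamp (f a)) (g a) := by
  refine ⟨(hs.measurable_clamp j).comp (hf.measurable.prodMk hg.measurable), fun T => ?_⟩
  obtain ⟨D, hD⟩ := (LocBounded.of_continuous hg).bounded T
  obtain ⟨B, hB⟩ := hs.bounded_clamp D
  exact ⟨B, fun t ht => hB j _ (hD t ht) _⟩

/-- The equations integrated along the characteristics, parametrized by the travel time. -/
theorem IsSolution.along (hs : P.IsSolution univ u ξ x) (i : Fin 2) (s : ℝ) {a₀ a₁ : ℝ}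
    (h0 : 0 ≤ a₀) (h01 : a₀ ≤ a₁) (h1 : a₁ ≤ P.tau i) :
    x i (P.phiInv i a₁) (s - sgn i * a₁) = x i (P.phiInv i a₀) (s - sgn i * a₀)
      - sgn i * ∫ a in a₀..a₁, ∑ j, P.A (P.phiInv i a) i j * x j (P.phiInv i a) (s - sgn i * a) := by
  let G : ℝ → ℝ := fun a => ∑ j, P.A (P.phiInv i a) i j * x j (P.phiInv i a) (s - sgn i * a)
  have hss := sgn_mul_self i
  have key : ∀ t₀ t₁ : ℝ, t₀ ≤ t₁ → (∀ t ∈ Icc t₀ t₁, sgn i * (s - t) ∈ Icc a₀ a₁) →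
      x i (P.phiInv i (sgn i * (s - t₁))) t₁ = x i (P.phiInv i (sgn i * (s - t₀))) t₀
        - sgn i * ∫ σ in (sgn i * (s - t₀))..(sgn i * (s - t₁)), G σ := by
    intro t₀ t₁ ht hmem
    have := hs.pde i t₀ t₁ (fun t => P.phiInv i (sgn i * (s - t))) ht (subset_univ _) fun t htt => by
      have hm := P.phiInv_mem_Icc i ⟨h0.trans (hmem t htt).1, (hmem t htt).2.trans h1⟩
      refine ⟨hm, ?_⟩
      have hd := (P.travelTime i).hasDerivAt_inv_line (sgn i * s) (-sgn i) t
      have e : ∀ t, sgn i * s + -sgn i * t = sgn i * (s - t) := fun t => by ring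
      simp only [e] at hd
      rw [P.Lam_eq, ← P.lamE_of_mem i hm, ← neg_mul]
      exact hd.hasDerivWithinAt
    have e3 : ∀ t, G (sgn i * (s - t)) = ∑ j, P.A (P.phiInv i (sgn i * (s - t))) i j
        * x j (P.phiInv i (sgn i * (s - t))) t := fun t => by
      have e2 : s - sgn i * (sgn i * (s - t)) = t := by linear_combination (-(s - t)) * hss
      simp only [G, e2]
    have e4 := integral_along_line i G s t₀ t₁
    simp only [e3] at e4
    rw [this, e4]
    ring
  have ht : ∀ a, sgn i * (s - (s - sgn i * a)) = a := fun a => by linear_combination a * hss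
  have hcases : sgn i = 1 ∨ sgn i = -1 := by fin_cases i; exacts [Or.inl rfl, Or.inr rfl]
  rcases hcases with h | h
  · have := key (s - sgn i * a₁) (s - sgn i * a₀) (by rw [h]; linarith) (fun t ht => by
      rw [h] at ht ⊢
      exact ⟨by linarith [ht.2], by linarith [ht.1]⟩)
    rw [ht, ht, intervalIntegral.integral_symm] at this
    rw [this]
    ring
  · have := key (s - sgn i * a₀) (s - sgn i * a₁) (by rw [h]; linarith) (fun t ht => by
      rw [h] at ht ⊢
      exact ⟨by linarith [ht.1], by linarith [ht.2]⟩)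
    rwa [ht, ht] at this

/-- The scaling factors are integrating factors for the diagonal of `A`: in the product rule the
terms with `AE i i` cancel, and `AtE_rev` identifies the remaining coupling. -/
theorem IsSolution.isScaledSolution (hs : P.IsSolution univ u ξ x) :
    P.IsScaledSolution fun j z t => P.scaleE j (unitClamp z) * x j (unitClamp z) t := by
  refine ⟨fun j => ?_, fun T => ?_, fun i s a₀ a₁ h0 h01 h1 => ?_⟩
  · exact ((P.continuous_scaleE j).measurable.comp
      (continuous_unitClamp.measurable.comp measurable_fst)).mul (hs.measurable_clamp j)
  · obtain ⟨B, hB⟩ := hs.bounded_clamp T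
    obtain ⟨M, hM0, hM⟩ := exists_scaleE_bound P
    refine ⟨M * B, fun j t ht z => ?_⟩
    rw [abs_mul, abs_of_pos (P.scaleE_pos j _)]
    exact mul_le_mul (hM j _ (unitClamp_mem z)).1 (hB j t ht z) (abs_nonneg _) hM0.le
  · have hcl : ∀ a ∈ Icc a₀ a₁, unitClamp (P.phiInv i a) = P.phiInv i a := fun a ha =>
      unitClamp_of_mem (P.phiInv_mem_Icc i ⟨h0.trans ha.1, ha.2.trans h1⟩)
    let X : Fin 2 → ℝ → ℝ := fun j a => x j (unitClamp (P.phiInv i a)) (s - sgn i * a)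
    have hX : ∀ j, LocBounded (X j) := fun j =>
      hs.locBounded_along j (P.continuous_phiInv i) (by fun_prop)
    have hA : ∀ j, LocBounded fun a => P.AE (P.phiInv i a) i j := fun j =>
      .of_continuous ((P.continuous_AE i j).comp (P.continuous_phiInv i))
    have hS : ∀ j, LocBounded fun a => P.scaleE j (P.phiInv i a) := fun j =>
      .of_continuous ((P.continuous_scaleE j).comp (P.continuous_phiInv i))
    have hg : LocBounded fun a => -sgn i * ∑ j, P.AE (P.phiInv i a) i j * X j a :=
      (LocBounded.sum _ fun j _ => (hA j).mul (hX j)).const_mul _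
    have hf : LocBounded fun a => sgn i * P.AE (P.phiInv i a) i i * P.scaleE i (P.phiInv i a) :=
      ((hA i).const_mul _).mul (hS i)
    have hprod := mul_sub_mul_eq_integral (F := fun a => P.scaleE i (P.phiInv i a)) (G := X i)
      h01 (hf.intervalIntegrable _ _) (hg.intervalIntegrable _ _) (fun r _ => by
        rw [intervalIntegral.integral_eq_sub_of_hasDerivAt
          (fun a _ => P.hasDerivAt_scaleE_phiInv i a) (hf.intervalIntegrable _ _)]
        ring) (fun r hr => by
        have := hs.along i s h0 hr.1 (hr.2.trans h1)
        simp only [X]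
        rw [hcl r hr, hcl a₀ (left_mem_Icc.2 h01), this, intervalIntegral.integral_const_mul,
          neg_mul, sub_eq_add_neg]
        congr 3
        refine intervalIntegral.integral_congr fun a ha => ?_
        rw [uIcc_of_le hr.1] at ha
        simp only [AE, hcl a ⟨ha.1, ha.2.trans hr.2⟩])
    have e1 : ∀ a ∈ Icc a₀ a₁, P.scaleE i (unitClamp (P.phiInv i a)) = P.scaleE i (P.phiInv i a) :=
      fun a ha => by rw [hcl a ha]
    simp only [e1 a₀ (left_mem_Icc.2 h01), e1 a₁ (right_mem_Icc.2 h01)]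
    change P.scaleE i (P.phiInv i a₁) * X i a₁ = P.scaleE i (P.phiInv i a₀) * X i a₀ - _
    have e2 : ∫ r in a₀..a₁, (sgn i * P.AE (P.phiInv i r) i i * P.scaleE i (P.phiInv i r) * X i r +
        P.scaleE i (P.phiInv i r) * (-sgn i * ∑ j, P.AE (P.phiInv i r) i j * X j r))
        = ∫ a in a₀..a₁, -sgn i * ∑ j, P.AtE (P.phiInv i a) i j *
          (P.scaleE j (unitClamp (P.phiInv i a)) * X j a) := by
      refine intervalIntegral.integral_congr fun a ha => ?_
      rw [uIcc_of_le h01] at ha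
      have hm := P.phiInv_mem_Icc i ⟨h0.trans ha.1, ha.2.trans h1⟩
      simp only [hcl a ha, sum_eq_add_rev _ i, AtE_self]
      linear_combination sgn i * X (1 - i) a * P.AtE_rev hm i
    rw [e2, intervalIntegral.integral_const_mul] at hprod
    linarith

/-- The transformed state of a solution is given by the parametrization. -/
theorem IsSolution.xbar_eq_xPar (hq0 : P.q0 ≠ 0) (hK : P.IsKernel K) (hs : P.IsSolution univ u ξ x)
    {Y : ℕ → ℝ → ℝ} (hξ : ∀ t, P.xiPar Y t = ξ t) (hx : ∀ t, P.p1Par Y t = x 0 0 t) (t : ℝ)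
    (i : Fin 2) {z : ℝ} (hz : z ∈ Icc (0 : ℝ) 1) :
    P.xbar K (fun j z => x j z t) i z = P.xPar K (fun k τ => Y k (t + τ)) i z := by
  have hss := sgn_mul_self i
  have h00 : unitClamp 0 = 0 := unitClamp_of_mem (left_mem_Icc.2 zero_le_one)
  have hφ0 : ∀ i, P.lamE i 0 = P.lam i 0 := fun i => P.lamE_of_mem i (left_mem_Icc.2 zero_le_one)
  set s := t + sgn i * P.phiE i z with hsdef
  have hst : s - sgn i * P.phiE i z = t := by rw [hsdef]; ring
  have h := hs.isScaledSolution.transform hK i hz s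
  rw [hst] at h
  simp only [h00, P.scaleE_zero, one_mul] at h
  have hp : ∀ i t, x i 0 t = P.pPar Y i t := by
    intro i t
    fin_cases i
    · exact (hx t).symm
    · have := hs.bc0 t (by rw [interior_univ]; exact mem_univ t)
      rw [← hx, ← hξ] at this
      exact this
  have hl : P.xbar K (fun j z => x j z t) i z = P.scaleE i (unitClamp z) * x i (unitClamp z) t -
      ∫ ζ in (0 : ℝ)..z, ∑ j, kerE K z ζ i j *
        (P.scaleE j (unitClamp ζ) * x j (unitClamp ζ) t) := by
    rw [P.xbar_eq_xbarE K _ i hz, xbarE, unitClamp_of_mem hz]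
    congr 1
    refine intervalIntegral.integral_congr fun ζ hζ => ?_
    rw [uIcc_of_le hz.1] at hζ
    simp only [unitClamp_of_mem ⟨hζ.1, hζ.2.trans hz.2⟩]
  rw [hl, h, P.xPar_eq K _ i hz, (P.travelTime i).integral_zero_eq]
  have e0 : P.pPar (fun k τ => Y k (t + τ)) i (sgn i * P.phiE i z) = x i 0 s := (hp i s).symm
  rw [e0, ← intervalIntegral.integral_sub, ← intervalIntegral.integral_const_mul]
  · congr 1
    refine intervalIntegral.integral_congr fun w hw => ?_
    rw [uIcc_of_le hz.1] at hw
    have hw' : w ∈ Icc (0 : ℝ) 1 := ⟨hw.1, hw.2.trans hz.2⟩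
    have e1 : P.xiPar (fun k τ => Y k (t + τ)) (sgn i * (P.phiE i z - P.phiE i w))
        = P.xiPar Y (s - sgn i * P.phiE i w) := by
      rw [hsdef, show t + sgn i * P.phiE i z - sgn i * P.phiE i w
        = t + sgn i * (P.phiE i z - P.phiE i w) by ring]
      rfl
    have hk : kerE K w 0 = K w 0 := kerE_of_mem K ⟨le_rfl, hw.1, hw'.2⟩
    have hl0 := (P.lam_pos 0 0 (left_mem_Icc.2 zero_le_one)).ne'
    have hl1 := (P.lam_pos 1 0 (left_mem_Icc.2 zero_le_one)).ne'
    simp only [delayCoeff, P.phiInv_phiE, hk, hφ0, hp, e1]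
    set r := s - sgn i * P.phiE i w
    clear_value r
    -- The conditions on `K` at `ζ = 0` take effect here: after inserting `x₂(0,·) = q₀ x₁(0,·) + cᵀ
    -- ξ` the terms with `x₁(0,·)` cancel and only `cᵀ ξ` survives.
    fin_cases i
    · have hb := hK.bc11 w hw'
      simp only [Fin.zero_eta, sub_zero, pPar_zero, pPar_one, sgn_zero, hb]
      field_simp
      ring
    · have hb := hK.bc22 w hw'
      have hb' : K w 0 1 0 = P.q0 * P.lam 1 0 / P.lam 0 0 * K w 0 1 1 := by
        rw [hb]; field_simp
      have h11 : (1 : Fin 2) - 1 = 0 := rfl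
      simp only [Fin.mk_one, h11, pPar_zero, pPar_one, sgn_one, hb']
      field_simp
      ring
  all_goals
    have hlam : LocBounded fun w => 1 / P.lamE i w := .of_continuous
      (continuous_const.div (P.continuous_lamE i) fun z => (P.lamE_pos i z).ne')
    have hφ := (P.travelTime i).continuous_travel
    have hxL : ∀ j, LocBounded fun w => x j 0 (s - sgn i * P.phiE i w) := fun j => by
      have := hs.locBounded_along j (f := fun _ => 0) (g := fun w => s - sgn i * P.phiE i w)
        continuous_const (by fun_prop)
      simpa only [h00] using this
    have hkL : ∀ j, LocBounded fun w => kerE K w 0 i j := fun j => .of_continuous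
      ((continuous_kerE hK.continuous i j).comp (continuous_id.prodMk continuous_const))
    have := fun j => ((((hkL j).mul (.const (P.lamE j 0))).mul (hxL j)).mul hlam).intervalIntegrable 0 z
    simp only [mul_one_div] at this
  · exact this i
  · exact this (1 - i)

end System

/-! ### The reference trajectory and solutions on the half line -/

theorem locBounded_of_indicator {x : ℝ → ℝ → ℝ}
    (hm : Measurable ((Icc (0 : ℝ) 1 ×ˢ univ).indicator fun p : ℝ × ℝ => x p.1 p.2))
    (hb : ∀ T : ℝ, ∃ B, ∀ t, |t| ≤ T → ∀ z ∈ Icc (0 : ℝ) 1, |x z t| ≤ B) {f : ℝ → ℝ}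
    (hf : Continuous f) (hf01 : ∀ t, f t ∈ Icc (0 : ℝ) 1) : LocBounded fun t => x (f t) t := by
  refine ⟨?_, fun T => (hb T).imp fun B hB t ht => hB t ht _ (hf01 t)⟩
  have h := hm.comp (hf.measurable.prodMk measurable_id)
  convert h using 1
  funext t
  exact (indicator_of_mem (f := fun p : ℝ × ℝ => x p.1 p.2)
    (show ((f t, t) : ℝ × ℝ) ∈ Icc (0 : ℝ) 1 ×ˢ univ from ⟨hf01 t, mem_univ _⟩)).symm

namespace System

variable {n : ℕ} {P : System n} {K : ℝ → ℝ → Matrix (Fin 2) (Fin 2) ℝ}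

theorem IsSolution.isProfile {I : Set ℝ} {u : ℝ → ℝ} {ξ : ℝ → Fin n → ℝ} {x : Fin 2 → ℝ → ℝ → ℝ}
    (hs : P.IsSolution I u ξ x) {t : ℝ} (ht : t ∈ I) : IsProfile fun j z => x j z t := by
  refine fun j => ⟨?_, ?_⟩
  · have h := (hs.measurable j).comp (measurable_id.prodMk (measurable_const (a := t)))
    convert h using 1
    funext z
    by_cases hz : z ∈ Icc (0 : ℝ) 1
    · simp [indicator, hz, ht]
    · simp [indicator, hz]
  · obtain ⟨B, hB⟩ := hs.bounded |t|
    exact ⟨B, fun z hz => hB j t ht le_rfl z hz⟩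

theorem xbar_sub_of_isProfile (hK : P.IsKernel K) {x y : Fin 2 → ℝ → ℝ} (hx : IsProfile x)
    (hy : IsProfile y) (j : Fin 2) {z : ℝ} (hz : z ∈ Ioc (0 : ℝ) 1) :
    P.xbar K (fun j z => x j z - y j z) j z = P.xbar K x j z - P.xbar K y j z := by
  obtain ⟨X, hX, hXx⟩ := hx.exists_locBounded
  obtain ⟨Y, hY, hYy⟩ := hy.exists_locBounded
  have hz' := Ioc_subset_Icc_self hz
  rw [P.xbar_congr K (X := x) (X' := X) (fun j z hz => (hXx j z (Ioc_subset_Icc_self hz)).symm) j hz,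
    P.xbar_congr K (X := y) (X' := Y) (fun j z hz => (hYy j z (Ioc_subset_Icc_self hz)).symm) j hz,
    P.xbar_congr K (X := fun j z => x j z - y j z) (X' := fun j z => X j z - Y j z)
      (fun j z hz => by rw [hXx j z (Ioc_subset_Icc_self hz), hYy j z (Ioc_subset_Icc_self hz)]) j hz,
    P.xbar_eq_xbarE K _ j hz', P.xbar_eq_xbarE K _ j hz', P.xbar_eq_xbarE K _ j hz']
  have hc : ∀ X : Fin 2 → ℝ → ℝ, (∀ k, LocBounded (X k)) → IntervalIntegrable
      (fun ζ => ∑ k, kerE K z ζ j k * (P.scaleE k ζ * X k ζ)) volume 0 z := fun X hX =>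
    (LocBounded.sum _ fun k _ => (LocBounded.of_continuous ((continuous_kerE hK.continuous j k).comp
      (continuous_const.prodMk continuous_id))).mul
      ((LocBounded.of_continuous (P.continuous_scaleE k)).mul (hX k))).intervalIntegrable _ _
  simp only [xbarE, mul_sub, Finset.sum_sub_distrib]
  rw [intervalIntegral.integral_sub (hc X hX) (hc Y hY)]
  ring

/-- The difference of the profiles has image zero on `(0,1]`, and the bound for the inverse in
`exists_bound_xbarE` forces it to vanish there. -/
theorem xbar_injective (hK : P.IsKernel K) {x y : Fin 2 → ℝ → ℝ} (hx : IsProfile x)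
    (hy : IsProfile y) (h : ∀ j, ∀ z ∈ Ioc (0 : ℝ) 1, P.xbar K x j z = P.xbar K y j z) (j : Fin 2)
    {z : ℝ} (hz : z ∈ Ioc (0 : ℝ) 1) : x j z = y j z := by
  obtain ⟨X, hX, hXx⟩ := hx.exists_locBounded
  obtain ⟨Y, hY, hYy⟩ := hy.exists_locBounded
  obtain ⟨C, -, hC⟩ := exists_bound_xbarE hK
  have h0 : ∀ j, ∀ z ∈ Ioc (0 : ℝ) 1, P.xbarE K (fun j z => X j z - Y j z) j z = 0 := by
    intro j z hz
    rw [← P.xbar_eq_xbarE K _ j (Ioc_subset_Icc_self hz),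
      P.xbar_congr K (X' := fun j z => x j z - y j z) (fun j z hz => by
        rw [hXx j z (Ioc_subset_Icc_self hz), hYy j z (Ioc_subset_Icc_self hz)]) j hz,
      xbar_sub_of_isProfile hK hx hy j hz, h j z hz, sub_self]
  have h1 : ∀ j, ∫ z in (0 : ℝ)..1, |P.xbarE K (fun j z => X j z - Y j z) j z| = 0 := fun j => by
    rw [intervalIntegral.integral_congr_ae (g := fun _ => 0)
      (Filter.Eventually.of_forall fun z hz => by
        rw [uIoc_of_le zero_le_one] at hz
        rw [h0 j z hz, abs_zero])]
    simp
  have h2 := (hC _ (fun k => (hX k).sub (hY k)) j z (Ioc_subset_Icc_self hz)).2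
  rw [h0 j z hz, mass, h1, h1, abs_zero, add_zero, add_zero, mul_zero] at h2
  rw [← hXx j z (Ioc_subset_Icc_self hz), ← hYy j z (Ioc_subset_Icc_self hz)]
  exact sub_eq_zero.1 (abs_nonpos_iff.1 h2)

/-- The integral in `ubar` is the Volterra part of `x̄₁(1) - q̄₁ x̄₂(1)`, and `q̄₁` absorbs the
ratio of the scaling factors at `z = 1`. -/
theorem ubar_eq_of_bc (hK : P.IsKernel K) {x : Fin 2 → ℝ → ℝ} (hx : IsProfile x) {u : ℝ}
    (h : x 0 1 = P.q1 * x 1 1 + u) :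
    P.ubar K x u = P.xbar K x 0 1 - P.qbar1 * P.xbar K x 1 1 := by
  obtain ⟨X, hX, hXx⟩ := hx.exists_locBounded
  have hI : ∀ j, IntervalIntegrable (fun z => ((K 1 z).mulVec (P.scaled x z)) j) volume 0 1 := by
    intro j
    have h1 : LocBounded fun z => ∑ k, kerE K 1 z j k * (P.scaleE k z * X k z) :=
      LocBounded.sum _ fun k _ => (LocBounded.of_continuous
        ((continuous_kerE hK.continuous j k).comp (continuous_const.prodMk continuous_id))).mul
        ((LocBounded.of_continuous (P.continuous_scaleE k)).mul (hX k))
    refine (h1.intervalIntegrable 0 1).congr fun z hz => ?_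
    rw [uIoc_of_le zero_le_one] at hz
    have hz' := Ioc_subset_Icc_self hz
    simp only [Matrix.mulVec, dotProduct, scaled, P.E_of_mem _ hz', hXx _ z hz']
    rw [kerE_of_mem K ⟨hz'.1, hz'.2, le_rfl⟩]
  have hu : u = x 0 1 - P.q1 * x 1 1 := by linarith
  have he : Real.exp (P.alpha 0 1 + P.alpha 1 1) * Real.exp (-P.alpha 1 1)
      = Real.exp (P.alpha 0 1) := by rw [← Real.exp_add]; congr 1; ring
  rw [ubar, intervalIntegral.integral_sub ((hI 1).const_mul _) (hI 0),
    intervalIntegral.integral_const_mul, xbar, xbar, hu]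
  simp only [scaled, E, Matrix.cons_val_zero, Matrix.cons_val_one, qbar1]
  linear_combination (P.q1 * x 1 1) * he

variable {u : ℝ → ℝ} {ξ : ℝ → Fin n → ℝ} {x : Fin 2 → ℝ → ℝ → ℝ}

theorem IsSolution.ubar_eq (hq0 : P.q0 ≠ 0) (hK : P.IsKernel K) (hs : P.IsSolution univ u ξ x)
    {Y : ℕ → ℝ → ℝ} (hY : IsGlobalJet n Y) (hξ : ∀ t, P.xiPar Y t = ξ t)
    (hx : ∀ t, P.p1Par Y t = x 0 0 t) {a : Fin (n + 1) → ℝ} {aD : ℝ → ℝ}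
    (ha : P.IsHCCFCoeff K a aD) (t : ℝ) :
    P.ubar K (fun j z => x j z t) (u t) = Y n (t + P.tau 0)
      + P.hccfFunctional a aD (fun i => Y i (t + -P.tau 1)) (fun τ => Y n (t + τ)) := by
  rw [ubar_eq_of_bc hK (hs.isProfile (mem_univ t))
    (hs.bc1 t (by rw [interior_univ]; exact mem_univ t)),
    hs.xbar_eq_xPar hq0 hK hξ hx t 0 (right_mem_Icc.2 zero_le_one),
    hs.xbar_eq_xPar hq0 hK hξ hx t 1 (right_mem_Icc.2 zero_le_one)]
  exact ha.param _ ((hY.shift t).isJet P)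

/-- The reference trajectory. -/
theorem exists_reference (hu : IsUnit P.kalman.det) (hq0 : P.q0 ≠ 0) (hK : P.IsKernel K)
    {a : Fin (n + 1) → ℝ} {aD : ℝ → ℝ} (ha : P.IsHCCFCoeff K a aD) {yr : ℝ → ℝ}
    (hyr : ContDiff ℝ n yr) : ∃ (ξr : ℝ → Fin n → ℝ) (xr : Fin 2 → ℝ → ℝ → ℝ) (ur : ℝ → ℝ),
      P.IsGeneratedBy K a aD yr ξr xr ur ∧ P.IsSolution univ ur ξr xr := by
  have hY := IsGlobalJet.of_contDiff hyr
  obtain ⟨x, hs, hx⟩ := exists_solution_of_jet (P := P) hu hY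
  have hp : ∀ t, P.p1Par (fun k => iteratedDeriv k yr) t = x 0 0 t := fun t => (hx 0 t).symm
  refine ⟨_, x, _, ⟨fun t => ?_, fun t j z hz => ?_, fun t => ?_⟩, hs⟩
  · rw [← add_zero t]
    simp only [xiPar, jetAt, add_zero]
  · exact hs.xbar_eq_xPar hq0 hK (fun _ => rfl) hp t j hz
  · exact hs.ubar_eq hq0 hK hY (fun _ => rfl) hp ha t

/-- The characteristics of the first component leave the boundary `z = 0` only backward in time. -/
theorem pos_of_characteristic {t₀ t₁ : ℝ} (ht : t₀ < t₁) {Z : ℝ → ℝ}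
    (hZ : ∀ t ∈ Icc t₀ t₁, Z t ∈ Icc (0 : ℝ) 1 ∧
      HasDerivWithinAt Z (-P.Lam (Z t) 0) (Icc t₀ t₁) t) : 0 < Z t₀ := by
  refine lt_of_le_of_ne (hZ t₀ (left_mem_Icc.2 ht.le)).1.1 fun hz => ?_
  have hd := (P.travelTime 0).travel_of_hasDerivWithinAt (Z := Z) (c := -sgn 0) (t₀ := t₀)
    (t₁ := t₁) (fun r hr => by
      have := (hZ r hr).2
      rwa [P.Lam_eq, ← P.lamE_of_mem 0 (hZ r hr).1, ← neg_mul] at this)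
    t₁ (right_mem_Icc.2 ht.le)
  have h := P.phiE_nonneg 0 (hZ t₁ (right_mem_Icc.2 ht.le)).1.1
  rw [hd, ← hz, P.phiE_zero, sgn_zero] at h
  linarith

/-- Solutions for nonnegative time extend to all times, up to the value of `x₁` at `z = 0` at the
initial time, which has no influence. -/
theorem IsSolution.exists_extension (hu : IsUnit P.kalman.det) (hq0 : P.q0 ≠ 0)
    (hK : P.IsKernel K) (hs : P.IsSolution (Ici 0) u ξ x) :
    ∃ (u' : ℝ → ℝ) (ξ' : ℝ → Fin n → ℝ) (x' : Fin 2 → ℝ → ℝ → ℝ), P.IsSolution univ u' ξ' x' ∧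
      (∀ t ≥ 0, ξ' t = ξ t) ∧ (∀ t > 0, ∀ j z, x' j z t = x j z t) ∧ (∀ t > 0, u' t = u t) ∧
      ∀ j, ∀ z ∈ Ioc (0 : ℝ) 1, x' j z 0 = x j z 0 := by
  have h0I : (0 : ℝ) ∈ Ici (0 : ℝ) := self_mem_Ici
  -- The free value of `x₁(0,·)` at time zero is chosen so that the generated `x₂` agrees with the
  -- given one at `z = 0`, where characteristics of the second component start.
  obtain ⟨Y, hY, hY1, hY2, hY3⟩ := exists_jet_of_profile hu hq0 hK (ξ 0) (hs.isProfile h0I)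
    (P.q0⁻¹ * (x 1 0 0 - P.c ⬝ᵥ ξ 0))
  obtain ⟨xE, hE, hxE⟩ := exists_solution_of_jet (P := P) hu hY
  have hxE0 : ∀ j, ∀ z ∈ Ioc (0 : ℝ) 1, xE j z 0 = x j z 0 := fun j z hz => by
    refine xbar_injective hK (hE.isProfile (mem_univ 0)) (hs.isProfile h0I) (fun j z hz => ?_) j hz
    rw [hY3 j z hz, hE.xbar_eq_xPar hq0 hK (fun _ => rfl) (fun t => (hxE 0 t).symm) 0 j
      (Ioc_subset_Icc_self hz)]
    simp only [zero_add]
  have hxE1 : xE 1 0 0 = x 1 0 0 := by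
    rw [hxE, pPar_one, hY2, hY1]; field_simp; ring
  -- The generated past is glued to the given future. At time zero the two agree except possibly for
  -- `x₁` at `z = 0`.
  let x' : Fin 2 → ℝ → ℝ → ℝ := fun j z t => if t ≤ 0 then xE j z t else x j z t
  let ξ' : ℝ → Fin n → ℝ := fun t => if t ≤ 0 then P.xiPar Y t else ξ t
  have hx'n : ∀ {t}, t ≤ 0 → ∀ j z, x' j z t = xE j z t := fun ht j z => if_pos ht
  have hx'p : ∀ {t}, 0 < t → ∀ j z, x' j z t = x j z t := fun ht j z => if_neg (not_le.2 ht)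
  have hξ'n : ∀ {t}, t ≤ 0 → ξ' t = P.xiPar Y t := fun ht => if_pos ht
  have hξ'p : ∀ {t}, 0 ≤ t → ξ' t = ξ t := fun {t} ht => by
    rcases ht.eq_or_lt with rfl | ht
    · rw [hξ'n le_rfl, hY1]
    · exact if_neg (not_le.2 ht)
  have hm : ∀ j, Measurable ((Icc (0 : ℝ) 1 ×ˢ univ).indicator fun p : ℝ × ℝ => x' j p.1 p.2) := by
    intro j
    have h : Measurable fun p : ℝ × ℝ => if p.2 ≤ 0
        then (Icc (0 : ℝ) 1 ×ˢ univ).indicator (fun p : ℝ × ℝ => xE j p.1 p.2) p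
        else (Icc (0 : ℝ) 1 ×ˢ Ici 0).indicator (fun p : ℝ × ℝ => x j p.1 p.2) p := Measurable.ite
      (measurableSet_le measurable_snd measurable_const) (hE.measurable j) (hs.measurable j)
    convert h using 1
    funext p
    by_cases h1 : p.2 ≤ 0
    · by_cases h2 : p.1 ∈ Icc (0 : ℝ) 1
      · simp [indicator, h1, h2, hx'n h1]
      · simp [indicator, h1, h2]
    · by_cases h2 : p.1 ∈ Icc (0 : ℝ) 1
      · simp [indicator, h1, h2, hx'p (not_le.1 h1), (not_le.1 h1).le]
      · simp [indicator, h1, h2]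
  have hb : ∀ T : ℝ, ∃ B, ∀ j, ∀ t ∈ univ, |t| ≤ T → ∀ z ∈ Icc (0 : ℝ) 1, |x' j z t| ≤ B := by
    intro T
    obtain ⟨B, hB⟩ := hE.bounded T
    obtain ⟨D, hD⟩ := hs.bounded T
    refine ⟨max B D, fun j t _ ht z hz => ?_⟩
    rcases le_or_gt t 0 with h | h
    · rw [hx'n h]; exact (hB j t (mem_univ t) ht z hz).trans (le_max_left _ _)
    · rw [hx'p h]; exact (hD j t h.le ht z hz).trans (le_max_right _ _)
  have hL : ∀ j (f : ℝ → ℝ), Continuous f → (∀ t, f t ∈ Icc (0 : ℝ) 1) →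
      LocBounded fun t => x' j (f t) t := fun j f hf hf01 =>
    locBounded_of_indicator (hm j) (fun T => (hb T).imp fun B hB t ht => hB j t (mem_univ t) ht)
      hf hf01
  have hξ' : Continuous ξ' := by
    have h1 : Continuous fun t => ξ (max t 0) := hs.continuous_ode.comp_continuous
      (continuous_id.max continuous_const) fun t => mem_Ici.2 (le_max_right _ _)
    have h2 : ξ' = fun t => if t ≤ 0 then P.xiPar Y t else ξ (max t 0) := by
      funext t
      rcases le_or_gt t 0 with h | h
      · rw [hξ'n h, if_pos h]
      · rw [hξ'p h.le, if_neg (not_le.2 h), max_eq_left h.le]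
    rw [h2]
    refine Continuous.if_le (continuous_xiPar hY) h1 continuous_id continuous_const ?_
    rintro t rfl
    simp [hY1]
  refine ⟨fun t => x' 0 1 t - P.q1 * x' 1 1 t, ξ', x', ⟨hm, hb, hξ'.continuousOn, ?_, ?_, ?_, ?_⟩,
    fun t ht => hξ'p ht, fun t ht j z => hx'p ht j z, fun t ht => ?_, fun j z hz => ?_⟩
  · intro s _ t _ hst i
    have hf : LocBounded fun r => P.F.mulVec (ξ' r) i + P.b i * x' 0 0 r :=
      (LocBounded.mulVec _ (fun j => .of_continuous ((continuous_apply j).comp hξ')) i).add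
        ((hL 0 _ continuous_const fun _ => left_mem_Icc.2 zero_le_one).const_mul _)
    have hneg : ∀ s ≤ 0, ∀ t ≤ 0, s ≤ t →
        ξ' t i = ξ' s i + ∫ r in s..t, (P.F.mulVec (ξ' r) i + P.b i * x' 0 0 r) := by
      intro s hs0 t ht0 hst
      rw [hξ'n hs0, hξ'n ht0, hE.ode s (mem_univ s) t (mem_univ t) hst i]
      congr 1
      refine intervalIntegral.integral_congr fun r hr => ?_
      rw [uIcc_of_le hst] at hr
      simp only [hξ'n (hr.2.trans ht0), hx'n (hr.2.trans ht0)]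
    have hpos : ∀ s ≥ 0, ∀ t, s ≤ t →
        ξ' t i = ξ' s i + ∫ r in s..t, (P.F.mulVec (ξ' r) i + P.b i * x' 0 0 r) := by
      intro s hs0 t hst
      rw [hξ'p hs0, hξ'p (hs0.le.trans hst), hs.ode s hs0 t (hs0.le.trans hst) hst i]
      congr 1
      refine intervalIntegral.integral_congr_ae (Filter.Eventually.of_forall fun r hr => ?_)
      rw [uIoc_of_le hst] at hr
      have h0 : 0 < r := lt_of_le_of_lt hs0 hr.1
      rw [hξ'p h0.le, hx'p h0]
    rcases le_total t 0 with ht | ht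
    · exact hneg s (hst.trans ht) t ht hst
    · rcases le_total 0 s with hs0 | hs0
      · exact hpos s hs0 t hst
      · rw [hpos 0 le_rfl t ht, hneg s hs0 0 le_rfl hs0, add_assoc,
          intervalIntegral.integral_add_adjacent_intervals (hf.intervalIntegrable _ _)
            (hf.intervalIntegrable _ _)]
  · intro t _
    rcases le_or_gt t 0 with h | h
    · rw [hx'n h, hx'n h, hξ'n h]
      exact hE.bc0 t (by rw [interior_univ]; exact mem_univ t)
    · rw [hx'p h, hx'p h, hξ'p h.le]
      exact hs.bc0 t (by rw [interior_Ici]; exact h)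
  · intro t _; ring
  · intro i t₀ t₁ Z ht _ hZ
    let f : ℝ → ℝ := fun t => ∑ j, P.A (Z t) i j * x' j (Z t) t
    have hneg : ∀ s t, t₀ ≤ s → s ≤ t → t ≤ t₁ → t ≤ 0 →
        x' i (Z t) t = x' i (Z s) s + ∫ t in s..t, f t := by
      intro s t h1 h2 h3 h4
      rw [hx'n h4, hx'n (h2.trans h4), hE.pde i s t Z h2 (subset_univ _) fun r hr =>
        ⟨(hZ r ⟨h1.trans hr.1, hr.2.trans h3⟩).1, (hZ r ⟨h1.trans hr.1, hr.2.trans h3⟩).2.mono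
          (Icc_subset_Icc h1 h3)⟩]
      congr 1
      refine intervalIntegral.integral_congr fun r hr => ?_
      rw [uIcc_of_le h2] at hr
      simp only [f, hx'n (hr.2.trans h4)]
    have hpos : ∀ s t, t₀ ≤ s → s ≤ t → t ≤ t₁ → 0 ≤ s →
        x' i (Z t) t = x' i (Z s) s + ∫ t in s..t, f t := by
      intro s t h1 h2 h3 h4
      rcases h2.eq_or_lt with rfl | h2
      · simp
      have hZ' : ∀ r ∈ Icc s t, Z r ∈ Icc (0 : ℝ) 1 ∧
          HasDerivWithinAt Z (-P.Lam (Z r) i) (Icc s t) r := fun r hr =>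
        ⟨(hZ r ⟨h1.trans hr.1, hr.2.trans h3⟩).1, (hZ r ⟨h1.trans hr.1, hr.2.trans h3⟩).2.mono
          (Icc_subset_Icc h1 h3)⟩
      have hs0 : x' i (Z s) s = x i (Z s) s := by
        rcases h4.eq_or_lt with rfl | h4
        · rw [hx'n le_rfl]
          obtain ⟨hz0, hz1⟩ := (hZ' 0 (left_mem_Icc.2 h2.le)).1
          -- A characteristic that starts at `z = 0` and continues forward in time belongs to the
          -- second component, whose value there has been matched.
          rcases hz0.eq_or_lt with hz | hz
          · obtain rfl : i = 1 := by
              fin_cases i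
              · exact absurd hz (pos_of_characteristic h2 hZ').ne
              · rfl
            rw [← hz]
            exact hxE1
          · exact hxE0 i _ ⟨hz, hz1⟩
        · exact hx'p h4 i _
      rw [hx'p (lt_of_le_of_lt h4 h2), hs0, hs.pde i s t Z h2.le (fun r hr => h4.trans hr.1) hZ']
      congr 1
      refine intervalIntegral.integral_congr_ae (Filter.Eventually.of_forall fun r hr => ?_)
      rw [uIoc_of_le h2.le] at hr
      simp only [f, hx'p (lt_of_le_of_lt h4 hr.1)]
    rcases le_total t₁ 0 with h1 | h1
    · exact hneg t₀ t₁ le_rfl ht le_rfl h1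
    · rcases le_total 0 t₀ with h0 | h0
      · exact hpos t₀ t₁ le_rfl ht le_rfl h0
      · have hint : ∀ a b, t₀ ≤ a → a ≤ b → b ≤ t₁ → IntervalIntegrable f volume a b := by
          intro a b h1 h2 h3
          let Zc : ℝ → ℝ := fun t => Z (max t₀ (min t t₁))
          have hcl : ∀ t, max t₀ (min t t₁) ∈ Icc t₀ t₁ := fun t =>
            ⟨le_max_left _ _, max_le ht (min_le_right _ _)⟩
          have hZc : Continuous Zc := ContinuousOn.comp_continuous
            (s := Icc t₀ t₁) (fun r hr => (hZ r hr).2.continuousWithinAt) (by fun_prop) hcl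
          have h4 : LocBounded fun t => ∑ j, P.AE (Zc t) i j * x' j (Zc t) t :=
            LocBounded.sum _ fun j _ => (LocBounded.of_continuous
              ((P.continuous_AE i j).comp hZc)).mul (hL j Zc hZc fun t => (hZ _ (hcl t)).1)
          refine (h4.intervalIntegrable a b).congr fun r hr => ?_
          rw [uIoc_of_le h2] at hr
          have h5 : Zc r = Z r := by
            simp only [Zc]
            rw [min_eq_left (hr.2.trans h3), max_eq_right (h1.trans hr.1.le)]
          have h6 := (hZ r ⟨h1.trans hr.1.le, hr.2.trans h3⟩).1
          simp only [h5, f, AE, unitClamp_of_mem h6]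
        rw [hpos 0 t₁ h0 h1 le_rfl le_rfl, hneg t₀ 0 le_rfl h0 h1 le_rfl, add_assoc,
          intervalIntegral.integral_add_adjacent_intervals (hint _ _ le_rfl h0 h1)
            (hint _ _ h0 h1 le_rfl)]
  · simp only [hx'p ht]
    have := hs.bc1 t (by rw [interior_Ici]; exact ht)
    linarith
  · rw [hx'n le_rfl, hxE0 j z hz]

end System

/-! ### The closed loop as a difference equation for the tracking error -/

/-- Taylor's formula with integral remainder. -/
theorem IsGlobalJet.taylor {n : ℕ} {Y : ℕ → ℝ → ℝ} (hY : IsGlobalJet n Y) {a b : ℝ} (hab : a ≤ b)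
    (k m : ℕ) (h : k + m + 1 ≤ n) :
    Y k b = (∑ j ∈ Finset.range (m + 1), Y (k + j) a * (b - a) ^ j / (j.factorial : ℝ))
      + ∫ σ in a..b, (b - σ) ^ m / (m.factorial : ℝ) * Y (k + m + 1) σ := by
  induction m with
  | zero => simpa using hY.deriv k (by omega) a b
  | succ m ih =>
    rw [ih (by omega), Finset.sum_range_succ _ (m + 1)]
    have hc : Continuous fun σ : ℝ => -((b - σ) ^ (m + 1) / ((m + 1).factorial : ℝ)) := by fun_prop
    have hc' : Continuous fun σ : ℝ => (b - σ) ^ m / (m.factorial : ℝ) := by fun_prop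
    have hd : ∀ σ, HasDerivAt (fun σ : ℝ => -((b - σ) ^ (m + 1) / ((m + 1).factorial : ℝ)))
        ((b - σ) ^ m / (m.factorial : ℝ)) σ := fun σ => by
      refine ((((hasDerivAt_id σ).const_sub b).pow (m + 1)).div_const _).neg.congr_deriv ?_
      rw [Nat.factorial_succ]
      push_cast
      have h1 : (m.factorial : ℝ) ≠ 0 := by positivity
      have h2 : (m : ℝ) + 1 ≠ 0 := by positivity
      simp only [id]
      field_simp
    have h1 : LocBounded (Y (k + m + 1)) := hY.locBounded (by omega)
    have h2 : LocBounded (Y (k + m + 1 + 1)) := hY.locBounded (by omega)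
    have e := mul_sub_mul_eq_integral (F := fun σ : ℝ => -((b - σ) ^ (m + 1) / ((m + 1).factorial : ℝ)))
      (G := Y (k + m + 1)) hab (hc'.intervalIntegrable a b) (h2.intervalIntegrable a b)
      (fun t _ => by
        rw [intervalIntegral.integral_eq_sub_of_hasDerivAt (fun σ _ => hd σ)
          (hc'.intervalIntegrable a t)]; ring)
      (fun t _ => hY.deriv (k + m + 1) (by omega) a t)
    rw [intervalIntegral.integral_add
      (((LocBounded.of_continuous hc').mul h1).intervalIntegrable a b)
      (((LocBounded.of_continuous hc).mul h2).intervalIntegrable a b)] at e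
    have e2 : ∫ σ in a..b, -((b - σ) ^ (m + 1) / ((m + 1).factorial : ℝ)) * Y (k + m + 1 + 1) σ
        = -∫ σ in a..b, (b - σ) ^ (m + 1) / ((m + 1).factorial : ℝ) * Y (k + (m + 1) + 1) σ := by
      rw [← intervalIntegral.integral_neg]
      congr 1
      funext σ
      rw [neg_mul, ← add_assoc k]
    rw [e2] at e
    simp only [sub_self, zero_pow (Nat.succ_ne_zero m), zero_div, neg_zero, zero_mul] at e
    simp only [← add_assoc k] at e ⊢
    linear_combination -e

theorem sum_fin_ite_le {n k : ℕ} (f : ℕ → ℝ) :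
    ∑ i : Fin n, (if k ≤ (i : ℕ) then f i else 0) = ∑ j ∈ Finset.range (n - k), f (k + j) := by
  rw [Fin.sum_univ_eq_sum_range (fun i => if k ≤ i then f i else 0) n, ← Finset.sum_filter,
    ← Finset.sum_Ico_eq_sum_range]
  refine Finset.sum_congr ?_ fun _ _ => rfl
  ext i
  simp only [Finset.mem_filter, Finset.mem_range, Finset.mem_Ico]
  omega

namespace System

variable {n : ℕ} {P : System n} {K : ℝ → ℝ → Matrix (Fin 2) (Fin 2) ℝ}

/-- The differential operator `yⁿ + κ_{n-1} y^{n-1} + … + κ₀ y` of the tracking error. -/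
def errorOp (κ : Fin n → ℝ) (Y : ℕ → ℝ → ℝ) (t : ℝ) : ℝ := Y n t + ∑ i : Fin n, κ i * Y i t

theorem taylor_window {Y : ℕ → ℝ → ℝ} (hY : IsGlobalJet n Y) (k : Fin n) :
    Y k (P.tau 0) = (∑ i : Fin n, if k ≤ i then
        (P.tau 0 + P.tau 1) ^ ((i : ℕ) - k) / (((i : ℕ) - k).factorial : ℝ) * Y i (-P.tau 1) else 0)
      + ∫ σ in (-P.tau 1)..(P.tau 0),
        (P.tau 0 - σ) ^ (n - (k : ℕ) - 1) / ((n - (k : ℕ) - 1).factorial : ℝ) * Y n σ := by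
  have hk := k.2
  have h := hY.taylor P.window_le k (n - k - 1) (by omega)
  rw [show (k : ℕ) + (n - k - 1) + 1 = n by omega, show n - (k : ℕ) - 1 + 1 = n - k by omega] at h
  rw [h]
  congr 1
  simp only [Fin.le_def]
  rw [sum_fin_ite_le fun i =>
    (P.tau 0 + P.tau 1) ^ (i - k) / ((i - (k : ℕ)).factorial : ℝ) * Y i (-P.tau 1)]
  refine Finset.sum_congr rfl fun j _ => ?_
  rw [Nat.add_sub_cancel_left, sub_neg_eq_add]
  ring

/-- The desired closed loop in terms of the tracking error. -/
theorem add_hccfFunctional_abar (κ : Fin n → ℝ) (γ : ℝ) {Y : ℕ → ℝ → ℝ} (hY : IsGlobalJet n Y) :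
    Y n (P.tau 0) + P.hccfFunctional (P.abar κ γ) (P.abarD κ) (fun i => Y i (-P.tau 1)) (Y n)
      = errorOp κ Y (P.tau 0) + γ * errorOp κ Y (-P.tau 1) := by
  have hI : ∀ i : Fin n, IntervalIntegrable (fun σ => κ i * ((P.tau 0 - σ) ^ (n - (i : ℕ) - 1)
      / ((n - (i : ℕ) - 1).factorial : ℝ) * Y n σ)) volume (-P.tau 1) (P.tau 0) := fun i =>
    (((LocBounded.of_continuous (by fun_prop)).mul hY.top).const_mul _).intervalIntegrable _ _
  have h1 : ∫ τ in (-P.tau 1)..(P.tau 0), P.abarD κ τ * Y n τ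
      = ∑ i : Fin n, κ i * ∫ σ in (-P.tau 1)..(P.tau 0),
        (P.tau 0 - σ) ^ (n - (i : ℕ) - 1) / ((n - (i : ℕ) - 1).factorial : ℝ) * Y n σ := by
    simp only [← intervalIntegral.integral_const_mul]
    rw [← intervalIntegral.integral_finsetSum fun i _ => hI i]
    congr 1
    funext τ
    rw [abarD, Finset.sum_mul]
    exact Finset.sum_congr rfl fun i _ => by ring
  have h2 : ∑ i : Fin n, P.abar κ γ i.castSucc * Y i (-P.tau 1)
      = γ * (∑ i : Fin n, κ i * Y i (-P.tau 1)) + ∑ k : Fin n, κ k * ∑ i : Fin n, if k ≤ i then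
        (P.tau 0 + P.tau 1) ^ ((i : ℕ) - k) / (((i : ℕ) - k).factorial : ℝ) * Y i (-P.tau 1)
        else 0 := by
    simp only [abar, Fin.snoc_castSucc, add_mul, Finset.sum_add_distrib, Finset.mul_sum,
      Finset.sum_mul]
    rw [Finset.sum_comm (γ := Fin n)]
    congr 1
    · exact Finset.sum_congr rfl fun i _ => by ring
    · refine Finset.sum_congr rfl fun k _ => Finset.sum_congr rfl fun i _ => ?_
      split_ifs <;> ring
  -- Taylor's formula carries the derivatives at `τ₁` back to `-τ₂`. Its polynomial part gives the
  -- terms of `abar` without `γ`, its remainder the function `abarD`.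
  have h3 : ∑ k : Fin n, κ k * Y k (P.tau 0)
      = (∑ k : Fin n, κ k * ∑ i : Fin n, if k ≤ i then
        (P.tau 0 + P.tau 1) ^ ((i : ℕ) - k) / (((i : ℕ) - k).factorial : ℝ) * Y i (-P.tau 1)
        else 0) + ∑ i : Fin n, κ i * ∫ σ in (-P.tau 1)..(P.tau 0),
        (P.tau 0 - σ) ^ (n - (i : ℕ) - 1) / ((n - (i : ℕ) - 1).factorial : ℝ) * Y n σ := by
    rw [← Finset.sum_add_distrib]
    exact Finset.sum_congr rfl fun k _ => by rw [← mul_add, ← taylor_window hY k]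
  rw [hccfFunctional, h1, h2, errorOp, errorOp, h3]
  simp only [abar, Fin.snoc_last]
  ring

theorem intervalIntegrable_window {aD f : ℝ → ℝ} (ha : ContinuousOn aD P.window)
    (hf : LocBounded f) :
    IntervalIntegrable (fun τ => aD τ * f τ) volume (-P.tau 1) (P.tau 0) := by
  refine (hf.intervalIntegrable _ _).continuousOn_mul ?_
  rwa [uIcc_of_le P.window_le]

theorem hccfFunctional_sub_coeff (a a' : Fin (n + 1) → ℝ) {aD aD' : ℝ → ℝ}
    (ha : ContinuousOn aD P.window) (ha' : ContinuousOn aD' P.window) (η : Fin n → ℝ) {f : ℝ → ℝ}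
    (hf : LocBounded f) :
    P.hccfFunctional (fun i => a i - a' i) (fun τ => aD τ - aD' τ) η f
      = P.hccfFunctional a aD η f - P.hccfFunctional a' aD' η f := by
  simp only [hccfFunctional, sub_mul, Finset.sum_sub_distrib]
  rw [intervalIntegral.integral_sub (intervalIntegrable_window ha hf)
    (intervalIntegrable_window ha' hf)]
  ring

theorem hccfFunctional_sub_state (a : Fin (n + 1) → ℝ) {aD : ℝ → ℝ}
    (ha : ContinuousOn aD P.window) (η η' : Fin n → ℝ) {f f' : ℝ → ℝ}
    (hf : LocBounded f) (hf' : LocBounded f') :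
    P.hccfFunctional a aD (fun i => η i - η' i) (fun τ => f τ - f' τ)
      = P.hccfFunctional a aD η f - P.hccfFunctional a aD η' f' := by
  simp only [hccfFunctional, mul_sub, Finset.sum_sub_distrib]
  rw [intervalIntegral.integral_sub (intervalIntegrable_window ha hf)
    (intervalIntegrable_window ha hf')]
  ring

theorem continuous_abarD (P : System n) (κ : Fin n → ℝ) : Continuous (P.abarD κ) := by
  unfold abarD; fun_prop

variable {u : ℝ → ℝ} {ξ : ℝ → Fin n → ℝ} {x : Fin 2 → ℝ → ℝ → ℝ}

/-- The feedback law in terms of the tracking error of the flat output. -/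
theorem IsSolution.isFeedback_iff (hu : IsUnit P.kalman.det) (hq0 : P.q0 ≠ 0) (hK : P.IsKernel K)
    (hs : P.IsSolution univ u ξ x) {Y : ℕ → ℝ → ℝ} (hY : IsGlobalJet n Y)
    (hξ : ∀ t, P.xiPar Y t = ξ t) (hx : ∀ t, P.p1Par Y t = x 0 0 t) {a : Fin (n + 1) → ℝ}
    {aD : ℝ → ℝ} (ha : P.IsHCCFCoeff K a aD) (κ : Fin n → ℝ) (γ : ℝ) {yr : ℝ → ℝ}
    (hyr : ContDiff ℝ n yr) (t : ℝ) :
    P.IsFeedback K a aD κ γ yr t (ξ t) (fun j z => x j z t) (u t) ↔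
      errorOp κ (fun k t => Y k t - iteratedDeriv k yr t) (t + P.tau 0)
        + γ * errorOp κ (fun k t => Y k t - iteratedDeriv k yr t) (t + -P.tau 1) = 0 := by
  have hR := IsGlobalJet.of_contDiff hyr
  have hYt := hY.shift t
  have hRt := hR.shift t
  have hst : P.IsHCCFState K (ξ t) (P.xbar K fun j z => x j z t) (fun i => Y i (t + -P.tau 1))
      (fun τ => Y n (t + τ)) := by
    refine hYt.isHCCFState (by rw [← hξ]; simp only [xiPar, add_zero]) fun i z hz => ?_
    exact hs.xbar_eq_xPar hq0 hK hξ hx t i (Ioc_subset_Icc_self hz)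
  have h1 := hs.ubar_eq hq0 hK hY hξ hx ha t
  have hc := (P.continuous_abarD κ).continuousOn (s := P.window)
  have h2 := add_hccfFunctional_abar (P := P) κ γ (hYt.sub hRt)
  -- The functional is linear in its coefficients and in the state. The terms with `a` cancel
  -- between actual input and feedback, and the functional with coefficients `abar` applied to the
  -- error remains.
  have h3 := hccfFunctional_sub_coeff (P := P) a (P.abar κ γ) ha.continuous hc
    (fun i : Fin n => Y i (t + -P.tau 1) - iteratedDeriv i yr (t + -P.tau 1)) (hYt.sub hRt).top
  have h4 := hccfFunctional_sub_state (P := P) a ha.continuous (fun i : Fin n => Y i (t + -P.tau 1))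
    (fun i : Fin n => iteratedDeriv i yr (t + -P.tau 1)) hYt.top hRt.top
  have h5 : P.ubarRef a aD yr t = iteratedDeriv n yr (t + P.tau 0) + P.hccfFunctional a aD
    (fun i : Fin n => iteratedDeriv i yr (t + -P.tau 1)) (fun τ => iteratedDeriv n yr (t + τ)) := rfl
  have h6 : P.ubar K (fun j z => x j z t) (u t) = P.ubarRef a aD yr t
        + P.hccfFunctional (fun i => a i - P.abar κ γ i) (fun τ => aD τ - P.abarD κ τ)
          (fun i => Y i (t + -P.tau 1) - jetAt yr t i (-P.tau 1))
          (fun τ => Y n (t + τ) - jetAt yr t n τ) ↔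
      errorOp κ (fun k t => Y k t - iteratedDeriv k yr t) (t + P.tau 0)
        + γ * errorOp κ (fun k t => Y k t - iteratedDeriv k yr t) (t + -P.tau 1) = 0 := by
    simp only [jetAt]
    simp only [errorOp] at h2 ⊢
    rw [h3, h4, h5, h1, ← h2]
    constructor <;> intro h <;> linarith
  rw [← h6]
  constructor
  · rintro ⟨η, v, hst', h⟩
    obtain ⟨e1, e2⟩ := hst'.unique hu hq0 hK hst
    rw [h]
    congr 1
    refine hccfFunctional_congr _ _ ?_ fun τ hτ h0 => ?_
    · funext i; rw [e1]
    · rw [e2 τ hτ h0]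
  · exact fun h => ⟨_, _, hst, h⟩

/-- The trajectory of the flat output that belongs to a solution for all times. -/
theorem IsSolution.exists_jet (hu : IsUnit P.kalman.det) (hs : P.IsSolution univ u ξ x) :
    ∃ Y, IsGlobalJet n Y ∧ (∀ t, P.xiPar Y t = ξ t) ∧ ∀ t, P.p1Par Y t = x 0 0 t := by
  have h0 : LocBounded fun t => x 0 0 t := locBounded_of_indicator (hs.measurable 0)
    (fun T => (hs.bounded T).imp fun B hB t ht => hB 0 t (mem_univ t) ht)
    (continuous_const (y := (0 : ℝ))) fun _ => left_mem_Icc.2 zero_le_one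
  have hc : Continuous ξ := continuousOn_univ.1 hs.continuous_ode
  refine ⟨P.flatJet ξ (x 0 0), isGlobalJet_flatJet hu hc h0 fun s t i => ?_,
    fun t => xiPar_flatJet P hu _ _ t, fun t => p1Par_flatJet P _ _ _⟩
  rcases le_total s t with h | h
  · exact hs.ode s (mem_univ s) t (mem_univ t) h i
  · rw [hs.ode t (mem_univ t) s (mem_univ s) h i, intervalIntegral.integral_symm]
    ring

/-- The tracking error of a closed-loop solution satisfies a difference equation. -/
theorem IsClosedLoopSolution.exists_jet (hu : IsUnit P.kalman.det) (hq0 : P.q0 ≠ 0)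
    (hK : P.IsKernel K) {a : Fin (n + 1) → ℝ} {aD : ℝ → ℝ} (ha : P.IsHCCFCoeff K a aD)
    {κ : Fin n → ℝ} {γ : ℝ} {yr : ℝ → ℝ} (hyr : ContDiff ℝ n yr)
    (hs : P.IsClosedLoopSolution K a aD κ γ yr ξ x u) :
    ∃ Y, IsGlobalJet n Y ∧ (∀ t ≥ 0, P.xiPar Y t = ξ t) ∧
      (∀ t ≥ 0, ∀ j, ∀ z ∈ Ioc (0 : ℝ) 1,
        P.xbar K (fun j z => x j z t) j z = P.xPar K (fun k τ => Y k (t + τ)) j z) ∧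
      ∀ t > 0, errorOp κ (fun k t => Y k t - iteratedDeriv k yr t) (t + P.tau 0)
        + γ * errorOp κ (fun k t => Y k t - iteratedDeriv k yr t) (t + -P.tau 1) = 0 := by
  obtain ⟨u', ξ', x', hs', hξ, hx, hu', hx0⟩ := hs.solution.exists_extension hu hq0 hK
  obtain ⟨Y, hY, hY1, hY2⟩ := hs'.exists_jet hu
  refine ⟨Y, hY, fun t ht => (hY1 t).trans (hξ t ht), fun t ht j z hz => ?_, fun t ht => ?_⟩
  · rw [← hs'.xbar_eq_xPar hq0 hK hY1 hY2 t j (Ioc_subset_Icc_self hz)]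
    refine P.xbar_congr K (fun j z hz => ?_) j hz
    rcases ht.le.eq_or_lt with rfl | ht
    · exact (hx0 j z hz).symm
    · exact (hx t ht j z).symm
  · rw [← hs'.isFeedback_iff hu hq0 hK hY hY1 hY2 ha κ γ hyr t]
    have e : (fun j z => x' j z t) = fun j z => x j z t := by funext j z; exact hx t ht j z
    rw [e, hξ t ht.le, hu' t ht]
    exact hs.feedback t ht

end System

/-! ### Exponential decay of the tracking error -/

/-- Weighted energy estimate for `g' = (σ + iτ) g + h` with `σ < 0`, written in real and imaginary
parts. -/
theorem exp_mul_sq_le {g₁ g₂ h₁ h₂ : ℝ → ℝ} (hg₁ : LocBounded g₁) (hg₂ : LocBounded g₂)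
    (hh₁ : LocBounded h₁) (hh₂ : LocBounded h₂) {σ τ ω a : ℝ} (hσ : σ < 0) (hω : ω ≤ -σ)
    (e₁ : ∀ t, g₁ t = g₁ a + ∫ r in a..t, (h₁ r + σ * g₁ r - τ * g₂ r))
    (e₂ : ∀ t, g₂ t = g₂ a + ∫ r in a..t, (h₂ r + σ * g₂ r + τ * g₁ r)) {t : ℝ} (ht : a ≤ t) :
    Real.exp (ω * (t - a)) * (g₁ t ^ 2 + g₂ t ^ 2) ≤ g₁ a ^ 2 + g₂ a ^ 2
      + (-σ)⁻¹ * ∫ r in a..t, Real.exp (ω * (r - a)) * (h₁ r ^ 2 + h₂ r ^ 2) := by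
  have hf₁ : LocBounded fun r => h₁ r + σ * g₁ r - τ * g₂ r :=
    (hh₁.add (hg₁.const_mul σ)).sub (hg₂.const_mul τ)
  have hf₂ : LocBounded fun r => h₂ r + σ * g₂ r + τ * g₁ r :=
    (hh₂.add (hg₂.const_mul σ)).add (hg₁.const_mul τ)
  let f₁ : ℝ → ℝ := fun r => h₁ r + σ * g₁ r - τ * g₂ r
  let f₂ : ℝ → ℝ := fun r => h₂ r + σ * g₂ r + τ * g₁ r
  let f : ℝ → ℝ := fun r => (f₁ r * g₁ r + g₁ r * f₁ r) + (f₂ r * g₂ r + g₂ r * f₂ r)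
  have hN₁ : LocBounded fun r => f₁ r * g₁ r + g₁ r * f₁ r := (hf₁.mul hg₁).add (hg₁.mul hf₁)
  have hN₂ : LocBounded fun r => f₂ r * g₂ r + g₂ r * f₂ r := (hf₂.mul hg₂).add (hg₂.mul hf₂)
  have hf : LocBounded f := hN₁.add hN₂
  have hN : ∀ t ≥ a, g₁ t ^ 2 + g₂ t ^ 2 = g₁ a ^ 2 + g₂ a ^ 2 + ∫ r in a..t, f r := by
    intro t ht
    have k₁ := mul_sub_mul_eq_integral ht (hf₁.intervalIntegrable a t) (hf₁.intervalIntegrable a t)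
      (fun r _ => e₁ r) (fun r _ => e₁ r)
    have k₂ := mul_sub_mul_eq_integral ht (hf₂.intervalIntegrable a t) (hf₂.intervalIntegrable a t)
      (fun r _ => e₂ r) (fun r _ => e₂ r)
    have k₃ : ∫ r in a..t, f r = _ := intervalIntegral.integral_add (hN₁.intervalIntegrable a t)
      (hN₂.intervalIntegrable a t)
    linarith
  have hE : LocBounded fun r => Real.exp (ω * (r - a)) := .of_continuous (by fun_prop)
  have hE' : LocBounded fun r => ω * Real.exp (ω * (r - a)) := hE.const_mul ω
  have hg : LocBounded fun r => g₁ r ^ 2 + g₂ r ^ 2 := hg₁.sq.add hg₂.sq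
  have key := mul_sub_mul_eq_integral (F := fun r => Real.exp (ω * (r - a)))
    (G := fun r => g₁ r ^ 2 + g₂ r ^ 2) ht (hE'.intervalIntegrable a t) (hf.intervalIntegrable a t)
    (fun r _ => by
      rw [intervalIntegral.integral_eq_sub_of_hasDerivAt (f := fun r => Real.exp (ω * (r - a)))
        (fun s _ => ?_) (hE'.intervalIntegrable a r)]
      · ring
      · have := (((hasDerivAt_id s).sub_const a).const_mul ω).exp
        simpa [mul_comm] using this) (fun r hr => hN r hr.1)
  have hle : ∫ r in a..t, (ω * Real.exp (ω * (r - a)) * (g₁ r ^ 2 + g₂ r ^ 2)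
        + Real.exp (ω * (r - a)) * f r)
      ≤ ∫ r in a..t, (-σ)⁻¹ * (Real.exp (ω * (r - a)) * (h₁ r ^ 2 + h₂ r ^ 2)) := by
    refine intervalIntegral.integral_mono_on ht (((hE'.mul hg).add (hE.mul hf)).intervalIntegrable _ _)
      (((hE.mul (hh₁.sq.add hh₂.sq)).const_mul _).intervalIntegrable _ _) fun r _ => ?_
    have hs : 0 < -σ := neg_pos.2 hσ
    -- The rotation `τ` drops out of the derivative of the square; the rest follows from `(σ g + h)²
    -- ≥ 0` and `ω ≤ -σ`.
    have h1 : ω * (g₁ r ^ 2 + g₂ r ^ 2) + f r ≤ (-σ)⁻¹ * (h₁ r ^ 2 + h₂ r ^ 2) := by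
      rw [inv_mul_eq_div, le_div_iff₀ hs]
      have e : f r = 2 * (g₁ r * h₁ r + g₂ r * h₂ r) + 2 * σ * (g₁ r ^ 2 + g₂ r ^ 2) := by
        simp only [f, f₁, f₂]; ring
      have h2 : ω * (g₁ r ^ 2 + g₂ r ^ 2) ≤ -σ * (g₁ r ^ 2 + g₂ r ^ 2) :=
        mul_le_mul_of_nonneg_right hω (by positivity)
      have h3 := mul_le_mul_of_nonneg_right h2 hs.le
      rw [e]
      linarith [sq_nonneg (σ * g₁ r + h₁ r), sq_nonneg (σ * g₂ r + h₂ r)]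
    have h2 := mul_le_mul_of_nonneg_left h1 (Real.exp_pos (ω * (r - a))).le
    linarith
  rw [intervalIntegral.integral_const_mul] at hle
  simp only [sub_self, mul_zero, Real.exp_zero, one_mul] at key
  linarith

open Polynomial in
/-- The differential operator with characteristic polynomial `q`, of degree at most `n`. -/
def polyOp (n : ℕ) (q : ℂ[X]) (z : ℕ → ℝ) : ℂ := ∑ i ∈ Finset.range (n + 1), q.coeff i * (z i : ℂ)

section PolyOp

open Polynomial

variable {n : ℕ}

/-- Multiplication by `X` acts on jets as differentiation, a shift of the orders. The bound on the
degree keeps the shifted sum within the orders up to `n`. -/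
theorem polyOp_X_sub_C_mul {q : ℂ[X]} (hq : q.natDegree < n) (s : ℂ) (z : ℕ → ℝ) :
    polyOp n ((X - C s) * q) z = polyOp n q (fun i => z (i + 1)) - s * polyOp n q z := by
  have h1 : q.coeff n = 0 := coeff_eq_zero_of_natDegree_lt hq
  have h2 : ∑ i ∈ Finset.range (n + 1), (X * q).coeff i * (z i : ℂ)
      = polyOp n q (fun i => z (i + 1)) := by
    rw [Finset.sum_range_succ', polyOp, Finset.sum_range_succ, h1]
    simp
  simp only [polyOp, sub_mul, coeff_sub, coeff_C_mul, Finset.sum_sub_distrib, Finset.mul_sum,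
    mul_assoc] at h2 ⊢
  rw [h2]

/-- The sum of the absolute values of the coefficients. -/
def coeffNorm (n : ℕ) (q : ℂ[X]) : ℝ := ∑ i ∈ Finset.range (n + 1), ‖q.coeff i‖

theorem coeffNorm_nonneg (n : ℕ) (q : ℂ[X]) : 0 ≤ coeffNorm n q :=
  Finset.sum_nonneg fun _ _ => norm_nonneg _

theorem norm_polyOp_le {q : ℂ[X]} {z : ℕ → ℝ} {B : ℝ} (h : ∀ k ≤ q.natDegree, |z k| ≤ B) :
    ‖polyOp n q z‖ ≤ coeffNorm n q * B := by
  rw [coeffNorm, Finset.sum_mul]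
  refine (norm_sum_le _ _).trans (Finset.sum_le_sum fun i _ => ?_)
  rw [norm_mul, Complex.norm_real, Real.norm_eq_abs]
  rcases le_or_gt i q.natDegree with hi | hi
  · exact mul_le_mul_of_nonneg_left (h i hi) (norm_nonneg _)
  · simp [coeff_eq_zero_of_natDegree_lt hi]

/-- The leading coefficient is one, so the highest derivative is the value of the operator minus
terms of lower order. -/
theorem abs_le_norm_polyOp_add {q : ℂ[X]} (hq : q.Monic) (hqn : q.natDegree ≤ n) {z : ℕ → ℝ} {B : ℝ}
    (hB : 0 ≤ B) (h : ∀ k < q.natDegree, |z k| ≤ B) :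
    |z q.natDegree| ≤ ‖polyOp n q z‖ + coeffNorm n q * B := by
  have h1 : (z q.natDegree : ℂ)
      = polyOp n q z - polyOp n q (fun k => if k = q.natDegree then 0 else z k) := by
    rw [polyOp, polyOp, ← Finset.sum_sub_distrib, Finset.sum_eq_single q.natDegree]
    · simp [hq.coeff_natDegree]
    · intro i _ hi; simp [hi]
    · intro hi; simp at hi; omega
  have h2 := norm_polyOp_le (n := n) (q := q) (z := fun k => if k = q.natDegree then 0 else z k)
    (B := B) fun k hk => by
      split_ifs with h'
      · rwa [abs_zero]
      · exact h k (lt_of_le_of_ne hk h')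
  rw [← Real.norm_eq_abs, ← Complex.norm_real, h1]
  exact (norm_sub_le _ _).trans (by linarith)

theorem re_polyOp (q : ℂ[X]) (z : ℕ → ℝ) :
    (polyOp n q z).re = ∑ i ∈ Finset.range (n + 1), (q.coeff i).re * z i := by
  simp [polyOp]

theorem im_polyOp (q : ℂ[X]) (z : ℕ → ℝ) :
    (polyOp n q z).im = ∑ i ∈ Finset.range (n + 1), (q.coeff i).im * z i := by
  simp [polyOp]

theorem sq_re_add_sq_im (w : ℂ) : w.re ^ 2 + w.im ^ 2 = ‖w‖ ^ 2 := by
  rw [Complex.sq_norm, Complex.normSq_apply]; ring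

variable {Y : ℕ → ℝ → ℝ}

theorem IsGlobalJet.locBounded_sum (hY : IsGlobalJet n Y) (c : ℕ → ℝ) :
    LocBounded fun t => ∑ i ∈ Finset.range (n + 1), c i * Y i t :=
  LocBounded.sum _ fun i hi => (hY.locBounded (by simp at hi; omega)).const_mul _

/-- The coefficient of order `n` has to vanish because the jet says nothing about `Y (n + 1)`. -/
theorem IsGlobalJet.sum_eq_add_integral (hY : IsGlobalJet n Y) (c : ℕ → ℝ) (hc : c n = 0) (a t : ℝ) :
    ∑ i ∈ Finset.range (n + 1), c i * Y i t = ∑ i ∈ Finset.range (n + 1), c i * Y i a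
      + ∫ r in a..t, ∑ i ∈ Finset.range (n + 1), c i * Y (i + 1) r := by
  simp only [Finset.sum_range_succ _ n, hc, zero_mul, add_zero]
  rw [intervalIntegral.integral_finsetSum fun i hi =>
    ((hY.locBounded (by simp at hi; omega)).const_mul _).intervalIntegrable _ _,
    ← Finset.sum_add_distrib]
  refine Finset.sum_congr rfl fun i hi => ?_
  rw [intervalIntegral.integral_const_mul, ← mul_add, ← hY.deriv i (by simpa using hi) a t]

/-- Estimate of one factor of a differential operator. -/
theorem IsGlobalJet.exp_mul_sq_polyOp_le (hY : IsGlobalJet n Y) {q : ℂ[X]} (hq : q.natDegree < n)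
    {s : ℂ} (hs : s.re < 0) {ω : ℝ} (hω : ω ≤ -s.re) {a t : ℝ} (ht : a ≤ t) :
    Real.exp (ω * (t - a)) * ‖polyOp n q fun i => Y i t‖ ^ 2 ≤ ‖polyOp n q fun i => Y i a‖ ^ 2
      + (-s.re)⁻¹ * ∫ r in a..t, Real.exp (ω * (r - a))
        * ‖polyOp n ((X - C s) * q) fun i => Y i r‖ ^ 2 := by
  have hn : q.coeff n = 0 := coeff_eq_zero_of_natDegree_lt hq
  have hL := fun c : ℕ → ℝ => hY.locBounded_sum c
  have hP : ∀ r, (polyOp n q fun i => Y (i + 1) r)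
      = polyOp n ((X - C s) * q) (fun i => Y i r) + s * polyOp n q (fun i => Y i r) := fun r => by
    rw [polyOp_X_sub_C_mul hq]; ring
  have h := exp_mul_sq_le (g₁ := fun r => (polyOp n q fun i => Y i r).re)
    (g₂ := fun r => (polyOp n q fun i => Y i r).im)
    (h₁ := fun r => (polyOp n ((X - C s) * q) fun i => Y i r).re)
    (h₂ := fun r => (polyOp n ((X - C s) * q) fun i => Y i r).im) (σ := s.re) (τ := s.im) (ω := ω)
    (a := a) (by simpa only [re_polyOp] using hL _) (by simpa only [im_polyOp] using hL _)
    (by simpa only [re_polyOp] using hL _) (by simpa only [im_polyOp] using hL _) hs hω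
    (fun t => by
      have e : ∀ r, (polyOp n ((X - C s) * q) fun i => Y i r).re
          + s.re * (polyOp n q fun i => Y i r).re - s.im * (polyOp n q fun i => Y i r).im
          = (polyOp n q fun i => Y (i + 1) r).re := fun r => by
        rw [hP, Complex.add_re, Complex.mul_re]; ring
      simp only [e]
      simp only [re_polyOp]
      exact hY.sum_eq_add_integral _ (by simp [hn]) a t)
    (fun t => by
      have e : ∀ r, (polyOp n ((X - C s) * q) fun i => Y i r).im
          + s.re * (polyOp n q fun i => Y i r).im + s.im * (polyOp n q fun i => Y i r).re
          = (polyOp n q fun i => Y (i + 1) r).im := fun r => by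
        rw [hP, Complex.add_im, Complex.mul_im]; ring
      simp only [e]
      simp only [im_polyOp]
      exact hY.sum_eq_add_integral _ (by simp [hn]) a t) ht
  simpa only [sq_re_add_sq_im] using h

theorem integral_exp_neg_le {ω : ℝ} (hω : 0 < ω) {a t : ℝ} :
    ∫ r in a..t, Real.exp (-ω * (r - a)) ≤ ω⁻¹ := by
  have hd : ∀ r, HasDerivAt (fun r => -ω⁻¹ * Real.exp (-ω * (r - a))) (Real.exp (-ω * (r - a))) r :=
    fun r => by
      refine (((((hasDerivAt_id r).sub_const a).const_mul (-ω)).exp).const_mul (-ω⁻¹)).congr_deriv ?_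
      simp only [id]; field_simp
  rw [intervalIntegral.integral_eq_sub_of_hasDerivAt (fun r _ => hd r)
    (by apply Continuous.intervalIntegrable; fun_prop)]
  have := mul_pos (inv_pos.2 hω) (Real.exp_pos (-ω * (t - a)))
  simp only [sub_self, mul_zero, Real.exp_zero]
  linarith

/-- Exponential decay for a Hurwitz differential operator whose right-hand side decays in a weighted
square mean. -/
theorem exists_decay_of_hurwitz (m : ℕ) (hm : m ≤ n) (q : ℂ[X]) (hq : q.Monic)
    (hqm : q.natDegree = m) (hH : ∀ s, q.IsRoot s → s.re < 0) (ω : ℝ) (hω : 0 < ω) :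
    ∃ ω' > 0, ω' ≤ ω ∧ ∃ D ≥ 0, ∀ Y, IsGlobalJet n Y → ∀ a B G, 0 ≤ B → 0 ≤ G →
      (∀ k < m, Y k a ^ 2 ≤ B) →
      (∀ t ≥ a, ∫ r in a..t, Real.exp (ω * (r - a)) * ‖polyOp n q fun i => Y i r‖ ^ 2 ≤ G) →
      ∀ t ≥ a, ∀ k < m, Y k t ^ 2 ≤ D * Real.exp (-ω' * (t - a)) * (B + G) := by
  induction m generalizing q ω with
  | zero => exact ⟨ω, hω, le_rfl, 0, le_rfl, fun Y _ a B G _ _ _ _ t _ k hk => absurd hk k.not_lt_zero⟩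
  | succ m ih =>
    -- Splitting off a root, `q = (X - s) p`, makes `w = p(D) y` a solution of `w' - s w = q(D) y`.
    -- The energy estimate bounds `w`, and the induction hypothesis then applies to `p`.
    obtain ⟨s, hs⟩ := IsAlgClosed.exists_root q (by
      rw [degree_eq_natDegree hq.ne_zero, hqm]; exact_mod_cast m.succ_ne_zero)
    obtain ⟨p, rfl⟩ := dvd_iff_isRoot.2 hs
    have hp : p.Monic := (monic_X_sub_C s).of_mul_monic_left hq
    have hpm : p.natDegree = m := by
      rw [(monic_X_sub_C s).natDegree_mul hp, natDegree_X_sub_C] at hqm; omega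
    have hsr : 0 < -s.re := neg_pos.2 (hH s hs)
    set ω₁ := min ω (-s.re) with hω₁
    have hω₁0 : 0 < ω₁ := lt_min hω hsr
    -- The square of `p(D) y` decays pointwise at the rate `ω₁`. Half of that rate is spent on the
    -- convergence of its weighted integral.
    obtain ⟨ω', hω'0, hω', D, hD, h⟩ := ih (by omega) p hp hpm
      (fun r hr => hH r (by rw [IsRoot.def] at hr ⊢; rw [eval_mul, hr, mul_zero])) (ω₁ / 2) (by positivity)
    set S := coeffNorm n p
    have hS : 0 ≤ S := coeffNorm_nonneg n p
    let c : ℝ := S ^ 2 + (-s.re)⁻¹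
    have hc : 0 ≤ c := by positivity
    let D' : ℝ := D * (1 + (ω₁ / 2)⁻¹ * c)
    have hD' : 0 ≤ D' := by positivity
    refine ⟨ω', hω'0, by linarith [min_le_left ω (-s.re)], D' + 2 * c + 2 * S ^ 2 * D',
      by positivity, fun Y hY a B G hB hG hYa hI => ?_⟩
    have hp0 : ‖polyOp n p fun i => Y i a‖ ^ 2 ≤ S ^ 2 * B := by
      have := norm_polyOp_le (n := n) (q := p) (z := fun i => Y i a) (B := √B) fun k hk =>
        Real.abs_le_sqrt (hYa k (by omega))
      calc _ ≤ (S * √B) ^ 2 := pow_le_pow_left₀ (norm_nonneg _) this 2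
        _ = _ := by rw [mul_pow, Real.sq_sqrt hB]
    have hpt : ∀ t ≥ a, ‖polyOp n p fun i => Y i t‖ ^ 2 ≤ Real.exp (-ω₁ * (t - a)) * (c * (B + G)) := by
      intro t ht
      have h1 := hY.exp_mul_sq_polyOp_le (q := p) (by omega) (hH s hs)
        (min_le_right ω (-s.re)) ht
      have h2 : ∫ r in a..t, Real.exp (ω₁ * (r - a))
          * ‖polyOp n ((X - C s) * p) fun i => Y i r‖ ^ 2 ≤ G := by
        refine le_trans (intervalIntegral.integral_mono_on ht ?_ ?_ fun r hr => ?_) (hI t ht)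
        · refine LocBounded.intervalIntegrable (.mul (.of_continuous (by fun_prop)) ?_) _ _
          simp only [← sq_re_add_sq_im, re_polyOp, im_polyOp]
          exact (hY.locBounded_sum _).sq.add (hY.locBounded_sum _).sq
        · refine LocBounded.intervalIntegrable (.mul (.of_continuous (by fun_prop)) ?_) _ _
          simp only [← sq_re_add_sq_im, re_polyOp, im_polyOp]
          exact (hY.locBounded_sum _).sq.add (hY.locBounded_sum _).sq
        · refine mul_le_mul_of_nonneg_right (Real.exp_le_exp.2 ?_) (by positivity)
          exact mul_le_mul_of_nonneg_right (min_le_left _ _) (sub_nonneg.2 hr.1)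
      have h3 : Real.exp (ω₁ * (t - a)) * ‖polyOp n p fun i => Y i t‖ ^ 2 ≤ c * (B + G) := by
        have h4 := mul_le_mul_of_nonneg_left h2 (inv_pos.2 hsr).le
        have h5 : 0 ≤ S ^ 2 * G := by positivity
        have h6 : 0 ≤ (-s.re)⁻¹ * B := by positivity
        simp only [c, add_mul, mul_add]
        linarith
      have h4 := mul_le_mul_of_nonneg_left h3 (Real.exp_pos (-ω₁ * (t - a))).le
      rwa [← mul_assoc, ← Real.exp_add, neg_mul, neg_add_cancel, Real.exp_zero, one_mul,
        ← neg_mul] at h4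
    have hlow := h Y hY a B ((ω₁ / 2)⁻¹ * (c * (B + G))) hB (by positivity)
      (fun k hk => hYa k (by omega)) fun t ht => by
        calc _ ≤ ∫ r in a..t, Real.exp (-(ω₁ / 2) * (r - a)) * (c * (B + G)) := by
              refine intervalIntegral.integral_mono_on ht ?_ ?_ fun r hr => ?_
              · refine LocBounded.intervalIntegrable (.mul (.of_continuous (by fun_prop)) ?_) _ _
                simp only [← sq_re_add_sq_im, re_polyOp, im_polyOp]
                exact (hY.locBounded_sum _).sq.add (hY.locBounded_sum _).sq
              · exact Continuous.intervalIntegrable (by fun_prop) _ _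
              · refine (mul_le_mul_of_nonneg_left (hpt r hr.1) (Real.exp_pos _).le).trans (le_of_eq ?_)
                rw [← mul_assoc, ← Real.exp_add]
                congr 2
                ring
          _ ≤ _ := by
              rw [intervalIntegral.integral_mul_const]
              exact mul_le_mul_of_nonneg_right (integral_exp_neg_le (by positivity)) (by positivity)
    have hlow' : ∀ t ≥ a, ∀ k < m, Y k t ^ 2 ≤ D' * Real.exp (-ω' * (t - a)) * (B + G) := by
      intro t ht k hk
      refine (hlow t ht k hk).trans ?_
      have h1 : 0 ≤ D * Real.exp (-ω' * (t - a)) * G := by positivity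
      simp only [D']
      linarith
    intro t ht k hk
    have hpos : 0 ≤ Real.exp (-ω' * (t - a)) * (B + G) := by positivity
    rcases Nat.lt_succ_iff_lt_or_eq.1 hk with hk | rfl
    · refine (hlow' t ht k hk).trans ?_
      have h1 : 0 ≤ (2 * c + 2 * S ^ 2 * D') * (Real.exp (-ω' * (t - a)) * (B + G)) := by positivity
      linarith
    -- The additional order `k`, the degree of `p`, is recovered from `p(D) y` and the lower orders.
    · have h1 := abs_le_norm_polyOp_add hp (hpm.le.trans (by omega : k ≤ n)) (z := fun i => Y i t)
        (Real.sqrt_nonneg (D' * Real.exp (-ω' * (t - a)) * (B + G)))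
        fun i hi => Real.abs_le_sqrt (hlow' t ht i (by omega))
      rw [hpm] at h1
      have h2 : Y k t ^ 2 ≤ 2 * ‖polyOp n p fun i => Y i t‖ ^ 2
          + 2 * (S ^ 2 * (D' * Real.exp (-ω' * (t - a)) * (B + G))) := by
        have h3 := pow_le_pow_left₀ (abs_nonneg _) h1 2
        rw [sq_abs] at h3
        have h4 : (S * √(D' * Real.exp (-ω' * (t - a)) * (B + G))) ^ 2
            = S ^ 2 * (D' * Real.exp (-ω' * (t - a)) * (B + G)) := by
          rw [mul_pow, Real.sq_sqrt (by positivity)]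
        rw [← h4]
        exact h3.trans (add_sq_le.trans (le_of_eq (by ring)))
      have h3 : ‖polyOp n p fun i => Y i t‖ ^ 2 ≤ Real.exp (-ω' * (t - a)) * (c * (B + G)) := by
        refine (hpt t ht).trans (mul_le_mul_of_nonneg_right (Real.exp_le_exp.2 ?_) (by positivity))
        exact mul_le_mul_of_nonneg_right (by linarith) (sub_nonneg.2 ht)
      have h4 : 0 ≤ D' * (Real.exp (-ω' * (t - a)) * (B + G)) := by positivity
      linarith

end PolyOp

/-- Weighted integrals of a function that decays geometrically from one period to the next. -/
theorem integral_exp_mul_le_of_delay {f : ℝ → ℝ} (hf : LocBounded f) (h0 : ∀ r, 0 ≤ f r)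
    {T ρ μ a : ℝ} (hT : 0 ≤ T) (hρ : 0 ≤ ρ) (hμ : 0 ≤ μ) (h : ∀ r > a, f (r + T) ≤ ρ * f r)
    (hθ : ρ * Real.exp (μ * T) < 1) {t : ℝ} (ht : a ≤ t) :
    ∫ r in a..t, Real.exp (μ * (r - a)) * f r
      ≤ Real.exp (μ * T) / (1 - ρ * Real.exp (μ * T)) * ∫ r in a..(a + T), f r := by
  let φ : ℝ → ℝ := fun r => Real.exp (μ * (r - a)) * f r
  have hφ : LocBounded φ := (LocBounded.of_continuous (by fun_prop)).mul hf
  have hφ0 : ∀ r, 0 ≤ φ r := fun r => mul_nonneg (Real.exp_pos _).le (h0 r)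
  set θ := ρ * Real.exp (μ * T) with hθd
  have hθ0 : 0 ≤ θ := by positivity
  have h1 : ∫ r in a..(a + T), φ r ≤ Real.exp (μ * T) * ∫ r in a..(a + T), f r := by
    rw [← intervalIntegral.integral_const_mul]
    refine intervalIntegral.integral_mono_on (by linarith) (hφ.intervalIntegrable _ _)
      ((hf.const_mul _).intervalIntegrable _ _) fun r hr => ?_
    refine mul_le_mul_of_nonneg_right (Real.exp_le_exp.2 ?_) (h0 r)
    exact mul_le_mul_of_nonneg_left (by linarith [hr.2]) hμ
  -- Shifted back by one period, the integral beyond the first period is at most `θ` times the whole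
  -- integral. It is absorbed on the left because `θ < 1`, so no series over the periods is needed.
  have h2 : (1 - θ) * ∫ r in a..t, φ r ≤ ∫ r in a..(a + T), φ r := by
    rcases le_total t (a + T) with htT | htT
    · have h3 := integral_le_of_subinterval hφ hφ0 (le_refl a) ht htT
      have h4 : 0 ≤ ∫ r in a..t, φ r := intervalIntegral.integral_nonneg ht fun r _ => hφ0 r
      nlinarith
    · have h3 : ∫ r in (a + T)..t, φ r ≤ θ * ∫ r in a..(t - T), φ r := by
        have e := intervalIntegral.integral_comp_add_right (a := a) (b := t - T) φ T
        rw [sub_add_cancel] at e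
        rw [← e, ← intervalIntegral.integral_const_mul]
        refine intervalIntegral.integral_mono_on_of_le_Ioo (by linarith)
          ((hφ.comp_continuous (by fun_prop)).intervalIntegrable _ _)
          ((hφ.const_mul _).intervalIntegrable _ _) fun r hr => ?_
        have e2 : Real.exp (μ * (r + T - a)) = Real.exp (μ * T) * Real.exp (μ * (r - a)) := by
          rw [← Real.exp_add]; congr 1; ring
        simp only [φ, e2, hθd]
        have := mul_le_mul_of_nonneg_left (h r hr.1)
          (mul_pos (Real.exp_pos (μ * T)) (Real.exp_pos (μ * (r - a)))).le
        linarith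
      have h4 := integral_le_of_subinterval hφ hφ0 (le_refl a) (by linarith : a ≤ t - T)
        (by linarith : t - T ≤ t)
      have h5 := intervalIntegral.integral_add_adjacent_intervals
        (hφ.intervalIntegrable a (a + T)) (hφ.intervalIntegrable (a + T) t)
      have h6 := mul_le_mul_of_nonneg_left h4 hθ0
      linarith
  rw [div_mul_eq_mul_div, le_div_iff₀ (by linarith)]
  change (∫ r in a..t, φ r) * _ ≤ _
  linarith

open Polynomial in
/-- The characteristic polynomial of the tracking error dynamics. -/
def errorPoly {n : ℕ} (κ : Fin n → ℝ) : ℂ[X] := X ^ n + ∑ i : Fin n, C (κ i : ℂ) * X ^ (i : ℕ)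

section ErrorPoly

open Polynomial

variable {n : ℕ} (κ : Fin n → ℝ)

theorem errorPoly_monic : (errorPoly κ).Monic :=
  monic_X_pow_add (degree_sum_fin_lt fun i => (κ i : ℂ))

theorem natDegree_errorPoly : (errorPoly κ).natDegree = n := by
  rw [errorPoly, natDegree_add_eq_left_of_degree_lt, natDegree_X_pow]
  rw [degree_X_pow]
  exact degree_sum_fin_lt fun i => (κ i : ℂ)

theorem polyOp_errorPoly (z : ℕ → ℝ) :
    polyOp n (errorPoly κ) z = ((z n + ∑ i : Fin n, κ i * z i : ℝ) : ℂ) := by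
  have h : ∀ i : Fin n, (errorPoly κ).coeff i = κ i := fun i => by
    rw [errorPoly, coeff_add, coeff_X_pow, if_neg i.2.ne, zero_add, finsetSum_coeff,
      Finset.sum_eq_single i]
    · simp
    · intro j _ hj
      rw [coeff_C_mul, coeff_X_pow, if_neg fun e => hj (Fin.ext e.symm), mul_zero]
    · simp
  have h1 : (errorPoly κ).coeff n = 1 := by
    have := (errorPoly_monic κ).coeff_natDegree
    rwa [natDegree_errorPoly] at this
  rw [polyOp, Finset.sum_range_succ, h1,
    ← Fin.sum_univ_eq_sum_range (fun i => (errorPoly κ).coeff i * (z i : ℂ))]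
  simp only [h]
  push_cast
  ring

variable {κ} in
theorem IsHurwitz.re_neg (hκ : IsHurwitz κ) {s : ℂ} (hs : (errorPoly κ).IsRoot s) : s.re < 0 := by
  refine hκ s ?_
  simpa [errorPoly, IsRoot.def, eval_finsetSum] using hs

end ErrorPoly

namespace System

variable {n : ℕ} {P : System n} {K : ℝ → ℝ → Matrix (Fin 2) (Fin 2) ℝ}

theorem locBounded_errorOp (κ : Fin n → ℝ) {Y : ℕ → ℝ → ℝ} (hY : IsGlobalJet n Y) :
    LocBounded (errorOp κ Y) :=
  hY.top.add (LocBounded.sum _ fun i _ => (hY.locBounded i.2.le).const_mul _)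

theorem sq_sum_mul_le (κ : Fin n → ℝ) {z : ℕ → ℝ} {B : ℝ} (hz : ∀ k < n, z k ^ 2 ≤ B) :
    (∑ i : Fin n, κ i * z i) ^ 2 ≤ (∑ i : Fin n, κ i ^ 2) * (n * B) := by
  refine (Finset.sum_mul_sq_le_sq_mul_sq _ _ _).trans
    (mul_le_mul_of_nonneg_left ?_ (Finset.sum_nonneg fun i _ => sq_nonneg _))
  refine (Finset.sum_le_sum fun (i : Fin n) _ => hz i i.2).trans ?_
  simp

/-- The jet of a global trajectory on a window is bounded by its state. -/
theorem exists_sq_le_jetSq (P : System n) : ∃ D ≥ 0, ∀ Y, IsGlobalJet n Y → ∀ k < n,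
    ∀ τ ∈ P.window, Y k τ ^ 2 ≤ D * P.jetSq Y := by
  set L := P.tau 0 - -P.tau 1 with hL
  have hL0 : 0 < L := by linarith [P.tau_pos 0, P.tau_pos 1]
  refine ⟨((2 * (1 + L)) ^ n) ^ 2 * (2 * (1 + L)), by positivity, fun Y hY k hk τ hτ => ?_⟩
  have h1 := hY.abs_le hk hτ
  rw [← hL] at h1
  have h2 := sq_integral_abs_le hY.top (show -P.tau 1 < P.tau 0 by linarith)
  rw [← hL] at h2
  have hI : 0 ≤ ∫ σ in (-P.tau 1)..(P.tau 0), Y n σ ^ 2 :=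
    intervalIntegral.integral_nonneg P.window_le fun σ _ => sq_nonneg _
  have h3 := pow_le_pow_left₀ (abs_nonneg _) h1 2
  rw [sq_abs, mul_pow] at h3
  refine h3.trans ?_
  rw [mul_assoc]
  refine mul_le_mul_of_nonneg_left ?_ (by positivity)
  refine add_sq_le.trans ?_
  rw [jetSq]
  nlinarith [sq_nonneg ‖fun i : Fin n => Y i (-P.tau 1)‖]

/-- Exponential decay of the tracking error of the flat output. -/
theorem exists_decay (P : System n) {κ : Fin n → ℝ} (hκ : IsHurwitz κ) {γ : ℝ} (hγ : |γ| < 1) :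
    ∃ ω > 0, ∃ D ≥ 0, ∀ Y, IsGlobalJet n Y →
      (∀ t > 0, errorOp κ Y (t + P.tau 0) + γ * errorOp κ Y (t + -P.tau 1) = 0) →
      ∀ t ≥ 0, P.jetSq (fun k τ => Y k (t + τ)) ≤ D * Real.exp (-ω * t) * P.jetSq Y := by
  set a := -P.tau 1 with ha
  set T := P.tau 0 + P.tau 1 with hT
  have hT0 : 0 < T := by linarith [P.tau_pos 0, P.tau_pos 1]
  have haT : a + T = P.tau 0 := by rw [ha, hT]; ring
  -- Per period `T` the square of the error operator shrinks by `γ² < 1`; by continuity in `ω` this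
  -- leaves room for a positive exponential rate.
  obtain ⟨ω, hωθ, hω0⟩ : ∃ ω : ℝ, γ ^ 2 * Real.exp (ω * T) < 1 ∧ 0 < ω := by
    have hc : Continuous fun ω : ℝ => γ ^ 2 * Real.exp (ω * T) := by fun_prop
    have h1 : ∀ᶠ ω in nhds (0 : ℝ), γ ^ 2 * Real.exp (ω * T) < 1 :=
      hc.continuousAt.eventually_lt continuousAt_const (by
        simpa [sq_lt_one_iff_abs_lt_one] using hγ)
    exact ((h1.filter_mono nhdsWithin_le_nhds).and
      (self_mem_nhdsWithin : Ioi (0 : ℝ) ∈ nhdsWithin 0 (Ioi 0))).exists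
  obtain ⟨ω', hω'0, hω', D, hD, hdec⟩ := exists_decay_of_hurwitz n le_rfl (errorPoly κ)
    (errorPoly_monic κ) (natDegree_errorPoly κ) (fun s hs => hκ.re_neg hs) ω hω0
  obtain ⟨D₁, hD₁, hjet⟩ := P.exists_sq_le_jetSq
  set k₂ := (∑ i : Fin n, κ i ^ 2) * n with hk₂
  have hk₂0 : 0 ≤ k₂ := mul_nonneg (Finset.sum_nonneg fun i _ => sq_nonneg _) n.cast_nonneg
  set c := Real.exp (ω * T) / (1 - γ ^ 2 * Real.exp (ω * T)) with hc
  have hc0 : 0 ≤ c := div_nonneg (Real.exp_pos _).le (by linarith)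
  let G₁ : ℝ := c * (2 + 2 * k₂ * D₁ * T)
  have hG₁ : 0 ≤ G₁ := by positivity
  let D₂ : ℝ := D * (1 + G₁)
  have hD₂ : 0 ≤ D₂ := by positivity
  refine ⟨ω', hω'0, D₂ + (2 * G₁ + 2 * k₂ * D₂ * T), by positivity, fun Y hY hE t ht => ?_⟩
  set J := P.jetSq Y with hJ
  have hJ0 : 0 ≤ J := P.jetSq_nonneg Y
  have hg := locBounded_errorOp κ hY
  have hI : 0 ≤ ∫ σ in a..(P.tau 0), Y n σ ^ 2 :=
    intervalIntegral.integral_nonneg P.window_le fun σ _ => sq_nonneg _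
  have hη : ∀ k < n, Y k a ^ 2 ≤ J := fun k hk => by
    have h1 := norm_le_pi_norm (fun i : Fin n => Y i a) ⟨k, hk⟩
    rw [Real.norm_eq_abs] at h1
    have h2 := pow_le_pow_left₀ (abs_nonneg _) h1 2
    rw [sq_abs] at h2
    rw [hJ, jetSq]
    exact h2.trans (le_add_of_nonneg_right hI)
  have hg0 : ∫ r in a..(a + T), errorOp κ Y r ^ 2 ≤ (2 + 2 * k₂ * D₁ * T) * J := by
    rw [haT]
    have h1 : ∫ r in a..(P.tau 0), errorOp κ Y r ^ 2
        ≤ ∫ r in a..(P.tau 0), (2 * Y n r ^ 2 + 2 * (k₂ * (D₁ * J))) := by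
      refine intervalIntegral.integral_mono_on P.window_le (hg.sq.intervalIntegrable _ _)
        (((hY.top.sq.const_mul 2).add (.const _)).intervalIntegrable _ _) fun r hr => ?_
      have h2 := sq_sum_mul_le κ (z := fun k => Y k r) fun k hk => hjet Y hY k hk r hr
      rw [← mul_assoc, ← hk₂] at h2
      exact add_sq_le.trans (by linarith)
    rw [intervalIntegral.integral_add ((hY.top.sq.const_mul 2).intervalIntegrable _ _)
      (by simp), intervalIntegral.integral_const_mul, intervalIntegral.integral_const,
      smul_eq_mul, show P.tau 0 - a = T by linarith] at h1
    have h2 : ∫ σ in a..(P.tau 0), Y n σ ^ 2 ≤ J := by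
      rw [hJ, jetSq]; linarith [sq_nonneg ‖fun i : Fin n => Y i (-P.tau 1)‖]
    linarith
  have hG : ∀ t ≥ a, ∫ r in a..t, Real.exp (ω * (r - a)) * errorOp κ Y r ^ 2 ≤ G₁ * J := by
    intro t ht
    refine (integral_exp_mul_le_of_delay hg.sq (fun r => sq_nonneg _) hT0.le (sq_nonneg γ) hω0.le
      (fun r hr => ?_) hωθ ht).trans ?_
    -- With `a = -τ₂`, the closed-loop equation at the time `r - a > 0` expresses the error operator
    -- at `r + T` by `-γ` times its value at `r`.
    · have h1 := hE (r - a) (by linarith)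
      rw [sub_add_cancel, ← haT, show r - a + (a + T) = r + T by ring] at h1
      rw [eq_neg_of_add_eq_zero_left h1, neg_sq, mul_pow]
    · have := mul_le_mul_of_nonneg_left hg0 hc0
      simp only [G₁]
      linarith
  have hlow : ∀ t ≥ a, ∀ k < n, Y k t ^ 2 ≤ D₂ * Real.exp (-ω' * (t - a)) * J := by
    intro t ht k hk
    refine (hdec Y hY a J (G₁ * J) hJ0 (by positivity) hη (fun t ht => ?_) t ht k hk).trans
      (le_of_eq (by simp only [D₂]; ring))
    refine le_trans (le_of_eq ?_) (hG t ht)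
    simp only [polyOp_errorPoly, Complex.norm_real, Real.norm_eq_abs, sq_abs]
    rfl
  have hlow' : ∀ τ ∈ P.window, ∀ k < n, Y k (t + τ) ^ 2 ≤ D₂ * Real.exp (-ω' * t) * J := by
    intro τ hτ k hk
    refine (hlow (t + τ) (by linarith [hτ.1]) k hk).trans ?_
    refine mul_le_mul_of_nonneg_right (mul_le_mul_of_nonneg_left (Real.exp_le_exp.2 ?_) hD₂) hJ0
    have : ω' * t ≤ ω' * (t + τ - a) := mul_le_mul_of_nonneg_left (by linarith [hτ.1]) hω'0.le
    linarith
  have he : 0 < Real.exp (-ω' * t) := Real.exp_pos _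
  have hη' : ‖fun i : Fin n => Y i (t + a)‖ ^ 2 ≤ D₂ * Real.exp (-ω' * t) * J := by
    have h1 : ‖fun i : Fin n => Y i (t + a)‖ ≤ √(D₂ * Real.exp (-ω' * t) * J) :=
      (pi_norm_le_iff_of_nonneg (Real.sqrt_nonneg _)).2 fun i => by
        rw [Real.norm_eq_abs]
        exact Real.abs_le_sqrt (hlow' a P.left_mem_window i i.2)
    have h2 := pow_le_pow_left₀ (norm_nonneg _) h1 2
    rwa [Real.sq_sqrt (by positivity)] at h2
  -- On the window at time `t` the weight is at least `exp (ω' t)`, so the global weighted bound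
  -- yields decay of the integral over this window.
  have hgt : ∫ σ in a..(P.tau 0), errorOp κ Y (t + σ) ^ 2 ≤ Real.exp (-ω' * t) * (G₁ * J) := by
    have h1 := hG (t + P.tau 0) (by linarith [P.window_le])
    have h2 : LocBounded fun r => Real.exp (ω * (r - a)) * errorOp κ Y r ^ 2 :=
      (LocBounded.of_continuous (by fun_prop)).mul hg.sq
    have h3 := (integral_le_of_subinterval h2 (fun r => by positivity)
      (by linarith : a ≤ t + a) (by linarith [P.window_le] : t + a ≤ t + P.tau 0) le_rfl).trans h1
    rw [← intervalIntegral.integral_comp_add_left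
      (fun r => Real.exp (ω * (r - a)) * errorOp κ Y r ^ 2) t] at h3
    have h4 : Real.exp (ω' * t) * ∫ σ in a..(P.tau 0), errorOp κ Y (t + σ) ^ 2 ≤ G₁ * J := by
      rw [← intervalIntegral.integral_const_mul]
      refine le_trans (intervalIntegral.integral_mono_on P.window_le
        (((hg.shift t).sq.const_mul _).intervalIntegrable _ _)
        ((h2.shift t).intervalIntegrable _ _) fun σ hσ => ?_) h3
      refine mul_le_mul_of_nonneg_right (Real.exp_le_exp.2 ?_) (sq_nonneg _)
      exact mul_le_mul hω' (by linarith [hσ.1]) ht hω0.le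
    have h5 := mul_le_mul_of_nonneg_left h4 he.le
    rwa [← mul_assoc, ← Real.exp_add, neg_mul, neg_add_cancel, Real.exp_zero, one_mul,
      ← neg_mul] at h5
  -- The derivative of order `n` is the error operator minus lower orders. The operator is
  -- controlled only in mean square over a window, and so is this derivative.
  have htop : ∫ σ in a..(P.tau 0), Y n (t + σ) ^ 2
      ≤ 2 * (Real.exp (-ω' * t) * (G₁ * J)) + T * (2 * (k₂ * (D₂ * Real.exp (-ω' * t) * J))) := by
    have h1 : ∫ σ in a..(P.tau 0), Y n (t + σ) ^ 2
        ≤ ∫ σ in a..(P.tau 0), (2 * errorOp κ Y (t + σ) ^ 2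
          + 2 * (k₂ * (D₂ * Real.exp (-ω' * t) * J))) := by
      refine intervalIntegral.integral_mono_on P.window_le ((hY.top.shift t).sq.intervalIntegrable _ _)
        ((((hg.shift t).sq.const_mul 2).add (.const _)).intervalIntegrable _ _) fun σ hσ => ?_
      have h2 := sq_sum_mul_le κ (z := fun k => Y k (t + σ)) (hlow' σ hσ)
      rw [← mul_assoc, ← hk₂] at h2
      have h3 : Y n (t + σ) = errorOp κ Y (t + σ) - ∑ i : Fin n, κ i * Y i (t + σ) := by
        rw [errorOp]; ring
      rw [h3]
      have h4 := sq_nonneg (errorOp κ Y (t + σ) + ∑ i : Fin n, κ i * Y i (t + σ))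
      nlinarith
    rw [intervalIntegral.integral_add (((hg.shift t).sq.const_mul 2).intervalIntegrable _ _)
      (by simp), intervalIntegral.integral_const_mul, intervalIntegral.integral_const,
      smul_eq_mul, show P.tau 0 - a = T by linarith] at h1
    linarith
  have hres : P.jetSq (fun k τ => Y k (t + τ)) = ‖fun i : Fin n => Y i (t + a)‖ ^ 2
      + ∫ σ in a..(P.tau 0), Y n (t + σ) ^ 2 := rfl
  rw [hres]
  linarith

/-! ### Exponential stability of the closed loop -/

theorem stateNorm_congr (ξ : Fin n → ℝ) {x y : Fin 2 → ℝ → ℝ}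
    (h : ∀ j, ∀ z ∈ Icc (0 : ℝ) 1, x j z = y j z) : stateNorm ξ x = stateNorm ξ y := by
  rw [stateNorm, stateNorm]
  congr 2
  refine intervalIntegral.integral_congr fun z hz => ?_
  rw [uIcc_of_le zero_le_one] at hz
  simp only [h _ z hz]

/-- Exponential stability of the closed loop. -/
theorem exists_stability (hu : IsUnit P.kalman.det) (hq0 : P.q0 ≠ 0) (hK : P.IsKernel K)
    {a : Fin (n + 1) → ℝ} {aD : ℝ → ℝ} (ha : P.IsHCCFCoeff K a aD) {κ : Fin n → ℝ}
    (hκ : IsHurwitz κ) {γ : ℝ} (hγ : |γ| < 1) :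
    ∃ M > 0, ∃ ω > 0, ∀ yr : ℝ → ℝ, ContDiff ℝ n yr → ∀ ξr xr ur,
      P.IsGeneratedBy K a aD yr ξr xr ur → P.IsSolution univ ur ξr xr → ∀ ξ x u,
      P.IsClosedLoopSolution K a aD κ γ yr ξ x u → ∀ t ≥ 0,
        stateNorm (ξ t - ξr t) (fun j z => x j z t - xr j z t) ≤ M * Real.exp (-ω * t) *
          stateNorm (ξ 0 - ξr 0) (fun j z => x j z 0 - xr j z 0) := by
  obtain ⟨C, hC, hequiv⟩ := exists_norm_equiv hu hq0 hK
  obtain ⟨ω, hω, D, hD, hdec⟩ := P.exists_decay hκ hγ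
  -- The estimates concern squared norms, so the rate is halved; `C² D ≤ (C (D + 1))²` avoids a
  -- square root in the constant.
  refine ⟨C * (D + 1), by positivity, ω / 2, by positivity,
    fun yr hyr ξr xr ur hr hsr ξ x u hs t ht => ?_⟩
  obtain ⟨Y, hY, hY1, hY2, hY3⟩ := hs.exists_jet hu hq0 hK ha hyr
  have hR := IsGlobalJet.of_contDiff hyr
  have hE := hY.sub hR
  have key : ∀ t ≥ 0,
      P.jetSq (fun k τ => Y k (t + τ) - iteratedDeriv k yr (t + τ))
        ≤ C * stateNorm (ξ t - ξr t) (fun j z => x j z t - xr j z t) ^ 2 ∧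
      stateNorm (ξ t - ξr t) (fun j z => x j z t - xr j z t) ^ 2
        ≤ C * P.jetSq (fun k τ => Y k (t + τ) - iteratedDeriv k yr (t + τ)) := by
    intro t ht
    have hx := hs.solution.isProfile (mem_Ici.2 ht)
    have hxr := hsr.isProfile (mem_univ t)
    obtain ⟨X, hX, hXx⟩ := hx.exists_locBounded
    obtain ⟨Z, hZ, hZx⟩ := hxr.exists_locBounded
    have h := hequiv _ (hE.shift t) (fun j z => X j z - Z j z) (fun j => (hX j).sub (hZ j))
      fun j z hz => by
        rw [P.xbar_congr K (X' := fun j z => x j z t - xr j z t) (fun j z hz => by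
            rw [hXx j z (Ioc_subset_Icc_self hz), hZx j z (Ioc_subset_Icc_self hz)]) j hz,
          xbar_sub_of_isProfile hK hx hxr j hz, hY2 t ht j z hz,
          hr.pde t j z (Ioc_subset_Icc_self hz)]
        exact (xPar_sub hK (hY.shift t) (hR.shift t) j (Ioc_subset_Icc_self hz)).symm
    have e1 : P.xiPar (fun k τ => Y k (t + τ) - iteratedDeriv k yr (t + τ)) 0 = ξ t - ξr t := by
      rw [P.xiPar_sub (fun k τ => Y k (t + τ)) (fun k τ => iteratedDeriv k yr (t + τ)), hr.ode t,
        ← hY1 t ht]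
      simp only [xiPar, jetAt, add_zero]
    rw [e1, stateNorm_congr _ (y := fun j z => x j z t - xr j z t)
      fun j z hz => by rw [hXx j z hz, hZx j z hz]] at h
    exact h
  have h0 := (key 0 le_rfl).1
  simp only [zero_add] at h0
  have h1 := (key t ht).2
  have h2 := hdec _ hE hY3 t ht
  set S₀ := stateNorm (ξ 0 - ξr 0) (fun j z => x j z 0 - xr j z 0) with hS₀
  have hS0 : 0 ≤ S₀ := Real.sqrt_nonneg _
  have he : Real.exp (-(ω / 2) * t) ^ 2 = Real.exp (-ω * t) := by
    rw [← Real.exp_nat_mul]; congr 1; push_cast; ring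
  refine le_of_sq_le_sq ?_ (by positivity)
  rw [mul_pow, mul_pow, he]
  calc _ ≤ C * (D * Real.exp (-ω * t) * (C * S₀ ^ 2)) :=
        h1.trans (mul_le_mul_of_nonneg_left
          (h2.trans (mul_le_mul_of_nonneg_left h0 (by positivity))) hC.le)
    _ = C ^ 2 * D * (Real.exp (-ω * t) * S₀ ^ 2) := by ring
    _ ≤ C ^ 2 * (D + 1) ^ 2 * (Real.exp (-ω * t) * S₀ ^ 2) := by
        gcongr
        nlinarith
    _ = _ := by ring

end System

/-! ### Existence of closed-loop solutions -/

/-- Continuation of a function by a difference equation. -/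
theorem exists_of_delay {g₀ : ℝ → ℝ} (hg : LocBounded g₀) {γ T : ℝ} (hγ : |γ| ≤ 1) (hT : 0 < T)
    (b : ℝ) : ∃ g, LocBounded g ∧ (∀ t ≤ b, g t = g₀ t) ∧ ∀ t > b, g t + γ * g (t - T) = 0 := by
  -- The number of periods by which `t` is moved back to reach `(-∞, b]`; the ceiling in `ℕ` is `0`
  -- for `t ≤ b`.
  let N : ℝ → ℕ := fun t => ⌈(t - b) / T⌉₊
  have hN : Measurable N := Nat.measurable_ceil.comp (by fun_prop)
  let g : ℝ → ℝ := fun t => (-γ) ^ N t * g₀ (t - N t * T)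
  have hN0 : ∀ t ≤ b, N t = 0 := fun t ht =>
    Nat.ceil_eq_zero.2 (div_nonpos_of_nonpos_of_nonneg (by linarith) hT.le)
  refine ⟨g, ⟨?_, fun S => ?_⟩, fun t ht => by simp [g, hN0 t ht], fun t ht => ?_⟩
  · have h : Measurable fun p : ℕ × ℝ => (-γ) ^ p.1 * g₀ (p.2 - p.1 * T) :=
      measurable_from_prod_countable_right fun k =>
        (hg.measurable.comp (by fun_prop : Measurable fun t : ℝ => t - k * T)).const_mul ((-γ) ^ k)
    exact h.comp (hN.prodMk measurable_id)
  · obtain ⟨B, hB⟩ := hg.bounded (S + N S * T)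
    refine ⟨B, fun t ht => ?_⟩
    have h1 : (N t : ℝ) ≤ N S := by
      refine Nat.cast_le.2 (Nat.ceil_mono ?_)
      gcongr
      exact (le_abs_self t).trans ht
    have h2 : |g₀ (t - N t * T)| ≤ B := by
      refine hB _ ((abs_sub _ _).trans (add_le_add ht ?_))
      rw [abs_of_nonneg (by positivity)]
      exact mul_le_mul_of_nonneg_right h1 hT.le
    rw [abs_mul, abs_pow, abs_neg]
    calc _ ≤ 1 * |g₀ (t - N t * T)| :=
          mul_le_mul_of_nonneg_right (pow_le_one₀ (abs_nonneg _) hγ) (abs_nonneg _)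
      _ ≤ B := by rwa [one_mul]
  · have h : N t = N (t - T) + 1 := by
      have e : (t - T - b) / T = (t - b) / T - 1 := by field_simp; ring
      have hpos : 0 < (t - b) / T := div_pos (by linarith) hT
      have h1 : 1 ≤ N t := Nat.one_le_ceil_iff.2 hpos
      simp only [N, e, Nat.ceil_sub_one] at h1 ⊢
      omega
    simp only [g, h]
    push_cast
    rw [show t - ((N (t - T) : ℝ) + 1) * T = t - T - N (t - T) * T by ring]
    ring

namespace System

variable {n : ℕ} {P : System n} {K : ℝ → ℝ → Matrix (Fin 2) (Fin 2) ℝ}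

/-- Continuation of a trajectory of the flat output with prescribed image under the error
operator. -/
theorem exists_jet_continuation (hu : IsUnit P.kalman.det) (κ : Fin n → ℝ) {Y : ℕ → ℝ → ℝ}
    (hY : IsGlobalJet n Y) {g : ℝ → ℝ} (hg : LocBounded g) (b : ℝ) :
    ∃ Z, IsGlobalJet n Z ∧ (∀ k ≤ n, ∀ t ≤ b, Z k t = Y k t) ∧ ∀ t > b, errorOp κ Z t = g t := by
  let e : Fin n → ℝ := Matrix.vecMul (eLast n) (P.Tc * P.F * P.Tc⁻¹ * P.Tc)
  -- Prescribing the error operator as `g` amounts to the feedback `x₁(0,·) = g - wᵀ ξ`, hence to a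
  -- linear differential equation for `ξ` driven by `g`. The solver for equations with memory is
  -- used with zero memory.
  let w : Fin n → ℝ := Matrix.vecMul κ P.Tc + e
  have he : ∀ v, e ⬝ᵥ v = eLast n ⬝ᵥ (P.Tc * P.F * P.Tc⁻¹).mulVec (P.Tc.mulVec v) := fun v => by
    rw [Matrix.mulVec_mulVec, Matrix.dotProduct_mulVec]
  have hw : ∀ v, w ⬝ᵥ v = κ ⬝ᵥ P.Tc.mulVec v + e ⬝ᵥ v := fun v => by
    rw [add_dotProduct, Matrix.dotProduct_mulVec]
  obtain ⟨V, hV, hVe⟩ := exists_ode_with_memory (P.F - Matrix.vecMulVec P.b w) P.b 0 (P.xiPar Y b)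
    (d := fun _ => 0) (r := fun t => g (b + t)) continuous_const (M := 0) (by simp) (hg.shift b)
  have hF : ∀ v i, (P.F - Matrix.vecMulVec P.b w).mulVec v i = P.F.mulVec v i - P.b i * (w ⬝ᵥ v) := by
    intro v i
    rw [Matrix.sub_mulVec, Pi.sub_apply]
    congr 1
    simp only [Matrix.mulVec, dotProduct, Matrix.vecMulVec_apply, Finset.mul_sum, mul_assoc]
  simp only [hF, zero_mul, intervalIntegral.integral_zero, add_zero] at hVe
  let ξ : ℝ → Fin n → ℝ := fun t => if t ≤ b then P.xiPar Y t else V (t - b)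
  let x₁ : ℝ → ℝ := fun t => if t ≤ b then P.p1Par Y t else g t - w ⬝ᵥ V (t - b)
  have hV0 : V 0 = P.xiPar Y b := funext fun i => by simpa using hVe 0 le_rfl i
  have hξn : ∀ {t}, t ≤ b → ξ t = P.xiPar Y t := fun ht => if_pos ht
  have hξp : ∀ {t}, b < t → ξ t = V (t - b) := fun ht => if_neg (not_le.2 ht)
  have hxn : ∀ {t}, t ≤ b → x₁ t = P.p1Par Y t := fun ht => if_pos ht
  have hxp : ∀ {t}, b < t → x₁ t = g t - w ⬝ᵥ V (t - b) := fun ht => if_neg (not_le.2 ht)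
  have hξ : Continuous ξ := by
    refine Continuous.if_le (continuous_xiPar hY) (hV.comp (by fun_prop)) continuous_id
      continuous_const ?_
    rintro t rfl
    simp [hV0]
  have hx : LocBounded x₁ := (locBounded_p1Par hY).ite
    (hg.sub (LocBounded.dotProduct_of_continuous w (hV.comp (by fun_prop)))) measurableSet_Iic
  have hf : ∀ i, LocBounded fun r => P.F.mulVec (ξ r) i + P.b i * x₁ r := fun i =>
    (LocBounded.mulVec _ (fun j => .of_continuous ((continuous_apply j).comp hξ)) i).add
      (hx.const_mul _)
  have hbase : ∀ t i, ξ t i = ξ b i + ∫ r in b..t, (P.F.mulVec (ξ r) i + P.b i * x₁ r) := by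
    intro t i
    rcases le_or_gt t b with ht | ht
    · rw [hξn ht, hξn le_rfl, xiPar_eq_integral hu hY b t i]
      congr 1
      refine intervalIntegral.integral_congr fun r hr => ?_
      rw [uIcc_of_ge ht] at hr
      simp only [hξn hr.2, hxn hr.2]
    · rw [hξp ht, hξn le_rfl, hVe (t - b) (by linarith) i]
      congr 1
      have e1 := intervalIntegral.integral_comp_add_left (a := 0) (b := t - b)
        (fun r => P.F.mulVec (ξ r) i + P.b i * x₁ r) b
      rw [add_zero, add_sub_cancel] at e1
      rw [← e1]
      refine intervalIntegral.integral_congr_ae (Filter.Eventually.of_forall fun r hr => ?_)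
      rw [uIoc_of_le (by linarith)] at hr
      rw [hξp (by linarith [hr.1]), hxp (by linarith [hr.1]), add_sub_cancel_left]
      ring
  have hode : ∀ s t i, ξ t i = ξ s i + ∫ r in s..t, (P.F.mulVec (ξ r) i + P.b i * x₁ r) := by
    intro s t i
    rw [hbase t i, hbase s i, add_assoc, intervalIntegral.integral_add_adjacent_intervals
      ((hf i).intervalIntegrable _ _) ((hf i).intervalIntegrable _ _)]
  have hlt : ∀ t, (fun i : Fin n => P.flatJet ξ x₁ i t) = P.Tc.mulVec (ξ t) := P.flatJet_lt ξ x₁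
  have htop : ∀ t, P.flatJet ξ x₁ n t = x₁ t + e ⬝ᵥ ξ t := fun t => by
    rw [he]; simp [flatJet]
  refine ⟨P.flatJet ξ x₁, isGlobalJet_flatJet hu hξ hx hode, fun k hk t ht => ?_, fun t ht => ?_⟩
  · rcases hk.eq_or_lt with rfl | hk
    · rw [htop, hxn ht, hξn ht, he, P.Tc_mulVec_xiPar hu, p1Par, sub_add_cancel]
    · have h := congrFun (hlt t) ⟨k, hk⟩
      rw [hξn ht, P.Tc_mulVec_xiPar hu] at h
      exact h
  · have h : ∑ i : Fin n, κ i * P.flatJet ξ x₁ i t = κ ⬝ᵥ P.Tc.mulVec (ξ t) := by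
      rw [← hlt, dotProduct]
    rw [errorOp, h, htop, hxp ht, hξp ht, hw]
    ring

variable {u : ℝ → ℝ} {ξ : ℝ → Fin n → ℝ} {x x' : Fin 2 → ℝ → ℝ → ℝ}

/-- Restriction of a solution to nonnegative time; the initial value of `x₁` at `z = 0` has no
influence. -/
theorem IsSolution.restrict (hs : P.IsSolution univ u ξ x')
    (hp : ∀ t > 0, ∀ j z, x j z t = x' j z t) (h0 : ∀ j, ∀ z ∈ Ioc (0 : ℝ) 1, x j z 0 = x' j z 0)
    (h1 : x 1 0 0 = x' 1 0 0) : P.IsSolution (Ici 0) u ξ x := by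
  have h0I : (0 : ℝ) ∈ Icc (0 : ℝ) 1 := left_mem_Icc.2 zero_le_one
  have hne : ∀ j z t, z ∈ Icc (0 : ℝ) 1 → 0 ≤ t → (z, t) ≠ ((0 : ℝ), (0 : ℝ)) →
      x j z t = x' j z t := by
    intro j z t hz ht hzt
    rcases ht.eq_or_lt with rfl | ht
    · refine h0 j z ⟨lt_of_le_of_ne hz.1 fun h => hzt (by rw [← h]), hz.2⟩
    · exact hp t ht j z
  refine ⟨fun j => ?_, fun T => ?_, hs.continuous_ode.mono (subset_univ _), fun s hs0 t _ hst i => ?_,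
    fun t ht => ?_, fun t ht => ?_, fun i t₀ t₁ Z ht hI hZ => ?_⟩
  · have h : Measurable fun p : ℝ × ℝ => if p = ((0 : ℝ), (0 : ℝ)) then x j 0 0
        else (Icc (0 : ℝ) 1 ×ˢ Ici 0).indicator
          ((Icc (0 : ℝ) 1 ×ˢ univ).indicator fun p : ℝ × ℝ => x' j p.1 p.2) p :=
      Measurable.ite (measurableSet_singleton _) measurable_const
        ((hs.measurable j).indicator (measurableSet_Icc.prod measurableSet_Ici))
    convert h using 1
    funext p
    by_cases hpm : p ∈ Icc (0 : ℝ) 1 ×ˢ Ici (0 : ℝ)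
    · rw [indicator_of_mem hpm]
      split_ifs with h'
      · rw [h']
      · rw [indicator_of_mem hpm, indicator_of_mem (s := Icc (0 : ℝ) 1 ×ˢ univ) ⟨hpm.1, mem_univ _⟩,
          hne j p.1 p.2 hpm.1 hpm.2 h']
    · rw [indicator_of_notMem hpm, if_neg, indicator_of_notMem hpm]
      rintro rfl
      exact hpm ⟨h0I, self_mem_Ici⟩
  · obtain ⟨B, hB⟩ := hs.bounded T
    refine ⟨max B (max |x 0 0 0| |x 1 0 0|), fun j t ht htT z hz => ?_⟩
    by_cases h : (z, t) = ((0 : ℝ), (0 : ℝ))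
    · obtain ⟨rfl, rfl⟩ := Prod.mk.inj h
      refine le_max_of_le_right ?_
      fin_cases j
      · exact le_max_left _ _
      · exact le_max_right _ _
    · rw [hne j z t hz ht h]
      exact le_max_of_le_left (hB j t (mem_univ t) htT z hz)
  · rw [hs.ode s (mem_univ s) t (mem_univ t) hst i]
    congr 1
    refine intervalIntegral.integral_congr_ae (Filter.Eventually.of_forall fun r hr => ?_)
    rw [uIoc_of_le hst] at hr
    rw [hp r (lt_of_le_of_lt hs0 hr.1)]
  · rw [interior_Ici] at ht
    rw [hp t ht, hp t ht]
    exact hs.bc0 t (by rw [interior_univ]; exact mem_univ t)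
  · rw [interior_Ici] at ht
    rw [hp t ht, hp t ht]
    exact hs.bc1 t (by rw [interior_univ]; exact mem_univ t)
  · rcases ht.eq_or_lt with rfl | ht'
    · simp
    have ht0 : 0 ≤ t₀ := hI (left_mem_Icc.2 ht)
    have e : x i (Z t₀) t₀ = x' i (Z t₀) t₀ := by
      rcases ht0.eq_or_lt with rfl | ht0
      · rcases (hZ 0 (left_mem_Icc.2 ht)).1.1.eq_or_lt with hz | hz
        · obtain rfl : i = 1 := by
            fin_cases i
            · exact absurd hz (pos_of_characteristic ht' hZ).ne
            · rfl
          rw [← hz]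
          exact h1
        · exact h0 i _ ⟨hz, (hZ 0 (left_mem_Icc.2 ht)).1.2⟩
      · exact hp t₀ ht0 i _
    rw [hp t₁ (lt_of_le_of_lt ht0 ht'), e, hs.pde i t₀ t₁ Z ht (subset_univ _) hZ]
    congr 1
    refine intervalIntegral.integral_congr_ae (Filter.Eventually.of_forall fun r hr => ?_)
    rw [uIoc_of_le ht] at hr
    simp only [hp r (lt_of_le_of_lt ht0 hr.1)]

/-- Existence of solutions of the closed loop. -/
theorem exists_closedLoopSolution (hu : IsUnit P.kalman.det) (hq0 : P.q0 ≠ 0) (hK : P.IsKernel K)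
    {a : Fin (n + 1) → ℝ} {aD : ℝ → ℝ} (ha : P.IsHCCFCoeff K a aD) (κ : Fin n → ℝ) {γ : ℝ}
    (hγ : |γ| ≤ 1) {yr : ℝ → ℝ} (hyr : ContDiff ℝ n yr) (ξ₀ : Fin n → ℝ) {x₀ : Fin 2 → ℝ → ℝ}
    (hx₀ : IsProfile x₀) : ∃ (ξ : ℝ → Fin n → ℝ) (x : Fin 2 → ℝ → ℝ → ℝ) (u : ℝ → ℝ),
      P.IsClosedLoopSolution K a aD κ γ yr ξ x u ∧ ξ 0 = ξ₀ ∧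
      ∀ j, ∀ z ∈ Icc (0 : ℝ) 1, x j z 0 = x₀ j z := by
  -- The free value of `x₁(0,·)` at time zero is again chosen so that `x₂` at `z = 0` starts with
  -- the prescribed value.
  obtain ⟨Y₀, hY₀, hξ₀, hp₀, hxb⟩ := exists_jet_of_profile hu hq0 hK ξ₀ hx₀
    (P.q0⁻¹ * (x₀ 1 0 - P.c ⬝ᵥ ξ₀))
  have hR := IsGlobalJet.of_contDiff hyr
  have hE₀ := hY₀.sub hR
  have hT : 0 < P.tau 0 + P.tau 1 := add_pos (P.tau_pos 0) (P.tau_pos 1)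
  -- Up to `τ₁` the error is the one fixed by the initial state. Beyond it the closed-loop equation
  -- prescribes the error operator, from which the error itself is then continued.
  obtain ⟨g, hg, hg0, hgT⟩ := exists_of_delay (locBounded_errorOp κ hE₀) hγ hT (P.tau 0)
  obtain ⟨E, hE, hEn, hEp⟩ := exists_jet_continuation hu κ hE₀ hg (P.tau 0)
  have hEg : ∀ t, errorOp κ E t = g t := fun t => by
    rcases le_or_gt t (P.tau 0) with h | h
    · rw [hg0 t h, errorOp, errorOp, hEn n le_rfl t h]
      simp only [hEn _ (Fin.is_lt _).le t h]
    · exact hEp t h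
  have hY := hE.add hR
  set Y : ℕ → ℝ → ℝ := fun k t => E k t + iteratedDeriv k yr t with hYd
  have hYn : ∀ k ≤ n, ∀ t ≤ P.tau 0, Y k t = Y₀ k t := fun k hk t ht => by
    simp only [hYd, hEn k hk t ht, sub_add_cancel]
  have h00 : (0 : ℝ) ≤ P.tau 0 := (P.tau_pos 0).le
  have hY1 : P.xiPar Y 0 = ξ₀ := by rw [← hξ₀]; exact P.xiPar_congr fun k hk => hYn k hk.le 0 h00
  have hY2 : P.p1Par Y 0 = P.q0⁻¹ * (x₀ 1 0 - P.c ⬝ᵥ ξ₀) := by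
    rw [← hp₀]; exact P.p1Par_congr fun k hk => hYn k hk 0 h00
  obtain ⟨x', hs, hx'⟩ := exists_solution_of_jet (P := P) hu hY
  have hx'0 : ∀ t, P.p1Par Y t = x' 0 0 t := fun t => (hx' 0 t).symm
  have hini : ∀ j, ∀ z ∈ Ioc (0 : ℝ) 1, x₀ j z = x' j z 0 := fun j z hz => by
    refine xbar_injective hK hx₀ (hs.isProfile (mem_univ 0)) (fun j z hz => ?_) j hz
    rw [hxb j z hz, hs.xbar_eq_xPar hq0 hK (fun _ => rfl) hx'0 0 j (Ioc_subset_Icc_self hz)]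
    simp only [zero_add]
    exact (P.xPar_congr K (fun k hk τ hτ => hYn k hk τ hτ.2) j (Ioc_subset_Icc_self hz)).symm
  have hini1 : x₀ 1 0 = x' 1 0 0 := by
    rw [hx', pPar_one, hY2, hY1]; field_simp; ring
  -- The prescribed `x₁` at `z = 0` may differ from the generated one. Inserting the initial profile
  -- by hand is harmless: boundary conditions are required only for `t > 0`, and no characteristic
  -- of the first component leaves that point forward in time.
  let x : Fin 2 → ℝ → ℝ → ℝ := fun j z t => if t = 0 then x₀ j z else x' j z t
  have hxp : ∀ t > 0, ∀ j z, x j z t = x' j z t := fun t ht j z => if_neg ht.ne'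
  have hx0 : ∀ j z, x j z 0 = x₀ j z := fun j z => if_pos rfl
  refine ⟨P.xiPar Y, x, _, ⟨hs.restrict hxp (fun j z hz => (hx0 j z).trans (hini j z hz))
    ((hx0 1 0).trans hini1), fun t ht => ?_⟩, hY1, fun j z _ => hx0 j z⟩
  have e : (fun j z => x j z t) = fun j z => x' j z t := by funext j z; exact hxp t ht j z
  have e2 : (fun k t => Y k t - iteratedDeriv k yr t) = E := by
    funext k t; simp [hYd]
  rw [e, hs.isFeedback_iff hu hq0 hK hY (fun _ => rfl) hx'0 ha κ γ hyr t, e2, hEg, hEg]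
  have h := hgT (t + P.tau 0) (by linarith)
  rwa [show t + P.tau 0 - (P.tau 0 + P.tau 1) = t + -P.tau 1 by ring] at h

end System

end HyperbolicPDEODE

end

open HyperbolicPDEODE in
theorem theorem1 {n : ℕ} (P : System n) (hFb : Controllable P.F P.b) (hq0 : P.q0 ≠ 0)
    (γ : ℝ) (hγ : |γ| < 1) (κ : Fin n → ℝ) (hκ : IsHurwitz κ) :
    -- the kernel and the coefficients of the canonical form exist
    (∃ K, P.IsKernel K) ∧
    ∀ K, P.IsKernel K →
      (∃ a aD, P.IsHCCFCoeff K a aD) ∧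
      ∀ a aD, P.IsHCCFCoeff K a aD →
        -- the controller is a well-defined static state feedback
        (∀ yr : ℝ → ℝ, ContDiff ℝ n yr → ∀ (t : ℝ) (ξ : Fin n → ℝ) (x : Fin 2 → ℝ → ℝ),
          IsProfile x → ∃! u, P.IsFeedback K a aD κ γ yr t ξ x u) ∧
        -- exponential stability of the closed loop along the reference
        ∃ M > 0, ∃ ω > 0, ∀ yr : ℝ → ℝ, ContDiff ℝ n yr →
          ∃ (ξr : ℝ → Fin n → ℝ) (xr : Fin 2 → ℝ → ℝ → ℝ) (ur : ℝ → ℝ),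
            P.IsGeneratedBy K a aD yr ξr xr ur ∧
            P.IsSolution Set.univ ur ξr xr ∧
            (∀ (ξ₀ : Fin n → ℝ) (x₀ : Fin 2 → ℝ → ℝ), IsProfile x₀ →
              ∃ (ξ : ℝ → Fin n → ℝ) (x : Fin 2 → ℝ → ℝ → ℝ) (u : ℝ → ℝ),
                P.IsClosedLoopSolution K a aD κ γ yr ξ x u ∧ ξ 0 = ξ₀ ∧
                ∀ j, ∀ z ∈ Set.Icc (0 : ℝ) 1, x j z 0 = x₀ j z) ∧
            ∀ (ξ : ℝ → Fin n → ℝ) (x : Fin 2 → ℝ → ℝ → ℝ) (u : ℝ → ℝ),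
              P.IsClosedLoopSolution K a aD κ γ yr ξ x u → ∀ t ≥ 0,
                stateNorm (ξ t - ξr t) (fun j z => x j z t - xr j z t) ≤
                  M * Real.exp (-ω * t) *
                    stateNorm (ξ 0 - ξr 0) (fun j z => x j z 0 - xr j z 0) := by
  have hu := P.isUnit_kalman hFb
  refine ⟨P.exists_isKernel hq0, fun K hK => ⟨System.exists_isHCCFCoeff hK, fun a aD ha =>
    ⟨fun yr _ t ξ x hx => System.existsUnique_isFeedback hu hq0 hK a aD κ γ yr t ξ hx, ?_⟩⟩⟩
  obtain ⟨M, hM, ω, hω, h⟩ := System.exists_stability hu hq0 hK ha hκ hγ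
  refine ⟨M, hM, ω, hω, fun yr hyr => ?_⟩
  obtain ⟨ξr, xr, ur, hr, hsr⟩ := System.exists_reference hu hq0 hK ha hyr
  exact ⟨ξr, xr, ur, hr, hsr, fun ξ₀ x₀ hx₀ =>
    System.exists_closedLoopSolution hu hq0 hK ha κ hγ.le hyr ξ₀ hx₀,
    h yr hyr ξr xr ur hr hsr⟩
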